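/- Let $R$ be a commutative semiring. **Colors and objects.** Colors are generated by $A,B ::= \mathbb 0\mid \mathbb 1\mid A\oplus B\mid A\otimes B$. Let $\approx$ be the least equivalence relation on colors, closed under $\oplus$ and $\otimes$, with $A\oplus\mathbb 0\approx A\approx\mathbb 0\oplus A$, $A\otimes\mathbb 1\approx A\approx\mathbb 1\otimes A$, $(A\oplus B)\oplus C\approx A\oplus(B\oplus C)$ and $(A\otimes B)\otimes C\approx A\otimes(B\otimes C)$. Objects are finite lists $A_1\parallel\dots\parallel A_n$ of colors ($\varnothing$ is the empty list). Put $\dim\mathbb 0=\dim\varnothing=0$, $\dim\mathbb 1=1$, $\dim(A\oplus B)=\dim A+\dim B$, $\dim(A\otimes B)=\dim A\dim B$ and $\dim(X\parallel B)=\dim X\dim B+\dim X+\dim B$. **Diagrams.** The diagrams of the full Tensor-Plus calculus are the morphisms of the colored PROP generated by the Tensor $\otimes_{A,B}:A\parallel B\to A\otimes B$, the Plus $\oplus_{A,B}:A\parallel B\to A\oplus B$, the Contraction $\nabla_A:A\parallel A\to A$, the Null $0_A:\varnothing\to A$, the Unit $u:\varnothing\to\mathbb 1$, their up-down mirrors $\otimes_{A,B}^\dagger,\oplus_{A,B}^\dagger,\nabla_A^\dagger,0_A^\dagger,u^\dagger$,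 the Adapters $m_{A,A'}:A\to A'$ for $A\approx A'$ and the Scalars $[s]_A:A\to A$ for $s\in R$. The mirror $d^\dagger$ of a diagram reverses it, exchanging each generator with its mirror, with $[s]_A^\dagger=[s]_A$ and $m_{A,A'}^\dagger=m_{A',A}$. Write $d;e$ for $e\circ d$, $\sigma_{X,Y}$ for swaps, $A$ for the identity of $A$; $\parallel$ binds more strongly than $;$. Abbreviate $\mathrm X_{A,B}=\oplus_{A,B};\oplus_{A,B}^\dagger$, $\ \tau_A=m_{A,A\otimes\mathbb 1};\otimes_{A,\mathbb 1}^\dagger:A\to A\parallel\mathbb 1$, $\ \tau'_A=m_{A,\mathbb 1\otimes A};\otimes_{\mathbb 1,A}^\dagger:A\to\mathbb 1\parallel A$, and $\nabla_{A,B}=(A\parallel\sigma_{B,A}\parallel B);(\nabla_A\parallel\nabla_B):A\parallel B\parallel A\parallel B\to A\parallel B$. **Equations.** $\equiv$ is the congruence on diagrams generated by the following equations and their up-down mirrors (for all colors $A,B,C$, all $s,t\in R$ and all adapters that type-check): * $\otimes_{A,B}^\dagger;\otimes_{A,B}=A\otimes B$; $\ \oplus_{A,B}^\dagger;\oplus_{A,B}=A\oplus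 B$; $\ \oplus_{A,B}^\dagger;\otimes_{A,B}=0_{A\oplus B}^\dagger;0_{A\otimes B}$; $\ \mathrm{id}_{\mathbb 0}=0_{\mathbb 0}^\dagger;0_{\mathbb 0}$; $\ \sigma_{A,A};\nabla_A=\nabla_A$; * $(\otimes_{A,B}^\dagger\parallel C);(A\parallel\otimes_{B,C})=\otimes_{A\otimes B,C};m;\otimes_{A,B\otimes C}^\dagger$; * $\mathrm X_{A,B}=(\tau_A\parallel\tau'_B);(A\parallel \mathrm X_{\mathbb 1,\mathbb 1}\parallel B);(\tau_A^\dagger\parallel\tau_B'^\dagger)$; $\ \oplus_{A,B}=(\tau_A\parallel\tau_B);(A\parallel\sigma_{\mathbb 1,B}\parallel\mathbb 1);(\oplus_{A,B}\parallel\nabla_{\mathbb 1});\tau_{A\oplus B}^\dagger$; * $A\parallel B=\nabla_{A,B}^\dagger;((\otimes_{A,B};\otimes_{A,B}^\dagger)\parallel\mathrm X_{A,B});\nabla_{A,B}$; * $0_{A\otimes B};\otimes_{A,B}^\dagger=0_A\parallel0_B$; $\ 0_{A\oplus B};\oplus_{A,B}^\dagger=0_A\parallel0_B$; $\ 0_A;\nabla_A^\dagger=0_A\parallel0_A$;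 $\ 0_A;0_A^\dagger=\mathrm{id}_\varnothing$; $\ 0_A;m_{A,B}=0_B$; $\ 0_A;[s]_A=0_A$; * $(A\parallel0_A);\nabla_A=A$; $\ (\nabla_A\parallel A);\nabla_A=(A\parallel\nabla_A);\nabla_A$; $\ \nabla_A;[s]_A=([s]_A\parallel[s]_A);\nabla_A$; $\ \nabla_A;m_{A,B}=(m_{A,B}\parallel m_{A,B});\nabla_B$; * $\nabla_{A\otimes B};\otimes_{A,B}^\dagger=(\otimes_{A,B}^\dagger\parallel\otimes_{A,B}^\dagger);\nabla_{A,B}$; $\ \nabla_{A\oplus B};\oplus_{A,B}^\dagger=(\oplus_{A,B}^\dagger\parallel\oplus_{A,B}^\dagger);\nabla_{A,B};\mathrm X_{A,B}$; $\ \nabla_A;\nabla_A^\dagger=\mathrm X_{A,A};(\nabla_A^\dagger\parallel\nabla_A^\dagger);\nabla_{A,A}$; * $(\nabla_A\parallel B);\otimes_{A,B}=(A\parallel A\parallel\nabla_B^\dagger);(A\parallel\sigma_{A,B}\parallel B);(\otimes_{A,B}\parallel\otimes_{A,B});\nabla_{A\otimes B}$; * $(\nabla_A\parallel C);\mathrm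 X_{A,C}=(A\parallel\mathrm X_{A,C});(A\parallel\sigma_{A,C});(\mathrm X_{A,C}\parallel A);(A\parallel\sigma_{C,A});(\nabla_A\parallel C)$; * $\otimes_{A,B\otimes C}^\dagger;(A\parallel\otimes_{B,C}^\dagger)=m;\otimes_{A\otimes B,C}^\dagger;(\otimes_{A,B}^\dagger\parallel C)$, and the same with $\oplus$ for $\otimes$; $\ (m_{A,A'}\parallel m_{B,B'});\otimes_{A',B'}=\otimes_{A,B};m$, and the same with $\oplus$ for $\otimes$; $\ \tau_A'^\dagger=\sigma_{\mathbb 1,A};\tau_A^\dagger$; $\ \oplus_{A,\mathbb 0};m_{A\oplus\mathbb 0,A}=A\parallel0_{\mathbb 0}^\dagger$; $\ \oplus_{\mathbb 0,A};m_{\mathbb 0\oplus A,A}=0_{\mathbb 0}^\dagger\parallel A$; $\ m_{A,B};m_{B,C}=m_{A,C}$; $\ m_{A,A}=A$; $\ [s]_A;m_{A,B}=m_{A,B};[s]_B$; * $[1]_A=A$; $\ [0]_A=0_A^\dagger;0_A$; $\ \nabla_A^\dagger;([s]_A\parallel[t]_A);\nabla_A=[s+t]_A$; $\ ([s]_A\parallel[t]_B);\otimes_{A,B}=\otimes_{A,B};[st]_{A\otimes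 B}$; * $\tau_A;(A\parallel u^\dagger)=A$; $\ u;0_{\mathbb 1}^\dagger=\mathrm{id}_\varnothing$; $\ L_s=L_t$ whenever $s+1=t+1$, where $L_s=(\mathbb 1\parallel u);(\mathbb 1\parallel\nabla_{\mathbb 1}^\dagger);(\sigma_{\mathbb 1,\mathbb 1}\parallel[s]_{\mathbb 1});(\mathbb 1\parallel\nabla_{\mathbb 1});(\mathbb 1\parallel u^\dagger):\mathbb 1\to\mathbb 1$. **Semantics.** Let $\mathbf H$ be a category with finite biproducts $(\oplus,\mathbb 0)$ and a symmetric monoidal structure $(\otimes,\mathbb 1)$ that distributes over them (the canonical maps $H\otimes(K\oplus L)\to(H\otimes K)\oplus(H\otimes L)$ and $H\otimes\mathbb 0\to\mathbb 0$ are isomorphisms), with a semiring isomorphism $\mathrm{scal}:R\to\mathbf H(\mathbb 1,\mathbb 1)$. Put $H\mid K=(H\otimes K)\oplus(H\oplus K)$, a symmetric monoidal product with unit $\mathbb 0$. Colors are interpreted by $\oplus,\otimes,\mathbb 0,\mathbb 1$ of $\mathbf H$, and objects by $[\![\varnothing]\!]=\mathbb 0$, $[\![X\parallel B]\!]=[\![X]\!]\mid[\![B]\!]$.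 A diagram $d:X\to Y$ is interpreted by $[\![d]\!]^{\oplus\mathbb 1}:[\![X]\!]\oplus\mathbb 1\to[\![Y]\!]\oplus\mathbb 1$ as follows, up to the coherence isomorphisms of $\mid$. On identities, swaps and generators other than $u,u^\dagger$ it is $[\![-]\!]\oplus\mathrm{id}_{\mathbb 1}$, where $[\![-]\!]$ sends swaps to the symmetry of $\mid$, the Tensor and its mirror to the projection of $[\![A]\!]\mid[\![B]\!]$ to, and the injection into it of, $[\![A]\!]\otimes[\![B]\!]$, the Plus and its mirror to those for $[\![A]\!]\oplus[\![B]\!]$, the Contraction and its mirror to the projection to $[\![A]\!]\oplus[\![A]\!]$ followed by the codiagonal, and the diagonal followed by the injection, Nulls to zero morphisms, $[s]_A$ to $s\cdot\mathrm{id}$, and $m_{A,A'}$ to the structural isomorphism composed of unitors and associators of $\otimes$ and $\oplus$. The Unit $u$ is sent to the diagonal $\mathbb 0\oplus\mathbb 1\cong\mathbb 1\to\mathbb 1\oplus\mathbb 1$, and $u^\dagger$ to the codiagonal. Further $[\![e\circ d]\!]^{\oplus\mathbb 1}=[\![e]\!]^{\oplus\mathbb 1}\circ[\![d]\!]^{\oplus\mathbb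 1}$, and $[\![d\parallel e]\!]^{\oplus\mathbb 1}$ is $[\![d]\!]^{\oplus\mathbb 1}\otimes[\![e]\!]^{\oplus\mathbb 1}$ conjugated by the isomorphisms $(H\oplus\mathbb 1)\otimes(K\oplus\mathbb 1)\cong(H\mid K)\oplus\mathbb 1$ given by distributivity. **Normal forms.** Let $\mathbb 1^{\parallel n}$ be $n$ wires of color $\mathbb 1$, and $\mathrm{disj}_n=\oplus_n;\oplus_n^\dagger$, where $\oplus_n$ is the $n$-ary Plus on $\mathbb 1^{\parallel n}$, bracketed to the left ($\oplus_1=\mathrm{id}$, $\oplus_0=0_{\mathbb 0}$). Let $\pi_{a,b}:\mathbb 1^{\parallel a}\parallel\mathbb 1^{\parallel b}\to\mathbb 1^{\parallel ab}$ copy every wire with mirrored Contractions (Nulls for no copy) and apply $\tau_{\mathbb 1}^\dagger:\mathbb 1\parallel\mathbb 1\to\mathbb 1$ to a copy of the $i$-th and a copy of the $j$-th wire for each pair $(i,j)$, ordered by $j$ and then by $i$. Define $\mathrm{iso}_X:X\to\mathbb 1^{\parallel\dim X}$ by $\mathrm{iso}_\varnothing=\mathrm{id}$, $\mathrm{iso}_{\mathbb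 0}=0_{\mathbb 0}^\dagger$, $\mathrm{iso}_{\mathbb 1}=\mathrm{id}$ for colors $\mathbb 0,\mathbb 1$, $\mathrm{iso}_{A\oplus B}=\oplus_{A,B}^\dagger;(\mathrm{iso}_A\parallel\mathrm{iso}_B);\mathrm{disj}$, $\ \mathrm{iso}_{A\otimes B}=\otimes_{A,B}^\dagger;(\mathrm{iso}_A\parallel\mathrm{iso}_B);\pi;\mathrm{disj}$, and $\mathrm{iso}_{X\parallel B}=(\mathrm{iso}_X\parallel\mathrm{iso}_B);\delta;(\pi\parallel\mathrm{id});\mathrm{disj}$, where $\delta$ duplicates all the wires. For an $m\times n$ matrix $M$ over $R$, $[M]:\mathbb 1^{\parallel n}\to\mathbb 1^{\parallel m}$ is $\mathrm{disj}_n$, followed by a copy of the $j$-th input through the Scalar $M_{ij}$ to the $i$-th output for all $i,j$ (mirrored Contractions on the inputs, Contractions on the outputs), followed by $\mathrm{disj}_m$. For a $(\dim Y+1)\times(\dim X+1)$ matrix $M$ put $\mathrm{NF}(M)=(\mathrm{iso}_X\parallel u);[M];(\mathrm{iso}_Y^\dagger\parallel u^\dagger):X\to Y$. **Theorem.** Fix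 a canonical representative in each class of the relation $s+1=t+1$ on $R$. 1. For every diagram $d:X\to Y$ there is a $(\dim Y+1)\times(\dim X+1)$ matrix $M$ over $R$, whose bottom-right entry is canonical, such that $d\equiv\mathrm{NF}(M)$. 2. If $d,e:X\to Y$ satisfy $[\![d]\!]^{\oplus\mathbb 1}=[\![e]\!]^{\oplus\mathbb 1}$, and $N,M$ are such matrices, with canonical bottom-right entries, with $d\equiv\mathrm{NF}(N)$ and $e\equiv\mathrm{NF}(M)$, then $N=M$ and $d\equiv e$. 3. Consequently the equational theory is complete: for all diagrams $d,e:X\to Y$, if $[\![d]\!]^{\oplus\mathbb 1}=[\![e]\!]^{\oplus\mathbb 1}$ then $d\equiv e$. -/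

import Mathlib

open CategoryTheory CategoryTheory.Limits MonoidalCategory
open scoped ZeroObject

universe u v w

namespace TensorPlus

/-! ## Colors and objects -/

/-- Colors, generated from `𝟘` and `𝟙` by `⊕` and `⊗`. -/
inductive Color : Type
  | zero : Color
  | one : Color
  | plus : Color → Color → Color
  | tensor : Color → Color → Color

/-- The equivalence relation `≈_{λρα}` on colors: units and associativity of `⊕` and of `⊗`,
closed under congruence. -/
inductive Color.Approx : Color → Color → Prop
  | refl (A : Color) : Approx A A
  | symm {A B : Color} : Approx A B → Approx B A
  | trans {A B C : Color} : Approx A B → Approx B C → Approx A C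
  | plus_zero (A : Color) : Approx (.plus A .zero) A
  | zero_plus (A : Color) : Approx (.plus .zero A) A
  | tensor_one (A : Color) : Approx (.tensor A .one) A
  | one_tensor (A : Color) : Approx (.tensor .one A) A
  | plus_assoc (A B C : Color) : Approx (.plus (.plus A B) C) (.plus A (.plus B C))
  | tensor_assoc (A B C : Color) : Approx (.tensor (.tensor A B) C) (.tensor A (.tensor B C))
  | plus_right {A B : Color} (C : Color) : Approx A B → Approx (.plus A C) (.plus B C)
  | plus_left {A B : Color} (C : Color) : Approx A B → Approx (.plus C A) (.plus C B)
  | tensor_right {A B : Color} (C : Color) : Approx A B → Approx (.tensor A C) (.tensor B C)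
  | tensor_left {A B : Color} (C : Color) : Approx A B → Approx (.tensor C A) (.tensor C B)

/-- Objects: finite lists of colors `A₁ ∥ … ∥ Aₙ`, extended on the right, so that
`snoc X B` is `X ∥ B` and `nil` is `∅`. -/
inductive Obj : Type
  | nil : Obj
  | snoc : Obj → Color → Obj

namespace Obj

/-- The strict monoidal product `X ∥ Y` of objects (concatenation). -/
def append (X : Obj) : Obj → Obj
  | nil => X
  | snoc Y B => snoc (append X Y) B

instance : Append Obj := ⟨append⟩

/-- A single wire. -/
abbrev of (A : Color) : Obj := snoc nil A

theorem nil_append : ∀ X : Obj, nil ++ X = X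
  | nil => rfl
  | snoc X B => congrArg (fun Z => snoc Z B) (nil_append X)

theorem append_assoc (X Y : Obj) : ∀ Z : Obj, (X ++ Y) ++ Z = X ++ (Y ++ Z)
  | nil => rfl
  | snoc Z B => congrArg (fun W => snoc W B) (append_assoc X Y Z)

/-- `n` wires of color `𝟙`. -/
def ones : ℕ → Obj
  | 0 => nil
  | n + 1 => snoc (ones n) .one

theorem ones_add (a : ℕ) : ∀ b : ℕ, ones a ++ ones b = ones (a + b)
  | 0 => rfl
  | b + 1 => congrArg (fun Z => snoc Z .one) (ones_add a b)

end Obj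

/-- The dimension of a color. -/
def Color.dim : Color → ℕ
  | zero => 0
  | one => 1
  | plus A B => A.dim + B.dim
  | tensor A B => A.dim * B.dim

/-- The dimension of an object. -/
def Obj.dim : Obj → ℕ
  | nil => 0
  | snoc X B => X.dim * B.dim + X.dim + B.dim

/-! ## Diagrams -/

open Obj

/-- The functional generators of the calculus other than the identity and the swap, which are
part of the PROP structure. The prefix `co` marks up-down mirrored generators. -/
inductive FGen (R : Type u) : Obj → Obj → Type u
  | tens (A B : Color) : FGen R (of A ++ of B) (of (.tensor A B))
  | cotens (A B : Color) : FGen R (of (.tensor A B)) (of A ++ of B)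
  | plus (A B : Color) : FGen R (of A ++ of B) (of (.plus A B))
  | coplus (A B : Color) : FGen R (of (.plus A B)) (of A ++ of B)
  | contr (A : Color) : FGen R (of A ++ of A) (of A)
  | cocontr (A : Color) : FGen R (of A) (of A ++ of A)
  | null (A : Color) : FGen R nil (of A)
  | conull (A : Color) : FGen R (of A) nil
  | adapt {A B : Color} (h : A.Approx B) : FGen R (of A) (of B)
  | scal (s : R) (A : Color) : FGen R (of A) (of A)

/-- Diagrams `X → Y` of the full calculus, with scalars in `R`. They are identified up to the
relation `Diag.Equiv` below, which contains the equations of a colored PROP. -/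
inductive Diag (R : Type u) : Obj → Obj → Type u
  | id (X : Obj) : Diag R X X
  | swap (X Y : Obj) : Diag R (X ++ Y) (Y ++ X)
  | comp {X Y Z : Obj} (d : Diag R X Y) (e : Diag R Y Z) : Diag R X Z
  | par {X Y X' Y' : Obj} (d : Diag R X Y) (e : Diag R X' Y') : Diag R (X ++ X') (Y ++ Y')
  | fgen {X Y : Obj} (g : FGen R X Y) : Diag R X Y
  | unit : Diag R nil (of .one)
  | counit : Diag R (of .one) nil

/-- Sequential composition in diagrammatic order: `d ⨟ e` is `e ∘ d`. -/
notation:60 d:60 " ⨟ " e:61 => Diag.comp (d :) (e :)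

/-- Parallel composition. -/
notation:65 d:65 " ∥ᵈ " e:66 => Diag.par (d :) (e :)

/-- Up-down mirror of a generator. -/
def FGen.mirror {R : Type u} : {X Y : Obj} → FGen R X Y → FGen R Y X
  | _, _, .tens A B => .cotens A B
  | _, _, .cotens A B => .tens A B
  | _, _, .plus A B => .coplus A B
  | _, _, .coplus A B => .plus A B
  | _, _, .contr A => .cocontr A
  | _, _, .cocontr A => .contr A
  | _, _, .null A => .conull A
  | _, _, .conull A => .null A
  | _, _, .adapt h => .adapt h.symm
  | _, _, .scal s A => .scal s A

namespace Diag

/-- Up-down mirror of a diagram. -/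
def mirror {R : Type u} : {X Y : Obj} → Diag R X Y → Diag R Y X
  | _, _, .id X => .id X
  | _, _, .swap X Y => .swap Y X
  | _, _, .comp d e => .comp e.mirror d.mirror
  | _, _, .par d e => .par d.mirror e.mirror
  | _, _, .fgen g => .fgen g.mirror
  | _, _, .unit => .counit
  | _, _, .counit => .unit

/-- Transport of a diagram along equalities of objects (strictness of `∥`). -/
def cast {R : Type u} {X X' Y Y' : Obj} : X = X' → Y = Y' → Diag R X Y → Diag R X' Y'
  | rfl, rfl, d => d

section Shorthands

variable {R : Type u}

/-- The identity wire of color `A`. -/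
abbrev wire (A : Color) : Diag R (of A) (of A) := id (of A)
/-- The swap of two wires. -/
abbrev sw (A B : Color) : Diag R (of A ++ of B) (of B ++ of A) := swap (of A) (of B)
/-- The Tensor. -/
abbrev tens (A B : Color) : Diag R (of A ++ of B) (of (.tensor A B)) := fgen (.tens A B)
/-- The mirrored Tensor. -/
abbrev cotens (A B : Color) : Diag R (of (.tensor A B)) (of A ++ of B) := fgen (.cotens A B)
/-- The Plus. -/
abbrev plus (A B : Color) : Diag R (of A ++ of B) (of (.plus A B)) := fgen (.plus A B)
/-- The mirrored Plus. -/
abbrev coplus (A B : Color) : Diag R (of (.plus A B)) (of A ++ of B) := fgen (.coplus A B)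
/-- The Contraction. -/
abbrev contr (A : Color) : Diag R (of A ++ of A) (of A) := fgen (.contr A)
/-- The mirrored Contraction. -/
abbrev cocontr (A : Color) : Diag R (of A) (of A ++ of A) := fgen (.cocontr A)
/-- The Null. -/
abbrev null (A : Color) : Diag R nil (of A) := fgen (.null A)
/-- The mirrored Null. -/
abbrev conull (A : Color) : Diag R (of A) nil := fgen (.conull A)
/-- The Adapter. -/
abbrev adapt {A B : Color} (h : A.Approx B) : Diag R (of A) (of B) := fgen (.adapt h)
/-- The Scalar. -/
abbrev scal (s : R) (A : Color) : Diag R (of A) (of A) := fgen (.scal s A)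

/-- A Plus followed by a mirrored Plus: the two wires are put in disjunction. -/
def xplus (A B : Color) : Diag R (of A ++ of B) (of A ++ of B) := plus A B ⨟ coplus A B

/-- A Tensor followed by a mirrored Tensor. -/
def xtens (A B : Color) : Diag R (of A ++ of B) (of A ++ of B) := tens A B ⨟ cotens A B

/-- Split a wire `𝟙` off to the right: `A → A ⊗ 𝟙 → A ∥ 𝟙`. -/
def tapR (A : Color) : Diag R (of A) (of A ++ of .one) :=
  adapt (Color.Approx.tensor_one A).symm ⨟ cotens A .one

/-- Split a wire `𝟙` off to the left: `A → 𝟙 ⊗ A → 𝟙 ∥ A`. -/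
def tapL (A : Color) : Diag R (of A) (of .one ++ of A) :=
  adapt (Color.Approx.one_tensor A).symm ⨟ cotens .one A

/-- Merge a wire `𝟙` on the right: `A ∥ 𝟙 → A ⊗ 𝟙 → A`. -/
def untapR (A : Color) : Diag R (of A ++ of .one) (of A) :=
  tens A .one ⨟ adapt (Color.Approx.tensor_one A)

/-- Merge a wire `𝟙` on the left: `𝟙 ∥ A → 𝟙 ⊗ A → A`. -/
def untapL (A : Color) : Diag R (of .one ++ of A) (of A) :=
  tens .one A ⨟ adapt (Color.Approx.one_tensor A)

/-- `(A ∥ B) ∥ (A ∥ B) → A ∥ B`: contraction of two copies of a pair of wires. -/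
def contr₂ (A B : Color) : Diag R (of A ++ of B ++ of A ++ of B) (of A ++ of B) :=
  (wire A ∥ᵈ sw B A ∥ᵈ wire B) ⨟ (contr A ∥ᵈ contr B)

/-- `A ∥ B → (A ∥ B) ∥ (A ∥ B)`: duplication of a pair of wires. -/
def cocontr₂ (A B : Color) : Diag R (of A ++ of B) (of A ++ of B ++ of A ++ of B) :=
  (cocontr A ∥ᵈ cocontr B) ⨟ (wire A ∥ᵈ sw A B ∥ᵈ wire B)

/-- The diagram `𝟙 → 𝟙` in which a wire leaving a Unit through a Scalar `s` to a mirrored Unit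
is attached, by two Contractions, to the given wire. -/
def canLoop (s : R) : Diag R (of .one) (of .one) :=
  (wire .one ∥ᵈ unit) ⨟ (wire .one ∥ᵈ cocontr .one) ⨟ (sw .one .one ∥ᵈ scal s .one) ⨟
    (wire .one ∥ᵈ contr .one) ⨟ (wire .one ∥ᵈ counit)

end Shorthands

/-! ## The equational theory -/

/-- The axioms of the equational theory, without the equations of a PROP and up to up-down
mirroring. -/
inductive Axiom {R : Type u} [CommSemiring R] : {X Y : Obj} → Diag R X Y → Diag R X Y → Prop
  -- main equations
  | tensor (A B : Color) : Axiom (cotens A B ⨟ tens A B) (wire (.tensor A B))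
  | plus (A B : Color) : Axiom (coplus A B ⨟ plus A B) (wire (.plus A B))
  | bot (A B : Color) :
      Axiom (coplus A B ⨟ tens A B) (conull (.plus A B) ⨟ null (.tensor A B))
  | zero : Axiom (wire .zero) (conull .zero ⨟ null .zero)
  | swap_contr (A : Color) : Axiom (sw A A ⨟ contr A) (contr A)
  | n_tensor (A B C : Color) :
      Axiom ((cotens A B ∥ᵈ wire C) ⨟ (wire A ∥ᵈ tens B C))
        (tens (.tensor A B) C ⨟ adapt (.tensor_assoc A B C) ⨟ cotens A (.tensor B C))
  | x_plus (A B : Color) :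
      Axiom (xplus A B)
        ((tapR A ∥ᵈ tapL B) ⨟ (wire A ∥ᵈ xplus .one .one ∥ᵈ wire B) ⨟ (untapR A ∥ᵈ untapL B))
  | plus_to_contr (A B : Color) :
      Axiom (plus A B)
        ((tapR A ∥ᵈ tapR B) ⨟ (wire A ∥ᵈ sw .one B ∥ᵈ wire .one) ⨟
          (plus A B ∥ᵈ contr .one) ⨟ untapR (.plus A B))
  | mix (A B : Color) :
      Axiom (wire A ∥ᵈ wire B)
        (cocontr₂ A B ⨟ (xtens A B ∥ᵈ xplus A B) ⨟ contr₂ A B)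
  -- commutation of the Null
  | tensor_null (A B : Color) :
      Axiom (null (.tensor A B) ⨟ cotens A B) (null A ∥ᵈ null B)
  | plus_null (A B : Color) :
      Axiom (null (.plus A B) ⨟ coplus A B) (null A ∥ᵈ null B)
  | contr_null (A : Color) : Axiom (null A ⨟ cocontr A) (null A ∥ᵈ null A)
  | null_null (A : Color) : Axiom (null A ⨟ conull A) (id nil)
  | null_adapt {A B : Color} (h : A.Approx B) : Axiom (null A ⨟ adapt h) (null B)
  | null_scal (s : R) (A : Color) : Axiom (null A ⨟ scal s A) (null A)
  -- commutation of the Contraction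
  | unit_contr (A : Color) : Axiom ((wire A ∥ᵈ null A) ⨟ contr A) (wire A)
  | assoc_contr (A : Color) :
      Axiom ((contr A ∥ᵈ wire A) ⨟ contr A) ((wire A ∥ᵈ contr A) ⨟ contr A)
  | tensor_contr (A B : Color) :
      Axiom (contr (.tensor A B) ⨟ cotens A B) ((cotens A B ∥ᵈ cotens A B) ⨟ contr₂ A B)
  | contr_tensor (A B : Color) :
      Axiom ((contr A ∥ᵈ wire B) ⨟ tens A B)
        ((wire A ∥ᵈ wire A ∥ᵈ cocontr B) ⨟ (wire A ∥ᵈ sw A B ∥ᵈ wire B) ⨟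
          (tens A B ∥ᵈ tens A B) ⨟ contr (.tensor A B))
  | plus_contr (A B : Color) :
      Axiom (contr (.plus A B) ⨟ coplus A B)
        ((coplus A B ∥ᵈ coplus A B) ⨟ contr₂ A B ⨟ xplus A B)
  | x_plus_contr (A C : Color) :
      Axiom ((contr A ∥ᵈ wire C) ⨟ xplus A C)
        ((wire A ∥ᵈ xplus A C) ⨟ (wire A ∥ᵈ sw A C) ⨟ (xplus A C ∥ᵈ wire A) ⨟
          (wire A ∥ᵈ sw C A) ⨟ (contr A ∥ᵈ wire C))
  | contr_contr (A : Color) :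
      Axiom (contr A ⨟ cocontr A) (xplus A A ⨟ (cocontr A ∥ᵈ cocontr A) ⨟ contr₂ A A)
  | contr_scal (s : R) (A : Color) :
      Axiom (contr A ⨟ scal s A) ((scal s A ∥ᵈ scal s A) ⨟ contr A)
  | contr_adapt {A B : Color} (h : A.Approx B) :
      Axiom (contr A ⨟ adapt h) ((adapt h ∥ᵈ adapt h) ⨟ contr B)
  -- the Adapter
  | assoc_tensor (A B C : Color) :
      Axiom (cotens A (.tensor B C) ⨟ (wire A ∥ᵈ cotens B C))
        (adapt (Color.Approx.tensor_assoc A B C).symm ⨟ cotens (.tensor A B) C ⨟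
          (cotens A B ∥ᵈ wire C))
  | assoc_plus (A B C : Color) :
      Axiom (coplus A (.plus B C) ⨟ (wire A ∥ᵈ coplus B C))
        (adapt (Color.Approx.plus_assoc A B C).symm ⨟ coplus (.plus A B) C ⨟
          (coplus A B ∥ᵈ wire C))
  | tensor_adapt {A A' B B' : Color} (h : A.Approx A') (k : B.Approx B') :
      Axiom ((adapt h ∥ᵈ adapt k) ⨟ tens A' B')
        (tens A B ⨟ adapt ((Color.Approx.tensor_right B h).trans (.tensor_left A' k)))
  | plus_adapt {A A' B B' : Color} (h : A.Approx A') (k : B.Approx B') :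
      Axiom ((adapt h ∥ᵈ adapt k) ⨟ plus A' B')
        (plus A B ⨟ adapt ((Color.Approx.plus_right B h).trans (.plus_left A' k)))
  | units_tensor (A : Color) : Axiom (untapL A) (sw .one A ⨟ untapR A)
  | unit_plus_right (A : Color) :
      Axiom (plus A .zero ⨟ adapt (.plus_zero A)) (wire A ∥ᵈ conull .zero)
  | unit_plus_left (A : Color) :
      Axiom (plus .zero A ⨟ adapt (.zero_plus A)) (conull .zero ∥ᵈ wire A)
  | adapt_adapt {A B C : Color} (h : A.Approx B) (k : B.Approx C) :
      Axiom (adapt h ⨟ adapt k) (adapt (h.trans k))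
  | adapt_refl (A : Color) : Axiom (adapt (.refl A)) (wire A)
  | scal_adapt {A B : Color} (s : R) (h : A.Approx B) :
      Axiom (scal s A ⨟ adapt h) (adapt h ⨟ scal s B)
  -- the Scalars
  | scal_one (A : Color) : Axiom (scal 1 A) (wire A)
  | scal_zero (A : Color) : Axiom (scal 0 A) (conull A ⨟ null A)
  | scal_add (s t : R) (A : Color) :
      Axiom (cocontr A ⨟ (scal s A ∥ᵈ scal t A) ⨟ contr A) (scal (s + t) A)
  | tensor_scal (s t : R) (A B : Color) :
      Axiom ((scal s A ∥ᵈ scal t B) ⨟ tens A B) (tens A B ⨟ scal (s * t) (.tensor A B))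
  -- the Unit
  | unit_tensor (A : Color) : Axiom (tapR A ⨟ (wire A ∥ᵈ counit)) (wire A)
  | unit_null : Axiom (unit ⨟ conull .one) (id nil)
  | can (s t : R) (h : s + 1 = t + 1) : Axiom (canLoop s) (canLoop t)

/-- The congruence `≡` on diagrams generated by the equations of a colored PROP, the axioms and
their up-down mirrors. -/
inductive Equiv {R : Type u} [CommSemiring R] : {X Y : Obj} → Diag R X Y → Diag R X Y → Prop
  | refl {X Y : Obj} (d : Diag R X Y) : Equiv d d
  | symm {X Y : Obj} {d e : Diag R X Y} : Equiv d e → Equiv e d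
  | trans {X Y : Obj} {d e f : Diag R X Y} : Equiv d e → Equiv e f → Equiv d f
  | comp_congr {X Y Z : Obj} {d d' : Diag R X Y} {e e' : Diag R Y Z} :
      Equiv d d' → Equiv e e' → Equiv (d ⨟ e) (d' ⨟ e')
  | par_congr {X Y X' Y' : Obj} {d d' : Diag R X Y} {e e' : Diag R X' Y'} :
      Equiv d d' → Equiv e e' → Equiv (d ∥ᵈ e) (d' ∥ᵈ e')
  -- strict symmetric monoidal category
  | id_comp {X Y : Obj} (d : Diag R X Y) : Equiv (id X ⨟ d) d
  | comp_id {X Y : Obj} (d : Diag R X Y) : Equiv (d ⨟ id Y) d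
  | assoc {X Y Z W : Obj} (d : Diag R X Y) (e : Diag R Y Z) (f : Diag R Z W) :
      Equiv ((d ⨟ e) ⨟ f) (d ⨟ (e ⨟ f))
  | par_id (X Y : Obj) : Equiv (id X ∥ᵈ id Y) (id (X ++ Y))
  | interchange {X Y Z X' Y' Z' : Obj} (d : Diag R X Y) (e : Diag R Y Z)
      (d' : Diag R X' Y') (e' : Diag R Y' Z') :
      Equiv ((d ∥ᵈ d') ⨟ (e ∥ᵈ e')) ((d ⨟ e) ∥ᵈ (d' ⨟ e'))
  | par_assoc {X Y X' Y' X'' Y'' : Obj} (d : Diag R X Y) (e : Diag R X' Y')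
      (f : Diag R X'' Y'') :
      Equiv (cast (append_assoc X X' X'') (append_assoc Y Y' Y'') ((d ∥ᵈ e) ∥ᵈ f))
        (d ∥ᵈ (e ∥ᵈ f))
  | nil_par {X Y : Obj} (d : Diag R X Y) :
      Equiv (cast (nil_append X) (nil_append Y) (id nil ∥ᵈ d)) d
  | par_nil {X Y : Obj} (d : Diag R X Y) : Equiv (d ∥ᵈ id nil) d
  | swap_naturality {X Y X' Y' : Obj} (d : Diag R X Y) (e : Diag R X' Y') :
      Equiv ((d ∥ᵈ e) ⨟ swap Y Y') (swap X X' ⨟ (e ∥ᵈ d))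
  | swap_swap (X Y : Obj) : Equiv (swap X Y ⨟ swap Y X) (id (X ++ Y))
  | swap_nil (X : Obj) : Equiv (cast rfl (nil_append X) (swap X nil)) (id X)
  | hexagon (X Y Z : Obj) :
      Equiv (swap X (Y ++ Z))
        (cast (append_assoc X Y Z) (append_assoc Y X Z) (swap X Y ∥ᵈ id Z) ⨟
          cast rfl (append_assoc Y Z X).symm (id Y ∥ᵈ swap X Z))
  -- the axioms
  | ax {X Y : Obj} {d e : Diag R X Y} : Axiom d e → Equiv d e
  | ax_mirror {X Y : Obj} {d e : Diag R X Y} : Axiom d e → Equiv d.mirror e.mirror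

end Diag

/-- Equality of diagrams modulo the equational theory. -/
notation:50 d:51 " ≣ " e:51 => Diag.Equiv d e

/-! ## Normal forms -/

namespace Diag

variable {R : Type u}

/-- Mirrored Nulls on `n` wires of color `𝟙`. -/
def discard : (n : ℕ) → Diag R (ones n) nil
  | 0 => id nil
  | n + 1 => discard n ∥ᵈ conull .one

/-- `X → X ∥ X`: mirrored Contractions on every wire. -/
def dup : (X : Obj) → Diag R X (X ++ X)
  | nil => id nil
  | snoc X B =>
      (dup X ∥ᵈ cocontr B) ⨟
        (cast rfl (append_assoc X (of B) X).symm (id X ∥ᵈ swap X (of B)) ∥ᵈ wire B)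

/-- `(… (𝟙 ⊕ 𝟙) ⊕ …) ⊕ 𝟙` with `n` copies of `𝟙`. -/
def nPlusColor : ℕ → Color
  | 0 => .zero
  | 1 => .one
  | n + 2 => .plus (nPlusColor (n + 1)) .one

/-- The `n`-ary Plus on wires of color `𝟙` (a Null if `n = 0`). -/
def nPlus : (n : ℕ) → Diag R (ones n) (of (nPlusColor n))
  | 0 => null .zero
  | 1 => wire .one
  | n + 2 => (nPlus (n + 1) ∥ᵈ wire .one) ⨟ plus (nPlusColor (n + 1)) .one

/-- The disjunction of `n` wires of color `𝟙`: an `n`-ary Plus followed by its mirror. -/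
def disj (n : ℕ) : Diag R (ones n) (ones n) := nPlus n ⨟ (nPlus n).mirror

/-- Tensors (with Adapter `𝟙 ⊗ 𝟙 → 𝟙`) of each of the first `a` wires with the last wire. -/
def pairOne : (a : ℕ) → Diag R (ones a ++ of .one) (ones a)
  | 0 => conull .one
  | a + 1 =>
      (id (ones a) ∥ᵈ wire .one ∥ᵈ cocontr .one) ⨟ (id (ones a) ∥ᵈ sw .one .one ∥ᵈ wire .one) ⨟
        (pairOne a ∥ᵈ untapR .one)

/-- Tensors (with Adapter `𝟙 ⊗ 𝟙 → 𝟙`) of each of the first `a` wires with each of the last `b`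
wires. -/
def pairing (a : ℕ) : (b : ℕ) → Diag R (ones a ++ ones b) (ones (a * b))
  | 0 => discard a
  | b + 1 =>
      cast rfl (ones_add (a * b) a)
        ((dup (ones a) ∥ᵈ id (ones (b + 1))) ⨟
          (cast (append_assoc (ones a) (ones a) (ones b)).symm
            (append_assoc (ones a) (ones b) (ones a)).symm
            (id (ones a) ∥ᵈ swap (ones a) (ones b)) ∥ᵈ wire .one) ⨟
          (pairing a b ∥ᵈ pairOne a))

/-- The almost-isomorphism from a wire of color `A` to `𝟙 ∥ … ∥ 𝟙` with `dim A` wires. -/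
def isoColor : (A : Color) → Diag R (of A) (ones A.dim)
  | .zero => conull .zero
  | .one => wire .one
  | .plus A B =>
      coplus A B ⨟ cast rfl (ones_add A.dim B.dim) (isoColor A ∥ᵈ isoColor B) ⨟
        disj (A.dim + B.dim)
  | .tensor A B =>
      cotens A B ⨟ (isoColor A ∥ᵈ isoColor B) ⨟ pairing A.dim B.dim ⨟ disj (A.dim * B.dim)

theorem ones_dim (x b : ℕ) : ones (x * b) ++ (ones x ++ ones b) = ones (x * b + x + b) := by
  rw [← append_assoc, ones_add, ones_add]

/-- The almost-isomorphism `iso_X` from `X` to `𝟙 ∥ … ∥ 𝟙` with `dim X` wires. -/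
def iso : (X : Obj) → Diag R X (ones X.dim)
  | nil => id nil
  | snoc X B =>
      (iso X ∥ᵈ isoColor B) ⨟ dup (ones X.dim ++ ones B.dim) ⨟
        cast rfl (ones_dim X.dim B.dim)
          (pairing X.dim B.dim ∥ᵈ id (ones X.dim ++ ones B.dim)) ⨟
        disj (X.dim * B.dim + X.dim + B.dim)

/-- The scalars `v 0, …, v (n - 1)` on `n` wires, followed by an `n`-ary Contraction. -/
def row : {n : ℕ} → (Fin n → R) → Diag R (ones n) (of .one)
  | 0, _ => null .one
  | 1, v => scal (v 0) .one
  | n + 2, v =>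
      (row (fun i : Fin (n + 1) => v i.castSucc) ∥ᵈ scal (v (Fin.last (n + 1))) .one) ⨟ contr .one

/-- Duplication of the `n` inputs, one copy of which is sent to each row of `M`. -/
def rows {n : ℕ} : {m : ℕ} → Matrix (Fin m) (Fin n) R → Diag R (ones n) (ones m)
  | 0, _ => discard n
  | 1, M => row (M 0)
  | m + 2, M =>
      dup (ones n) ⨟
        (rows (fun i : Fin (m + 1) => M i.castSucc) ∥ᵈ row (M (Fin.last (m + 1))))

/-- The diagram `[M]` of a matrix `M`. -/
def ofMatrix {m n : ℕ} (M : Matrix (Fin m) (Fin n) R) : Diag R (ones n) (ones m) :=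
  disj n ⨟ rows M ⨟ disj m

/-- The diagram in normal form given by a matrix `M`. -/
def nf {X Y : Obj} (M : Matrix (Fin (Y.dim + 1)) (Fin (X.dim + 1)) R) : Diag R X Y :=
  (iso X ∥ᵈ unit) ⨟ ofMatrix M ⨟ ((iso Y).mirror ∥ᵈ counit)

end Diag

/-! ## Semantics -/

section Semantics

/-- A monoidal category with biproducts in which `⊗` distributes over the biproducts: the
left-distributor `X ⊗ (K ⊞ L) ⟶ (X ⊗ K) ⊞ (X ⊗ L)` and the left-annihilator `X ⊗ 0 ⟶ 0` are
isomorphisms. -/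
class Distributive (H : Type v) [Category.{w} H] [HasZeroMorphisms H] [HasZeroObject H]
    [HasBinaryBiproducts H] [MonoidalCategory H] : Prop where
  distrib : ∀ X K L : H,
    IsIso (biprod.lift (X ◁ biprod.fst) (X ◁ biprod.snd) : X ⊗ (K ⊞ L) ⟶ (X ⊗ K) ⊞ (X ⊗ L))
  annihil : ∀ X : H, IsIso (0 : X ⊗ (0 : H) ⟶ (0 : H))

/-- A semiring isomorphism `scal` from `R` to the endomorphisms of the monoidal unit, whose sum is
the one of the semiadditive structure, `f + g = ∇ ∘ (f ⊕ g) ∘ Δ`, and whose product is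
composition. -/
structure ScalarIso (R : Type u) [CommSemiring R] (H : Type v) [Category.{w} H]
    [HasZeroMorphisms H] [HasBinaryBiproducts H] [MonoidalCategory H] where
  scal : R → (𝟙_ H ⟶ 𝟙_ H)
  bijective : Function.Bijective scal
  map_zero : scal 0 = 0
  map_one : scal 1 = 𝟙 (𝟙_ H)
  map_add : ∀ s t : R, scal (s + t) =
    biprod.lift (𝟙 (𝟙_ H)) (𝟙 (𝟙_ H)) ≫ biprod.map (scal s) (scal t) ≫
      biprod.desc (𝟙 (𝟙_ H)) (𝟙 (𝟙_ H))
  map_mul : ∀ s t : R, scal (s * t) = scal t ≫ scal s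

variable {H : Type v} [Category.{w} H] [HasZeroMorphisms H] [HasZeroObject H]
  [HasBinaryBiproducts H] [MonoidalCategory H]

/-- The scalar multiple `s · id` of an identity. -/
def smulId (s : 𝟙_ H ⟶ 𝟙_ H) (K : H) : K ⟶ K := (λ_ K).inv ≫ (s ▷ K) ≫ (λ_ K).hom

section Distributive

variable [Distributive H]

theorem isZero_tensor_zero (X : H) : IsZero (X ⊗ (0 : H)) := by
  have := Distributive.annihil X
  exact (isZero_zero H).of_iso (asIso (0 : X ⊗ (0 : H) ⟶ (0 : H)))

theorem whisker_zero (X : H) {K L : H} : X ◁ (0 : K ⟶ L) = 0 := by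
  have h : (0 : K ⟶ L) = (0 : K ⟶ (0 : H)) ≫ (0 : (0 : H) ⟶ L) := by simp
  rw [h, MonoidalCategory.whiskerLeft_comp, (isZero_tensor_zero X).eq_zero_of_tgt (X ◁ 0), zero_comp]

/-- The left-distributor. -/
noncomputable def distL (X K L : H) : X ⊗ (K ⊞ L) ≅ (X ⊗ K) ⊞ (X ⊗ L) where
  hom := biprod.lift (X ◁ biprod.fst) (X ◁ biprod.snd)
  inv := biprod.desc (X ◁ biprod.inl) (X ◁ biprod.inr)
  hom_inv_id := by
    have := Distributive.distrib X K L
    rw [← cancel_mono (biprod.lift (X ◁ biprod.fst) (X ◁ biprod.snd) :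
      X ⊗ (K ⊞ L) ⟶ (X ⊗ K) ⊞ (X ⊗ L)), Category.assoc]
    have : (biprod.desc (X ◁ biprod.inl) (X ◁ biprod.inr) ≫
      biprod.lift (X ◁ biprod.fst) (X ◁ biprod.snd) :
        (X ⊗ K) ⊞ (X ⊗ L) ⟶ (X ⊗ K) ⊞ (X ⊗ L)) = 𝟙 _ := by
      ext <;> simp [← MonoidalCategory.whiskerLeft_comp, whisker_zero]
    rw [this]; simp
  inv_hom_id := by
    ext <;> simp [← MonoidalCategory.whiskerLeft_comp, whisker_zero]

@[simp]
theorem distL_hom_fst (X K L : H) : (distL X K L).hom ≫ biprod.fst = X ◁ biprod.fst := by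
  simp [distL]

@[simp]
theorem distL_hom_snd (X K L : H) : (distL X K L).hom ≫ biprod.snd = X ◁ biprod.snd := by
  simp [distL]

@[simp]
theorem distL_inv_fst (X K L : H) : (distL X K L).inv ≫ (X ◁ biprod.fst) = biprod.fst := by
  rw [Iso.inv_comp_eq, distL_hom_fst]

@[simp]
theorem distL_inv_snd (X K L : H) : (distL X K L).inv ≫ (X ◁ biprod.snd) = biprod.snd := by
  rw [Iso.inv_comp_eq, distL_hom_snd]

variable [SymmetricCategory H]

theorem zero_whisker (X : H) {K L : H} : (0 : K ⟶ L) ▷ X = 0 := by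
  rw [← cancel_mono (β_ L X).hom, BraidedCategory.braiding_naturality_left, whisker_zero]
  simp

/-- The right-distributor. -/
noncomputable def distR (K L X : H) : (K ⊞ L) ⊗ X ≅ (K ⊗ X) ⊞ (L ⊗ X) where
  hom := biprod.lift (biprod.fst ▷ X) (biprod.snd ▷ X)
  inv := biprod.desc (biprod.inl ▷ X) (biprod.inr ▷ X)
  hom_inv_id := by
    have h := (distL X K L).hom_inv_id
    have h1 : (biprod.lift (biprod.fst ▷ X) (biprod.snd ▷ X) : (K ⊞ L) ⊗ X ⟶ _) =
        (β_ _ _).hom ≫ (distL X K L).hom ≫ biprod.map (β_ X K).hom (β_ X L).hom := by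
      ext <;> simp [distL]
    have h2 : (biprod.desc (biprod.inl ▷ X) (biprod.inr ▷ X) : _ ⟶ (K ⊞ L) ⊗ X) =
        biprod.map (β_ X K).inv (β_ X L).inv ≫ (distL X K L).inv ≫ (β_ _ _).hom := by
      ext <;> simp [distL]
    have h3 : (biprod.map (β_ X K).hom (β_ X L).hom ≫ biprod.map (β_ X K).inv (β_ X L).inv) =
        𝟙 _ := by ext <;> simp
    rw [h1, h2]
    simp only [Category.assoc]
    rw [reassoc_of% h3, reassoc_of% h]
    simp
  inv_hom_id := by
    ext <;> simp [← MonoidalCategory.comp_whiskerRight, zero_whisker]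

@[simp]
theorem distR_hom_fst (K L X : H) : (distR K L X).hom ≫ biprod.fst = biprod.fst ▷ X := by
  simp [distR]

@[simp]
theorem distR_hom_snd (K L X : H) : (distR K L X).hom ≫ biprod.snd = biprod.snd ▷ X := by
  simp [distR]

@[simp]
theorem distR_inv_fst (K L X : H) : (distR K L X).inv ≫ (biprod.fst ▷ X) = biprod.fst := by
  rw [Iso.inv_comp_eq, distR_hom_fst]

@[simp]
theorem distR_inv_snd (K L X : H) : (distR K L X).inv ≫ (biprod.snd ▷ X) = biprod.snd := by
  rw [Iso.inv_comp_eq, distR_hom_snd]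

end Distributive

/-! ### The parallel monoidal structure -/

/-- `K | L = (K ⊗ L) ⊕ (K ⊕ L)`. -/
noncomputable abbrev bar (K L : H) : H := (K ⊗ L) ⊞ (K ⊞ L)

/-- Functoriality of `|` on isomorphisms. -/
@[simps]
noncomputable def barIso {K K' L L' : H} (f : K ≅ K') (g : L ≅ L') : bar K L ≅ bar K' L' where
  hom := biprod.map (f.hom ⊗ₘ g.hom) (biprod.map f.hom g.hom)
  inv := biprod.map (f.inv ⊗ₘ g.inv) (biprod.map f.inv g.inv)

/-- The symmetry `σ^| = σ^⊗ ⊕ σ^⊕`. -/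
noncomputable def barSwap [SymmetricCategory H] (K L : H) : bar K L ⟶ bar L K :=
  biprod.map (β_ K L).hom (biprod.lift biprod.snd biprod.fst)

section Distributive

variable [Distributive H] [SymmetricCategory H]

/-- The left unitor of `|`. -/
noncomputable def barLeft (K : H) : bar (0 : H) K ≅ K where
  hom := (biprod.snd : bar (0 : H) K ⟶ (0 : H) ⊞ K) ≫ biprod.snd
  inv := (biprod.inr : K ⟶ (0 : H) ⊞ K) ≫ biprod.inr
  hom_inv_id := by
    have h : IsZero ((0 : H) ⊗ K) := (isZero_tensor_zero K).of_iso (β_ _ _)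
    apply biprod.hom_ext
    · exact h.eq_of_tgt _ _
    · apply biprod.hom_ext
      · exact (isZero_zero H).eq_of_tgt _ _
      · simp

/-- The right unitor of `|`. -/
noncomputable def barRight (K : H) : bar K (0 : H) ≅ K where
  hom := (biprod.snd : bar K (0 : H) ⟶ K ⊞ (0 : H)) ≫ biprod.fst
  inv := (biprod.inl : K ⟶ K ⊞ (0 : H)) ≫ biprod.inr
  hom_inv_id := by
    apply biprod.hom_ext
    · exact (isZero_tensor_zero K).eq_of_tgt _ _
    · apply biprod.hom_ext
      · simp
      · exact (isZero_zero H).eq_of_tgt _ _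

set_option linter.unusedSimpArgs false in
/-- The associator of `|`, which matches the seven summands of both sides. -/
noncomputable def barAssoc (K L M : H) : bar (bar K L) M ≅ bar K (bar L M) where
  hom := biprod.lift
    (biprod.lift (biprod.fst ≫ (biprod.fst ▷ M) ≫ (α_ K L M).hom)
      (biprod.lift (biprod.snd ≫ biprod.fst ≫ biprod.fst)
        (biprod.fst ≫ (biprod.snd ▷ M) ≫ (biprod.fst ▷ M)) ≫ (distL K L M).inv) ≫
      (distL K (L ⊗ M) (L ⊞ M)).inv)
    (biprod.lift (biprod.snd ≫ biprod.fst ≫ biprod.snd ≫ biprod.fst)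
      (biprod.lift (biprod.fst ≫ (biprod.snd ▷ M) ≫ (biprod.snd ▷ M))
        (biprod.lift (biprod.snd ≫ biprod.fst ≫ biprod.snd ≫ biprod.snd)
          (biprod.snd ≫ biprod.snd))))
  inv := biprod.lift
    (biprod.lift (biprod.fst ≫ (K ◁ biprod.fst) ≫ (α_ K L M).inv)
      (biprod.lift (biprod.fst ≫ (K ◁ biprod.snd) ≫ (K ◁ biprod.snd))
        (biprod.snd ≫ biprod.snd ≫ biprod.fst) ≫ (distR K L M).inv) ≫
      (distR (K ⊗ L) (K ⊞ L) M).inv)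
    (biprod.lift
      (biprod.lift (biprod.fst ≫ (K ◁ biprod.snd) ≫ (K ◁ biprod.fst))
        (biprod.lift (biprod.snd ≫ biprod.fst)
          (biprod.snd ≫ biprod.snd ≫ biprod.snd ≫ biprod.fst)))
      (biprod.snd ≫ biprod.snd ≫ biprod.snd ≫ biprod.snd))
  hom_inv_id := by
    apply biprod.hom_ext
    · rw [← cancel_mono (distR _ _ _).hom]
      apply biprod.hom_ext
      · simp [reassoc_of% (distL_inv_fst (H := H)), reassoc_of% (distL_inv_snd (H := H))]
      · rw [← cancel_mono (distR _ _ _).hom]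
        apply biprod.hom_ext <;> simp [reassoc_of% (distL_inv_fst (H := H)), reassoc_of% (distL_inv_snd (H := H))]
    · apply biprod.hom_ext
      · apply biprod.hom_ext
        · simp [reassoc_of% (distL_inv_fst (H := H)), reassoc_of% (distL_inv_snd (H := H))]
        · apply biprod.hom_ext <;> simp [reassoc_of% (distL_inv_fst (H := H)), reassoc_of% (distL_inv_snd (H := H))]
      · simp [reassoc_of% (distL_inv_fst (H := H)), reassoc_of% (distL_inv_snd (H := H))]
  inv_hom_id := by
    apply biprod.hom_ext
    · rw [← cancel_mono (distL _ _ _).hom]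
      apply biprod.hom_ext
      · simp [reassoc_of% (distR_inv_fst (H := H)), reassoc_of% (distR_inv_snd (H := H))]
      · rw [← cancel_mono (distL _ _ _).hom]
        apply biprod.hom_ext <;> simp [reassoc_of% (distR_inv_fst (H := H)), reassoc_of% (distR_inv_snd (H := H))]
    · apply biprod.hom_ext
      · simp [reassoc_of% (distR_inv_fst (H := H)), reassoc_of% (distR_inv_snd (H := H))]
      · apply biprod.hom_ext
        · simp [reassoc_of% (distR_inv_fst (H := H)), reassoc_of% (distR_inv_snd (H := H))]
        · apply biprod.hom_ext <;> simp [reassoc_of% (distR_inv_fst (H := H)), reassoc_of% (distR_inv_snd (H := H))]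

/-- The isomorphism `expand : (K ⊕ 𝟙) ⊗ (L ⊕ 𝟙) → (K | L) ⊕ 𝟙`. -/
noncomputable def expand (K L : H) : (K ⊞ 𝟙_ H) ⊗ (L ⊞ 𝟙_ H) ≅ bar K L ⊞ 𝟙_ H :=
  distR K (𝟙_ H) (L ⊞ 𝟙_ H) ≪≫
    biprod.mapIso (distL K L (𝟙_ H) ≪≫ biprod.mapIso (Iso.refl _) (ρ_ K)) (λ_ (L ⊞ 𝟙_ H)) ≪≫
    (biprod.associator ((K ⊗ L) ⊞ K) L (𝟙_ H)).symm ≪≫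
    biprod.mapIso (biprod.associator (K ⊗ L) K L) (Iso.refl _)

end Distributive

/-! ### Semantics of objects -/

/-- The semantics of a color. -/
noncomputable def Color.sem (H : Type v) [Category.{w} H] [HasZeroMorphisms H] [HasZeroObject H]
    [HasBinaryBiproducts H] [MonoidalCategory H] : Color → H
  | .zero => 0
  | .one => 𝟙_ H
  | .plus A B => A.sem H ⊞ B.sem H
  | .tensor A B => A.sem H ⊗ B.sem H

/-- The semantics of an object. -/
noncomputable def Obj.sem (H : Type v) [Category.{w} H] [HasZeroMorphisms H] [HasZeroObject H]
    [HasBinaryBiproducts H] [MonoidalCategory H] : Obj → H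
  | .nil => 0
  | .snoc X B => bar (X.sem H) (B.sem H)

section Distributive

variable [Distributive H] [SymmetricCategory H]

/-- The structural isomorphism `m^|` from `⟦X⟧ | ⟦Y⟧` to `⟦X ∥ Y⟧`. -/
noncomputable def appendIso (X : Obj) : (Y : Obj) → (bar (X.sem H) (Y.sem H) ≅ (X ++ Y).sem H)
  | .nil => barRight (X.sem H)
  | .snoc Y B =>
      (barAssoc (X.sem H) (Y.sem H) (B.sem H)).symm ≪≫ barIso (appendIso X Y) (Iso.refl (B.sem H))

/-- The structural isomorphism `m^|` from `⟦A⟧` as an object to `⟦A⟧` as a color. -/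
noncomputable def oneIso (A : Color) : (of A).sem H ≅ A.sem H := barLeft (A.sem H)

/-- The structural isomorphism `m^|` from `⟦A ∥ B⟧` to `⟦A⟧ | ⟦B⟧`. -/
noncomputable def twoIso (A B : Color) : (of A ++ of B).sem H ≅ bar (A.sem H) (B.sem H) :=
  barIso (oneIso A) (Iso.refl (B.sem H))

end Distributive

/-! ### Semantics of diagrams -/

/-- The structural morphisms between the semantics of two colors: those obtained from
the unitors and the associators of `⊗` and `⊕`, and their inverses, by composition, `⊗` and
`⊕`. -/
inductive IsCoherence : (A B : Color) → (A.sem H ⟶ B.sem H) → Prop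
  | id (A : Color) : IsCoherence A A (𝟙 _)
  | comp {A B C : Color} {f : A.sem H ⟶ B.sem H} {g : B.sem H ⟶ C.sem H} :
      IsCoherence A B f → IsCoherence B C g → IsCoherence A C (f ≫ g)
  | tensor {A A' B B' : Color} {f : A.sem H ⟶ A'.sem H} {g : B.sem H ⟶ B'.sem H} :
      IsCoherence A A' f → IsCoherence B B' g →
        IsCoherence (.tensor A B) (.tensor A' B') (f ⊗ₘ g)
  | plus {A A' B B' : Color} {f : A.sem H ⟶ A'.sem H} {g : B.sem H ⟶ B'.sem H} :
      IsCoherence A A' f → IsCoherence B B' g →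
        IsCoherence (.plus A B) (.plus A' B') (biprod.map f g)
  | tensor_one (A : Color) : IsCoherence (.tensor A .one) A (ρ_ (A.sem H)).hom
  | tensor_one_inv (A : Color) : IsCoherence A (.tensor A .one) (ρ_ (A.sem H)).inv
  | one_tensor (A : Color) : IsCoherence (.tensor .one A) A (λ_ (A.sem H)).hom
  | one_tensor_inv (A : Color) : IsCoherence A (.tensor .one A) (λ_ (A.sem H)).inv
  | tensor_assoc (A B C : Color) :
      IsCoherence (.tensor (.tensor A B) C) (.tensor A (.tensor B C))
        (α_ (A.sem H) (B.sem H) (C.sem H)).hom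
  | tensor_assoc_inv (A B C : Color) :
      IsCoherence (.tensor A (.tensor B C)) (.tensor (.tensor A B) C)
        (α_ (A.sem H) (B.sem H) (C.sem H)).inv
  | plus_zero (A : Color) : IsCoherence (.plus A .zero) A biprod.fst
  | plus_zero_inv (A : Color) : IsCoherence A (.plus A .zero) biprod.inl
  | zero_plus (A : Color) : IsCoherence (.plus .zero A) A biprod.snd
  | zero_plus_inv (A : Color) : IsCoherence A (.plus .zero A) biprod.inr
  | plus_assoc (A B C : Color) :
      IsCoherence (.plus (.plus A B) C) (.plus A (.plus B C))
        (biprod.associator (A.sem H) (B.sem H) (C.sem H)).hom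
  | plus_assoc_inv (A B C : Color) :
      IsCoherence (.plus A (.plus B C)) (.plus (.plus A B) C)
        (biprod.associator (A.sem H) (B.sem H) (C.sem H)).inv

theorem exists_isCoherence (H : Type v) [Category.{w} H] [HasZeroMorphisms H] [HasZeroObject H]
    [HasBinaryBiproducts H] [MonoidalCategory H] {A B : Color} (h : A.Approx B) :
    (∃ f : A.sem H ⟶ B.sem H, IsCoherence A B f) ∧ ∃ f : B.sem H ⟶ A.sem H, IsCoherence B A f := by
  induction h with
  | refl A => exact ⟨⟨_, .id A⟩, ⟨_, .id A⟩⟩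
  | symm _ ih => exact ⟨ih.2, ih.1⟩
  | trans _ _ ih ih' =>
      obtain ⟨⟨f, hf⟩, ⟨f', hf'⟩⟩ := ih
      obtain ⟨⟨g, hg⟩, ⟨g', hg'⟩⟩ := ih'
      exact ⟨⟨_, hf.comp hg⟩, ⟨_, hg'.comp hf'⟩⟩
  | plus_zero A => exact ⟨⟨_, .plus_zero A⟩, ⟨_, .plus_zero_inv A⟩⟩
  | zero_plus A => exact ⟨⟨_, .zero_plus A⟩, ⟨_, .zero_plus_inv A⟩⟩
  | tensor_one A => exact ⟨⟨_, .tensor_one A⟩, ⟨_, .tensor_one_inv A⟩⟩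
  | one_tensor A => exact ⟨⟨_, .one_tensor A⟩, ⟨_, .one_tensor_inv A⟩⟩
  | plus_assoc A B C => exact ⟨⟨_, .plus_assoc A B C⟩, ⟨_, .plus_assoc_inv A B C⟩⟩
  | tensor_assoc A B C => exact ⟨⟨_, .tensor_assoc A B C⟩, ⟨_, .tensor_assoc_inv A B C⟩⟩
  | plus_right C _ ih =>
      obtain ⟨⟨f, hf⟩, ⟨f', hf'⟩⟩ := ih
      exact ⟨⟨_, hf.plus (.id C)⟩, ⟨_, hf'.plus (.id C)⟩⟩
  | plus_left C _ ih =>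
      obtain ⟨⟨f, hf⟩, ⟨f', hf'⟩⟩ := ih
      exact ⟨⟨_, (IsCoherence.id C).plus hf⟩, ⟨_, (IsCoherence.id C).plus hf'⟩⟩
  | tensor_right C _ ih =>
      obtain ⟨⟨f, hf⟩, ⟨f', hf'⟩⟩ := ih
      exact ⟨⟨_, hf.tensor (.id C)⟩, ⟨_, hf'.tensor (.id C)⟩⟩
  | tensor_left C _ ih =>
      obtain ⟨⟨f, hf⟩, ⟨f', hf'⟩⟩ := ih
      exact ⟨⟨_, (IsCoherence.id C).tensor hf⟩, ⟨_, (IsCoherence.id C).tensor hf'⟩⟩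

/-- The structural morphism `⟦A ≈ B⟧`; by coherence it does not depend on the choice. -/
noncomputable def coherence (H : Type v) [Category.{w} H] [HasZeroMorphisms H] [HasZeroObject H]
    [HasBinaryBiproducts H] [MonoidalCategory H] {A B : Color} (h : A.Approx B) :
    A.sem H ⟶ B.sem H :=
  (exists_isCoherence H h).1.choose

variable [SymmetricCategory H] [Distributive H] {R : Type u} [CommSemiring R]

/-- The semantics `⟦g⟧` of a functional generator. -/
noncomputable def FGen.sem (S : ScalarIso R H) : {X Y : Obj} → FGen R X Y → (X.sem H ⟶ Y.sem H)
  | _, _, .tens A B => (twoIso A B).hom ≫ biprod.fst ≫ (oneIso (.tensor A B)).inv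
  | _, _, .cotens A B => (oneIso (.tensor A B)).hom ≫ biprod.inl ≫ (twoIso A B).inv
  | _, _, .plus A B => (twoIso A B).hom ≫ biprod.snd ≫ (oneIso (.plus A B)).inv
  | _, _, .coplus A B => (oneIso (.plus A B)).hom ≫ biprod.inr ≫ (twoIso A B).inv
  | _, _, .contr A =>
      (twoIso A A).hom ≫ biprod.snd ≫ biprod.desc (𝟙 (A.sem H)) (𝟙 (A.sem H)) ≫ (oneIso A).inv
  | _, _, .cocontr A =>
      (oneIso A).hom ≫ biprod.lift (𝟙 (A.sem H)) (𝟙 (A.sem H)) ≫ biprod.inr ≫ (twoIso A A).inv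
  | _, _, .null _ => 0
  | _, _, .conull _ => 0
  | _, _, .adapt (A := A) (B := B) h => (oneIso A).hom ≫ coherence H h ≫ (oneIso B).inv
  | _, _, .scal s A => (oneIso A).hom ≫ smulId (S.scal s) (A.sem H) ≫ (oneIso A).inv

/-- The semantics `⟦d⟧^{⊕ 𝟙}` of a diagram, a morphism from `⟦X⟧ ⊕ 𝟙` to `⟦Y⟧ ⊕ 𝟙`. On the identity,
the swap and the functional generators it is `⟦-⟧ ⊕ id`. -/
noncomputable def Diag.sem (S : ScalarIso R H) :
    {X Y : Obj} → Diag R X Y → (X.sem H ⊞ 𝟙_ H ⟶ Y.sem H ⊞ 𝟙_ H)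
  | _, _, .id X => 𝟙 (X.sem H ⊞ 𝟙_ H)
  | _, _, .swap X Y =>
      biprod.map ((appendIso X Y).inv ≫ barSwap (X.sem H) (Y.sem H) ≫ (appendIso Y X).hom)
        (𝟙 (𝟙_ H))
  | _, _, .comp d e => d.sem S ≫ e.sem S
  | _, _, .par (X := X) (Y := Y) (X' := X') (Y' := Y') d e =>
      biprod.map (appendIso X X').inv (𝟙 (𝟙_ H)) ≫ (expand (X.sem H) (X'.sem H)).inv ≫
        (d.sem S ⊗ₘ e.sem S) ≫ (expand (Y.sem H) (Y'.sem H)).hom ≫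
        biprod.map (appendIso Y Y').hom (𝟙 (𝟙_ H))
  | _, _, .fgen g => biprod.map (g.sem S) (𝟙 (𝟙_ H))
  | _, _, .unit =>
      (biprod.snd : (0 : H) ⊞ 𝟙_ H ⟶ 𝟙_ H) ≫ biprod.lift (𝟙 (𝟙_ H)) (𝟙 (𝟙_ H)) ≫
        biprod.map (oneIso .one).inv (𝟙 (𝟙_ H))
  | _, _, .counit =>
      biprod.map (oneIso .one).hom (𝟙 (𝟙_ H)) ≫ biprod.desc (𝟙 (𝟙_ H)) (𝟙 (𝟙_ H)) ≫
        (biprod.inr : 𝟙_ H ⟶ (0 : H) ⊞ 𝟙_ H)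

end Semantics

end TensorPlus

open TensorPlus

namespace TensorPlus

open Obj

variable {R : Type u} [CommSemiring R]

/-! ## Diagrams modulo the equational theory -/

namespace Diag

/-- Diagrams modulo `≣`. -/
def setoid (R : Type u) [CommSemiring R] (X Y : Obj) : Setoid (Diag R X Y) :=
  ⟨Equiv, ⟨Equiv.refl, Equiv.symm, Equiv.trans⟩⟩

end Diag

/-- Diagrams modulo the equational theory. -/
def Hom (R : Type u) [CommSemiring R] (X Y : Obj) : Type u := Quotient (Diag.setoid R X Y)

namespace Hom

variable {R : Type u} [CommSemiring R] {X Y Z W X' Y' Z' X'' Y'' : Obj}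

/-- The class of a diagram. -/
def mk (d : Diag R X Y) : Hom R X Y := Quotient.mk _ d

theorem mk_eq_iff {d e : Diag R X Y} : mk d = mk e ↔ d ≣ e :=
  ⟨fun h => Quotient.exact h, fun h => Quotient.sound h⟩

theorem sound {d e : Diag R X Y} (h : d ≣ e) : mk d = mk e := Quotient.sound h

/-- The identity. -/
def id (X : Obj) : Hom R X X := mk (.id X)

/-- The swap. -/
def swap (X Y : Obj) : Hom R (X ++ Y) (Y ++ X) := mk (.swap X Y)

/-- Sequential composition. -/
def comp (f : Hom R X Y) (g : Hom R Y Z) : Hom R X Z :=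
  Quotient.map₂ Diag.comp (fun _ _ h _ _ k => Diag.Equiv.comp_congr h k) f g

/-- Parallel composition. -/
def par (f : Hom R X Y) (g : Hom R X' Y') : Hom R (X ++ X') (Y ++ Y') :=
  Quotient.map₂ Diag.par (fun _ _ h _ _ k => Diag.Equiv.par_congr h k) f g

/-- Transport along equalities of objects. -/
def cast (h : X = X') (k : Y = Y') (f : Hom R X Y) : Hom R X' Y' := h ▸ k ▸ f

end Hom

/-- Sequential composition of classes of diagrams, in diagrammatic order. -/
infixl:70 " ⬝ " => Hom.comp

/-- Parallel composition of classes of diagrams. -/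
infixl:75 " ⊠ " => Hom.par

/-- Addition of a wire on the right. -/
def Hom.whisk {R : Type u} [CommSemiring R] {X Y : Obj} (f : Hom R X Y) (A : Color) :
    Hom R (snoc X A) (snoc Y A) := f ⊠ (Hom.id (of A) : Hom R (of A) (of A))

/-- Addition of a wire on the right. -/
infixl:75 " ◃ " => Hom.whisk

namespace Hom

variable {R : Type u} [CommSemiring R] {X Y Z W X' Y' Z' X'' Y'' : Obj}

@[simp] theorem id_comp (f : Hom R X Y) : id X ⬝ f = f := by
  induction f using Quotient.ind; exact sound (.id_comp _)
@[simp] theorem comp_id (f : Hom R X Y) : f ⬝ id Y = f := by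
  induction f using Quotient.ind; exact sound (.comp_id _)
theorem assoc (f : Hom R X Y) (g : Hom R Y Z) (h : Hom R Z W) : f ⬝ g ⬝ h = f ⬝ (g ⬝ h) := by
  induction f using Quotient.ind; induction g using Quotient.ind; induction h using Quotient.ind
  exact sound (.assoc _ _ _)
@[simp] theorem par_id (X Y : Obj) : (id X ⊠ id Y : Hom R _ _) = id (X ++ Y) :=
  sound (.par_id _ _)
@[simp] theorem id_whisk (X : Obj) (A : Color) : (id X ◃ A : Hom R _ _) = id (snoc X A) :=
  sound (.par_id _ _)
theorem whisk_eq (f : Hom R X Y) (A : Color) : f ◃ A = f ⊠ id (of A) := rfl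
theorem interchange (f : Hom R X Y) (g : Hom R Y Z) (f' : Hom R X' Y') (g' : Hom R Y' Z') :
    (f ⊠ f') ⬝ (g ⊠ g') = (f ⬝ g) ⊠ (f' ⬝ g') := by
  induction f using Quotient.ind; induction g using Quotient.ind
  induction f' using Quotient.ind; induction g' using Quotient.ind
  exact sound (.interchange _ _ _ _)
theorem whisk_comp (f : Hom R X Y) (g : Hom R Y Z) (A : Color) :
    (f ⬝ g) ◃ A = (f ◃ A) ⬝ (g ◃ A) := by
  change (f ⬝ g) ⊠ id (of A) = _
  refine Eq.trans ?_ (interchange f g (id (of A)) (id (of A))).symm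
  rw [id_comp]
theorem cast_mk (h : X = X') (k : Y = Y') (d : Diag R X Y) :
    mk (Diag.cast h k d) = cast h k (mk d) := by
  subst h k; rfl
theorem par_assoc (f : Hom R X Y) (g : Hom R X' Y') (h : Hom R X'' Y'') :
    cast (append_assoc X X' X'') (append_assoc Y Y' Y'') (f ⊠ g ⊠ h) = f ⊠ (g ⊠ h) := by
  induction f using Quotient.ind; induction g using Quotient.ind; induction h using Quotient.ind
  exact (cast_mk _ _ _).symm.trans (sound (.par_assoc _ _ _))
theorem par_whisk (f : Hom R X Y) (g : Hom R X' Y') (A : Color) :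
    (f ⊠ g) ◃ A = f ⊠ (g ◃ A) :=
  par_assoc f g (id (of A))
theorem nil_par (f : Hom R X Y) : cast (nil_append X) (nil_append Y) (id nil ⊠ f) = f := by
  induction f using Quotient.ind
  exact (cast_mk _ _ _).symm.trans (sound (.nil_par _))
@[simp] theorem par_nil (f : Hom R X Y) : f ⊠ (id nil : Hom R nil nil) = f := by
  induction f using Quotient.ind; exact sound (.par_nil _)
theorem swap_naturality (f : Hom R X Y) (g : Hom R X' Y') :
    (f ⊠ g) ⬝ swap Y Y' = swap X X' ⬝ (g ⊠ f) := by
  induction f using Quotient.ind; induction g using Quotient.ind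
  exact sound (.swap_naturality _ _)
@[simp] theorem swap_swap (X Y : Obj) : (swap X Y ⬝ swap Y X : Hom R _ _) = id (X ++ Y) :=
  sound (.swap_swap _ _)
theorem swap_nil (X : Obj) : cast rfl (nil_append X) (swap X nil : Hom R _ _) = id X :=
  (cast_mk _ _ _).symm.trans (sound (.swap_nil _))
theorem hexagon (X Y Z : Obj) :
    (swap X (Y ++ Z) : Hom R _ _) =
      cast (append_assoc X Y Z) (append_assoc Y X Z) (swap X Y ⊠ id Z) ⬝
        cast rfl (append_assoc Y Z X).symm (id Y ⊠ swap X Z) := by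
  refine (sound (.hexagon X Y Z)).trans ?_
  refine (congrArg₂ comp (cast_mk _ _ (Diag.swap X Y ∥ᵈ Diag.id Z))
    (cast_mk _ _ (Diag.id Y ∥ᵈ Diag.swap X Z)))

theorem cast_comp (h : X = X') (k : Y = Y') (l : Z = Z') (f : Hom R X Y) (g : Hom R Y Z) :
    cast h l (f ⬝ g) = cast h k f ⬝ cast k l g := by
  subst h k l; rfl
@[simp] theorem cast_cast (h : X = X') (k : Y = Y') (h' : X' = X'') (k' : Y' = Y'')
    (f : Hom R X Y) : cast h' k' (cast h k f) = cast (h.trans h') (k.trans k') f := by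
  subst h k h' k'; rfl
@[simp] theorem cast_rfl (f : Hom R X Y) : cast rfl rfl f = f := rfl
theorem cast_whisk (h : X = X') (k : Y = Y') (f : Hom R X Y) (A : Color) :
    cast h k f ◃ A = cast (congrArg (snoc · A) h) (congrArg (snoc · A) k) (f ◃ A) := by
  subst h k; rfl
theorem cast_id (h : X = X') : cast h h (id X : Hom R X X) = id X' := by
  subst h; rfl

/-! ### Mirroring -/

end Hom

theorem Diag.mirror_mirror {R : Type u} {X Y : Obj} (d : Diag R X Y) : d.mirror.mirror = d := by
  induction d with
  | fgen g => cases g <;> rfl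
  | comp d e hd he => simp [Diag.mirror, hd, he]
  | par d e hd he => simp [Diag.mirror, hd, he]
  | _ => rfl

theorem Diag.mirror_cast {R : Type u} {X Y X' Y' : Obj} (h : X = X') (k : Y = Y')
    (d : Diag R X Y) : (Diag.cast h k d).mirror = Diag.cast k h d.mirror := by
  subst h k; rfl

theorem Diag.Equiv.cast_congr {R : Type u} [CommSemiring R] {X Y X' Y' : Obj} (h : X = X')
    (k : Y = Y') {d e : Diag R X Y} (H : d ≣ e) : Diag.cast h k d ≣ Diag.cast h k e := by
  subst h k; exact H

namespace Hom

variable {R : Type u} [CommSemiring R] {X Y Z W X' Y' Z' X'' Y'' : Obj}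

theorem comp_swap_cancel {f g : Hom R X (Y ++ Z)} (h : f ⬝ swap Y Z = g ⬝ swap Y Z) : f = g := by
  have := congrArg (· ⬝ swap Z Y) h
  simpa [assoc] using this

theorem hexagon_mirror (X Y Z : Obj) :
    (swap (Y ++ Z) X : Hom R _ _) =
      cast (append_assoc Y Z X).symm rfl (id Y ⊠ swap Z X) ⬝
        cast (append_assoc Y X Z) (append_assoc X Y Z) (swap Y X ⊠ id Z) := by
  apply comp_swap_cancel
  rw [swap_swap, hexagon X Y Z, assoc, ← assoc (cast (append_assoc Y X Z) _ _), ← cast_comp,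
    interchange, swap_swap, id_comp, par_id, cast_id, id_comp, ← cast_comp, interchange,
    swap_swap, id_comp, par_id, cast_id]

theorem mirror_sound {d e : Diag R X Y} (h : d ≣ e) : d.mirror ≣ e.mirror := by
  induction h with
  | refl => exact .refl _
  | symm _ ih => exact .symm ih
  | trans _ _ ih ih' => exact .trans ih ih'
  | comp_congr _ _ ih ih' => exact .comp_congr ih' ih
  | par_congr _ _ ih ih' => exact .par_congr ih ih'
  | id_comp => exact .comp_id _
  | comp_id => exact .id_comp _
  | assoc => exact .symm (.assoc _ _ _)
  | par_id => exact .par_id _ _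
  | interchange => exact .interchange _ _ _ _
  | par_assoc => rw [Diag.mirror_cast]; exact .par_assoc _ _ _
  | nil_par => rw [Diag.mirror_cast]; exact .nil_par _
  | par_nil => exact .par_nil _
  | swap_naturality => exact .symm (.swap_naturality _ _)
  | swap_swap => exact .swap_swap _ _
  | swap_nil X =>
      rw [Diag.mirror_cast, ← mk_eq_iff, cast_mk]
      have h : (swap X nil : Hom R _ _) = cast rfl (nil_append X).symm (id X) :=
        ((congrArg (cast rfl (nil_append X).symm) (swap_nil X)).symm.trans
          (cast_cast _ _ _ _ _)).symm
      have h2 := swap_swap (R := R) X nil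
      rw [h] at h2
      have h4 : ∀ {V : Obj} (e : V = X) (g : Hom R V X),
          cast rfl e.symm (id X) ⬝ g = id X → cast e rfl g = id X := by
        intro V e g; subst e; intro h; simpa using h
      exact h4 (nil_append X) _ h2
  | hexagon X Y Z =>
      rw [← mk_eq_iff]
      refine (hexagon_mirror X Y Z).trans ?_
      change _ = mk (Diag.comp _ _)
      change _ = mk _ ⬝ mk _
      rw [Diag.mirror_cast, Diag.mirror_cast, cast_mk, cast_mk]
      rfl
  | ax h => exact .ax_mirror h
  | ax_mirror h => rw [Diag.mirror_mirror, Diag.mirror_mirror]; exact .ax h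

/-- Up-down mirror. -/
def mirror (f : Hom R X Y) : Hom R Y X := Quotient.map Diag.mirror (fun _ _ h => mirror_sound h) f

@[simp] theorem mirror_mirror (f : Hom R X Y) : f.mirror.mirror = f := by
  induction f using Quotient.ind; exact congrArg mk (Diag.mirror_mirror _)
@[simp] theorem mirror_comp (f : Hom R X Y) (g : Hom R Y Z) :
    (f ⬝ g).mirror = g.mirror ⬝ f.mirror := by
  induction f using Quotient.ind; induction g using Quotient.ind; rfl
@[simp] theorem mirror_par (f : Hom R X Y) (g : Hom R X' Y') :
    (f ⊠ g).mirror = f.mirror ⊠ g.mirror := by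
  induction f using Quotient.ind; induction g using Quotient.ind; rfl
@[simp] theorem mirror_whisk (f : Hom R X Y) (A : Color) : (f ◃ A).mirror = f.mirror ◃ A :=
  mirror_par f (id (of A))
@[simp] theorem mirror_id (X : Obj) : (id X : Hom R X X).mirror = id X := rfl
@[simp] theorem mirror_swap (X Y : Obj) : (swap X Y : Hom R _ _).mirror = swap Y X := rfl
theorem mirror_injective {f g : Hom R X Y} (h : f.mirror = g.mirror) : f = g := by
  rw [← mirror_mirror f, h, mirror_mirror]

/-! ### Swaps of two wires next to the right end -/

/-- The swap of the last two wires. -/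
def tw (X : Obj) (A B : Color) : Hom R (snoc (snoc X A) B) (snoc (snoc X B) A) :=
  id X ⊠ swap (of A) (of B)

@[simp] theorem tw_tw (X : Obj) (A B : Color) : (tw X A B ⬝ tw X B A : Hom R _ _) = id _ := by
  refine (interchange (id X) (id X) (swap (of A) (of B)) (swap (of B) (of A))).trans ?_
  rw [swap_swap, id_comp, par_id]; rfl

theorem whisk_whisk (f : Hom R X Y) (A B : Color) :
    f ◃ A ◃ B = f ⊠ (id (of A ++ of B) : Hom R _ _) :=
  (par_whisk f (id (of A)) B).trans (congrArg (f ⊠ ·) (par_id (of A) (of B)))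

theorem tw_naturality (f : Hom R X Y) (A B : Color) :
    (f ◃ A ◃ B) ⬝ tw Y A B = tw X A B ⬝ (f ◃ B ◃ A) := by
  rw [whisk_whisk, whisk_whisk]
  refine (interchange f (id Y) (id (of A ++ of B)) (swap (of A) (of B))).trans ?_
  refine Eq.trans ?_ (interchange (id X) f (swap (of A) (of B)) (id (of B ++ of A))).symm
  rw [id_comp, id_comp, comp_id, comp_id]

theorem tw_whisk (X : Obj) (A B C : Color) :
    (tw X A B ◃ C : Hom R _ _) = id X ⊠ (swap (of A) (of B) ◃ C) := par_whisk _ _ _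

theorem tw_snoc (X : Obj) (A B C : Color) :
    (tw (snoc X A) B C : Hom R _ _) = id X ⊠ (id (of A) ⊠ swap (of B) (of C)) := by
  refine Eq.trans ?_ (par_assoc (id X) (id (of A)) (swap (of B) (of C)))
  rw [par_id]; rfl

theorem swap_braid (A B C : Color) :
    (swap (of A) (of B) ◃ C : Hom R _ _) ⬝ (id (of B) ⊠ swap (of A) (of C)) ⬝
      (swap (of B) (of C) ◃ A) =
    (id (of A) ⊠ swap (of B) (of C)) ⬝ (swap (of A) (of C) ◃ B) ⬝
      (id (of C) ⊠ swap (of A) (of B)) := by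
  have h : (swap (of A) (of B ++ of C) : Hom R _ _) =
      (swap (of A) (of B) ◃ C) ⬝ (id (of B) ⊠ swap (of A) (of C)) := hexagon _ _ _
  have h' : (swap (of A) (of C ++ of B) : Hom R _ _) =
      (swap (of A) (of C) ◃ B) ⬝ (id (of C) ⊠ swap (of A) (of B)) := hexagon _ _ _
  have n := swap_naturality (R := R) (id (of A)) (swap (of B) (of C))
  rw [h, h'] at n
  exact n.symm.trans (assoc _ _ _).symm

theorem tw_braid (X : Obj) (A B C : Color) :
    (tw X A B ◃ C : Hom R _ _) ⬝ tw (snoc X B) A C ⬝ (tw X B C ◃ A) =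
      tw (snoc X A) B C ⬝ (tw X A C ◃ B) ⬝ tw (snoc X C) A B := by
  rw [tw_whisk, tw_whisk, tw_whisk, tw_snoc, tw_snoc, tw_snoc]
  have e : ∀ {P Q S T : Obj} (a : Hom R P Q) (b : Hom R Q S) (c : Hom R S T),
      (id X ⊠ a) ⬝ (id X ⊠ b) ⬝ (id X ⊠ c) = id X ⊠ (a ⬝ b ⬝ c) := by
    intros; rw [interchange, interchange, id_comp, id_comp]
  exact (e _ _ _).trans ((congrArg (id X ⊠ ·) (swap_braid A B C)).trans (e _ _ _).symm)

end Hom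

/-! ## Programs with named wires -/

/-- A named wire. -/
abbrev Wire := ℕ × Color

/-- The object of a list of named wires; the head of the list is the rightmost wire. -/
@[reducible] def ob : List Wire → Obj
  | [] => nil
  | n :: l => snoc (ob l) n.2

theorem ob_append (b a : List Wire) : ob (b ++ a) = ob a ++ ob b := by
  induction b with
  | nil => rfl
  | cons n b ih => exact congrArg (snoc · n.2) ih

/-- The names of a list of wires. -/
abbrev keys (l : List Wire) : List ℕ := l.map Prod.fst

/-- Composites of swaps of adjacent wires. -/
inductive IsPerm : (l l' : List Wire) → Hom R (ob l) (ob l') → Prop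
  | id (l) : IsPerm l l (Hom.id _)
  | comp {l l' l''} {f : Hom R (ob l) (ob l')} {g : Hom R (ob l') (ob l'')} :
      IsPerm l l' f → IsPerm l' l'' g → IsPerm l l'' (f ⬝ g)
  | whisk (n : Wire) {l l'} {f : Hom R (ob l) (ob l')} :
      IsPerm l l' f → IsPerm (n :: l) (n :: l') (f ◃ n.2)
  | tw {a b : Wire} (l) : a.1 ≠ b.1 → IsPerm (b :: a :: l) (a :: b :: l) (Hom.tw (ob l) a.2 b.2)

theorem IsPerm.congr {l l' : List Wire} {f g : Hom R (ob l) (ob l')} (h : IsPerm l l' f)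
    (e : f = g) : IsPerm l l' g := e ▸ h

/-- The wire `n` is moved to the right end. -/
inductive IsMove (n : Wire) : (l l' : List Wire) → Hom R (ob l) (ob (n :: l')) → Prop
  | head (l) : IsMove n (n :: l) l (Hom.id _)
  | cons (k : Wire) {l l'} {m : Hom R (ob l) (ob (n :: l'))} : IsMove n l l' m → k.1 ≠ n.1 →
      IsMove n (k :: l) (k :: l') ((m ◃ k.2) ⬝ Hom.tw (ob l') n.2 k.2)

/-- Composites of moves. -/
inductive IsCanPerm : (l l' : List Wire) → Hom R (ob l) (ob l') → Prop
  | nil : IsCanPerm [] [] (Hom.id _)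
  | cons (n : Wire) {l l₀ l' m f} : IsMove n l l₀ m → IsCanPerm l₀ l' f →
      IsCanPerm l (n :: l') (m ⬝ (f ◃ n.2))

theorem IsCanPerm.congr {l l' : List Wire} {f g : Hom R (ob l) (ob l')} (h : IsCanPerm l l' f)
    (e : f = g) : IsCanPerm l l' g := e ▸ h

theorem IsMove.comm {k n : Wire} (hkn : k.1 ≠ n.1) {l lk lkn : List Wire}
    {mk : Hom R (ob l) (ob (k :: lk))} {m₂ : Hom R (ob lk) (ob (n :: lkn))}
    (h : IsMove k l lk mk) (h₂ : IsMove n lk lkn m₂) :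
    ∃ ln, ∃ m₃ : Hom R (ob l) (ob (n :: ln)), ∃ m₄ : Hom R (ob ln) (ob (k :: lkn)),
      IsMove n l ln m₃ ∧ IsMove k ln lkn m₄ ∧
        mk ⬝ (m₂ ◃ k.2) ⬝ Hom.tw (ob lkn) n.2 k.2 = m₃ ⬝ (m₄ ◃ n.2) := by
  induction h generalizing lkn with
  | head l =>
      refine ⟨k :: lkn, _, _, .cons k h₂ hkn, .head _, ?_⟩
      rw [Hom.id_whisk]
      refine Eq.trans ?_ (Hom.comp_id _).symm
      rw [Hom.id_comp]
  | @cons j l₁ lk₁ mk₁ h₁ hj ih =>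
      cases h₂ with
      | head =>
          refine ⟨_, _, _, .head _, h₁, ?_⟩
          rw [Hom.id_whisk]
          refine (congrArg (· ⬝ _) (Hom.comp_id _)).trans ?_
          rw [Hom.assoc, Hom.tw_tw, Hom.id_comp]
          exact Hom.comp_id _
      | cons _ h₂ hjn =>
          obtain ⟨ln, m₃, m₄, h₃, h₄, e⟩ := ih h₂
          refine ⟨_, _, _, .cons j h₃ hjn, .cons j h₄ hj, ?_⟩
          rename_i lkn₁ m₂
          have e' := congrArg (· ◃ j.2) e
          simp only [Hom.whisk_comp] at e'
          rw [Hom.whisk_comp, Hom.whisk_comp]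
          calc _ = (mk₁ ◃ j.2) ⬝ (Hom.tw (ob lk₁) k.2 j.2 ⬝ (m₂ ◃ j.2 ◃ k.2)) ⬝
                (Hom.tw (ob lkn₁) n.2 j.2 ◃ k.2) ⬝ Hom.tw (snoc (ob lkn₁) j.2) n.2 k.2 := by
                simp only [Hom.assoc]
            _ = (mk₁ ◃ j.2) ⬝ (m₂ ◃ k.2 ◃ j.2) ⬝ (Hom.tw (snoc (ob lkn₁) n.2) k.2 j.2 ⬝
                (Hom.tw (ob lkn₁) n.2 j.2 ◃ k.2) ⬝ Hom.tw (snoc (ob lkn₁) j.2) n.2 k.2) := by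
                rw [← Hom.tw_naturality]; simp only [Hom.assoc]
            _ = _ := by
                rw [← Hom.tw_braid]
                simp only [← Hom.assoc]
                refine (congrArg (fun x => x ⬝ Hom.tw (snoc (ob lkn₁) k.2) n.2 j.2 ⬝
                  (Hom.tw (ob lkn₁) k.2 j.2 ◃ n.2)) e').trans ?_
                have := Hom.tw_naturality m₄ n.2 j.2
                exact (congrArg (· ⬝ (Hom.tw (ob lkn₁) k.2 j.2 ◃ n.2)) ((Hom.assoc _ _ _).trans
                  ((congrArg (_ ⬝ ·) this).trans (Hom.assoc _ _ _).symm)))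

theorem IsMove.ext {n : Wire} {l l₁ l₂ : List Wire} {m₁ : Hom R (ob l) (ob (n :: l₁))}
    {m₂ : Hom R (ob l) (ob (n :: l₂))} (h₁ : IsMove n l l₁ m₁) (h₂ : IsMove n l l₂ m₂) :
    l₁ = l₂ ∧ HEq m₁ m₂ := by
  induction h₁ generalizing l₂ with
  | head l =>
      cases h₂ with
      | head => exact ⟨rfl, HEq.rfl⟩
      | cons _ _ h => exact absurd rfl h
  | cons k h hk ih =>
      cases h₂ with
      | head => exact absurd rfl hk
      | cons _ h₂ _ =>
          obtain ⟨rfl, e⟩ := ih h₂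
          obtain rfl := eq_of_heq e
          exact ⟨rfl, HEq.rfl⟩

theorem IsCanPerm.ext {l l' : List Wire} {f g : Hom R (ob l) (ob l')}
    (hf : IsCanPerm l l' f) (hg : IsCanPerm l l' g) : f = g := by
  induction hf with
  | nil => cases hg; rfl
  | cons n hm hf ih =>
      cases hg with
      | cons _ hm' hg =>
          obtain ⟨rfl, e⟩ := hm.ext hm'
          obtain rfl := eq_of_heq e
          rw [ih hg]

theorem IsCanPerm.id (l : List Wire) : IsCanPerm l l (Hom.id (ob l) : Hom R (ob l) (ob l)) := by
  induction l with
  | nil => exact .nil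
  | cons n l ih => simpa using IsCanPerm.cons (R := R) n (.head l) ih

theorem IsCanPerm.comp_move {l l' l₀' : List Wire} {n : Wire} {f : Hom R (ob l) (ob l')}
    {m' : Hom R (ob l') (ob (n :: l₀'))} (hf : IsCanPerm l l' f) (hm : IsMove n l' l₀' m') :
    ∃ l₀, ∃ m : Hom R (ob l) (ob (n :: l₀)), ∃ f₀ : Hom R (ob l₀) (ob l₀'),
      IsMove n l l₀ m ∧ IsCanPerm l₀ l₀' f₀ ∧ f ⬝ m' = m ⬝ (f₀ ◃ n.2) := by
  induction hf generalizing l₀' with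
  | nil => cases hm
  | @cons k l lk l₁' mk f₁ hk hf ih =>
      cases hm with
      | head => exact ⟨_, _, _, hk, hf, Hom.comp_id _⟩
      | @cons _ _ l₁'' m₁ hm hkn =>
          obtain ⟨lkn, m₂, f₂, h₂, hf₂, e⟩ := ih hm
          obtain ⟨ln, m₃, m₄, h₃, h₄, e'⟩ := IsMove.comm hkn hk h₂
          refine ⟨_, _, _, h₃, .cons k h₄ hf₂, ?_⟩
          have e'' := congrArg (· ◃ k.2) e
          simp only [Hom.whisk_comp] at e''
          calc _ = mk ⬝ ((f₁ ◃ k.2) ⬝ (m₁ ◃ k.2)) ⬝ Hom.tw _ n.2 k.2 := by simp only [Hom.assoc]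
            _ = mk ⬝ (m₂ ◃ k.2) ⬝ ((f₂ ◃ n.2 ◃ k.2) ⬝ Hom.tw _ n.2 k.2) := by
                refine (congrArg (fun x => mk ⬝ x ⬝ Hom.tw _ n.2 k.2) e'').trans ?_
                simp only [Hom.assoc]
            _ = (mk ⬝ (m₂ ◃ k.2) ⬝ Hom.tw _ n.2 k.2) ⬝ (f₂ ◃ k.2 ◃ n.2) := by
                rw [Hom.tw_naturality]; simp only [Hom.assoc]
            _ = _ := by
                rw [Hom.whisk_comp, ← Hom.assoc m₃]
                exact congrArg (· ⬝ (f₂ ◃ k.2 ◃ n.2)) e'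

theorem IsCanPerm.comp {l l' l'' : List Wire} {f : Hom R (ob l) (ob l')}
    {g : Hom R (ob l') (ob l'')} (hf : IsCanPerm l l' f) (hg : IsCanPerm l' l'' g) :
    IsCanPerm l l'' (f ⬝ g) := by
  induction hg generalizing l with
  | nil => simpa using hf
  | cons n hm hg ih =>
      obtain ⟨l₀, m, f₀, h, h₀, e⟩ := hf.comp_move hm
      rw [← Hom.assoc, e, Hom.assoc]
      exact (IsCanPerm.cons n h (ih h₀)).congr (congrArg (m ⬝ ·) (Hom.whisk_comp _ _ _))

theorem IsPerm.isCanPerm {l l' : List Wire} {f : Hom R (ob l) (ob l')} (h : IsPerm l l' f) :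
    IsCanPerm l l' f := by
  induction h with
  | id l => exact .id l
  | comp _ _ ih ih' => exact ih.comp ih'
  | whisk n _ ih => simpa using IsCanPerm.cons (R := R) n (.head _) ih
  | @tw a b l hab =>
      have := IsCanPerm.cons (R := R) a (.cons b (.head l) (Ne.symm hab)) (.id (b :: l))
      rw [Hom.id_whisk] at this
      refine this.congr ?_
      refine (congrArg (_ ⬝ ·) (Hom.id_whisk (R := R) _ _)).trans ?_
      exact (Hom.comp_id _).trans (Hom.id_comp _)

/-- Coherence: a composite of swaps is determined by its source and its target. -/
theorem IsPerm.unique {l l' : List Wire} {f g : Hom R (ob l) (ob l')}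
    (hf : IsPerm l l' f) (hg : IsPerm l l' g) : f = g :=
  hf.isCanPerm.ext hg.isCanPerm

theorem IsPerm.perm {l l' : List Wire} {f : Hom R (ob l) (ob l')} (h : IsPerm l l' f) :
    l.Perm l' := by
  induction h with
  | id => exact .refl _
  | comp _ _ ih ih' => exact ih.trans ih'
  | whisk n _ ih => exact ih.cons n
  | tw l => exact .swap _ _ _

theorem IsPerm.exists {l l' : List Wire} (h : l.Perm l') (hl : (keys l).Nodup) :
    ∃ f : Hom R (ob l) (ob l'), IsPerm l l' f := by
  induction h with
  | nil => exact ⟨_, .id _⟩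
  | cons n _ ih =>
      obtain ⟨f, hf⟩ := ih (List.nodup_cons.1 hl).2
      exact ⟨_, hf.whisk n⟩
  | swap a b l =>
      refine ⟨_, .tw l ?_⟩
      simp only [keys, List.map_cons, List.nodup_cons, List.mem_cons, not_or] at hl
      exact Ne.symm hl.1.1
  | trans h _ ih ih' =>
      obtain ⟨f, hf⟩ := ih hl
      obtain ⟨g, hg⟩ := ih' ((h.map _).nodup_iff.1 hl)
      exact ⟨_, hf.comp hg⟩

theorem IsPerm.mirror {l l' : List Wire} {f : Hom R (ob l) (ob l')} (h : IsPerm l l' f) :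
    IsPerm l' l f.mirror := by
  induction h with
  | id => exact .id _
  | comp _ _ ih ih' => rw [Hom.mirror_comp]; exact ih'.comp ih
  | whisk n _ ih => rw [Hom.mirror_whisk]; exact ih.whisk n
  | @tw a b l hab =>
      have : (Hom.tw (ob l) a.2 b.2 : Hom R _ _).mirror = Hom.tw (ob l) b.2 a.2 :=
        Hom.mirror_par _ _
      rw [this]; exact .tw l hab.symm

theorem IsPerm.comp_mirror {l l' : List Wire} {f : Hom R (ob l) (ob l')} (h : IsPerm l l' f) :
    f ⬝ f.mirror = Hom.id _ := (h.comp h.mirror).unique (.id _)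

/-! ### Adding wires -/

/-- The wires `c` are added on the right of `f`. -/
def wh {a b : List Wire} : (c : List Wire) → Hom R (ob a) (ob b) → Hom R (ob (c ++ a)) (ob (c ++ b))
  | [], f => f
  | n :: c, f => wh c f ◃ n.2

theorem wh_mirror {a b : List Wire} (c : List Wire) (f : Hom R (ob a) (ob b)) :
    (wh c f).mirror = wh c f.mirror := by
  induction c with
  | nil => rfl
  | cons n c ih => exact (Hom.mirror_whisk _ _).trans (congrArg (· ◃ n.2) ih)

theorem wh_slide {c c' a b : List Wire} (h : c.Perm c') (f : Hom R (ob a) (ob b))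
    (hc : (keys c).Nodup) : ∃ p q, IsPerm (c ++ a) (c' ++ a) p ∧
      IsPerm (c ++ b) (c' ++ b) q ∧ p ⬝ wh c' f = wh c f ⬝ q := by
  induction h with
  | nil => exact ⟨_, _, .id _, .id _, by rw [Hom.id_comp, Hom.comp_id]⟩
  | cons n _ ih =>
      obtain ⟨p, q, hp, hq, e⟩ := ih (List.nodup_cons.1 hc).2
      refine ⟨_, _, hp.whisk n, hq.whisk n, ?_⟩
      exact (Hom.whisk_comp _ _ _).symm.trans ((congrArg (· ◃ n.2) e).trans (Hom.whisk_comp _ _ _))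
  | swap m n l =>
      have : m.1 ≠ n.1 := by
        simp only [keys, List.map_cons, List.nodup_cons, List.mem_cons, not_or] at hc
        exact Ne.symm hc.1.1
      exact ⟨_, _, .tw _ this, .tw _ this, (Hom.tw_naturality _ _ _).symm⟩
  | trans h _ ih ih' =>
      obtain ⟨p, q, hp, hq, e⟩ := ih hc
      obtain ⟨p', q', hp', hq', e'⟩ := ih' ((h.map _).nodup_iff.1 hc)
      exact ⟨_, _, hp.comp hp', hq.comp hq', by
        rw [Hom.assoc, e', ← Hom.assoc, e, Hom.assoc]⟩

/-! ### Parallel composition on lists of wires -/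

/-- Parallel composition on lists of wires. -/
def pr {a b a' b' : List Wire} (f : Hom R (ob a) (ob b)) (g : Hom R (ob a') (ob b')) :
    Hom R (ob (a' ++ a)) (ob (b' ++ b)) :=
  Hom.cast (ob_append a' a).symm (ob_append b' b).symm (f ⊠ g)

/-- The swap of two lists of wires. -/
def sw (R : Type u) [CommSemiring R] (a b : List Wire) : Hom R (ob (b ++ a)) (ob (a ++ b)) :=
  Hom.cast (ob_append b a).symm (ob_append a b).symm (Hom.swap (ob a) (ob b))

theorem pr_comp {a b d a' b' d' : List Wire} (f : Hom R (ob a) (ob b)) (g : Hom R (ob b) (ob d))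
    (f' : Hom R (ob a') (ob b')) (g' : Hom R (ob b') (ob d')) :
    pr f f' ⬝ pr g g' = pr (f ⬝ g) (f' ⬝ g') := by
  rw [pr, pr, ← Hom.cast_comp, Hom.interchange, pr]

theorem pr_sw {a b a' b' : List Wire} (f : Hom R (ob a) (ob b)) (g : Hom R (ob a') (ob b')) :
    pr f g ⬝ sw R b b' = sw R a a' ⬝ pr g f := by
  rw [pr, pr, sw, sw, ← Hom.cast_comp, ← Hom.cast_comp, Hom.swap_naturality]

theorem sw_sw (a b : List Wire) : sw R a b ⬝ sw R b a = Hom.id _ := by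
  rw [sw, sw, ← Hom.cast_comp, Hom.swap_swap, Hom.cast_id]

theorem pr_whisk {a b a' b' : List Wire} (f : Hom R (ob a) (ob b)) (g : Hom R (ob a') (ob b'))
    (n : Wire) : (pr (a' := n :: a') (b' := n :: b') f (g ◃ n.2)) = pr f g ◃ n.2 := by
  rw [pr, pr, Hom.cast_whisk, Hom.par_whisk]; rfl

theorem pr_id {a b : List Wire} (c : List Wire) (f : Hom R (ob a) (ob b)) :
    pr f (Hom.id (ob c)) = wh c f := by
  induction c with
  | nil => exact Hom.par_nil f
  | cons n c ih =>
      refine Eq.trans ?_ (congrArg (· ◃ n.2) ih)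
      refine Eq.trans ?_ (pr_whisk f (Hom.id (ob c)) n)
      rw [Hom.id_whisk]

theorem Hom.swap_snoc (X : Obj) (A B : Color) :
    (Hom.swap (snoc X A) (of B) : Hom R _ _) = Hom.tw X A B ⬝ (Hom.swap X (of B) ◃ A) :=
  Hom.hexagon_mirror (of B) X (of A)

theorem Hom.nil_swap (B : Color) :
    (Hom.swap nil (of B) : Hom R (of B) (of B)) = Hom.id (of B) := by
  have h : (Hom.swap (of B) nil : Hom R (of B) (of B)) = Hom.id (of B) := Hom.swap_nil (of B)
  have h' : (Hom.swap nil (of B) : Hom R (of B) (of B)) ⬝ Hom.swap (of B) nil = Hom.id (of B) :=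
    Hom.swap_swap nil (of B)
  rw [h] at h'
  exact (Hom.comp_id _).symm.trans h'

theorem ob_append_cons (a b : List Wire) (n : Wire) :
    ob b ++ (of n.2 ++ ob a) = ob (a ++ n :: b) := by
  rw [ob_append]; exact (append_assoc _ _ _).symm

theorem IsPerm.move (a b : List Wire) (n : Wire) (h : n.1 ∉ keys a) :
    IsPerm (n :: (a ++ b)) (a ++ n :: b)
      (Hom.cast (congrArg (snoc · n.2) (ob_append a b).symm) (ob_append_cons a b n)
        (Hom.id (ob b) ⊠ (Hom.swap (ob a) (of n.2) : Hom R _ _))) := by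
  induction a with
  | nil =>
      refine (IsPerm.id (R := R) (n :: b)).congr ?_
      have e : (Hom.id (ob b) ⊠ (Hom.swap nil (of n.2)) : Hom R _ _) = Hom.id (ob (n :: b)) :=
        (congrArg (Hom.id (ob b) ⊠ ·) (Hom.nil_swap n.2)).trans (Hom.par_id _ _)
      exact e.symm
  | cons m a ih =>
      simp only [keys, List.map_cons, List.mem_cons, not_or] at h
      refine (IsPerm.comp (.tw (a ++ b) (Ne.symm h.1)) ((ih h.2).whisk m)).congr ?_
      have e : (Hom.id (ob b) ⊠ Hom.swap (snoc (ob a) m.2) (of n.2) : Hom R _ _) =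
          Hom.tw (ob b ++ ob a) m.2 n.2 ⬝
            ((Hom.id (ob b) ⊠ (Hom.swap (ob a) (of n.2) : Hom R _ _)) ◃ m.2) := by
        rw [Hom.swap_snoc]
        refine Eq.trans (congrArg (· ⊠ _) (Hom.id_comp (Hom.id (ob b))).symm) ?_
        refine (Hom.interchange _ _ _ _).symm.trans ?_
        refine congrArg₂ Hom.comp ?_ ?_
        · refine (Hom.par_assoc _ _ _).symm.trans ?_
          rw [Hom.par_id]; rfl
        · exact (Hom.par_whisk _ _ _).symm
      refine Eq.symm ((congrArg (Hom.cast _ _) e).trans ?_)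
      generalize_proofs p1 p2 p3 p4
      refine (Hom.cast_comp p1 (congrArg (snoc · m.2) p3) _ _ _).trans ?_
      refine congrArg₂ Hom.comp ?_ ?_
      · have e : ∀ {X Y : Obj} (h : X = Y) (h₁) (h₂), Hom.cast h₁ h₂ (Hom.tw X m.2 n.2 : Hom R _ _)
            = (Hom.tw Y m.2 n.2 : Hom R _ _) := by
          rintro X _ rfl _ _; rfl
        exact e (ob_append a b).symm _ _
      · exact (Hom.cast_whisk _ _ _ _).symm

theorem IsPerm.sw (a b : List Wire) (h : (keys (b ++ a)).Nodup) :
    IsPerm (b ++ a) (a ++ b) (sw R a b) := by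
  induction b with
  | nil =>
      have e : ∀ {l : List Wire} (h : a = l), IsPerm a l (Hom.cast rfl
          (congrArg ob h) (Hom.id (ob a) : Hom R _ _)) := by
        rintro _ rfl; exact .id _
      refine (e (l := a ++ []) (List.append_nil a).symm).congr ?_
      have := congrArg (Hom.cast rfl ((nil_append (ob a)).symm.trans (ob_append a []).symm))
        (Hom.swap_nil (R := R) (ob a))
      rw [Hom.cast_cast] at this
      exact this.symm
  | cons n b ih =>
      have h' := h
      simp only [keys, List.cons_append, List.map_cons, List.nodup_cons, List.map_append,
        List.mem_append, not_or] at h'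
      refine (((ih (by simpa using h'.2)).whisk n).comp
        (IsPerm.move a b n h'.1.2)).congr ?_
      have e := congrArg (Hom.cast (ob_append (n :: b) a).symm (ob_append a (n :: b)).symm)
        (Hom.hexagon (R := R) (ob a) (ob b) (of n.2))
      refine Eq.symm (e.trans ?_)
      refine (Hom.cast_comp _ (congrArg (snoc · n.2) (ob_append a b).symm) _ _ _).trans ?_
      refine congrArg₂ Hom.comp ?_ ?_
      · exact (Hom.cast_whisk (ob_append b a).symm (ob_append a b).symm
          (Hom.swap (ob a) (ob b)) n.2).symm
      · exact Hom.cast_cast _ _ _ _ _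

/-- A diagram whose input and output wires are named. -/
structure Step (R : Type u) [CommSemiring R] where
  /-- The input wires. -/
  ins : List Wire
  /-- The output wires. -/
  outs : List Wire
  /-- The diagram. -/
  box : Hom R (ob ins) (ob outs)

/-- All input wires of a program. -/
abbrev insOf (P : List (Step R)) : List Wire := P.flatMap Step.ins

/-- All output wires of a program. -/
abbrev outsOf (P : List (Step R)) : List Wire := P.flatMap Step.outs

/-- The steps of a program are performed one after the other; `f` is the resulting morphism. -/
inductive Run : List (Step R) → (l l' : List Wire) → Hom R (ob l) (ob l') → Prop
  | nil {l l' p} : IsPerm l l' p → Run [] l l' p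
  | cons {s : Step R} {P l l'} (c) {p : Hom R (ob l) (ob (c ++ s.ins))}
      {g : Hom R (ob (c ++ s.outs)) (ob l')} : IsPerm l (c ++ s.ins) p → Run P (c ++ s.outs) l' g →
      Run (s :: P) l l' (p ⬝ wh c s.box ⬝ g)

/-- Every wire name is produced only once. -/
def Fresh (P : List (Step R)) (l : List Wire) : Prop :=
  (Multiset.map Prod.fst ((outsOf P : Multiset Wire) + (l : Multiset Wire))).Nodup

theorem coe_append (a b : List Wire) :
    ((a ++ b : List Wire) : Multiset Wire) = (a : Multiset Wire) + (b : Multiset Wire) := rfl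

theorem IsPerm.coe {l l' : List Wire} {f : Hom R (ob l) (ob l')} (h : IsPerm l l' f) :
    (l : Multiset Wire) = (l' : Multiset Wire) := Multiset.coe_eq_coe.2 h.perm

theorem Fresh.tail {s : Step R} {P : List (Step R)} {l c : List Wire} (h : Fresh (s :: P) l)
    (hl : (l : Multiset Wire) = ((c ++ s.ins : List Wire) : Multiset Wire)) :
    Fresh P (c ++ s.outs) := by
  refine Multiset.nodup_of_le (Multiset.map_le_map ?_) h
  rw [hl]
  simp only [outsOf, List.flatMap_cons, coe_append]
  refine Multiset.le_iff_exists_add.2 ⟨(s.ins : Multiset Wire), ?_⟩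
  abel

theorem Fresh.nodup {P : List (Step R)} {l : List Wire} (h : Fresh P l) : (keys l).Nodup := by
  have : (Multiset.map Prod.fst (l : Multiset Wire)).Nodup :=
    Multiset.nodup_of_le (Multiset.map_le_map (Multiset.le_add_left _ _)) h
  simpa using this

theorem Fresh.congr {P : List (Step R)} {l l' : List Wire} (h : Fresh P l)
    (hl : (l : Multiset Wire) = (l' : Multiset Wire)) : Fresh P l' := by
  rw [Fresh, ← hl]; exact h

theorem exists_isPerm {l l' : List Wire} (h : (l : Multiset Wire) = (l' : Multiset Wire))
    (hl : (keys l).Nodup) : ∃ f : Hom R (ob l) (ob l'), IsPerm l l' f :=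
  IsPerm.exists (Multiset.coe_eq_coe.1 h) hl

namespace Run

variable {P Q : List (Step R)} {l l' l₁ l₂ : List Wire}

theorem congr {f g : Hom R (ob l) (ob l')} (h : Run P l l' f) (e : f = g) : Run P l l' g := e ▸ h

theorem balance {f : Hom R (ob l) (ob l')} (h : Run P l l' f) :
    (l : Multiset Wire) + (outsOf P : Multiset Wire) =
      (l' : Multiset Wire) + (insOf P : Multiset Wire) := by
  induction h with
  | nil h => simp [h.coe]
  | cons c h _ ih =>
      rw [h.coe]
      simp only [outsOf, insOf, List.flatMap_cons, coe_append] at ih ⊢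
      rename_i s P _ _ _ _ _
      calc _ = (c : Multiset Wire) + s.outs + (P.flatMap Step.outs : List Wire) + s.ins := by abel
        _ = _ := by rw [ih]; abel

theorem pre {p : Hom R (ob l₁) (ob l)} {f : Hom R (ob l) (ob l')} (hp : IsPerm l₁ l p)
    (h : Run P l l' f) : Run P l₁ l' (p ⬝ f) := by
  cases h with
  | nil h => exact .nil (hp.comp h)
  | cons c h h' => exact (Run.cons c (hp.comp h) h').congr (by simp only [Hom.assoc])

theorem post {f : Hom R (ob l) (ob l')} {p : Hom R (ob l') (ob l₁)} (h : Run P l l' f)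
    (hp : IsPerm l' l₁ p) : Run P l l₁ (f ⬝ p) := by
  induction h with
  | nil h => exact .nil (h.comp hp)
  | cons c h _ ih => exact (Run.cons c h (ih hp)).congr (by simp only [Hom.assoc])

theorem append {f : Hom R (ob l) (ob l')} {g : Hom R (ob l') (ob l₁)} (h : Run P l l' f)
    (h' : Run Q l' l₁ g) : Run (P ++ Q) l l₁ (f ⬝ g) := by
  induction h with
  | nil h => exact h'.pre h
  | cons c h _ ih => exact (Run.cons c h (ih h')).congr (by simp only [Hom.assoc])

theorem split {h : Hom R (ob l) (ob l')} (H : Run (P ++ Q) l l' h) :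
    ∃ l₁, ∃ f : Hom R (ob l) (ob l₁), ∃ g : Hom R (ob l₁) (ob l'),
      Run P l l₁ f ∧ Run Q l₁ l' g ∧ h = f ⬝ g := by
  induction P generalizing l with
  | nil => exact ⟨l, _, h, .nil (.id l), H, (Hom.id_comp _).symm⟩
  | cons s P ih =>
      cases H with
      | cons c hp H =>
          obtain ⟨l₁, f, g, hf, hg, rfl⟩ := ih H
          exact ⟨l₁, _, g, .cons c hp hf, hg, by simp only [Hom.assoc]⟩

/-- The result of a program is determined by the program. -/
theorem unique {f g : Hom R (ob l) (ob l')} (hf : Run P l l' f) (hg : Run P l l' g)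
    (hl : Fresh P l) : f = g := by
  induction hf with
  | nil h => cases hg with | nil h' => exact h.unique h'
  | cons c h hP ih =>
      cases hg with
      | @cons _ _ _ _ c' q g' h' hP' =>
          rename_i s P l l' p g
          have e : (c : Multiset Wire) = c' := by
            have := h.coe.symm.trans h'.coe
            rw [coe_append, coe_append] at this
            exact add_right_cancel this
          have hc : (keys c).Nodup := by
            have := hl.nodup
            rw [((h.perm.map Prod.fst)).nodup_iff, List.map_append] at this
            exact (List.nodup_append.1 this).1
          obtain ⟨r, r', hr, hr', er⟩ := wh_slide (Multiset.coe_eq_coe.1 e) s.box hc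
          have e1 : q = p ⬝ r := h'.unique (h.comp hr)
          have e2 := ih (hP'.pre hr') (hl.tail h.coe)
          rw [e1, e2, Hom.assoc p r, er]
          simp only [Hom.assoc]

theorem whisk (n : Wire) {f : Hom R (ob l) (ob l')} (h : Run P l l' f) :
    Run P (n :: l) (n :: l') (f ◃ n.2) := by
  induction h with
  | nil h => exact .nil (h.whisk n)
  | cons c h _ ih =>
      refine (Run.cons (n :: c) (h.whisk n) ih).congr ?_
      rw [Hom.whisk_comp, Hom.whisk_comp]; rfl

theorem wh (c : List Wire) {f : Hom R (ob l) (ob l')} (h : Run P l l' f) :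
    Run P (c ++ l) (c ++ l') (wh c f) := by
  induction c with
  | nil => exact h
  | cons n c ih => exact ih.whisk n

theorem single (s : Step R) : Run [s] s.ins s.outs s.box := by
  refine (Run.cons [] (.id _) (.nil (.id _))).congr ?_
  exact (Hom.comp_id _).trans (Hom.id_comp _)

theorem pr {a b a' b' : List Wire} {f : Hom R (ob a) (ob b)} {g : Hom R (ob a') (ob b')}
    (hf : Run P a b f) (hg : Run Q a' b' g)
    (h₂ : (keys (a' ++ b)).Nodup) (h₃ : (keys (b' ++ b)).Nodup) :
    Run (P ++ Q) (a' ++ a) (b' ++ b) (pr f g) := by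
  have h := ((hf.wh a').append ((hg.wh b).pre (IsPerm.sw b a' h₂))).post
    (IsPerm.sw b' b ((List.perm_append_comm.map _).nodup_iff.1 h₃))
  refine h.congr ?_
  rw [← pr_id, ← pr_id, ← pr_sw, Hom.assoc, Hom.assoc, sw_sw, Hom.comp_id, pr_comp, Hom.comp_id,
    Hom.id_comp]

theorem pr' {a b a' b' : List Wire} {f : Hom R (ob a) (ob b)} {g : Hom R (ob a') (ob b')}
    (hf : Run P a b f) (hg : Run Q a' b' g) (h₁ : (keys (a' ++ a)).Nodup)
    (h₂ : (keys (b' ++ a)).Nodup) :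
    Run (Q ++ P) (a' ++ a) (b' ++ b) (TensorPlus.pr f g) := by
  have h := (((hg.wh a).pre (IsPerm.sw a a' h₁)).post
    (IsPerm.sw b' a ((List.perm_append_comm.map _).nodup_iff.1 h₂))).append (hf.wh b')
  refine h.congr ?_
  rw [← pr_id, ← pr_id, ← pr_sw, Hom.assoc (TensorPlus.pr _ _), sw_sw, Hom.comp_id, pr_comp,
    Hom.comp_id, Hom.id_comp]

theorem mirror {f : Hom R (ob l) (ob l')} (h : Run P l l' f) :
    Run (P.map fun s => (⟨s.outs, s.ins, s.box.mirror⟩ : Step R)).reverse l' l f.mirror := by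
  induction h with
  | nil h => exact .nil h.mirror
  | cons c h _ ih =>
      rename_i s P l l' p g _
      rw [List.map_cons, List.reverse_cons]
      have := Run.cons (s := ⟨s.outs, s.ins, s.box.mirror⟩) c (.id (R := R) _) (.nil h.mirror)
      refine (ih.append this).congr ?_
      rw [Hom.mirror_comp, Hom.mirror_comp, wh_mirror, Hom.id_comp]

end Run

theorem Fresh.mono {P : List (Step R)} {l a : List Wire} (h : Fresh P l)
    (ha : (a : Multiset Wire) ≤ (outsOf P : Multiset Wire) + (l : Multiset Wire)) :
    (keys a).Nodup := by
  have := Multiset.nodup_of_le (Multiset.map_le_map ha) h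
  simpa using this

theorem exists_append_of_subset {a b : List Wire} (h : (keys a).Nodup) (hab : a ⊆ b) :
    ∃ c : List Wire, (b : Multiset Wire) = ((c ++ a : List Wire) : Multiset Wire) := by
  have : (a : Multiset Wire) ≤ (b : Multiset Wire) :=
    (Multiset.le_iff_subset (Multiset.coe_nodup.2 (List.Nodup.of_map _ h))).2 hab
  obtain ⟨c, hc⟩ := Multiset.le_iff_exists_add.1 this
  obtain ⟨c, rfl⟩ := Quotient.exists_rep c
  exact ⟨c, hc.trans (add_comm _ _)⟩

theorem Run.exchange {s t : Step R} {P : List (Step R)} {l l' : List Wire}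
    {f : Hom R (ob l) (ob l')} (h : Run (s :: t :: P) l l' f) (hl : Fresh (s :: t :: P) l)
    (ht : ∀ n ∈ t.ins, n ∈ l) : Run (t :: s :: P) l l' f := by
  obtain ⟨l₁, f₁, f₂, h₁, h₂, rfl⟩ := Run.split (P := [s, t]) h
  refine Run.append (P := [t, s]) ?_ h₂
  cases h₁ with
  | @cons _ _ _ _ c p _ hp h₁ =>
  cases h₁ with
  | @cons _ _ _ _ d q _ hq h₁ =>
  cases h₁ with
  | nil hr =>
  simp only [Fresh, outsOf, List.flatMap_cons] at hl
  have eq1 : (l : Multiset Wire) = (c : Multiset Wire) + s.ins := hp.coe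
  have eq2 : (c : Multiset Wire) + s.outs = (d : Multiset Wire) + t.ins := hq.coe
  have eq3 : (d : Multiset Wire) + t.outs = (l₁ : Multiset Wire) := hr.coe
  have hso : ∀ n ∈ s.outs, n ∈ d := by
    intro n hn
    have : n ∈ (c : Multiset Wire) + s.outs := by simp [hn]
    rw [eq2] at this
    rcases Multiset.mem_add.1 this with h | h
    · exact h
    · exfalso
      have hnl := ht n h
      have : (Multiset.map Prod.fst ((s.outs : Multiset Wire) + (l : Multiset Wire))).Nodup := by
        refine Multiset.nodup_of_le (Multiset.map_le_map ?_) hl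
        refine Multiset.le_iff_exists_add.2
          ⟨((t.outs ++ List.flatMap Step.outs P : List Wire) : Multiset Wire), ?_⟩
        simp only [coe_append]; abel
      rw [Multiset.map_add, Multiset.nodup_add] at this
      exact Multiset.disjoint_left.1 this.2.2 (Multiset.mem_map_of_mem _ hn)
        (Multiset.mem_map_of_mem _ hnl)
  have hkey : ∀ {a : Multiset Wire}, a ≤ (s.outs : Multiset Wire) + t.outs + l →
      (a.map Prod.fst).Nodup := by
    intro a ha
    refine Multiset.nodup_of_le (Multiset.map_le_map (ha.trans ?_)) hl
    refine Multiset.le_iff_exists_add.2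
      ⟨((List.flatMap Step.outs P : List Wire) : Multiset Wire), ?_⟩
    simp only [coe_append]; abel
  have hs : (keys s.outs).Nodup := by
    have := hkey (a := s.outs) ((Multiset.le_add_right _ _).trans (Multiset.le_add_right _ _))
    simpa using this
  obtain ⟨e, he⟩ := exists_append_of_subset hs hso
  rw [coe_append] at he
  have eq4 : (c : Multiset Wire) = (e : Multiset Wire) + t.ins := by
    apply add_right_cancel (b := (s.outs : Multiset Wire))
    rw [eq2, he]; abel
  have k1 : (keys (t.ins ++ s.ins)).Nodup := by
    have := hkey (a := ((t.ins ++ s.ins : List Wire) : Multiset Wire))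
      (Multiset.le_iff_exists_add.2 ⟨(s.outs : Multiset Wire) + t.outs + e, by
        rw [eq1, eq4, coe_append]; abel⟩)
    simpa using this
  have k2 : (keys (t.ins ++ s.outs)).Nodup := by
    have := hkey (a := ((t.ins ++ s.outs : List Wire) : Multiset Wire))
      (Multiset.le_iff_exists_add.2 ⟨(s.ins : Multiset Wire) + t.outs + e, by
        rw [eq1, eq4, coe_append]; abel⟩)
    simpa using this
  have k3 : (keys (t.outs ++ s.outs)).Nodup := by
    have := hkey (a := ((t.outs ++ s.outs : List Wire) : Multiset Wire))
      (Multiset.le_iff_exists_add.2 ⟨(l : Multiset Wire), by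
        rw [coe_append]; abel⟩)
    simpa using this
  have k4 : (keys (t.outs ++ s.ins)).Nodup := by
    have := hkey (a := ((t.outs ++ s.ins : List Wire) : Multiset Wire))
      (Multiset.le_iff_exists_add.2 ⟨(s.outs : Multiset Wire) + t.ins + e, by
        rw [eq1, eq4, coe_append]; abel⟩)
    simpa using this
  obtain ⟨p', hp'⟩ := exists_isPerm (R := R) (l := l) (l' := e ++ (t.ins ++ s.ins))
    (by rw [eq1, eq4]; simp only [coe_append]; abel)
    (by
      have := hkey (a := (l : Multiset Wire)) (Multiset.le_add_left _ _)
      simpa using this)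
  obtain ⟨q', hq'⟩ := exists_isPerm (R := R) (l := e ++ (t.outs ++ s.outs)) (l' := l₁)
    (by rw [← eq3, he]; simp only [coe_append]; abel)
    (by
      have := hkey (a := ((e ++ (t.outs ++ s.outs) : List Wire) : Multiset Wire))
        (Multiset.le_iff_exists_add.2 ⟨(s.ins : Multiset Wire) + t.ins, by
          rw [eq1, eq4]; simp only [coe_append]; abel⟩)
      simpa using this)
  have r1 := ((((Run.single s).pr (Run.single t) k2 k3).wh e).pre hp').post hq'
  have r2 := ((((Run.single s).pr' (Run.single t) k1 k4).wh e).pre hp').post hq'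
  have hF : Fresh [s, t] l := by
    refine hkey (le_of_eq ?_)
    simp only [outsOf, List.flatMap_cons, coe_append, List.flatMap_nil, Multiset.coe_nil]; abel
  have r3 := Run.cons c hp (.cons d hq (.nil hr))
  exact r2.congr (r1.unique r3 hF)

theorem Fresh.perm {P Q : List (Step R)} {l : List Wire} (h : Fresh P l) (hPQ : P.Perm Q) :
    Fresh Q l := by
  have : (outsOf P : Multiset Wire) = outsOf Q := Multiset.coe_eq_coe.2 (hPQ.flatMap_right _)
  rw [Fresh, ← this]; exact h

/-- Names are also consumed at most once. -/
theorem Run.nodup_ins {P : List (Step R)} {l l' : List Wire} {f : Hom R (ob l) (ob l')}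
    (h : Run P l l' f) (hl : Fresh P l) :
    (Multiset.map Prod.fst ((l' : Multiset Wire) + (insOf P : Multiset Wire))).Nodup := by
  rw [← h.balance, add_comm]; exact hl

/-- A step whose inputs are available can be performed first. -/
theorem Run.bring {s : Step R} {P Q : List (Step R)} {l l' : List Wire}
    {f : Hom R (ob l) (ob l')} (h : Run (P ++ s :: Q) l l' f) (hl : Fresh (P ++ s :: Q) l)
    (hs : ∀ n ∈ s.ins, n ∈ l) : Run (s :: (P ++ Q)) l l' f := by
  induction P generalizing l with
  | nil => exact h
  | cons t P ih =>
      have hn := h.nodup_ins hl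
      cases h with
      | cons c hp h =>
      have := ih h (hl.tail hp.coe) (fun n hn' => by
        have h1 := hs n hn'
        rw [hp.perm.mem_iff, List.mem_append] at h1
        rcases h1 with h1 | h1
        · simp [h1]
        · exfalso
          rw [Multiset.map_add, Multiset.nodup_add] at hn
          have hn2 := hn.2.1
          simp only [insOf, List.cons_append, List.flatMap_cons, List.flatMap_append, coe_append,
            Multiset.map_add, Multiset.nodup_add, Multiset.disjoint_add_right] at hn2
          exact Multiset.disjoint_left.1 hn2.2.2.2.1 (Multiset.mem_map_of_mem _ h1)
            (Multiset.mem_map_of_mem _ hn'))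
      refine Run.exchange (.cons c hp this) (hl.perm ?_) hs
      exact List.Perm.cons t List.perm_middle

/-- Every step of a program finds its inputs, and the wires `l'` remain. -/
def Valid : List (Step R) → List Wire → List Wire → Prop
  | [], l, l' => l.Perm l'
  | s :: P, l, l' => ∃ c : List Wire, l.Perm (c ++ s.ins) ∧ Valid P (c ++ s.outs) l'

theorem Valid.exists_run {P : List (Step R)} {l l' : List Wire} (h : Valid P l l')
    (hl : Fresh P l) : ∃ f, Run P l l' f := by
  induction P generalizing l with
  | nil =>
      obtain ⟨f, hf⟩ := IsPerm.exists (R := R) h hl.nodup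
      exact ⟨f, .nil hf⟩
  | cons s P ih =>
      obtain ⟨c, hc, h⟩ := h
      obtain ⟨p, hp⟩ := IsPerm.exists (R := R) hc hl.nodup
      obtain ⟨g, hg⟩ := ih h (hl.tail hp.coe)
      exact ⟨_, .cons c hp hg⟩

/-- The order of the steps is irrelevant. -/
theorem Run.reorder {P Q : List (Step R)} {l l' l'' : List Wire} {f} (h : Run P l l' f)
    (hPQ : P.Perm Q) (hl : Fresh P l) (hQ : Valid Q l l'') : Run Q l l' f := by
  induction Q generalizing P l with
  | nil => rw [List.perm_nil.1 hPQ] at h; exact h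
  | cons s Q ih =>
      obtain ⟨P₁, P₂, rfl⟩ := List.append_of_mem (hPQ.symm.mem_iff.1 List.mem_cons_self)
      obtain ⟨c, hc, hQ⟩ := hQ
      have hp := List.Perm.trans List.perm_middle.symm hPQ
      have := h.bring hl (fun n hn => by rw [hc.mem_iff]; simp [hn])
      have hl' := hl.perm List.perm_middle
      cases this with
      | cons d hd h₂ =>
      have e : c.Perm d := (List.perm_append_right_iff s.ins).1 (hc.symm.trans hd.perm)
      have e' : (c ++ s.outs).Perm (d ++ s.outs) := e.append_right _
      refine .cons d hd (ih h₂ ((List.perm_cons s).1 hp) (hl'.tail hd.coe) ?_)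
      cases Q with
      | nil => exact e'.symm.trans hQ
      | cons t Q =>
          obtain ⟨c', hc', hQ⟩ := hQ
          exact ⟨c', e'.symm.trans hc', hQ⟩

/-! ### Equations between programs -/

/-- The two programs have the same result. -/
def Rule (l l' : List Wire) (P Q : List (Step R)) : Prop :=
  Fresh P l ∧ Fresh Q l ∧ ∃ f : Hom R (ob l) (ob l'), Run P l l' f ∧ Run Q l l' f

namespace Rule

variable {l l' : List Wire} {P Q S : List (Step R)}

theorem symm (h : Rule l l' P Q) : Rule l l' Q P :=
  ⟨h.2.1, h.1, h.2.2.imp fun _ h => ⟨h.2, h.1⟩⟩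

theorem trans (h : Rule l l' P Q) (h' : Rule l l' Q S) : Rule l l' P S := by
  obtain ⟨hP, hQ, f, h₁, h₂⟩ := h
  obtain ⟨_, hS, g, h₃, h₄⟩ := h'
  exact ⟨hP, hS, f, h₁, h₄.congr (h₃.unique h₂ hQ)⟩

theorem refl (hP : Fresh P l) (h : Valid P l l') : Rule l l' P P :=
  ⟨hP, hP, (h.exists_run hP).imp fun _ h => ⟨h, h⟩⟩

theorem of_eq {f g : Hom R (ob l) (ob l')} (e : f = g) (hf : Run P l l' f) (hg : Run Q l l' g)
    (hP : Fresh P l) (hQ : Fresh Q l) : Rule l l' P Q := ⟨hP, hQ, f, hf, e ▸ hg⟩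

theorem eq {f g : Hom R (ob l) (ob l')} (h : Rule l l' P Q) (hf : Run P l l' f)
    (hg : Run Q l l' g) : f = g := by
  obtain ⟨hP, hQ, k, h₁, h₂⟩ := h
  rw [hf.unique h₁ hP, hg.unique h₂ hQ]

end Rule

/-! ### Renaming and mirroring -/

/-- Renaming of a wire. -/
abbrev rnw (σ : ℕ → ℕ) (n : Wire) : Wire := (σ n.1, n.2)

/-- Renaming of a list of wires. -/
abbrev rn (σ : ℕ → ℕ) (l : List Wire) : List Wire := l.map (rnw σ)

theorem ob_rn (σ : ℕ → ℕ) : ∀ l : List Wire, ob l = ob (rn σ l)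
  | [] => rfl
  | n :: l => congrArg (snoc · n.2) (ob_rn σ l)

/-- Renaming of the wires of a step. -/
def Step.rename (σ : ℕ → ℕ) (s : Step R) : Step R :=
  ⟨rn σ s.ins, rn σ s.outs, Hom.cast (ob_rn σ _) (ob_rn σ _) s.box⟩

/-- The mirrored step. -/
def Step.mirror (s : Step R) : Step R := ⟨s.outs, s.ins, s.box.mirror⟩

theorem IsPerm.rename (σ : ℕ → ℕ) {l l' : List Wire} {f : Hom R (ob l) (ob l')}
    (h : IsPerm l l' f) (hl : (keys (rn σ l)).Nodup) :
    IsPerm (rn σ l) (rn σ l') (Hom.cast (ob_rn σ l) (ob_rn σ l') f) := by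
  induction h with
  | id l => exact (IsPerm.id _).congr (Hom.cast_id _).symm
  | comp h _ ih ih' =>
      exact ((ih hl).comp (ih' (((h.perm.map _).map _).nodup_iff.1 hl))).congr
        (Hom.cast_comp _ _ _ _ _).symm
  | whisk n _ ih =>
      exact ((ih (List.nodup_cons.1 hl).2).whisk (rnw σ n)).congr (Hom.cast_whisk _ _ _ _)
  | @tw a b l hab =>
      have e : ∀ {X Y : Obj} (h : X = Y) (h₁) (h₂), Hom.cast h₁ h₂ (Hom.tw X a.2 b.2 : Hom R _ _)
            = (Hom.tw Y a.2 b.2 : Hom R _ _) := by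
        rintro X _ rfl _ _; rfl
      refine (IsPerm.tw (a := rnw σ a) (b := rnw σ b) (rn σ l) ?_).congr (e (ob_rn σ l) _ _).symm
      intro h
      exact (List.nodup_cons.1 hl).1 (by simp [rnw] at h ⊢; exact Or.inl h.symm)

theorem wh_rename (σ : ℕ → ℕ) {a b : List Wire} (c : List Wire) (f : Hom R (ob a) (ob b))
    (h₁ h₂) : Hom.cast h₁ h₂ (wh c f) =
      wh (rn σ c) (Hom.cast (ob_rn σ a) (ob_rn σ b) f) := by
  induction c with
  | nil => rfl
  | cons n c ih =>
      have e₁ : ob (c ++ a) = ob (rn σ c ++ rn σ a) := by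
        rw [← List.map_append]; exact ob_rn σ _
      have e₂ : ob (c ++ b) = ob (rn σ c ++ rn σ b) := by
        rw [← List.map_append]; exact ob_rn σ _
      exact (Hom.cast_whisk e₁ e₂ (wh c f) n.2).symm.trans (congrArg (· ◃ n.2) (ih e₁ e₂))

theorem IsPerm.cast_right {l l' l'' : List Wire} {f : Hom R (ob l) (ob l')} (h : IsPerm l l' f)
    (e : l' = l'') : IsPerm l l'' (Hom.cast rfl (congrArg ob e) f) := by
  subst e; exact h

theorem Run.cast_left {P : List (Step R)} {l l' l'' : List Wire} {f : Hom R (ob l) (ob l')}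
    (h : Run P l l' f) (e : l = l'') : Run P l'' l' (Hom.cast (congrArg ob e) rfl f) := by
  subst e; exact h

theorem Run.rename (σ : ℕ → ℕ) {P : List (Step R)} {l l' : List Wire} {f : Hom R (ob l) (ob l')}
    (h : Run P l l' f) (hl : Fresh (P.map (Step.rename σ)) (rn σ l)) :
    Run (P.map (Step.rename σ)) (rn σ l) (rn σ l') (Hom.cast (ob_rn σ l) (ob_rn σ l') f) := by
  induction h with
  | nil h => exact .nil (h.rename σ hl.nodup)
  | cons c h _ ih =>
      rename_i s P l l' p g _
      have h' := (h.rename σ hl.nodup).cast_right (l'' := rn σ c ++ (s.rename σ).ins)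
        (List.map_append ..)
      have ih' := (ih ((hl.tail h'.coe).congr (congrArg _ (List.map_append ..).symm))).cast_left
        (l'' := rn σ c ++ (s.rename σ).outs) (List.map_append ..)
      refine (Run.cons (rn σ c) h' ih').congr ?_
      have e₁ : ob (c ++ s.ins) = ob (rn σ c ++ rn σ s.ins) := by
        rw [← List.map_append]; exact ob_rn σ _
      have e₂ : ob (c ++ s.outs) = ob (rn σ c ++ rn σ s.outs) := by
        rw [← List.map_append]; exact ob_rn σ _
      rw [Hom.cast_comp _ e₂, Hom.cast_comp _ e₁, wh_rename σ, Hom.cast_cast, Hom.cast_cast]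
      rfl

theorem Rule.rename (σ : ℕ → ℕ) {l l' : List Wire} {P Q : List (Step R)} (h : Rule l l' P Q)
    (hP : Fresh (P.map (Step.rename σ)) (rn σ l)) (hQ : Fresh (Q.map (Step.rename σ)) (rn σ l)) :
    Rule (rn σ l) (rn σ l') (P.map (Step.rename σ)) (Q.map (Step.rename σ)) := by
  obtain ⟨_, _, f, h₁, h₂⟩ := h
  exact ⟨hP, hQ, _, h₁.rename σ hP, h₂.rename σ hQ⟩

theorem Fresh.mirror {P : List (Step R)} {l l' : List Wire} {f : Hom R (ob l) (ob l')}
    (h : Run P l l' f) (hl : Fresh P l) : Fresh (P.map Step.mirror).reverse l' := by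
  have := h.nodup_ins hl
  have e : (outsOf (P.map Step.mirror).reverse : Multiset Wire) = insOf P := by
    refine (Multiset.coe_eq_coe.2 ((List.reverse_perm _).flatMap_right _)).trans ?_
    simp only [List.flatMap_map]; rfl
  rw [Fresh, e, add_comm]; exact this

theorem Rule.mirror {l l' : List Wire} {P Q : List (Step R)} (h : Rule l l' P Q) :
    Rule l' l (P.map Step.mirror).reverse (Q.map Step.mirror).reverse := by
  obtain ⟨hP, hQ, f, h₁, h₂⟩ := h
  exact ⟨hP.mirror h₁, hQ.mirror h₂, _, h₁.mirror, h₂.mirror⟩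

/-! ### Rewriting -/

theorem Fresh.right {P Q : List (Step R)} {l l' : List Wire} {f : Hom R (ob l) (ob l')}
    (h : Run P l l' f) (hl : Fresh (P ++ Q) l) : Fresh Q l' := by
  refine Multiset.nodup_of_le (Multiset.map_le_map ?_) hl
  simp only [outsOf, List.flatMap_append, coe_append]
  refine Multiset.le_iff_exists_add.2 ⟨(insOf P : Multiset Wire), ?_⟩
  have := h.balance
  calc _ = ((Q.flatMap Step.outs : List Wire) : Multiset Wire) +
      ((l : Multiset Wire) + (outsOf P : Multiset Wire)) := by abel
    _ = _ := by rw [this]; abel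

theorem Fresh.left {P Q : List (Step R)} {l : List Wire} (hl : Fresh (P ++ Q) l) : Fresh P l := by
  refine Multiset.nodup_of_le (Multiset.map_le_map ?_) hl
  simp only [outsOf, List.flatMap_append, coe_append]
  exact Multiset.le_iff_exists_add.2 ⟨(outsOf Q : Multiset Wire), by abel⟩

theorem Fresh.of_valid {A L B : List (Step R)} {l c a : List Wire}
    (hl : Fresh (A ++ (L ++ B)) l) (ha : Valid A l (c ++ a)) : Fresh L a := by
  obtain ⟨g, hg⟩ := ha.exists_run hl.left
  refine Multiset.nodup_of_le (Multiset.map_le_map ?_) (Fresh.right hg hl).left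
  exact Multiset.le_iff_exists_add.2 ⟨(c : Multiset Wire), by rw [coe_append]; abel⟩

theorem Rule.rewrite {a b l l' c : List Wire} {L M P Q A B : List (Step R)} (ρ : Rule a b L M)
    (h : Rule l l' P Q) (hQ : Q.Perm (A ++ (L ++ B))) (hv : Valid (A ++ (L ++ B)) l l')
    (ha : Valid A l (c ++ a)) (hf : Fresh (A ++ (M ++ B)) l) :
    Rule l l' P (A ++ (M ++ B)) := by
  obtain ⟨hP, hQ', f, h₁, h₂⟩ := h
  refine ⟨hP, hf, f, h₁, ?_⟩
  have fr := hQ'.perm hQ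
  obtain ⟨l₁, f₁, f', r₁, r', rfl⟩ := (h₂.reorder hQ hQ' hv).split
  obtain ⟨l₂, f₂, f₃, r₂, r₃, rfl⟩ := r'.split
  have fr' := Fresh.right r₁ fr
  obtain ⟨g, hg⟩ := ha.exists_run fr.left
  obtain ⟨hL, hM, k, kL, kM⟩ := ρ
  have e₁ : (l₁ : Multiset Wire) = ((c ++ a : List Wire) : Multiset Wire) :=
    add_right_cancel (r₁.balance.symm.trans hg.balance)
  have e₂ : (l₂ : Multiset Wire) = ((c ++ b : List Wire) : Multiset Wire) :=
    add_right_cancel (b := (insOf L : Multiset Wire)) (by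
      rw [← r₂.balance, e₁, coe_append, coe_append, add_assoc, kL.balance, add_assoc])
  obtain ⟨p, hp⟩ := exists_isPerm (R := R) e₁ fr'.nodup
  obtain ⟨q, hq⟩ := exists_isPerm (R := R) e₂ (Fresh.right r₂ fr').nodup
  have kL' := ((kL.wh c).pre hp).post hq.mirror
  have kM' := ((kM.wh c).pre hp).post hq.mirror
  have := r₂.unique kL' fr'.left
  exact r₁.append ((kM'.congr this.symm).append r₃)

/-! ### Checking programs -/

theorem Valid.congr_right {P : List (Step R)} {l l' l'' : List Wire} (h : Valid P l l')
    (e : l'.Perm l'') : Valid P l l'' := by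
  induction P generalizing l with
  | nil => exact List.Perm.trans h e
  | cons s P ih => exact h.imp fun c hc => ⟨hc.1, ih hc.2⟩

theorem Valid.congr_left {P : List (Step R)} {l l' l'' : List Wire} (h : Valid P l l')
    (e : l''.Perm l) : Valid P l'' l' := by
  cases P with
  | nil => exact List.Perm.trans e h
  | cons s P => exact h.imp fun c hc => ⟨e.trans hc.1, hc.2⟩

theorem Valid.append {P Q : List (Step R)} {l l' l'' : List Wire} (h : Valid P l l')
    (h' : Valid Q l' l'') : Valid (P ++ Q) l l'' := by
  induction P generalizing l with
  | nil => exact h'.congr_left h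
  | cons s P ih => exact h.imp fun c hc => ⟨hc.1, ih hc.2⟩

namespace Check

/-- Is `k` in the list? -/
def memb (k : ℕ) : List ℕ → Bool
  | [] => false
  | j :: l => cond (Nat.beq k j) true (memb k l)

theorem memb_eq_true {k : ℕ} {l : List ℕ} : memb k l = true ↔ k ∈ l := by
  induction l with
  | nil => simp [memb]
  | cons j l ih =>
      rw [memb, List.mem_cons, ← ih]
      cases h : Nat.beq k j
      · simp [Nat.ne_of_beq_eq_false h]
      · simp [Nat.eq_of_beq_eq_true h]

/-- Push the elements of a list onto another one. -/
def push {α : Type u} {γ : Type v} : List α → List α → (List α → γ) → γ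
  | [], acc, k => k acc
  | x :: l, acc, k => push l (x :: acc) k

theorem push_eq {α : Type u} {γ : Type v} (l acc : List α) (k : List α → γ) :
    push l acc k = k (l.reverse ++ acc) := by
  induction l generalizing acc with
  | nil => rfl
  | cons x l ih => simp [push, ih]

/-- Push the names of wires onto a list. -/
def pushKeys {γ : Type v} : List Wire → List ℕ → (List ℕ → γ) → γ
  | [], acc, k => k acc
  | x :: l, acc, k => pushKeys l (x.1 :: acc) k

/-- Are the names of the wires new? -/
def freshW : List Wire → List ℕ → (List ℕ → Bool) → Bool
  | [], seen, k => k seen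
  | x :: l, seen, k => cond (memb x.1 seen) false (freshW l (x.1 :: seen) k)

/-- Are the output names of the steps new? -/
def freshP : List (Step R) → List ℕ → Bool
  | [], _ => true
  | s :: P, seen => freshW s.outs seen fun seen => freshP P seen

theorem freshW_spec {l : List Wire} {seen : List ℕ} {k : List ℕ → Bool}
    (h : freshW l seen k = true) (hs : seen.Nodup) :
    ∃ s, s.Nodup ∧ s.Perm (keys l ++ seen) ∧ k s = true := by
  induction l generalizing seen with
  | nil => exact ⟨seen, hs, .refl _, h⟩
  | cons x l ih =>
      rw [freshW] at h
      cases hm : memb x.1 seen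
      · rw [hm] at h
        have : x.1 ∉ seen := fun hx => by rw [memb_eq_true.2 hx] at hm; cases hm
        obtain ⟨s, h1, h2, h3⟩ := ih h (List.nodup_cons.2 ⟨this, hs⟩)
        exact ⟨s, h1, h2.trans List.perm_middle, h3⟩
      · rw [hm] at h; cases h

theorem freshP_spec {P : List (Step R)} {seen : List ℕ} (h : freshP P seen = true)
    (hs : seen.Nodup) : (keys (outsOf P) ++ seen).Nodup := by
  induction P generalizing seen with
  | nil => exact hs
  | cons s P ih =>
      obtain ⟨s', h1, h2, h3⟩ := freshW_spec h hs
      have := ih h3 h1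
      rw [(h2.append_left _).nodup_iff] at this
      have e : (keys (outsOf P) ++ (keys s.outs ++ seen)).Perm
          (keys (outsOf (s :: P)) ++ seen) := by
        simp only [keys, outsOf, List.flatMap_cons, List.map_append]
        rw [← List.append_assoc]
        exact List.perm_append_comm.append_right _
      exact e.nodup_iff.1 this

/-- Are all names of the program distinct? -/
def fresh (P : List (Step R)) (l : List Wire) : Bool := freshW l [] fun seen => freshP P seen

theorem fresh_spec {P : List (Step R)} {l : List Wire} (h : fresh P l = true) : Fresh P l := by
  obtain ⟨s, h1, h2, h3⟩ := freshW_spec h List.nodup_nil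
  have := freshP_spec h3 h1
  rw [(h2.append_left _).nodup_iff, List.append_nil] at this
  rw [Fresh, ← coe_append, Multiset.map_coe, List.map_append]
  exact this

/-- Remove the wire with name `k` from the list. -/
def pull {γ : Type v} (k : ℕ) : List Wire → List Wire → (Wire → List Wire → Option γ) → Option γ
  | _, [], _ => none
  | acc, x :: l, c => cond (Nat.beq k x.1) (push acc l fun l => c x l) (pull k (x :: acc) l c)

/-- Remove wires from a list, and record the removed wires together with the expected ones. -/
def pulls {γ : Type v} : List Wire → List Wire → List (Wire × Wire) →
    (List Wire → List (Wire × Wire) → Option γ) → Option γ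
  | [], st, E, c => c st E
  | x :: l, st, E, c => pull x.1 [] st fun y st => pulls l st ((x, y) :: E) c

/-- Follow the available wires through a program. -/
def sim {γ : Type v} : List (Step R) → List Wire → List (Wire × Wire) →
    (List Wire → List (Wire × Wire) → Option γ) → Option γ
  | [], st, E, c => c st E
  | s :: P, st, E, c => pulls s.ins st E fun st E => push s.outs st fun st => sim P st E c

/-- The recorded pairs consist of equal elements. -/
def Ok {α : Type u} (E : List (α × α)) : Prop := ∀ p ∈ E, p.1 = p.2

theorem Ok.mono {α : Type u} {E E' : List (α × α)} (h : Ok E') (hE : E ⊆ E') : Ok E :=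
  fun p hp => h p (hE hp)

theorem Ok.of_map {α : Type u} {E : List (α × α)} (h : E.map Prod.fst = E.map Prod.snd) :
    Ok E := by
  intro p hp
  exact List.map_inj_left.1 h p hp

theorem pull_spec {γ : Type v} {k : ℕ} {acc l : List Wire} {c : Wire → List Wire → Option γ}
    {r : γ} (h : pull k acc l c = some r) :
    ∃ x l', c x l' = some r ∧ (acc ++ l).Perm (x :: l') := by
  induction l generalizing acc with
  | nil => cases h
  | cons x l ih =>
      rw [pull] at h
      cases hb : Nat.beq k x.1 <;> rw [hb] at h
      · obtain ⟨y, l', h1, h2⟩ := ih h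
        exact ⟨y, l', h1, List.perm_middle.trans h2⟩
      · change push acc l _ = _ at h
        rw [push_eq] at h
        exact ⟨x, _, h, List.perm_middle.trans
          (List.Perm.cons x ((List.reverse_perm acc).symm.append_right l))⟩

theorem pulls_spec {γ : Type v} {l st : List Wire} {E : List (Wire × Wire)}
    {c : List Wire → List (Wire × Wire) → Option γ} {r : γ} (h : pulls l st E c = some r) :
    ∃ st' E', c st' E' = some r ∧ E ⊆ E' ∧ (Ok E' → st.Perm (st' ++ l)) := by
  induction l generalizing st E with
  | nil => exact ⟨st, E, h, fun _ h => h, fun _ => by simp⟩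
  | cons x l ih =>
      obtain ⟨y, st₁, h1, h2⟩ := pull_spec h
      obtain ⟨st', E', h3, h4, h5⟩ := ih h1
      refine ⟨st', E', h3, fun p hp => h4 (List.mem_cons_of_mem _ hp), fun hE => ?_⟩
      have e : x = y := hE (x, y) (h4 List.mem_cons_self)
      subst e
      exact h2.trans ((List.Perm.cons x (h5 hE)).trans List.perm_middle.symm)

theorem sim_spec {γ : Type v} {P : List (Step R)} {st : List Wire} {E : List (Wire × Wire)}
    {c : List Wire → List (Wire × Wire) → Option γ} {r : γ} (h : sim P st E c = some r) :
    ∃ st' E', c st' E' = some r ∧ E ⊆ E' ∧ (Ok E' → Valid P st st') := by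
  induction P generalizing st E with
  | nil => exact ⟨st, E, h, fun _ h => h, fun _ => List.Perm.refl _⟩
  | cons s P ih =>
      obtain ⟨st₁, E₁, h1, h2, h3⟩ := pulls_spec h
      rw [push_eq] at h1
      obtain ⟨st', E', h4, h5, h6⟩ := ih h1
      refine ⟨st', E', h4, fun p hp => h5 (h2 hp), fun hE => ⟨st₁, h3 (hE.mono h5), (h6 hE).congr_left ?_⟩⟩
      exact List.perm_append_comm.trans ((List.reverse_perm _).symm.append_right _)

/-- Do the lists have the same names? -/
def sameKeys : List Wire → List Wire → Bool
  | [], [] => true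
  | x :: l, y :: l' => cond (Nat.beq x.1 y.1) (sameKeys l l') false
  | _, _ => false

/-- Have the steps the same names? -/
def same (s t : Step R) : Bool := cond (sameKeys s.ins t.ins) (sameKeys s.outs t.outs) false

/-- Remove a step with the names of `s` from a list. -/
def pick {γ : Type v} (s : Step R) : List (Step R) → List (Step R) →
    (Step R → List (Step R) → γ) → γ → γ
  | _, [], _, d => d
  | acc, t :: l, c, d => cond (same s t) (push acc l fun l => c t l) (pick s (t :: acc) l c d)

theorem pick_spec {γ : Type v} {s : Step R} {acc l : List (Step R)}
    {c : Step R → List (Step R) → γ} {d : γ} :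
    pick s acc l c d = d ∨ ∃ t l', pick s acc l c d = c t l' ∧ (acc ++ l).Perm (t :: l') := by
  induction l generalizing acc with
  | nil => exact .inl rfl
  | cons t l ih =>
      rw [pick]
      cases same s t
      · rcases ih (acc := t :: acc) with h | ⟨t', l', h1, h2⟩
        · exact .inl h
        · exact .inr ⟨t', l', h1, List.perm_middle.trans h2⟩
      · refine .inr ⟨t, _, push_eq _ _ _, List.perm_middle.trans
          (List.Perm.cons t ((List.reverse_perm acc).symm.append_right l))⟩

/-- Does one of the wires have its name in the list? -/
def meets : List Wire → List ℕ → Bool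
  | [], _ => false
  | x :: l, bad => cond (memb x.1 bad) true (meets l bad)

/-- Split a program into the steps in `rem`, those depending on them, and the others. -/
def classify {γ : Type v} : List (Step R) → List ℕ → List (Step R) → List (Step R) →
    List (Step R) → List (Step R × Step R) →
    (List (Step R) → List (Step R) → List (Step R × Step R) → Option γ) → Option γ
  | [], _, [], A, B, F, c => c A B F
  | [], _, _ :: _, _, _, _, _ => none
  | q :: Q, bad, rem, A, B, F, c => pick q [] rem
      (fun t rem => pushKeys q.outs bad fun bad => classify Q bad rem A B ((q, t) :: F) c)
      (cond (meets q.ins bad)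
        (pushKeys q.outs bad fun bad => classify Q bad rem A (q :: B) F c)
        (classify Q bad rem (q :: A) B F c))

theorem pushKeys_spec {γ : Type v} {l : List Wire} {acc : List ℕ} {k : List ℕ → γ} :
    ∃ acc', pushKeys l acc k = k acc' := by
  induction l generalizing acc with
  | nil => exact ⟨acc, rfl⟩
  | cons x l ih => exact ih

theorem classify_spec {γ : Type v} {Q rem A B : List (Step R)} {bad : List ℕ}
    {F : List (Step R × Step R)}
    {c : List (Step R) → List (Step R) → List (Step R × Step R) → Option γ} {r : γ}
    (h : classify Q bad rem A B F c = some r) :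
    ∃ A' B' F', c A' B' F' = some r ∧ F ⊆ F' ∧
      (Ok F' → (A ++ (B ++ Q)).Perm (A' ++ (rem ++ B'))) := by
  induction Q generalizing bad rem A B F with
  | nil =>
      cases rem with
      | nil => exact ⟨A, B, F, h, fun _ h => h, fun _ => by simp⟩
      | cons => cases h
  | cons q Q ih =>
      rw [classify] at h
      have hd : (cond (meets q.ins bad)
        (pushKeys q.outs bad fun bad => classify Q bad rem A (q :: B) F c)
        (classify Q bad rem (q :: A) B F c)) = some r → ∃ A' B' F', c A' B' F' = some r ∧ F ⊆ F' ∧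
          (Ok F' → (A ++ (B ++ q :: Q)).Perm (A' ++ (rem ++ B'))) := by
        intro h
        cases hm : meets q.ins bad <;> rw [hm] at h
        · obtain ⟨A', B', F', h1, h2, h3⟩ := ih h
          refine ⟨A', B', F', h1, h2, fun hF => List.Perm.trans ?_ (h3 hF)⟩
          rw [← List.append_assoc, ← List.append_assoc]
          exact List.perm_middle
        · obtain ⟨bad', hb⟩ := pushKeys_spec (l := q.outs) (acc := bad)
            (k := fun bad => classify Q bad rem A (q :: B) F c)
          obtain ⟨A', B', F', h1, h2, h3⟩ := ih (hb.symm.trans h)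
          refine ⟨A', B', F', h1, h2, fun hF => List.Perm.trans ?_ (h3 hF)⟩
          exact List.perm_middle.append_left _
      rcases pick_spec (s := q) (acc := []) (l := rem)
        (c := fun t rem => pushKeys q.outs bad fun bad => classify Q bad rem A B ((q, t) :: F) c)
        (d := cond (meets q.ins bad)
          (pushKeys q.outs bad fun bad => classify Q bad rem A (q :: B) F c)
          (classify Q bad rem (q :: A) B F c)) with e | ⟨t, rem', e, hp⟩
      · exact hd (e.symm.trans h)
      · obtain ⟨bad', hb⟩ := pushKeys_spec (l := q.outs) (acc := bad)
          (k := fun bad => classify Q bad rem' A B ((q, t) :: F) c)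
        obtain ⟨A', B', F', h1, h2, h3⟩ := ih (hb.symm.trans (e.symm.trans h))
        refine ⟨A', B', F', h1, fun p hp => h2 (List.mem_cons_of_mem _ hp), fun hF => ?_⟩
        have et : q = t := hF (q, t) (h2 List.mem_cons_self)
        subst et
        have h4 := h3 hF
        have h5 : (A ++ (B ++ q :: Q)).Perm (q :: (A ++ (B ++ Q))) := by
          rw [← List.append_assoc, ← List.append_assoc]
          exact List.perm_middle
        refine h5.trans ((List.Perm.cons q h4).trans ?_)
        refine List.perm_middle.symm.trans (List.Perm.append_left A' ?_)
        exact hp.symm.append_right B'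

/-- Rewrite the program `Q` with the equation between `L` and `M`. -/
def rewrite (l l' a : List Wire) (L M Q : List (Step R)) :
    Option (List (Step R) × List (Step R × Step R) × List (Wire × Wire)) :=
  classify Q [] L [] [] [] fun A B F => push A [] fun A' => push B [] fun B' =>
    sim A' l [] fun st E => pulls a st E fun _ E => sim L st E fun st E => sim B' st E fun st E =>
      pulls l' st E fun st E =>
        match st with
        | [] => push M [] fun M' => push M' B' fun C => push A C fun C =>
            cond (fresh C l) (some (C, F, E)) none
        | _ :: _ => none

/-- Both components of a list of pairs. -/
def unzip {α : Type u} (E : List (α × α)) : List α × List α := (E.map Prod.fst, E.map Prod.snd)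

/-- The result of a check, with the components of the lists of pairs separated. -/
def result {α : Type u} {β : Type v} (r : α × List (β × β) × List (Wire × Wire)) :
    α × (List β × List β) × List Wire × List Wire := (r.1, unzip r.2.1, unzip r.2.2)

theorem result_eq {α : Type u} {β : Type v} {r : Option (α × List (β × β) × List (Wire × Wire))}
    {x : α} {F : List β} {E : List Wire} (h : r.map result = some (x, (F, F), (E, E))) :
    ∃ F' E', r = some (x, F', E') ∧ Ok F' ∧ Ok E' := by
  cases r with
  | none => cases h
  | some r =>
      obtain ⟨x', F', E'⟩ := r
      simp only [Option.map_some, result, unzip, Option.some.injEq, Prod.mk.injEq] at h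
      obtain ⟨rfl, ⟨h1, h2⟩, h3, h4⟩ := h
      exact ⟨F', E', rfl, Ok.of_map (h1.trans h2.symm), Ok.of_map (h3.trans h4.symm)⟩

/-- Check the program `P` from `l` to `l'`. -/
def start (l l' : List Wire) (P : List (Step R)) :
    Option (Unit × List (Unit × Unit) × List (Wire × Wire)) :=
  sim P l [] fun st E => pulls l' st E fun st E =>
    match st with
    | [] => cond (fresh P l) (some ((), [], E)) none
    | _ :: _ => none

/-- Check that `P` and `Q` consist of the same steps. -/
def finish (l l' : List Wire) (P Q : List (Step R)) :
    Option (Unit × List (Step R × Step R) × List (Wire × Wire)) :=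
  classify P [] Q [] [] [] fun A B F =>
    match A, B with
    | [], [] => sim Q l [] fun st E => pulls l' st E fun st E =>
      match st with
      | [] => some ((), F, E)
      | _ :: _ => none
    | _, _ => none

end Check

open Check

theorem Rule.start {l l' : List Wire} {P : List (Step R)} {F : List Unit} {E : List Wire}
    (h : (Check.start l l' P).map result = some ((), (F, F), (E, E))) : Rule l l' P P := by
  obtain ⟨F, E, h, _, ok⟩ := result_eq h
  obtain ⟨st, E₁, h1, h2, h3⟩ := sim_spec h
  obtain ⟨st', E₂, h4, h5, h6⟩ := pulls_spec h1
  cases st' with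
  | cons => cases h4
  | nil =>
      change cond (fresh P l) (some ((), [], E₂)) none = _ at h4
      cases hf : fresh P l <;> rw [hf] at h4 <;> cases h4
      exact Rule.refl (fresh_spec hf) ((h3 (ok.mono h5)).congr_right (h6 ok))

theorem Rule.step_of_eq {l l' a b : List Wire} {P Q Q' L M : List (Step R)} (h : Rule l l' P Q)
    (ρ : Fresh L a → Fresh M a → Rule a b L M)
    {F : List (Step R × Step R)} {E : List (Wire × Wire)}
    (e : Check.rewrite l l' a L M Q = some (Q', F, E)) (okF : Ok F) (okE : Ok E) :
    Rule l l' P Q' := by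
  obtain ⟨A, B, F, e1, _, hperm⟩ := classify_spec e
  rw [push_eq, push_eq] at e1
  obtain ⟨st₁, E₁, e2, s1, v1⟩ := sim_spec e1
  obtain ⟨c, E₂, e3, s2, v2⟩ := pulls_spec e2
  obtain ⟨st₃, E₃, e4, s3, v3⟩ := sim_spec e3
  obtain ⟨st₄, E₄, e5, s4, v4⟩ := sim_spec e4
  obtain ⟨st₅, E₅, e6, s5, v5⟩ := pulls_spec e5
  cases st₅ with
  | cons => cases e6
  | nil =>
      simp only [push_eq] at e6
      simp only [List.append_nil, List.reverse_reverse] at *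
      obtain ⟨N, hN⟩ : ∃ N, N = A.reverse ++ (M ++ B.reverse) :=
        ⟨_, rfl⟩
      rw [← hN] at e6
      cases hf : fresh N l <;> rw [hf] at e6 <;> cases e6
      subst hN
      have hf := fresh_spec hf
      have ok4 := okE.mono s5
      have ok3 := ok4.mono s4
      have ok2 := ok3.mono s3
      have ok1 := ok2.mono s2
      have hp : Q.Perm (A.reverse ++ (L ++ B.reverse)) := by
        refine (hperm okF).trans ?_
        exact (List.reverse_perm A).symm.append ((List.reverse_perm B).symm.append_left _)
      have va := (v1 ok1).congr_right (v2 ok2)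
      have vL := (v1 ok1).append ((v3 ok3).append ((v4 ok4).congr_right (v5 okE)))
      have hfL : Fresh L a :=
        (h.2.1.perm hp).of_valid va
      have hfM : Fresh M a := hf.of_valid va
      exact (ρ hfL hfM).rewrite h hp vL va hf

/-- Rewriting with an equation whose names are replaced according to `σ`. -/
theorem Rule.step {l l' a b : List Wire} {P Q Q' L M : List (Step R)} (h : Rule l l' P Q)
    (ρ : Rule a b L M) (σ : List ℕ) {F : List (Step R)} {E : List Wire}
    (e : (Check.rewrite l l' (rn (σ.getD · 0) a) (L.map (Step.rename (σ.getD · 0)))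
      (M.map (Step.rename (σ.getD · 0))) Q).map result = some (Q', (F, F), (E, E))) :
    Rule l l' P Q' := by
  obtain ⟨F, E, e, okF, okE⟩ := result_eq e
  exact h.step_of_eq (fun hL hM => ρ.rename _ hL hM) e okF okE

theorem Rule.finish {l l' : List Wire} {P Q T : List (Step R)} (h : Rule l l' P Q)
    {F : List (Step R)} {E : List Wire}
    (e : (Check.finish l l' Q T).map result = some ((), (F, F), (E, E))) : Rule l l' P T := by
  obtain ⟨F, E, e, okF, okE⟩ := result_eq e
  obtain ⟨A, B, F, e1, _, hperm⟩ := classify_spec e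
  cases A with
  | cons => cases e1
  | nil =>
  cases B with
  | cons => cases e1
  | nil =>
  obtain ⟨st₁, E₁, e2, s1, v1⟩ := sim_spec e1
  obtain ⟨st₂, E₂, e3, s2, v2⟩ := pulls_spec e2
  cases st₂ with
  | cons => cases e3
  | nil =>
      cases e3
      obtain ⟨hP, hQ, f, h₁, h₂⟩ := h
      have hp := hperm okF
      simp only [List.nil_append, List.append_nil] at hp
      exact ⟨hP, hQ.perm hp, f, h₁, h₂.reorder hp hQ
        ((v1 (okE.mono s2)).congr_right (v2 okE))⟩

/-! ### Identities -/

/-- The identity of a wire, as a step. -/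
def Step.wire (R : Type u) [CommSemiring R] (A : Color) (a b : ℕ) : Step R :=
  ⟨[(a, A)], [(b, A)], Hom.id (of A)⟩

/-- Replacement of the name `a` by `b`. -/
def single (a b n : ℕ) : ℕ := cond (Nat.beq n a) b n

theorem single_self (a b : ℕ) : single a b a = b := by
  simp [single]

theorem single_ne {a b n : ℕ} (h : n ≠ a) : single a b n = n := by
  cases e : Nat.beq n a
  · simp [single, e]
  · exact absurd (Nat.eq_of_beq_eq_true e) h

/-- Renaming of the input wires of a step. -/
def Step.renameIns (σ : ℕ → ℕ) (s : Step R) : Step R :=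
  ⟨rn σ s.ins, s.outs, Hom.cast (ob_rn σ _) rfl s.box⟩

/-- Renaming of the output wires of a step. -/
def Step.renameOuts (σ : ℕ → ℕ) (s : Step R) : Step R :=
  ⟨s.ins, rn σ s.outs, Hom.cast rfl (ob_rn σ _) s.box⟩

theorem ob_append_single (c : List Wire) (A : Color) (a b : ℕ) :
    ob (c ++ [(a, A)]) = ob (c ++ [(b, A)]) := by rw [ob_append, ob_append]

theorem wh_wire (c : List Wire) (A : Color) (a b : ℕ) :
    wh c (Step.wire R A a b).box =
      Hom.cast rfl (ob_append_single c A a b) (Hom.id (ob (c ++ [(a, A)]))) := by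
  induction c with
  | nil => rfl
  | cons n c ih =>
      refine (congrArg (· ◃ n.2) ih).trans ?_
      refine (Hom.cast_whisk rfl (ob_append_single c A a b) _ _).trans ?_
      exact congrArg (Hom.cast _ _) (Hom.id_whisk _ _)

theorem Rule.absorb_ins (s : Step R) (A : Color) (a b : ℕ) (hs : (b, A) ∈ s.ins)
    (h : Fresh [Step.wire R A a b, s] (rn (single b a) s.ins))
    (h'' : Fresh [s.renameIns (single b a)] (rn (single b a) s.ins)) :
    Rule (rn (single b a) s.ins) s.outs [Step.wire R A a b, s]
      [s.renameIns (single b a)] := by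
  have h' : (keys s.ins).Nodup := by
    have := h.nodup
    rw [keys, rn, List.map_map] at this
    exact List.Nodup.of_map (single b a) (by rw [List.map_map]; exact this)
  obtain ⟨c, hc⟩ := exists_append_of_subset (a := [(b, A)]) (b := s.ins) (by simp) (by simpa)
  obtain ⟨q, hq⟩ := exists_isPerm (R := R) hc h'
  have hcb : rn (single b a) c = c := by
    have : (keys (c ++ [(b, A)])).Nodup :=
      ((Multiset.coe_eq_coe.1 hc).map Prod.fst).nodup_iff.1 h'
    rw [keys, List.map_append, List.nodup_append] at this
    refine (List.map_congr_left fun n hn => ?_).trans (List.map_id c)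
    have hn' := this.2.2 n.1 (List.mem_map_of_mem hn) b (by simp)
    exact Prod.ext (single_ne hn') rfl
  have e : rn (single b a) (c ++ [(b, A)]) = c ++ [(a, A)] := by
    rw [rn, List.map_append, ← rn, hcb]
    simp [single_self]
  have hq' := (hq.rename (single b a) h.nodup).cast_right e
  rw [Hom.cast_cast] at hq'
  refine .of_eq ?_ (Run.cons (s := Step.wire R A a b) c hq' ((Run.single s).pre hq.mirror))
    (.single (s.renameIns (single b a))) h h''
  rw [wh_wire]
  have e' : ∀ {X X' Y Y' Z : Obj} (hX : X = X') (hY : Y = Y') (hY' : Y' = Y) (f : Hom R X Y)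
      (g : Hom R Y X) (k : Hom R X Z), f ⬝ g = Hom.id X →
      Hom.cast hX hY f ⬝ Hom.cast rfl hY' (Hom.id Y') ⬝ (g ⬝ k) = Hom.cast hX rfl k := by
    rintro X _ Y _ Z rfl rfl _ f g k hfg
    simp only [Hom.cast_rfl, Hom.comp_id]
    rw [← Hom.assoc, hfg, Hom.id_comp]
  exact e' _ _ _ _ _ _ hq.comp_mirror

theorem Rule.absorb_outs (s : Step R) (A : Color) (a b : ℕ) (hs : (a, A) ∈ s.outs)
    (h : Fresh [s, Step.wire R A a b] s.ins) (h' : Fresh [s.renameOuts (single a b)] s.ins) :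
    Rule s.ins (rn (single a b) s.outs) [s, Step.wire R A a b]
      [s.renameOuts (single a b)] := by
  have hn : (keys s.outs).Nodup := h.mono (by
    simp only [outsOf, List.flatMap_cons, coe_append]
    exact (Multiset.le_add_right _ _).trans (Multiset.le_add_right _ _))
  have hn' : (keys (rn (single a b) s.outs)).Nodup := h'.mono (by
    simp only [outsOf, List.flatMap_cons, coe_append]
    exact (Multiset.le_add_right _ _).trans (Multiset.le_add_right _ _))
  obtain ⟨c, hc⟩ := exists_append_of_subset (a := [(a, A)]) (b := s.outs) (by simp) (by simpa)
  obtain ⟨q, hq⟩ := exists_isPerm (R := R) hc hn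
  have hcb : rn (single a b) c = c := by
    have : (keys (c ++ [(a, A)])).Nodup :=
      ((Multiset.coe_eq_coe.1 hc).map Prod.fst).nodup_iff.1 hn
    rw [keys, List.map_append, List.nodup_append] at this
    refine (List.map_congr_left fun n hn => ?_).trans (List.map_id c)
    have hn' := this.2.2 n.1 (List.mem_map_of_mem hn) a (by simp)
    exact Prod.ext (single_ne hn') rfl
  have e : rn (single a b) (c ++ [(a, A)]) = c ++ [(b, A)] := by
    rw [rn, List.map_append, ← rn, hcb]
    simp [single_self]
  have hq' := ((hq.rename (single a b) hn').cast_right e).mirror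
  rw [Hom.cast_cast] at hq'
  refine .of_eq ?_ ((Run.single s).append
      (Run.cons (s := Step.wire R A a b) c hq (.nil hq')))
    (.single (s.renameOuts (single a b))) h h'
  rw [wh_wire]
  have e' : ∀ {X Y Y' Z Z' : Obj} (hX : Z = Z') (hY : Y = Y') (hY' : Y = Y') (f : Hom R X Z)
      (q : Hom R Z Y), q ⬝ q.mirror = Hom.id Z →
      f ⬝ (q ⬝ Hom.cast rfl hY' (Hom.id Y) ⬝ (Hom.cast hX hY q).mirror) =
        Hom.cast rfl hX f := by
    rintro X Y _ Z _ rfl rfl _ f q hq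
    simp only [Hom.cast_rfl, Hom.comp_id]
    rw [hq, Hom.comp_id]
  exact e' _ _ _ _ _ hq.comp_mirror

namespace Check

/-- The color of the wire named `b`. -/
def colorOf {γ : Type v} (b : ℕ) : List Wire → (Color → γ) → γ → γ
  | [], _, d => d
  | x :: l, c, d => cond (Nat.beq b x.1) (c x.2) (colorOf b l c d)

theorem colorOf_spec {γ : Type v} (b : ℕ) (l : List Wire) (c : Color → γ) (d : γ) :
    colorOf b l c d = d ∨ ∃ A, (b, A) ∈ l ∧ colorOf b l c d = c A := by
  induction l with
  | nil => exact .inl rfl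
  | cons x l ih =>
      rw [colorOf]
      cases h : Nat.beq b x.1
      · exact ih.imp_right fun ⟨A, h, e⟩ => ⟨A, List.mem_cons_of_mem _ h, e⟩
      · refine .inr ⟨x.2, ?_, rfl⟩
        rw [Nat.eq_of_beq_eq_true h]; exact List.mem_cons_self

/-- Remove the identity from `a` to `b`, by a renaming in the other step that uses `b`. -/
def absorbIns (l l' : List Wire) (a b : ℕ) (Q : List (Step R)) : List (Step R) →
    Option (List (Step R) × List (Step R × Step R) × List (Wire × Wire))
  | [] => none
  | s :: S => colorOf b s.ins (fun A => rewrite l l' (rn (single b a) s.ins)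
      [Step.wire R A a b, s] [s.renameIns (single b a)] Q) (absorbIns l l' a b Q S)

/-- Remove the identity from `a` to `b`, by a renaming in the other step that uses `a`. -/
def absorbOuts (l l' : List Wire) (a b : ℕ) (Q : List (Step R)) : List (Step R) →
    Option (List (Step R) × List (Step R × Step R) × List (Wire × Wire))
  | [] => none
  | s :: S => colorOf a s.outs (fun A => rewrite l l' s.ins
      [s, Step.wire R A a b] [s.renameOuts (single a b)] Q) (absorbOuts l l' a b Q S)

/-- Insert an identity from `a` to the new name `b`, by a renaming in the step that uses `a`. -/
def insertIns (a b : ℕ) : List (Step R) → Option (List (Step R))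
  | [] => none
  | s :: S => colorOf a s.ins (fun A => some (Step.wire R A a b :: s.renameIns (single a b) :: S))
      ((insertIns a b S).map (s :: ·))

/-- Insert an identity from the new name `b` to `a`, by a renaming in the step that yields `a`. -/
def insertOuts (a b : ℕ) : List (Step R) → Option (List (Step R))
  | [] => none
  | s :: S => colorOf a s.outs (fun A => some (s.renameOuts (single a b) :: Step.wire R A b a :: S))
      ((insertOuts a b S).map (s :: ·))

/-- Insert an identity step at the wire `a`: before the step that uses `a`, or, if there is none,
after the step that yields `a`. Also return the names of the ends of the identity. -/
def insert (a b : ℕ) (Q : List (Step R)) : Option (List (Step R) × ℕ × ℕ) :=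
  ((insertIns a b Q).map (·, a, b)).orElse fun _ => (insertOuts a b Q).map (·, b, a)

end Check

/-- Removal of the identity step from `a` to `b`. -/
theorem Rule.absorb {l l' : List Wire} {P Q Q' : List (Step R)} (h : Rule l l' P Q) (a b : ℕ)
    {F : List (Step R)} {E : List Wire}
    (e : ((Check.absorbIns l l' a b Q Q).orElse fun _ => Check.absorbOuts l l' a b Q Q).map
      result = some (Q', (F, F), (E, E))) : Rule l l' P Q' := by
  obtain ⟨F, E, e, okF, okE⟩ := result_eq e
  have key₁ : ∀ S, Check.absorbIns l l' a b Q S = some (Q', F, E) → Rule l l' P Q' := by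
    intro S
    induction S with
    | nil => intro h; cases h
    | cons s S ih =>
        intro e
        rw [Check.absorbIns] at e
        rcases colorOf_spec b s.ins (fun A => Check.rewrite l l' (rn (single b a) s.ins)
          [Step.wire R A a b, s] [s.renameIns (single b a)] Q) (absorbIns l l' a b Q S)
          with h' | ⟨A, hA, h'⟩
        · exact ih (h'.symm.trans e)
        · exact h.step_of_eq (fun hL hM => .absorb_ins s A a b hA hL hM) (h'.symm.trans e) okF okE
  have key₂ : ∀ S, Check.absorbOuts l l' a b Q S = some (Q', F, E) → Rule l l' P Q' := by
    intro S
    induction S with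
    | nil => intro h; cases h
    | cons s S ih =>
        intro e
        rw [Check.absorbOuts] at e
        rcases colorOf_spec a s.outs (fun A => Check.rewrite l l' s.ins
          [s, Step.wire R A a b] [s.renameOuts (single a b)] Q) (absorbOuts l l' a b Q S)
          with h' | ⟨A, hA, h'⟩
        · exact ih (h'.symm.trans e)
        · exact h.step_of_eq (fun hL hM => .absorb_outs s A a b hA hL hM) (h'.symm.trans e)
            okF okE
  cases h₁ : Check.absorbIns l l' a b Q Q with
  | none => rw [h₁] at e; exact key₂ _ e
  | some r => rw [h₁] at e; exact key₁ Q (h₁.trans e)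

/-- Insertion of an identity step at the wire `a`, whose removal restores the program. -/
theorem Rule.intro {l l' : List Wire} {P Q Q' T : List (Step R)} (h : Rule l l' P Q) (a b : ℕ)
    {c d : ℕ} {F₁ : List Unit} {F₂ F₃ : List (Step R)} {E₁ E₂ E₃ : List Wire}
    (_ : Check.insert a b Q = some (Q', c, d))
    (e₁ : (Check.start l l' Q').map result = some ((), (F₁, F₁), (E₁, E₁)))
    (e₂ : ((Check.absorbIns l l' c d Q' Q').orElse fun _ => Check.absorbOuts l l' c d Q' Q').map
      result = some (T, (F₂, F₂), (E₂, E₂)))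
    (e₃ : (Check.finish l l' T Q).map result = some ((), (F₃, F₃), (E₃, E₃))) : Rule l l' P Q' :=
  h.trans (((Rule.start e₁).absorb c d e₂).finish e₃).symm

/-! ### Diagrams as programs -/

/-- Diagrams with named wires. -/
inductive NamedDiag (R : Type u) [CommSemiring R] : List Wire → List Wire → Type u
  | step (s : Step R) : NamedDiag R s.ins s.outs
  | id (l : List Wire) : NamedDiag R l l
  | swap (a b : List Wire) : NamedDiag R (b ++ a) (a ++ b)
  | comp {a b b' c : List Wire} (d : NamedDiag R a b) (e : NamedDiag R b' c) (h : b = b') :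
      NamedDiag R a c
  | par {a b a' b' : List Wire} (d : NamedDiag R a b) (e : NamedDiag R a' b') :
      NamedDiag R (a' ++ a) (b' ++ b)

namespace NamedDiag

/-- The steps of a diagram. -/
def steps {a b : List Wire} : NamedDiag R a b → List (Step R)
  | step s => [s]
  | id _ => []
  | swap _ _ => []
  | comp d e _ => d.steps ++ e.steps
  | par d e => d.steps ++ e.steps

/-- The diagram without its names. -/
def eval {a b : List Wire} : NamedDiag R a b → Hom R (ob a) (ob b)
  | step s => s.box
  | id _ => Hom.id _
  | swap a b => sw R a b
  | comp d e h => d.eval ⬝ Hom.cast (congrArg ob h.symm) rfl e.eval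
  | par d e => pr d.eval e.eval

theorem run {a b : List Wire} (d : NamedDiag R a b) (h : Fresh d.steps a) :
    Run d.steps a b d.eval := by
  induction d with
  | step s => exact .single s
  | id l => exact .nil (.id l)
  | swap a b => exact .nil (.sw a b h.nodup)
  | comp d e hb ih ih' =>
      subst hb
      have h1 := ih h.left
      exact h1.append (ih' (Fresh.right h1 h))
  | @par a b a' b' d e ih ih' =>
      simp only [steps] at h
      have hd : Fresh d.steps a := by
        refine Multiset.nodup_of_le (Multiset.map_le_map ?_) h
        simp only [outsOf, List.flatMap_append, coe_append]
        exact Multiset.le_iff_exists_add.2 ⟨(outsOf e.steps : Multiset Wire) + a', by abel⟩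
      have he : Fresh e.steps a' := by
        refine Multiset.nodup_of_le (Multiset.map_le_map ?_) h
        simp only [outsOf, List.flatMap_append, coe_append]
        exact Multiset.le_iff_exists_add.2 ⟨(outsOf d.steps : Multiset Wire) + a, by abel⟩
      have h1 := ih hd
      have h2 := ih' he
      refine h1.pr h2 ?_ ?_
      · refine h.mono ?_
        simp only [outsOf, List.flatMap_append, coe_append]
        refine Multiset.le_iff_exists_add.2
          ⟨(outsOf e.steps : Multiset Wire) + (insOf d.steps : Multiset Wire), ?_⟩
        calc _ = (outsOf e.steps : Multiset Wire) + a' + ((a : Multiset Wire) +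
            (outsOf d.steps : Multiset Wire)) := by simp only [outsOf]; abel
          _ = _ := by rw [h1.balance]; abel
      · refine h.mono ?_
        simp only [outsOf, List.flatMap_append, coe_append]
        refine Multiset.le_iff_exists_add.2
          ⟨(insOf e.steps : Multiset Wire) + (insOf d.steps : Multiset Wire), ?_⟩
        calc _ = ((a' : Multiset Wire) + (outsOf e.steps : Multiset Wire)) + ((a : Multiset Wire) +
            (outsOf d.steps : Multiset Wire)) := by simp only [outsOf]; abel
          _ = _ := by rw [h1.balance, h2.balance]; abel

end NamedDiag

theorem Rule.of_eval {a b : List Wire} (d e : NamedDiag R a b) (h : d.eval = e.eval)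
    (hd : fresh d.steps a = true) (he : fresh e.steps a = true) : Rule a b d.steps e.steps :=
  .of_eq h (d.run (fresh_spec hd)) (e.run (fresh_spec he)) (fresh_spec hd) (fresh_spec he)

theorem Rule.eval {a b : List Wire} (d e : NamedDiag R a b) (h : Rule a b d.steps e.steps) :
    d.eval = e.eval :=
  h.eq (d.run h.1) (e.run h.2.1)

/-- The rewriting rules over `R`. -/
local notation "𝓡" => Rule (R := R)

/-! ### The generators as steps -/

namespace Step

/-- A diagram with two inputs and one output, as a step. -/
def tens (A B : Color) (a b c : ℕ) : Step R :=
  ⟨[(b, B), (a, A)], [(c, .tensor A B)], Hom.mk (Diag.tens A B)⟩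
/-- The mirrored Tensor as a step. -/
def cotens (A B : Color) (c a b : ℕ) : Step R :=
  ⟨[(c, .tensor A B)], [(b, B), (a, A)], Hom.mk (Diag.cotens A B)⟩
/-- The Plus as a step. -/
def plus (A B : Color) (a b c : ℕ) : Step R :=
  ⟨[(b, B), (a, A)], [(c, .plus A B)], Hom.mk (Diag.plus A B)⟩
/-- The mirrored Plus as a step. -/
def coplus (A B : Color) (c a b : ℕ) : Step R :=
  ⟨[(c, .plus A B)], [(b, B), (a, A)], Hom.mk (Diag.coplus A B)⟩
/-- The Contraction as a step. -/
def contr (A : Color) (a b c : ℕ) : Step R :=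
  ⟨[(b, A), (a, A)], [(c, A)], Hom.mk (Diag.contr A)⟩
/-- The mirrored Contraction as a step. -/
def cocontr (A : Color) (c a b : ℕ) : Step R :=
  ⟨[(c, A)], [(b, A), (a, A)], Hom.mk (Diag.cocontr A)⟩
/-- The Null as a step. -/
def null (A : Color) (a : ℕ) : Step R := ⟨[], [(a, A)], Hom.mk (Diag.null A)⟩
/-- The mirrored Null as a step. -/
def conull (A : Color) (a : ℕ) : Step R := ⟨[(a, A)], [], Hom.mk (Diag.conull A)⟩
/-- The Unit as a step. -/
def unit (a : ℕ) : Step R := ⟨[], [(a, .one)], Hom.mk Diag.unit⟩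
/-- The mirrored Unit as a step. -/
def counit (a : ℕ) : Step R := ⟨[(a, .one)], [], Hom.mk Diag.counit⟩
/-- The Adapter as a step. -/
def adapt {A B : Color} (h : A.Approx B) (a b : ℕ) : Step R :=
  ⟨[(a, A)], [(b, B)], Hom.mk (Diag.adapt h)⟩
/-- The Scalar as a step. -/
def scal (s : R) (A : Color) (a b : ℕ) : Step R :=
  ⟨[(a, A)], [(b, A)], Hom.mk (Diag.scal s A)⟩
/-- Two wires in disjunction, as a step. -/
def xplus (A B : Color) (a b c d : ℕ) : Step R :=
  ⟨[(b, B), (a, A)], [(d, B), (c, A)], Hom.mk (Diag.xplus A B)⟩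
/-- A Tensor and its mirror, as a step. -/
def xtens (A B : Color) (a b c d : ℕ) : Step R :=
  ⟨[(b, B), (a, A)], [(d, B), (c, A)], Hom.mk (Diag.xtens A B)⟩
/-- A wire `𝟙` is split off to the right. -/
def tapR (A : Color) (a b c : ℕ) : Step R :=
  ⟨[(a, A)], [(c, .one), (b, A)], Hom.mk (Diag.tapR A)⟩
/-- A wire `𝟙` is split off to the left. -/
def tapL (A : Color) (a b c : ℕ) : Step R :=
  ⟨[(a, A)], [(c, A), (b, .one)], Hom.mk (Diag.tapL A)⟩
/-- A wire `𝟙` on the right is merged. -/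
def untapR (A : Color) (b c a : ℕ) : Step R :=
  ⟨[(c, .one), (b, A)], [(a, A)], Hom.mk (Diag.untapR A)⟩
/-- A wire `𝟙` on the left is merged. -/
def untapL (A : Color) (b c a : ℕ) : Step R :=
  ⟨[(c, A), (b, .one)], [(a, A)], Hom.mk (Diag.untapL A)⟩

end Step

/-- Sequential composition of diagrams with named wires. -/
notation:70 d:70 " ⨾ " e:71 => NamedDiag.comp d e rfl
/-- Parallel composition of diagrams with named wires. -/
infixl:75 " ⫼ " => NamedDiag.par
/-- A step as a diagram with named wires. -/
prefix:max "▣" => NamedDiag.step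
/-- The identity of a list of named wires. -/
prefix:max "▤" => NamedDiag.id
/-- The swap of two lists of named wires. -/
notation "⤨" => NamedDiag.swap

/-! ### The axioms as equations between programs -/

namespace Rule

open Step

/-- A derivation rewrites a program to another one. -/
theorem prove {l l' : List Wire} {P Q T : List (Step R)} {F : List Unit} {E E' : List Wire}
    {F' : List (Step R)}
    (e : (Check.start l l' P).map Check.result = some ((), (F, F), (E, E)))
    (h : Rule l l' P P → Rule l l' P Q)
    (e' : (Check.finish l l' Q T).map Check.result = some ((), (F', F'), (E', E'))) :
    Rule l l' P T := (h (.start e)).finish e'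

/-- Equal diagrams have interchangeable programs. -/
theorem of_diag {l l' a b a' b' : List Wire} {P Q : List (Step R)}
    (d : NamedDiag R a b) (e : NamedDiag R a' b') (ha : a = l) (hb : b = l') (ha' : a' = l)
    (hb' : b' = l') (fP : Check.fresh P l = true) (fQ : Check.fresh Q l = true)
    (hP : P = d.steps) (hQ : Q = e.steps) (h : d.eval = Hom.cast
      (congrArg ob (ha'.trans ha.symm)) (congrArg ob (hb'.trans hb.symm)) e.eval) :
    Rule l l' P Q := by
  subst ha hb ha' hb' hP hQ
  exact .of_eval d e h fP fQ

/-- Programs that are equal by definition of their steps. -/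
notation "by_diag " d:max e:max h:max => Rule.of_diag d e rfl rfl rfl rfl rfl rfl rfl rfl h
/-- Rewriting of the steps with the given names. -/
notation:50 r:50 " ⇝" l:max e:51 => Rule.step r e l rfl
/-- Removal of an identity. -/
notation:50 r:50 " ⇤" a:max b:max => Rule.absorb r a b rfl
/-- Insertion of an identity. -/
notation:50 r:50 " ⇥" a:max b:max => Rule.intro r a b rfl rfl rfl rfl
/-- A derivation. -/
notation "derive " h:max => Rule.prove rfl h rfl

theorem xplus_def (A B : Color) : 𝓡 [(1, B), (0, A)] [(3, B), (2, A)]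
    [xplus A B 0 1 2 3] [plus A B 0 1 4, coplus A B 4 2 3] :=
  by_diag ▣(xplus A B 0 1 2 3) (▣(plus A B 0 1 4) ⨾ ▣(coplus A B 4 2 3)) rfl

theorem xtens_def (A B : Color) : 𝓡 [(1, B), (0, A)] [(3, B), (2, A)]
    [xtens A B 0 1 2 3] [tens A B 0 1 4, cotens A B 4 2 3] :=
  by_diag ▣(xtens A B 0 1 2 3) (▣(tens A B 0 1 4) ⨾ ▣(cotens A B 4 2 3)) rfl

theorem tapR_def (A : Color) : 𝓡 [(0, A)] [(2, .one), (1, A)]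
    [tapR A 0 1 2] [adapt (Color.Approx.tensor_one A).symm 0 3, cotens A .one 3 1 2] :=
  by_diag ▣(tapR A 0 1 2) (▣(adapt (Color.Approx.tensor_one A).symm 0 3) ⨾
    ▣(cotens A .one 3 1 2)) rfl

theorem tapL_def (A : Color) : 𝓡 [(0, A)] [(2, A), (1, .one)]
    [tapL A 0 1 2] [adapt (Color.Approx.one_tensor A).symm 0 3, cotens .one A 3 1 2] :=
  by_diag ▣(tapL A 0 1 2) (▣(adapt (Color.Approx.one_tensor A).symm 0 3) ⨾
    ▣(cotens .one A 3 1 2)) rfl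

theorem untapR_def (A : Color) : 𝓡 [(1, .one), (0, A)] [(2, A)]
    [untapR A 0 1 2] [tens A .one 0 1 3, adapt (Color.Approx.tensor_one A) 3 2] :=
  (tapR_def A).mirror.rename (fun n => [2, 0, 1, 3].getD n 0) (Check.fresh_spec rfl)
    (Check.fresh_spec rfl)

theorem cotens_tens (A B : Color) : 𝓡 [(0, .tensor A B)] [(1, .tensor A B)]
    [cotens A B 0 2 3, tens A B 2 3 1] [wire R (.tensor A B) 0 1] :=
  by_diag (▣(cotens A B 0 2 3) ⨾ ▣(tens A B 2 3 1)) ▣(wire R (.tensor A B) 0 1) (Hom.sound (.ax (.tensor A B)))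

theorem coplus_plus (A B : Color) : 𝓡 [(0, .plus A B)] [(1, .plus A B)]
    [coplus A B 0 2 3, plus A B 2 3 1] [wire R (.plus A B) 0 1] :=
  by_diag (▣(coplus A B 0 2 3) ⨾ ▣(plus A B 2 3 1)) ▣(wire R (.plus A B) 0 1) (Hom.sound (.ax (.plus A B)))

theorem coplus_tens (A B : Color) : 𝓡 [(0, .plus A B)] [(1, .tensor A B)]
    [coplus A B 0 2 3, tens A B 2 3 1] [conull (.plus A B) 0, null (.tensor A B) 1] :=
  by_diag (▣(coplus A B 0 2 3) ⨾ ▣(tens A B 2 3 1)) (▣(conull (.plus A B) 0) ⨾ ▣(null (.tensor A B) 1)) (Hom.sound (.ax (.bot A B)))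

theorem wire_zero : 𝓡 [(0, .zero)] [(1, .zero)]
    [wire R .zero 0 1] [conull .zero 0, null .zero 1] :=
  by_diag ▣(wire R .zero 0 1) (▣(conull .zero 0) ⨾ ▣(null .zero 1)) (Hom.sound (.ax .zero))

theorem contr_comm (A : Color) : 𝓡 [(1, A), (0, A)] [(2, A)]
    [contr A 1 0 2] [contr A 0 1 2] :=
  by_diag (⤨ [(0, A)] [(1, A)] ⨾ ▣(contr A 1 0 2)) ▣(contr A 0 1 2) (Hom.sound (.ax (.swap_contr A)))

theorem cotens_tens_assoc (A B C : Color) :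
    𝓡 [(1, C), (0, .tensor A B)] [(3, .tensor B C), (2, A)]
    [cotens A B 0 2 4, tens B C 4 1 3]
    [tens (.tensor A B) C 0 1 5, adapt (.tensor_assoc A B C) 5 6, cotens A (.tensor B C) 6 2 3] :=
  by_diag ((▣(cotens A B 0 2 4) ⫼ ▤[(1, C)]) ⨾ (▤[(2, A)] ⫼ ▣(tens B C 4 1 3))) (▣(tens (.tensor A B) C 0 1 5) ⨾ ▣(adapt (.tensor_assoc A B C) 5 6) ⨾
      ▣(cotens A (.tensor B C) 6 2 3)) (Hom.sound (.ax (.n_tensor A B C)))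

theorem xplus_eq (A B : Color) : 𝓡 [(1, B), (0, A)] [(3, B), (2, A)]
    [xplus A B 0 1 2 3]
    [tapR A 0 4 5, tapL B 1 6 7, xplus .one .one 5 6 8 9, untapR A 4 8 2, untapL B 9 7 3] :=
  by_diag ▣(xplus A B 0 1 2 3) ((▣(tapR A 0 4 5) ⫼ ▣(tapL B 1 6 7)) ⨾
    (▤[(4, A)] ⫼ ▣(xplus .one .one 5 6 8 9) ⫼ ▤[(7, B)]) ⨾
    (▣(untapR A 4 8 2) ⫼ ▣(untapL B 9 7 3))) (Hom.sound (.ax (.x_plus A B)))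

theorem plus_eq (A B : Color) : 𝓡 [(1, B), (0, A)] [(2, .plus A B)]
    [plus A B 0 1 2] [tapR A 0 3 4, tapR B 1 5 6, plus A B 3 5 7, contr .one 4 6 8,
      untapR (.plus A B) 7 8 2] :=
  by_diag ▣(plus A B 0 1 2) ((▣(tapR A 0 3 4) ⫼ ▣(tapR B 1 5 6)) ⨾
    (▤[(3, A)] ⫼ ⤨ [(4, .one)] [(5, B)] ⫼ ▤[(6, .one)]) ⨾
    (▣(plus A B 3 5 7) ⫼ ▣(contr .one 4 6 8)) ⨾ ▣(untapR (.plus A B) 7 8 2)) (Hom.sound (.ax (.plus_to_contr A B)))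

theorem wire_wire (A B : Color) : 𝓡 [(1, B), (0, A)] [(3, B), (2, A)]
    [wire R A 0 2, wire R B 1 3] [cocontr A 0 4 5, cocontr B 1 6 7, xtens A B 4 6 8 9,
      xplus A B 5 7 10 11, contr A 8 10 2, contr B 9 11 3] :=
  by_diag (▣(wire R A 0 2) ⫼ ▣(wire R B 1 3)) ((▣(cocontr A 0 4 5) ⫼ ▣(cocontr B 1 6 7)) ⨾
    (▤[(4, A)] ⫼ ⤨ [(5, A)] [(6, B)] ⫼ ▤[(7, B)]) ⨾
    (▣(xtens A B 4 6 8 9) ⫼ ▣(xplus A B 5 7 10 11)) ⨾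
    ((▤[(8, A)] ⫼ ⤨ [(9, B)] [(10, A)] ⫼ ▤[(11, B)]) ⨾
      (▣(contr A 8 10 2) ⫼ ▣(contr B 9 11 3)))) (Hom.sound (.ax (.mix A B)))

theorem null_cotens (A B : Color) : 𝓡 [] [(1, B), (0, A)]
    [null (.tensor A B) 2, cotens A B 2 0 1] [null A 0, null B 1] :=
  by_diag (▣(null (.tensor A B) 2) ⨾ ▣(cotens A B 2 0 1)) (▣(null A 0) ⫼ ▣(null B 1)) (Hom.sound (.ax (.tensor_null A B)))

theorem null_coplus (A B : Color) : 𝓡 [] [(1, B), (0, A)]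
    [null (.plus A B) 2, coplus A B 2 0 1] [null A 0, null B 1] :=
  by_diag (▣(null (.plus A B) 2) ⨾ ▣(coplus A B 2 0 1)) (▣(null A 0) ⫼ ▣(null B 1)) (Hom.sound (.ax (.plus_null A B)))

theorem null_cocontr (A : Color) : 𝓡 [] [(1, A), (0, A)]
    [null A 2, cocontr A 2 0 1] [null A 0, null A 1] :=
  by_diag (▣(null A 2) ⨾ ▣(cocontr A 2 0 1)) (▣(null A 0) ⫼ ▣(null A 1)) (Hom.sound (.ax (.contr_null A)))

theorem null_conull (A : Color) : 𝓡 [] [] [null A 0, conull A 0] [] :=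
  by_diag (▣(null A 0) ⨾ ▣(conull A 0)) (▤[]) (Hom.sound (.ax (.null_null A)))

theorem null_adapt {A B : Color} (h : A.Approx B) : 𝓡 [] [(0, B)]
    [null A 1, adapt h 1 0] [null B 0] :=
  by_diag (▣(null A 1) ⨾ ▣(adapt h 1 0)) ▣(null B 0) (Hom.sound (.ax (.null_adapt h)))

theorem null_scal (s : R) (A : Color) : 𝓡 [] [(0, A)]
    [null A 1, scal s A 1 0] [null A 0] :=
  by_diag (▣(null A 1) ⨾ ▣(scal s A 1 0)) ▣(null A 0) (Hom.sound (.ax (.null_scal s A)))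

theorem contr_null (A : Color) : 𝓡 [(0, A)] [(1, A)]
    [null A 2, contr A 0 2 1] [wire R A 0 1] :=
  by_diag ((▤[(0, A)] ⫼ ▣(null A 2)) ⨾ ▣(contr A 0 2 1)) ▣(wire R A 0 1) (Hom.sound (.ax (.unit_contr A)))

theorem contr_assoc (A : Color) : 𝓡 [(2, A), (1, A), (0, A)] [(3, A)]
    [contr A 0 1 4, contr A 4 2 3] [contr A 1 2 5, contr A 0 5 3] :=
  by_diag ((▣(contr A 0 1 4) ⫼ ▤[(2, A)]) ⨾ ▣(contr A 4 2 3)) ((▤[(0, A)] ⫼ ▣(contr A 1 2 5)) ⨾ ▣(contr A 0 5 3)) (Hom.sound (.ax (.assoc_contr A)))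

theorem contr_cotens (A B : Color) :
    𝓡 [(1, .tensor A B), (0, .tensor A B)] [(3, B), (2, A)]
    [contr (.tensor A B) 0 1 4, cotens A B 4 2 3]
    [cotens A B 0 5 6, cotens A B 1 7 8, contr A 5 7 2, contr B 6 8 3] :=
  by_diag (▣(contr (.tensor A B) 0 1 4) ⨾ ▣(cotens A B 4 2 3)) ((▣(cotens A B 0 5 6) ⫼ ▣(cotens A B 1 7 8)) ⨾
      ((▤[(5, A)] ⫼ ⤨ [(6, B)] [(7, A)] ⫼ ▤[(8, B)]) ⨾
      (▣(contr A 5 7 2) ⫼ ▣(contr B 6 8 3)))) (Hom.sound (.ax (.tensor_contr A B)))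

theorem contr_tens (A B : Color) : 𝓡 [(2, B), (1, A), (0, A)] [(3, .tensor A B)]
    [contr A 0 1 4, tens A B 4 2 3]
    [cocontr B 2 5 6, tens A B 0 5 7, tens A B 1 6 8, contr (.tensor A B) 7 8 3] :=
  by_diag ((▣(contr A 0 1 4) ⫼ ▤[(2, B)]) ⨾ ▣(tens A B 4 2 3)) ((▤[(0, A)] ⫼ ▤[(1, A)] ⫼ ▣(cocontr B 2 5 6)) ⨾
      (▤[(0, A)] ⫼ ⤨ [(1, A)] [(5, B)] ⫼ ▤[(6, B)]) ⨾
      (▣(tens A B 0 5 7) ⫼ ▣(tens A B 1 6 8)) ⨾ ▣(contr (.tensor A B) 7 8 3)) (Hom.sound (.ax (.contr_tensor A B)))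

theorem contr_coplus (A B : Color) :
    𝓡 [(1, .plus A B), (0, .plus A B)] [(3, B), (2, A)]
    [contr (.plus A B) 0 1 4, coplus A B 4 2 3]
    [coplus A B 0 5 6, coplus A B 1 7 8, contr A 5 7 9, contr B 6 8 10, xplus A B 9 10 2 3] :=
  by_diag (▣(contr (.plus A B) 0 1 4) ⨾ ▣(coplus A B 4 2 3)) ((▣(coplus A B 0 5 6) ⫼ ▣(coplus A B 1 7 8)) ⨾
      ((▤[(5, A)] ⫼ ⤨ [(6, B)] [(7, A)] ⫼ ▤[(8, B)]) ⨾
      (▣(contr A 5 7 9) ⫼ ▣(contr B 6 8 10))) ⨾ ▣(xplus A B 9 10 2 3)) (Hom.sound (.ax (.plus_contr A B)))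

theorem contr_xplus (A C : Color) : 𝓡 [(2, C), (1, A), (0, A)] [(4, C), (3, A)]
    [contr A 0 1 5, xplus A C 5 2 3 4]
    [xplus A C 1 2 6 7, xplus A C 0 7 8 4, contr A 8 6 3] :=
  by_diag ((▣(contr A 0 1 5) ⫼ ▤[(2, C)]) ⨾ ▣(xplus A C 5 2 3 4)) ((▤[(0, A)] ⫼ ▣(xplus A C 1 2 6 7)) ⨾ (▤[(0, A)] ⫼ ⤨ [(6, A)] [(7, C)]) ⨾
      (▣(xplus A C 0 7 8 4) ⫼ ▤[(6, A)]) ⨾ (▤[(8, A)] ⫼ ⤨ [(4, C)] [(6, A)]) ⨾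
      (▣(contr A 8 6 3) ⫼ ▤[(4, C)])) (Hom.sound (.ax (.x_plus_contr A C)))

theorem contr_cocontr (A : Color) : 𝓡 [(1, A), (0, A)] [(3, A), (2, A)]
    [contr A 0 1 4, cocontr A 4 2 3]
    [xplus A A 0 1 5 6, cocontr A 5 7 8, cocontr A 6 9 10, contr A 7 9 2, contr A 8 10 3] :=
  by_diag (▣(contr A 0 1 4) ⨾ ▣(cocontr A 4 2 3)) (▣(xplus A A 0 1 5 6) ⨾ (▣(cocontr A 5 7 8) ⫼ ▣(cocontr A 6 9 10)) ⨾
      ((▤[(7, A)] ⫼ ⤨ [(8, A)] [(9, A)] ⫼ ▤[(10, A)]) ⨾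
      (▣(contr A 7 9 2) ⫼ ▣(contr A 8 10 3)))) (Hom.sound (.ax (.contr_contr A)))

theorem contr_scal (s : R) (A : Color) : 𝓡 [(1, A), (0, A)] [(2, A)]
    [contr A 0 1 3, scal s A 3 2] [scal s A 0 4, scal s A 1 5, contr A 4 5 2] :=
  by_diag (▣(contr A 0 1 3) ⨾ ▣(scal s A 3 2)) ((▣(scal s A 0 4) ⫼ ▣(scal s A 1 5)) ⨾ ▣(contr A 4 5 2)) (Hom.sound (.ax (.contr_scal s A)))

theorem contr_adapt {A B : Color} (h : A.Approx B) : 𝓡 [(1, A), (0, A)] [(2, B)]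
    [contr A 0 1 3, adapt h 3 2] [adapt h 0 4, adapt h 1 5, contr B 4 5 2] :=
  by_diag (▣(contr A 0 1 3) ⨾ ▣(adapt h 3 2)) ((▣(adapt h 0 4) ⫼ ▣(adapt h 1 5)) ⨾ ▣(contr B 4 5 2)) (Hom.sound (.ax (.contr_adapt h)))

theorem cotens_cotens (A B C : Color) :
    𝓡 [(0, .tensor A (.tensor B C))] [(3, C), (2, B), (1, A)]
    [cotens A (.tensor B C) 0 1 4, cotens B C 4 2 3]
    [adapt (Color.Approx.tensor_assoc A B C).symm 0 5, cotens (.tensor A B) C 5 6 3,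
      cotens A B 6 1 2] :=
  by_diag (▣(cotens A (.tensor B C) 0 1 4) ⨾ (▤[(1, A)] ⫼ ▣(cotens B C 4 2 3))) (▣(adapt (Color.Approx.tensor_assoc A B C).symm 0 5) ⨾ ▣(cotens (.tensor A B) C 5 6 3) ⨾
      (▣(cotens A B 6 1 2) ⫼ ▤[(3, C)])) (Hom.sound (.ax (.assoc_tensor A B C)))

theorem coplus_coplus (A B C : Color) :
    𝓡 [(0, .plus A (.plus B C))] [(3, C), (2, B), (1, A)]
    [coplus A (.plus B C) 0 1 4, coplus B C 4 2 3]
    [adapt (Color.Approx.plus_assoc A B C).symm 0 5, coplus (.plus A B) C 5 6 3,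
      coplus A B 6 1 2] :=
  by_diag (▣(coplus A (.plus B C) 0 1 4) ⨾ (▤[(1, A)] ⫼ ▣(coplus B C 4 2 3))) (▣(adapt (Color.Approx.plus_assoc A B C).symm 0 5) ⨾ ▣(coplus (.plus A B) C 5 6 3) ⨾
      (▣(coplus A B 6 1 2) ⫼ ▤[(3, C)])) (Hom.sound (.ax (.assoc_plus A B C)))

theorem adapt_tens {A A' B B' : Color} (h : A.Approx A') (k : B.Approx B')
    (m : (Color.tensor A B).Approx (.tensor A' B')) :
    𝓡 [(1, B), (0, A)] [(2, .tensor A' B')]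
    [adapt h 0 3, adapt k 1 4, tens A' B' 3 4 2] [tens A B 0 1 5, adapt m 5 2] :=
  by_diag ((▣(adapt h 0 3) ⫼ ▣(adapt k 1 4)) ⨾ ▣(tens A' B' 3 4 2)) (▣(tens A B 0 1 5) ⨾ ▣(adapt m 5 2)) (Hom.sound (.ax (.tensor_adapt h k)))

theorem adapt_plus {A A' B B' : Color} (h : A.Approx A') (k : B.Approx B')
    (m : (Color.plus A B).Approx (.plus A' B')) :
    𝓡 [(1, B), (0, A)] [(2, .plus A' B')]
    [adapt h 0 3, adapt k 1 4, plus A' B' 3 4 2] [plus A B 0 1 5, adapt m 5 2] :=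
  by_diag ((▣(adapt h 0 3) ⫼ ▣(adapt k 1 4)) ⨾ ▣(plus A' B' 3 4 2)) (▣(plus A B 0 1 5) ⨾ ▣(adapt m 5 2)) (Hom.sound (.ax (.plus_adapt h k)))

theorem untapL_eq (A : Color) : 𝓡 [(1, A), (0, .one)] [(2, A)]
    [untapL A 0 1 2] [untapR A 1 0 2] :=
  by_diag ▣(untapL A 0 1 2) (⤨ [(0, .one)] [(1, A)] ⨾ ▣(untapR A 1 0 2)) (Hom.sound (.ax (.units_tensor A)))

theorem plus_zero (A : Color) (h : (Color.plus A .zero).Approx A) :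
    𝓡 [(1, .zero), (0, A)] [(2, A)]
    [plus A .zero 0 1 3, adapt h 3 2] [wire R A 0 2, conull .zero 1] :=
  by_diag (▣(plus A .zero 0 1 3) ⨾ ▣(adapt h 3 2)) (▣(wire R A 0 2) ⫼ ▣(conull .zero 1)) (Hom.sound (.ax (.unit_plus_right A)))

theorem zero_plus (A : Color) (h : (Color.plus .zero A).Approx A) :
    𝓡 [(1, A), (0, .zero)] [(2, A)]
    [plus .zero A 0 1 3, adapt h 3 2] [conull .zero 0, wire R A 1 2] :=
  by_diag (▣(plus .zero A 0 1 3) ⨾ ▣(adapt h 3 2)) (▣(conull .zero 0) ⫼ ▣(wire R A 1 2)) (Hom.sound (.ax (.unit_plus_left A)))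

theorem adapt_adapt {A B C : Color} (h : A.Approx B) (k : B.Approx C) (m : A.Approx C) :
    𝓡 [(0, A)] [(1, C)] [adapt h 0 2, adapt k 2 1] [adapt m 0 1] :=
  by_diag (▣(adapt h 0 2) ⨾ ▣(adapt k 2 1)) ▣(adapt m 0 1) (Hom.sound (.ax (.adapt_adapt h k)))

theorem adapt_self {A : Color} (h : A.Approx A) :
    𝓡 [(0, A)] [(1, A)] [adapt h 0 1] [wire R A 0 1] :=
  by_diag ▣(adapt h 0 1) ▣(wire R A 0 1) (Hom.sound (.ax (.adapt_refl A)))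

theorem scal_adapt {A B : Color} (s : R) (h : A.Approx B) :
    𝓡 [(0, A)] [(1, B)] [scal s A 0 2, adapt h 2 1] [adapt h 0 3, scal s B 3 1] :=
  by_diag (▣(scal s A 0 2) ⨾ ▣(adapt h 2 1)) (▣(adapt h 0 3) ⨾ ▣(scal s B 3 1)) (Hom.sound (.ax (.scal_adapt s h)))

theorem scal_one (A : Color) : 𝓡 [(0, A)] [(1, A)] [scal (1 : R) A 0 1] [wire R A 0 1] :=
  by_diag ▣(scal (1 : R) A 0 1) ▣(wire R A 0 1) (Hom.sound (.ax (.scal_one (R := R) A)))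

theorem scal_zero (A : Color) :
    𝓡 [(0, A)] [(1, A)] [scal (0 : R) A 0 1] [conull A 0, null A 1] :=
  by_diag ▣(scal (0 : R) A 0 1) (▣(conull A 0) ⨾ ▣(null A 1)) (Hom.sound (.ax (.scal_zero (R := R) A)))

theorem scal_add (s t : R) (A : Color) : 𝓡 [(0, A)] [(1, A)]
    [cocontr A 0 2 3, scal s A 2 4, scal t A 3 5, contr A 4 5 1] [scal (s + t) A 0 1] :=
  by_diag (▣(cocontr A 0 2 3) ⨾ (▣(scal s A 2 4) ⫼ ▣(scal t A 3 5)) ⨾ ▣(contr A 4 5 1)) ▣(scal (s + t) A 0 1) (Hom.sound (.ax (.scal_add s t A)))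

theorem scal_tens (s t : R) (A B : Color) : 𝓡 [(1, B), (0, A)] [(2, .tensor A B)]
    [scal s A 0 3, scal t B 1 4, tens A B 3 4 2]
    [tens A B 0 1 5, scal (s * t) (.tensor A B) 5 2] :=
  by_diag ((▣(scal s A 0 3) ⫼ ▣(scal t B 1 4)) ⨾ ▣(tens A B 3 4 2)) (▣(tens A B 0 1 5) ⨾ ▣(scal (s * t) (.tensor A B) 5 2)) (Hom.sound (.ax (.tensor_scal s t A B)))

theorem tapR_counit (A : Color) : 𝓡 [(0, A)] [(1, A)]
    [tapR A 0 1 2, counit 2] [wire R A 0 1] :=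
  by_diag (▣(tapR A 0 1 2) ⨾ (▤[(1, A)] ⫼ ▣(counit 2))) ▣(wire R A 0 1) (Hom.sound (.ax (.unit_tensor A)))

end Rule

namespace Rule

open Step

theorem cotens_adapt {A A' B B' : Color} (h : A.Approx A') (k : B.Approx B')
    (m : (Color.tensor A B).Approx (.tensor A' B')) :
    𝓡 [(0, .tensor A B)] [(2, B'), (1, A')]
    [cotens A B 0 3 4, adapt k 4 2, adapt h 3 1] [adapt m 0 5, cotens A' B' 5 1 2] :=
  (adapt_tens h.symm k.symm m.symm).mirror.rename (fun n => [1, 2, 0, 3, 4, 5].getD n 0)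
    (Check.fresh_spec rfl) (Check.fresh_spec rfl)

theorem adapt_cocontr {A B : Color} (h : A.Approx B) :
    𝓡 [(0, A)] [(2, B), (1, B)]
    [adapt h 0 3, cocontr B 3 1 2] [cocontr A 0 4 5, adapt h 5 2, adapt h 4 1] :=
  (contr_adapt h.symm).mirror.rename (fun n => [1, 2, 0, 3, 4, 5].getD n 0)
    (Check.fresh_spec rfl) (Check.fresh_spec rfl)

theorem adapt_conull {A B : Color} (h : A.Approx B) :
    𝓡 [(0, A)] [] [adapt h 0 1, conull B 1] [conull A 0] :=
  (null_adapt h.symm).mirror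

theorem tapL_eq (A : Color) : 𝓡 [(0, A)] [(2, A), (1, .one)] [tapL A 0 1 2]
    [tapR A 0 2 1] :=
  derive (· ⇝[1,2,0] (untapL_eq A).mirror)

theorem tap_untap (A : Color) : 𝓡 [(0, A)] [(1, A)] [tapR A 0 2 3, untapR A 2 3 1]
    [wire R A 0 1] :=
  derive (· ⇝[0,2,3,4] tapR_def A ⇝[2,3,1,5] untapR_def A ⇝[4,5,2,3] cotens_tens A .one ⇤4 5
    ⇝[0,1,4] adapt_adapt ((Color.Approx.tensor_one A).symm) (Color.Approx.tensor_one A) (.refl _)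
    ⇝[0,1] adapt_self (.refl _))

theorem untap_tap (A : Color) : 𝓡 [(1, .one), (0, A)] [(3, .one), (2, A)]
    [untapR A 0 1 4, tapR A 4 2 3] [xtens A .one 0 1 2 3] :=
  derive (· ⇝[4,2,3,5] tapR_def A ⇝[0,1,4,6] untapR_def A
    ⇝[6,5,4] adapt_adapt (Color.Approx.tensor_one A) ((Color.Approx.tensor_one A).symm) (.refl _)
    ⇝[6,5] adapt_self (.refl _) ⇤6 5 ⇝[0,1,2,3,6] (xtens_def A .one).symm)

theorem tap_one_comm : 𝓡 [(0, .one)] [(2, .one), (1, .one)] [tapR .one 0 1 2]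
    [tapR .one 0 2 1] :=
  derive (· ⇝[0,1,2,3] tapR_def .one ⇝[0,1,2,3] (tapL_def .one).symm ⇝[0,1,2] tapL_eq .one)

theorem cotens_tap_right (A B : Color) :
    𝓡 [(0, .tensor A B)] [(3, .one), (2, B), (1, A)] [cotens A B 0 1 4, tapR B 4 2 3]
    [tapR (.tensor A B) 0 5 3, cotens A B 5 1 2] :=
  derive (· ⇝[4,2,3,6] tapR_def B ⇥1 7 ⇝[7,1] (adapt_self (.refl _)).symm
    ⇝[0,1,6,7,4,8] cotens_adapt (.refl _) ((Color.Approx.tensor_one B).symm) (.tensor_left A (.symm (.tensor_one B)))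
    ⇝[8,1,2,3,6,9,5] cotens_cotens A B .one
    ⇝[0,9,8] adapt_adapt (.tensor_left A (.symm (.tensor_one B))) ((Color.Approx.tensor_assoc A B .one).symm) (.symm (.tensor_one _))
    ⇝[0,5,3,9] (tapR_def (.tensor A B)).symm)

theorem tap_tap (A : Color) : 𝓡 [(0, A)] [(3, .one), (2, .one), (1, A)]
    [tapR A 0 4 3, tapR A 4 1 2] [tapR A 0 1 5, tapR .one 5 2 3] :=
  derive (· ⇝[4,1,2,6] tapR_def A ⇝[0,4,3,7] tapR_def A ⇥3 8 ⇝[8,3] (adapt_self (.refl _)).symm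
    ⇝[7,6,3,4,8,9] cotens_adapt ((Color.Approx.tensor_one A).symm) (.refl _) (.tensor_right .one (.symm (.tensor_one A)))
    ⇝[0,9,7] adapt_adapt ((Color.Approx.tensor_one A).symm) (.tensor_right .one (.symm (.tensor_one A))) (.trans (.symm (.tensor_one A)) (.tensor_right .one (.symm (.tensor_one A))))
    ⇝[0,9,10] (adapt_adapt (.trans (.symm (.tensor_one A)) (.tensor_left A (.symm (.tensor_one .one)))) (.symm (.tensor_assoc A .one .one)) (.trans (.symm (.tensor_one A)) (.tensor_right .one (.symm (.tensor_one A))))).symm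
    ⇝[10,1,2,3,11,9,6] (cotens_cotens A .one .one).symm
    ⇝[0,10,12] (adapt_adapt (.symm (.tensor_one A)) (.tensor_left A (.symm (.tensor_one .one))) (.trans (.symm (.tensor_one A)) (.tensor_left A (.symm (.tensor_one .one))))).symm
    ⇝[12,1,11,13,5,10] (cotens_adapt (.refl A) (.symm (.tensor_one .one)) (.tensor_left A (.symm (.tensor_one .one)))).symm
    ⇝[13,1] adapt_self (.refl A) ⇤13 1 ⇝[0,1,5,12] (tapR_def A).symm
    ⇝[5,2,3,11] (tapR_def .one).symm)

theorem untapL_def (A : Color) : 𝓡 [(1, A), (0, .one)] [(2, A)]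
    [untapL A 0 1 2] [tens .one A 0 1 3, adapt (Color.Approx.one_tensor A) 3 2] :=
  (tapL_def A).mirror.rename (fun n => [2, 0, 1, 3].getD n 0) (Check.fresh_spec rfl)
    (Check.fresh_spec rfl)

theorem adapt_tens_left {A A' : Color} (B : Color) (h : A.Approx A') (m : (Color.tensor A B).Approx (.tensor A' B)) :
    𝓡 [(1, B), (0, A)] [(2, .tensor A' B)] [adapt h 0 3, tens A' B 3 1 2]
    [tens A B 0 1 4, adapt m 4 2] :=
  derive (· ⇥1 5 ⇝[1,5] (adapt_self (.refl _)).symm ⇝[0,1,2,3,5,4] adapt_tens h (.refl _) m)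

theorem cotens_adapt_left {A A' : Color} (B : Color) (h : A.Approx A') (m : (Color.tensor A B).Approx (.tensor A' B)) :
    𝓡 [(0, .tensor A B)] [(2, B), (1, A')] [cotens A B 0 3 2, adapt h 3 1]
    [adapt m 0 4, cotens A' B 4 1 2] :=
  derive (· ⇥2 5 ⇝[5,2] (adapt_self (.refl _)).symm ⇝[0,1,2,3,5,4] cotens_adapt h (.refl _) m)

theorem cotens_adapt_right {B B' : Color} (A : Color) (h : B.Approx B') (m : (Color.tensor A B).Approx (.tensor A B')) :
    𝓡 [(0, .tensor A B)] [(2, B'), (1, A)] [cotens A B 0 1 3, adapt h 3 2]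
    [adapt m 0 4, cotens A B' 4 1 2] :=
  derive (· ⇥1 5 ⇝[5,1] (adapt_self (.refl _)).symm ⇝[0,1,2,5,3,4] cotens_adapt (.refl _) h m)

theorem adapt_tap {A B : Color} (h : A.Approx B) : 𝓡 [(0, A)] [(2, .one), (1, B)]
    [adapt h 0 3, tapR B 3 1 2] [tapR A 0 4 2, adapt h 4 1] :=
  derive (· ⇝[3,1,2,5] tapR_def B
    ⇝[0,5,3] adapt_adapt h ((Color.Approx.tensor_one B).symm) (.trans h (.symm (.tensor_one B)))
    ⇝[0,5,6] (adapt_adapt (.symm (.tensor_one A)) (.tensor_right .one h) (.trans h (.symm (.tensor_one B)))).symm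
    ⇝[6,1,2,4,5] (cotens_adapt_left .one h (.tensor_right .one h)).symm
    ⇝[0,4,2,6] (tapR_def A).symm)

theorem tap_untap_comm (A C : Color) : 𝓡 [(1, C), (0, A)] [(3, C), (2, A)]
    [tapR A 0 2 4, untapR C 1 4 3] [xtens A C 0 1 2 3] :=
  derive (· ⇝[4,1,3] (untapL_eq C).symm ⇝[4,1,3,5] untapL_def C ⇝[0,2,4,6] tapR_def A
    ⇝[6,1,2,5,4,7,8] cotens_tens_assoc A .one C
    ⇝[0,1,7,6,9] adapt_tens_left C ((Color.Approx.tensor_one A).symm) (.tensor_right C (.symm (.tensor_one A)))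
    ⇝[8,2,3,5,10] cotens_adapt_right A (Color.Approx.one_tensor C) (.tensor_left A (.one_tensor C))
    ⇝[9,8,7] adapt_adapt (.tensor_right C (.symm (.tensor_one A))) (.tensor_assoc A .one C) (.trans (.tensor_right C (.symm (.tensor_one A))) (.tensor_assoc A .one C))
    ⇝[9,10,8] adapt_adapt (.trans (.tensor_right C (.symm (.tensor_one A))) (.tensor_assoc A .one C)) (.tensor_left A (.one_tensor C)) (.refl _)
    ⇝[9,10] adapt_self (.refl _) ⇤9 10 ⇝[0,1,2,3,9] (xtens_def A C).symm)

theorem untap_tap_comm (A C : Color) : 𝓡 [(1, C), (0, A)] [(3, C), (2, A)]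
    [tapR C 1 3 4, untapR A 0 4 2] [xtens A C 0 1 2 3] :=
  derive (· ⇝[2,3,0,1,4] (tap_untap_comm A C).mirror)

theorem tens_tap_right (A B : Color) : 𝓡 [(1, B), (0, A)] [(3, .one), (2, .tensor A B)]
    [tens A B 0 1 4, tapR (.tensor A B) 4 2 3] [tapR B 1 5 3, tens A B 0 5 2] :=
  derive (· ⇥2 6 ⇝[6,2,7,8] (cotens_tens A B).symm ⇝[4,7,8,3,9,6] (cotens_tap_right A B).symm
    ⇝[0,1,7,9,4] (xtens_def A B).symm ⇝[0,1,7,9,10] (untap_tap_comm A B).symm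
    ⇝[1,8,3,10,9,11] tap_tap B ⇝[11,3,10] tap_one_comm ⇝[1,8,10,3,5,11] (tap_tap B).symm
    ⇝[0,5,7,8,10] untap_tap_comm A B ⇝[0,5,7,8,12] xtens_def A B ⇝[12,2,7,8] cotens_tens A B ⇤12 2)

theorem cotens_tap_left (A B : Color) : 𝓡 [(0, .tensor A B)] [(3, .one), (2, B), (1, A)]
    [cotens A B 0 4 2, tapR A 4 1 3] [tapR (.tensor A B) 0 5 3, cotens A B 5 1 2] :=
  derive (· ⇥0 6 ⇝[0,6,7,8] (cotens_tens A B).symm ⇝[7,8,4,2,6] (xtens_def A B).symm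
    ⇝[7,8,4,2,9] (tap_untap_comm A B).symm ⇝[7,1,3,9,4,10] tap_tap A
    ⇝[8,10,2,3,9] untap_tap_comm B .one ⇝[8,10,2,3,11] (untap_tap B).symm
    ⇝[7,8,1,11,10] tap_untap_comm A B ⇝[7,8,1,11,12] xtens_def A B ⇝[0,12,7,8] cotens_tens A B ⇤0 12
    ⇝[0,1,2,3,11,5] cotens_tap_right A B)

theorem tens_tap_left (A B : Color) : 𝓡 [(1, B), (0, A)] [(3, .one), (2, .tensor A B)]
    [tens A B 0 1 4, tapR (.tensor A B) 4 2 3] [tapR A 0 5 3, tens A B 5 1 2] :=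
  derive (· ⇥2 6 ⇝[6,2,7,8] (cotens_tens A B).symm ⇝[4,7,8,3,9,6] (cotens_tap_left A B).symm
    ⇝[0,1,9,8,4] (xtens_def A B).symm ⇝[0,1,9,8,10] (tap_untap_comm A B).symm
    ⇝[0,7,3,10,9,11] tap_tap A ⇝[11,3,10] tap_one_comm ⇝[0,7,10,3,5,11] (tap_tap A).symm
    ⇝[5,1,7,8,10] tap_untap_comm A B ⇝[5,1,7,8,12] xtens_def A B ⇝[12,2,7,8] cotens_tens A B ⇤12 2)

theorem contr_tap (A : Color) : 𝓡 [(1, A), (0, A)] [(3, .one), (2, A)]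
    [contr A 0 1 4, tapR A 4 2 3] [tapR A 0 5 6, tapR A 1 7 8, contr A 5 7 2, contr .one 6 8 3] :=
  derive (· ⇝[4,2,3,9] tapR_def A ⇝[0,1,9,4,10,11] contr_adapt ((Color.Approx.tensor_one A).symm)
    ⇝[10,11,2,3,9,5,6,7,8] contr_cotens A .one ⇝[0,5,6,10] (tapR_def A).symm
    ⇝[1,7,8,11] (tapR_def A).symm)

theorem null_tap (A : Color) : 𝓡 [] [(1, .one), (0, A)] [null A 2, tapR A 2 0 1]
    [null A 0, null .one 1] :=
  derive (· ⇝[2,0,1,3] tapR_def A ⇝[3,2] null_adapt ((Color.Approx.tensor_one A).symm)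
    ⇝[0,1,3] null_cotens A .one)

theorem scal_tens_of_eq {r s t : R} (A B : Color) (h : s * t = r) :
    𝓡 [(1, B), (0, A)] [(2, .tensor A B)]
    [scal s A 0 3, scal t B 1 4, tens A B 3 4 2] [tens A B 0 1 5, scal r (.tensor A B) 5 2] :=
  h ▸ scal_tens s t A B

theorem scal_tens_left (s : R) (A B : Color) : 𝓡 [(1, B), (0, A)] [(2, .tensor A B)]
    [scal s A 0 3, tens A B 3 1 2] [tens A B 0 1 4, scal s (.tensor A B) 4 2] :=
  derive (· ⇥1 5 ⇝[1,5] (scal_one B).symm ⇝[0,1,2,3,5,4] scal_tens_of_eq A B (mul_one s))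

theorem scal_tens_right (s : R) (A B : Color) : 𝓡 [(1, B), (0, A)] [(2, .tensor A B)]
    [scal s B 1 3, tens A B 0 3 2] [tens A B 0 1 4, scal s (.tensor A B) 4 2] :=
  derive (· ⇥0 5 ⇝[0,5] (scal_one A).symm ⇝[0,1,2,5,3,4] scal_tens_of_eq A B (one_mul s))

theorem scal_tap_left (s : R) (A : Color) : 𝓡 [(0, A)] [(2, .one), (1, A)]
    [scal s A 0 3, tapR A 3 1 2] [tapR A 0 4 2, scal s A 4 1] :=
  derive (· ⇝[3,1,2,5] tapR_def A ⇝[0,5,3,6] scal_adapt s ((Color.Approx.tensor_one A).symm)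
    ⇝[1,2,6,4,5] (scal_tens_left s A .one).mirror.symm ⇝[0,4,2,6] (tapR_def A).symm)

theorem scal_tap_right (s : R) (A : Color) : 𝓡 [(0, A)] [(2, .one), (1, A)]
    [scal s A 0 3, tapR A 3 1 2] [tapR A 0 1 4, scal s .one 4 2] :=
  derive (· ⇝[3,1,2,5] tapR_def A ⇝[0,5,3,6] scal_adapt s ((Color.Approx.tensor_one A).symm)
    ⇝[1,2,6,4,5] (scal_tens_right s A .one).mirror.symm ⇝[0,1,4,6] (tapR_def A).symm)

theorem null_tens_right (A B : Color) : 𝓡 [(0, A)] [(1, .tensor A B)]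
    [null B 2, tens A B 0 2 1] [conull A 0, null (.tensor A B) 1] :=
  derive (· ⇝[2,3] (null_scal 0 B).symm ⇝[0,3,1,2,4] scal_tens_right 0 A B
    ⇝[4,1] scal_zero (.tensor A B) ⇝[0,3,4] (null_cotens A B).mirror ⇝[3] null_conull B)

theorem null_tens_left (A B : Color) : 𝓡 [(0, B)] [(1, .tensor A B)]
    [null A 2, tens A B 2 0 1] [conull B 0, null (.tensor A B) 1] :=
  derive (· ⇝[2,3] (null_scal 0 A).symm ⇝[3,0,1,2,4] scal_tens_left 0 A B
    ⇝[4,1] scal_zero (.tensor A B) ⇝[3,0,4] (null_cotens A B).mirror ⇝[3] null_conull A)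

theorem null_contr (A : Color) : 𝓡 [(0, A)] [(1, A)] [null A 2, contr A 2 0 1]
    [wire R A 0 1] :=
  derive (· ⇝[0,2,1] contr_comm A ⇝[0,1,2] contr_null A)

theorem contr_xplus_self (A : Color) : 𝓡 [(1, A), (0, A)] [(2, A)] [contr A 0 1 2]
    [xplus A A 0 1 3 4, contr A 3 4 2] :=
  derive (· ⇥2 5 ⇝[2,5,6] (contr_null A).mirror.symm ⇝[0,1,2,6,5,3,4,7,8,9,10] contr_cocontr A
    ⇝[8,10,6] (null_cocontr A).mirror ⇝[7,3,8] (contr_null A).mirror ⇤3 7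
    ⇝[9,4,10] (contr_null A).mirror ⇤4 9)

theorem null_wire (A B : Color) : 𝓡 [(0, B)] [(2, B), (1, A)] [null A 1, wire R B 0 2]
    [null A 3, xplus A B 3 0 1 2] :=
  derive (· ⇥1 4 ⇝[4,0,1,2,5,3,6,7,8,9,10,11] wire_wire A B ⇝[5,3,4] null_cocontr A
    ⇝[5,6,8,9,12] xtens_def A B ⇝[6,12,5] null_tens_left A B ⇝[8,9,12] null_cotens A B
    ⇝[10,1,8] null_contr A ⇤10 1 ⇝[11,2,9] null_contr B ⇤11 2 ⇝[7,0,6] (null_contr B).mirror ⇤0 7)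

theorem wire_null (A B : Color) : 𝓡 [(0, A)] [(2, B), (1, A)] [wire R A 0 1, null B 2]
    [null B 3, xplus A B 0 3 1 2] :=
  derive (· ⇥2 4 ⇝[0,4,1,2,5,6,7,3,8,9,10,11] wire_wire A B ⇝[7,3,4] null_cocontr B
    ⇝[5,7,8,9,12] xtens_def A B ⇝[5,12,7] null_tens_right A B ⇝[8,9,12] null_cotens A B
    ⇝[10,1,8] null_contr A ⇤10 1 ⇝[11,2,9] null_contr B ⇤11 2 ⇝[6,0,5] (null_contr A).mirror ⇤0 6)

theorem xplus_tap_left (A C : Color) : 𝓡 [(1, C), (0, A)] [(4, C), (3, .one), (2, A)]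
    [xplus A C 0 1 5 4, tapR A 5 2 3] [tapR A 0 2 6, xplus .one C 6 1 3 4] :=
  derive (· ⇝[0,1,5,4,7,8,9,10,11,12] xplus_eq A C ⇝[7,11,2,3,5] untap_tap A
    ⇝[7,11,2,3,13] (tap_untap_comm A .one).symm ⇝[0,2,13,8,7,6] tap_tap A
    ⇝[3,11,13] tap_one_comm.mirror ⇝[6,1,3,4,13,8,9,10,11,12] (xplus_eq .one C).symm)

theorem xplus_tap_right (A C : Color) : 𝓡 [(1, C), (0, A)] [(4, .one), (3, C), (2, A)]
    [xplus A C 0 1 2 5, tapR C 5 3 4] [tapR C 1 3 6, xplus A .one 0 6 2 4] :=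
  derive (· ⇝[0,1,2,5,7,8,9,10,11,12] xplus_eq A C ⇝[12,10,5] untapL_eq C ⇝[1,9,10] tapL_eq C
    ⇝[10,12,3,4,5] untap_tap C ⇝[10,12,3,4,13] (tap_untap_comm C .one).symm
    ⇝[1,3,13,9,10,6] tap_tap C ⇝[4,12,13] tap_one_comm.mirror ⇝[6,9,13] (tapL_eq .one).symm
    ⇝[12,13,4] (untapL_eq .one).symm ⇝[0,6,2,4,7,8,9,13,11,12] (xplus_eq A .one).symm)

theorem xplus_counit (A C : Color) : 𝓡 [(1, C), (0, A)] [(3, C), (2, A)]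
    [tapR A 0 2 4, tapR C 1 3 5, xplus .one .one 4 5 6 7, counit 6, counit 7] [xplus A C 0 1 2 3] :=
  derive (· ⇝[0,5,2,6,7,8,4] (xplus_tap_left A .one).symm
    ⇝[0,1,8,3,7,9,5] (xplus_tap_right A C).symm ⇝[9,3,7] tapR_counit C ⇤9 3 ⇝[8,2,6] tapR_counit A
    ⇤8 2)

theorem plus_tap (A B : Color) : 𝓡 [(1, B), (0, A)] [(3, .one), (2, .plus A B)]
    [plus A B 0 1 4, tapR (.plus A B) 4 2 3]
    [tapR A 0 5 6, tapR B 1 7 8, plus A B 5 7 2, contr .one 6 8 3] :=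
  derive (· ⇝[0,1,4,9,10,11,12,13,14] plus_eq A B ⇝[13,14,2,3,4] untap_tap (.plus A B)
    ⇝[13,14,2,3,15] (untap_tap_comm (.plus A B) .one).symm ⇝[10,12,3,15,14,6,16,8,17] contr_tap .one
    ⇝[10,6,16] tap_one_comm ⇝[12,8,17] tap_one_comm ⇝[0,9,16,6,5,10] (tap_tap A).symm
    ⇝[1,11,17,8,7,12] (tap_tap B).symm ⇝[5,7,2,9,16,11,17,13,15] (plus_eq A B).symm)

theorem xplus_contr_counit (A B : Color) : 𝓡 [(1, B), (0, A)] [(3, B), (2, A)]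
    [xplus A B 0 1 2 3]
    [tapR A 0 4 5, tapR B 1 6 7, xplus A B 4 6 2 3, contr .one 5 7 8, counit 8] :=
  derive (· ⇝[0,1,2,3,9] xplus_def A B ⇥9 10 ⇝[9,10,8] (tapR_counit (.plus A B)).symm
    ⇝[0,1,10,8,9,4,5,6,7] plus_tap A B ⇝[4,6,2,3,10] (xplus_def A B).symm)

theorem counit_xplus : 𝓡 [(1, .one), (0, .one)] []
    [xplus .one .one 0 1 2 3, counit 2, counit 3] [contr .one 0 1 4, counit 4] :=
  derive (· ⇝[0,1,2,3,5,6,7,8,4] xplus_contr_counit .one .one ⇝[0,5,6] tap_one_comm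
    ⇝[1,7,8] tap_one_comm ⇝[0,1,6,8,5,7,2,3] xplus_counit .one .one
    ⇝[0,1,4,6,8] (contr_xplus_self .one).symm)

theorem xplus_tap (A C : Color) : 𝓡 [(1, C), (0, A)] [(3, C), (2, A)]
    [xplus A C 0 1 2 3] [tapR A 0 2 4, tapR C 1 3 5, contr .one 4 5 6, counit 6] :=
  derive (· ⇥2 7 ⇝[7,2,8] (tapR_counit A).symm ⇝[0,1,2,8,3,7,4] xplus_tap_left A C ⇥3 9
    ⇝[9,3,10] (tapR_counit C).symm ⇝[4,1,8,3,10,9,5] xplus_tap_right .one C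
    ⇝[4,5,8,10,6] counit_xplus)

theorem xplus_comm (A B : Color) : 𝓡 [(1, B), (0, A)] [(3, B), (2, A)]
    [xplus A B 0 1 2 3] [xplus B A 1 0 3 2] :=
  derive (· ⇝[0,1,2,3,4,5,6] xplus_tap A B ⇝[5,4,6] contr_comm .one
    ⇝[1,0,3,2,5,4,6] (xplus_tap B A).symm)

theorem xplus_tap_left_comm (A C : Color) :
    𝓡 [(1, C), (0, A)] [(4, C), (3, .one), (2, A)] [xplus A C 0 1 5 4, tapR A 5 2 3]
    [tapR A 0 6 3, xplus A C 6 1 2 4] :=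
  derive (· ⇝[0,1,5,4,7,8,9] xplus_tap A C ⇝[0,2,3,7,5,10] tap_tap A ⇝[10,3,7] tap_one_comm
    ⇝[0,2,7,3,6,10] (tap_tap A).symm ⇝[6,1,2,4,7,8,9] (xplus_tap A C).symm)

theorem contr_counit_contr : 𝓡 [(2, .one), (1, .one), (0, .one)] []
    [contr .one 0 1 3, contr .one 3 2 4, counit 4]
    [tapR .one 0 5 6, tapR .one 1 7 8, tapR .one 2 9 10, contr .one 5 9 11, contr .one 7 10 12,
      contr .one 6 8 13, counit 11, counit 12, counit 13] :=
  derive (· ⇝[3,2,13,14,4] counit_xplus.symm ⇝[0,1,2,13,14,3,8,9,6] contr_xplus .one .one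
    ⇝[1,2,8,9,7,10,12] xplus_tap .one .one ⇝[0,9,6,14,5,15,11] xplus_tap .one .one
    ⇝[9,14,15] tap_one_comm ⇝[9,15,14] tapR_counit .one ⇤9 15 ⇝[0,6,5] tap_one_comm
    ⇝[1,8,7] tap_one_comm)

theorem tens_xplus_right (A B C : Color) :
    𝓡 [(2, C), (1, B), (0, A)] [(4, C), (3, .tensor A B)]
    [tens A B 0 1 5, xplus (.tensor A B) C 5 2 3 4] [xplus B C 1 2 6 4, tens A B 0 6 3] :=
  derive (· ⇝[5,2,3,4,7,8,9] xplus_tap (.tensor A B) C ⇝[0,1,3,7,5,6] tens_tap_right A B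
    ⇝[1,2,6,4,7,8,9] (xplus_tap B C).symm)

theorem tens_xplus_left (A B C : Color) :
    𝓡 [(2, C), (1, B), (0, A)] [(4, C), (3, .tensor A B)]
    [tens A B 0 1 5, xplus (.tensor A B) C 5 2 3 4] [xplus A C 0 2 6 4, tens A B 6 1 3] :=
  derive (· ⇝[5,2,3,4,7,8,9] xplus_tap (.tensor A B) C ⇝[0,1,3,7,5,6] tens_tap_left A B
    ⇝[0,2,6,4,7,8,9] (xplus_tap A C).symm)

theorem coplus_xplus_self (A B : Color) : 𝓡 [(0, .plus A B)] [(2, B), (1, A)]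
    [coplus A B 0 3 4, xplus A B 3 4 1 2] [coplus A B 0 1 2] :=
  derive (· ⇝[3,4,1,2,5] xplus_def A B ⇝[0,5,3,4] coplus_plus A B ⇤0 5)

theorem xplus_tap_right_comm (A C : Color) :
    𝓡 [(1, C), (0, A)] [(4, .one), (3, C), (2, A)] [xplus A C 0 1 2 5, tapR C 5 3 4]
    [tapR C 1 6 4, xplus A C 0 6 2 3] :=
  derive (· ⇝[0,1,2,5] xplus_comm A C ⇝[1,0,3,4,2,5,6] xplus_tap_left_comm C A
    ⇝[6,0,3,2] xplus_comm C A)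

theorem coplus_tap (A B : Color) : 𝓡 [(0, .plus A B)] [(3, .one), (2, B), (1, A)]
    [tapR (.plus A B) 0 4 3, coplus A B 4 1 2]
    [coplus A B 0 5 6, tapR A 5 1 7, tapR B 6 2 8, contr .one 7 8 3] :=
  derive (· ⇥0 9 ⇝[0,9,10,11] (coplus_plus A B).symm ⇝[10,11,4,3,9,12,7,13,8] plus_tap A B
    ⇝[12,13,1,2,4] (xplus_def A B).symm ⇝[10,13,1,7,2,5,12] (xplus_tap_left_comm A B).symm
    ⇝[10,11,5,2,8,6,13] (xplus_tap_right_comm A B).symm ⇝[0,5,6,10,11] coplus_xplus_self A B)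

theorem coplus_xplus (A B C : Color) :
    𝓡 [(1, C), (0, .plus A B)] [(4, C), (3, B), (2, A)]
    [xplus (.plus A B) C 0 1 5 4, coplus A B 5 2 3]
    [coplus A B 0 6 7, xplus A C 6 1 2 8, xplus B C 7 8 3 4] :=
  derive (· ⇝[0,1,5,4,9,10,11] xplus_tap (.plus A B) C ⇝[0,2,3,9,5,12,13,14,15] coplus_tap A B
    ⇝[14,15,10,9,11,16,17,18,19,20,21,22,23,24] contr_counit_contr ⇝[10,20,21] tap_one_comm
    ⇝[12,2,16,17,6,14] (tap_tap A).symm ⇝[13,3,18,19,7,15] (tap_tap B).symm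
    ⇝[1,4,21,20,8,10] (tap_tap C).symm ⇝[12,13,6,7,17,19,24] (xplus_tap A B).symm
    ⇝[0,6,7,12,13] coplus_xplus_self A B ⇝[6,1,2,8,16,20,22] (xplus_tap A C).symm
    ⇝[7,8,3,4,18,21,23] (xplus_tap B C).symm)

theorem xplus_tens (A B : Color) : 𝓡 [(1, B), (0, A)] [(2, .tensor A B)]
    [xplus A B 0 1 3 4, tens A B 3 4 2] [conull A 0, conull B 1, null (.tensor A B) 2] :=
  derive (· ⇝[0,1,3,4,5] xplus_def A B ⇝[5,2,3,4] coplus_tens A B ⇝[0,1,5] (null_coplus A B).mirror)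

end Rule

/-- The classes of diagrams between single wires. -/
local notation:26 A:27 " ⇒ " B:27 => Hom R (of A) (of B)

/-- A diagram between single wires as a step. -/
def Step.hom {A B : Color} (f : A ⇒ B) (a b : ℕ) : Step R := ⟨[(a, A)], [(b, B)], f⟩

/-- The zero diagram between two wires. -/
def zeroHom (A B : Color) : A ⇒ B := Hom.mk (Diag.conull A) ⬝ Hom.mk (Diag.null B)

/-- The sum of two diagrams between single wires. -/
def addHom {A B : Color} (f g : A ⇒ B) : A ⇒ B :=
  Hom.mk (Diag.cocontr A) ⬝ (f ⊠ g) ⬝ Hom.mk (Diag.contr B)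

/-- The tensor product of two diagrams between single wires. -/
def tenHom {A B A' B' : Color} (f : A ⇒ B) (g : A' ⇒ B') :
    (.tensor A A') ⇒ (.tensor B B') :=
  Hom.mk (Diag.cotens A A') ⬝ (f ⊠ g) ⬝ Hom.mk (Diag.tens B B')

/-- The direct sum of two diagrams between single wires. -/
def osumHom {A B A' B' : Color} (f : A ⇒ B) (g : A' ⇒ B') :
    (.plus A A') ⇒ (.plus B B') :=
  Hom.mk (Diag.coplus A A') ⬝ (f ⊠ g) ⬝ Hom.mk (Diag.plus B B')

/-- The injection of the left summand. -/
def inl (A B : Color) : A ⇒ (.plus A B) :=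
  (Hom.id (of A) ⊠ Hom.mk (Diag.null B)) ⬝ Hom.mk (Diag.plus A B)

/-- The injection of the right summand. -/
def inr (A B : Color) : B ⇒ (.plus A B) :=
  Hom.cast (nil_append _) rfl (Hom.mk (Diag.null A) ⊠ Hom.id (of B)) ⬝ Hom.mk (Diag.plus A B)

/-- A diagram between single wires is linear if it commutes with splitting off a wire `𝟙`, with
the Contraction, with the Null and with their mirrors. -/
structure IsLin {A B : Color} (f : A ⇒ B) : Prop where
  tap : Rule [(0, A)] [(2, .one), (1, B)]
    [Step.hom f 0 3, Step.tapR B 3 1 2] [Step.tapR A 0 4 2, Step.hom f 4 1]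
  contr : Rule [(1, A), (0, A)] [(2, B)]
    [Step.contr A 0 1 3, Step.hom f 3 2] [Step.hom f 0 4, Step.hom f 1 5, Step.contr B 4 5 2]
  cocontr : Rule [(0, A)] [(2, B), (1, B)]
    [Step.hom f 0 3, Step.cocontr B 3 1 2] [Step.cocontr A 0 4 5, Step.hom f 4 1, Step.hom f 5 2]
  null : Rule [] [(0, B)] [Step.null A 1, Step.hom f 1 0] [Step.null B 0]
  conull : Rule [(0, A)] [] [Step.hom f 0 1, Step.conull B 1] [Step.conull A 0]

/-- The projection to the left summand. -/
def prl (A B : Color) : (.plus A B) ⇒ A :=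
  Hom.mk (Diag.coplus A B) ⬝ (Hom.id (of A) ⊠ Hom.mk (Diag.conull B))

/-- The projection to the right summand. -/
def prr (A B : Color) : (.plus A B) ⇒ B :=
  Hom.mk (Diag.coplus A B) ⬝
    Hom.cast rfl (nil_append _) (Hom.mk (Diag.conull A) ⊠ Hom.id (of B))

namespace Rule

open Step

theorem of_hom {A B : Color} {f g : A ⇒ B} (h : f = g) :
    Rule [(0, A)] [(1, B)] [hom f 0 1] [hom g 0 1] :=
  by_diag ▣(hom f 0 1) ▣(hom g 0 1) h

theorem hom_eq {A B : Color} {f g : A ⇒ B}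
    (h : Rule [(0, A)] [(1, B)] [hom f 0 1] [hom g 0 1]) : f = g :=
  Rule.eval ▣(hom f 0 1) ▣(hom g 0 1) h

theorem lin_tap {A B : Color} {f : A ⇒ B} (hf : IsLin f) :
    𝓡 [(0, A)] [(2, .one), (1, B)] [hom f 0 3, tapR B 3 1 2] [tapR A 0 4 2, hom f 4 1] :=
  hf.tap

theorem lin_contr {A B : Color} {f : A ⇒ B} (hf : IsLin f) :
    𝓡 [(1, A), (0, A)] [(2, B)] [contr A 0 1 3, hom f 3 2] [hom f 0 4, hom f 1 5, contr B 4 5 2] :=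
  hf.contr

theorem lin_cocontr {A B : Color} {f : A ⇒ B} (hf : IsLin f) :
    𝓡 [(0, A)] [(2, B), (1, B)] [hom f 0 3, cocontr B 3 1 2] [cocontr A 0 4 5, hom f 4 1, hom f 5 2] :=
  hf.cocontr

theorem lin_null {A B : Color} {f : A ⇒ B} (hf : IsLin f) :
    𝓡 [] [(0, B)] [null A 1, hom f 1 0] [null B 0] :=
  hf.null

theorem lin_conull {A B : Color} {f : A ⇒ B} (hf : IsLin f) :
    𝓡 [(0, A)] [] [hom f 0 1, conull B 1] [conull A 0] :=
  hf.conull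

theorem hom_comp {A B C : Color} (f : A ⇒ B) (g : B ⇒ C) :
    𝓡 [(0, A)] [(1, C)] [hom (f ⬝ g) 0 1] [hom f 0 2, hom g 2 1] :=
  by_diag ▣(hom (f ⬝ g) 0 1) (▣(hom f 0 2) ⨾ ▣(hom g 2 1)) rfl

theorem zeroHom_def (A B : Color) :
    𝓡 [(0, A)] [(1, B)] [hom (zeroHom A B) 0 1] [conull A 0, null B 1] :=
  by_diag ▣(hom (zeroHom A B) 0 1) (▣(conull A 0) ⨾ ▣(null B 1)) rfl

theorem addHom_def {A B : Color} (f g : A ⇒ B) :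
    𝓡 [(0, A)] [(1, B)] [hom (addHom f g) 0 1]
    [cocontr A 0 2 3, hom f 2 4, hom g 3 5, contr B 4 5 1] :=
  by_diag ▣(hom (addHom f g) 0 1) (▣(cocontr A 0 2 3) ⨾ (▣(hom f 2 4) ⫼ ▣(hom g 3 5)) ⨾ ▣(contr B 4 5 1)) rfl

theorem tenHom_def {A B A' B' : Color} (f : A ⇒ B) (g : A' ⇒ B') :
    𝓡 [(0, .tensor A A')] [(1, .tensor B B')] [hom (tenHom f g) 0 1]
    [cotens A A' 0 2 3, hom f 2 4, hom g 3 5, tens B B' 4 5 1] :=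
  by_diag ▣(hom (tenHom f g) 0 1) (▣(cotens A A' 0 2 3) ⨾ (▣(hom f 2 4) ⫼ ▣(hom g 3 5)) ⨾ ▣(tens B B' 4 5 1)) rfl

theorem osumHom_def {A B A' B' : Color} (f : A ⇒ B) (g : A' ⇒ B') :
    𝓡 [(0, .plus A A')] [(1, .plus B B')] [hom (osumHom f g) 0 1]
    [coplus A A' 0 2 3, hom f 2 4, hom g 3 5, plus B B' 4 5 1] :=
  by_diag ▣(hom (osumHom f g) 0 1) (▣(coplus A A' 0 2 3) ⨾ (▣(hom f 2 4) ⫼ ▣(hom g 3 5)) ⨾ ▣(plus B B' 4 5 1)) rfl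

theorem inl_def (A B : Color) :
    𝓡 [(0, A)] [(1, .plus A B)] [hom (inl A B) 0 1] [null B 2, plus A B 0 2 1] :=
  by_diag ▣(hom (inl A B) 0 1) ((▤[(0, A)] ⫼ ▣(null B 2)) ⨾ ▣(plus A B 0 2 1)) rfl

theorem inr_def (A B : Color) :
    𝓡 [(0, B)] [(1, .plus A B)] [hom (inr A B) 0 1] [null A 2, plus A B 2 0 1] :=
  by_diag ▣(hom (inr A B) 0 1) ((▣(null A 2) ⫼ ▤[(0, B)]) ⨾ ▣(plus A B 2 0 1)) rfl

theorem xplus_idem (A B : Color) : 𝓡 [(1, B), (0, A)] [(3, B), (2, A)]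
    [xplus A B 0 1 4 5, xplus A B 4 5 2 3] [xplus A B 0 1 2 3] :=
  derive (· ⇝[0,1,4,5,6] xplus_def A B ⇝[6,2,3,4,5] coplus_xplus_self A B
    ⇝[0,1,2,3,6] (xplus_def A B).symm)

theorem untap_eq (A : Color) : 𝓡 [(1, .one), (0, A)] [(2, A)] [untapR A 0 1 2]
    [tapR A 0 2 3, untapR .one 1 3 4, counit 4] :=
  derive (· ⇥2 5 ⇝[5,2,4] (tapR_counit A).symm ⇝[0,1,2,4,5] untap_tap A
    ⇝[0,1,2,4,3] (tap_untap_comm A .one).symm)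

theorem lin_untap {A B : Color} {f : A ⇒ B} (hf : IsLin f) :
    𝓡 [(1, .one), (0, A)] [(2, B)] [untapR A 0 1 3, hom f 3 2]
    [hom f 0 4, untapR B 4 1 2] :=
  derive (· ⇝[0,1,3,5,6] untap_eq A ⇝[0,2,5,4,3] (lin_tap hf).symm ⇝[4,1,2,5,6] (untap_eq B).symm)

theorem lin_xplus_left {A B : Color} {f : A ⇒ B} (C : Color) (hf : IsLin f) :
    𝓡 [(1, C), (0, A)] [(3, C), (2, B)] [hom f 0 4, xplus B C 4 1 2 3]
    [xplus A C 0 1 5 3, hom f 5 2] :=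
  derive (· ⇝[4,1,2,3,6,7,8] xplus_tap B C ⇝[0,2,6,4,5] lin_tap hf
    ⇝[0,1,5,3,6,7,8] (xplus_tap A C).symm)

theorem lin_xplus_right {A B : Color} {f : A ⇒ B} (C : Color) (hf : IsLin f) :
    𝓡 [(1, A), (0, C)] [(3, B), (2, C)] [hom f 1 4, xplus C B 0 4 2 3]
    [xplus C A 0 1 2 5, hom f 5 3] :=
  derive (· ⇝[0,4,2,3,6,7,8] xplus_tap C B ⇝[1,3,7,4,5] lin_tap hf
    ⇝[0,1,2,5,6,7,8] (xplus_tap C A).symm)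

theorem lin_xtens_left {A B : Color} {f : A ⇒ B} (C : Color) (hf : IsLin f) :
    𝓡 [(1, C), (0, A)] [(3, C), (2, B)] [hom f 0 4, xtens B C 4 1 2 3]
    [xtens A C 0 1 5 3, hom f 5 2] :=
  derive (· ⇝[4,1,2,3,6] (tap_untap_comm B C).symm ⇝[0,2,6,4,5] lin_tap hf
    ⇝[0,1,5,3,6] tap_untap_comm A C)

theorem lin_xtens_right {A B : Color} {f : A ⇒ B} (C : Color) (hf : IsLin f) :
    𝓡 [(1, A), (0, C)] [(3, B), (2, C)] [hom f 1 4, xtens C B 0 4 2 3]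
    [xtens C A 0 1 2 5, hom f 5 3] :=
  derive (· ⇝[0,4,2,3,6] (untap_tap_comm C B).symm ⇝[1,3,6,4,5] lin_tap hf
    ⇝[0,1,2,5,6] untap_tap_comm C A)

theorem tap_conull (A : Color) : 𝓡 [(0, A)] [(1, .one)] [tapR A 0 2 1, conull A 2]
    [conull A 0, null .one 1] :=
  derive (· ⇝[0,2,1,3] tapR_def A ⇝[1,3,2] (null_tens_left A .one).mirror
    ⇝[0,3] adapt_conull ((Color.Approx.tensor_one A).symm))

theorem tap_cocontr (A : Color) : 𝓡 [(0, A)] [(3, .one), (2, A), (1, A)]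
    [tapR A 0 4 3, cocontr A 4 1 2]
    [cocontr A 0 5 6, tapR A 5 1 7, tapR A 6 2 8, contr .one 7 8 3] :=
  derive (· ⇝[0,4,3,9] tapR_def A ⇝[1,2,3,9,4,7,8,10,11] (contr_tens A .one).mirror
    ⇝[0,10,11,9,5,6] adapt_cocontr ((Color.Approx.tensor_one A).symm) ⇝[6,2,8,11] (tapR_def A).symm
    ⇝[5,1,7,10] (tapR_def A).symm)

theorem contr_interchange (A : Color) : 𝓡 [(3, A), (2, A), (1, A), (0, A)] [(4, A)]
    [contr A 0 1 5, contr A 2 3 6, contr A 5 6 4] [contr A 0 2 7, contr A 1 3 8, contr A 7 8 4] :=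
  derive (· ⇝[0,1,6,4,5,9] contr_assoc A ⇝[1,2,3,9,10,6] (contr_assoc A).symm ⇝[2,1,10] contr_comm A
    ⇝[2,1,3,9,10,8] contr_assoc A ⇝[0,2,8,4,7,9] (contr_assoc A).symm)

theorem xtens_comm (A B : Color) : 𝓡 [(1, B), (0, A)] [(3, B), (2, A)]
    [xtens A B 0 1 2 3] [xtens B A 1 0 3 2] :=
  derive (· ⇝[0,1,2,3,4] (tap_untap_comm A B).symm ⇝[1,0,3,2,4] untap_tap_comm B A)

theorem cotens_xtens_self (A B : Color) : 𝓡 [(0, .tensor A B)] [(2, B), (1, A)]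
    [cotens A B 0 3 4, xtens A B 3 4 1 2] [cotens A B 0 1 2] :=
  derive (· ⇝[3,4,1,2,5] xtens_def A B ⇝[0,5,3,4] cotens_tens A B ⇤0 5)

theorem tens_tens_contr (A B : Color) :
    𝓡 [(3, B), (2, A), (1, B), (0, A)] [(4, .tensor A B)]
    [tens A B 0 1 5, tens A B 2 3 6, contr (.tensor A B) 5 6 4]
    [xtens A B 0 1 7 8, xtens A B 2 3 9 10, contr A 7 9 11, contr B 8 10 12, tens A B 11 12 4] :=
  derive (· ⇥4 13 ⇝[13,4,11,12] (cotens_tens A B).symm ⇝[5,6,11,12,13,7,8,9,10] contr_cotens A B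
    ⇝[0,1,7,8,5] (xtens_def A B).symm ⇝[2,3,9,10,6] (xtens_def A B).symm)

theorem plus_plus_contr (A B : Color) :
    𝓡 [(3, B), (2, A), (1, B), (0, A)] [(4, .plus A B)]
    [plus A B 0 1 5, plus A B 2 3 6, contr (.plus A B) 5 6 4]
    [xplus A B 0 1 7 8, xplus A B 2 3 9 10, contr A 7 9 11, contr B 8 10 12, plus A B 11 12 4] :=
  derive (· ⇥4 13 ⇝[13,4,14,15] (coplus_plus A B).symm
    ⇝[5,6,14,15,13,7,8,9,10,11,12] contr_coplus A B ⇝[0,1,7,8,5] (xplus_def A B).symm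
    ⇝[2,3,9,10,6] (xplus_def A B).symm ⇝[4,11,12,14,15] (coplus_xplus_self A B).mirror)

theorem comp_tap {A B C : Color} {f : A ⇒ B} {g : B ⇒ C} (hf : IsLin f) (hg : IsLin g) :
    𝓡 [(0, A)] [(2, .one), (1, C)] [hom (f ⬝ g) 0 3, tapR C 3 1 2]
    [tapR A 0 4 2, hom (f ⬝ g) 4 1] :=
  derive (· ⇝[0,3,5] hom_comp f g ⇝[5,1,2,3,6] lin_tap hg ⇝[0,6,2,5,4] lin_tap hf
    ⇝[4,1,6] (hom_comp f g).symm)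

theorem comp_contr {A B C : Color} {f : A ⇒ B} {g : B ⇒ C} (hf : IsLin f) (hg : IsLin g) :
    𝓡 [(1, A), (0, A)] [(2, C)] [contr A 0 1 3, hom (f ⬝ g) 3 2]
    [hom (f ⬝ g) 0 4, hom (f ⬝ g) 1 5, contr C 4 5 2] :=
  derive (· ⇝[3,2,6] hom_comp f g ⇝[0,1,6,3,7,8] lin_contr hf ⇝[7,8,2,6,4,5] lin_contr hg
    ⇝[0,4,7] (hom_comp f g).symm ⇝[1,5,8] (hom_comp f g).symm)

theorem comp_null {A B C : Color} {f : A ⇒ B} {g : B ⇒ C} (hf : IsLin f) (hg : IsLin g) :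
    𝓡 [] [(0, C)] [null A 1, hom (f ⬝ g) 1 0] [null C 0] :=
  derive (· ⇝[1,0,2] hom_comp f g ⇝[2,1] lin_null hf ⇝[0,2] lin_null hg)

theorem zero_tap (A B : Color) : 𝓡 [(0, A)] [(2, .one), (1, B)]
    [hom (zeroHom A B) 0 3, tapR B 3 1 2] [tapR A 0 4 2, hom (zeroHom A B) 4 1] :=
  derive (· ⇝[0,3] zeroHom_def A B ⇝[1,2,3] null_tap B ⇝[0,2,4] (tap_conull A).symm
    ⇝[4,1] (zeroHom_def A B).symm)

theorem zero_contr (A B : Color) : 𝓡 [(1, A), (0, A)] [(2, B)]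
    [contr A 0 1 3, hom (zeroHom A B) 3 2]
    [hom (zeroHom A B) 0 4, hom (zeroHom A B) 1 5, contr B 4 5 2] :=
  derive (· ⇝[3,2] zeroHom_def A B ⇝[0,1,3] (null_cocontr A).mirror ⇥2 5
    ⇝[5,2,4] (contr_null B).symm ⇝[1,5] (zeroHom_def A B).symm ⇝[0,4] (zeroHom_def A B).symm
    ⇝[4,5,2] contr_comm B)

theorem zero_null (A B : Color) : 𝓡 [] [(0, B)] [null A 1, hom (zeroHom A B) 1 0]
    [null B 0] :=
  derive (· ⇝[1,0] zeroHom_def A B ⇝[1] null_conull A)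

theorem add_xplus_left {A B : Color} {f g : A ⇒ B} (C : Color) (hf : IsLin f) (hg : IsLin g) :
    𝓡 [(1, C), (0, A)] [(3, C), (2, B)] [hom (addHom f g) 0 4, xplus B C 4 1 2 3]
    [xplus A C 0 1 5 3, hom (addHom f g) 5 2] :=
  derive (· ⇝[0,4,6,7,8,9] addHom_def f g ⇝[8,9,1,2,3,4,10,11,12] contr_xplus B C
    ⇝[6,11,12,3,8,13] lin_xplus_left C hf ⇝[7,1,10,11,9,14] lin_xplus_left C hg
    ⇝[7,6,0] (contr_comm A).mirror ⇝[14,13,3,0,1,5,6,11,7] (contr_xplus A C).mirror.symm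
    ⇝[13,14,5] (contr_comm A).mirror ⇝[5,2,13,14,12,10] (addHom_def f g).symm)

theorem add_xplus_right {A B : Color} {f g : A ⇒ B} (C : Color) (hf : IsLin f) (hg : IsLin g) :
    𝓡 [(1, A), (0, C)] [(3, B), (2, C)] [hom (addHom f g) 1 4, xplus C B 0 4 2 3]
    [xplus C A 0 1 2 5, hom (addHom f g) 5 3] :=
  derive (· ⇝[0,4,2,3] xplus_comm C B ⇝[1,0,3,2,4,5] add_xplus_left C hf hg
    ⇝[1,0,5,2] xplus_comm A C)

theorem add_tap {A B : Color} {f g : A ⇒ B} (hf : IsLin f) (hg : IsLin g) :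
    𝓡 [(0, A)] [(2, .one), (1, B)] [hom (addHom f g) 0 3, tapR B 3 1 2]
    [tapR A 0 4 2, hom (addHom f g) 4 1] :=
  derive (· ⇝[0,3,5,6,7,8] addHom_def f g ⇝[7,8,1,2,3,9,10,11,12] contr_tap B
    ⇝[5,9,10,7,13] lin_tap hf ⇝[6,11,12,8,14] lin_tap hg
    ⇝[0,13,14,2,4,5,6,10,12] (tap_cocontr A).symm ⇝[4,1,13,14,9,11] (addHom_def f g).symm)

theorem add_contr {A B : Color} {f g : A ⇒ B} (hf : IsLin f) (hg : IsLin g) :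
    𝓡 [(1, A), (0, A)] [(2, B)] [contr A 0 1 3, hom (addHom f g) 3 2]
    [hom (addHom f g) 0 4, hom (addHom f g) 1 5, contr B 4 5 2] :=
  derive (· ⇝[3,2,6,7,8,9] addHom_def f g ⇝[0,1,6,7,3,10,11,12,13,14,15] contr_cocontr A
    ⇝[12,14,8,6,16,17] lin_contr hf ⇝[13,15,9,7,18,19] lin_contr hg
    ⇝[16,17,18,19,2,8,9,20,21] contr_interchange B ⇝[10,20,12,13,16,18] (addHom_def f g).symm
    ⇝[11,21,14,15,17,19] (addHom_def f g).symm ⇝[0,1,20,11,4,10] (add_xplus_left A hf hg).symm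
    ⇝[4,1,20,21,5,11] (add_xplus_right B hf hg).symm ⇝[4,5,2,20,21] (contr_xplus_self B).symm)

theorem add_null {A B : Color} {f g : A ⇒ B} (hf : IsLin f) (hg : IsLin g) :
    𝓡 [] [(0, B)] [null A 1, hom (addHom f g) 1 0] [null B 0] :=
  derive (· ⇝[1,0,2,3,4,5] addHom_def f g ⇝[2,3,1] null_cocontr A ⇝[4,2] lin_null hf
    ⇝[5,3] lin_null hg ⇝[5,0,4] null_contr B ⇤5 0)

theorem ten_tap {A B A' B' : Color} {f : A ⇒ B} {g : A' ⇒ B'} (hf : IsLin f) (hg : IsLin g) :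
    𝓡 [(0, .tensor A A')] [(2, .one), (1, .tensor B B')]
    [hom (tenHom f g) 0 3, tapR (.tensor B B') 3 1 2]
    [tapR (.tensor A A') 0 4 2, hom (tenHom f g) 4 1] :=
  derive (· ⇝[0,3,5,6,7,8] tenHom_def f g ⇝[7,8,1,2,3,9] tens_tap_left B B' ⇝[5,9,2,7,10] lin_tap hf
    ⇝[0,10,6,2,5,4] cotens_tap_left A A' ⇝[4,1,10,6,9,8] (tenHom_def f g).symm)

theorem ten_contr {A B A' B' : Color} {f : A ⇒ B} {g : A' ⇒ B'} (hf : IsLin f) (hg : IsLin g) :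
    𝓡 [(1, .tensor A A'), (0, .tensor A A')] [(2, .tensor B B')]
    [contr (.tensor A A') 0 1 3, hom (tenHom f g) 3 2]
    [hom (tenHom f g) 0 4, hom (tenHom f g) 1 5, contr (.tensor B B') 4 5 2] :=
  derive (· ⇝[3,2,6,7,8,9] tenHom_def f g ⇝[0,1,6,7,3,10,11,12,13] contr_cotens A A'
    ⇝[10,12,8,6,14,15] lin_contr hf ⇝[11,13,9,7,16,17] lin_contr hg
    ⇝[0,10,11,18,19] (cotens_xtens_self A A').symm ⇝[18,19,14,11,20,10] (lin_xtens_left A' hf).symm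
    ⇝[20,19,14,16,21,11] (lin_xtens_right B hg).symm ⇝[1,12,13,22,23] (cotens_xtens_self A A').symm
    ⇝[22,23,15,13,24,12] (lin_xtens_left A' hf).symm
    ⇝[24,23,15,17,25,13] (lin_xtens_right B hg).symm
    ⇝[20,21,24,25,2,4,5,14,16,15,17,8,9] (tens_tens_contr B B').symm
    ⇝[0,4,18,19,20,21] (tenHom_def f g).symm ⇝[1,5,22,23,24,25] (tenHom_def f g).symm)

theorem ten_null {A B A' B' : Color} {f : A ⇒ B} {g : A' ⇒ B'} (hf : IsLin f) (hg : IsLin g) :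
    𝓡 [] [(0, .tensor B B')] [null (.tensor A A') 1, hom (tenHom f g) 1 0]
    [null (.tensor B B') 0] :=
  derive (· ⇝[1,0,2,3,4,5] tenHom_def f g ⇝[2,3,1] null_cotens A A' ⇝[4,2] lin_null hf
    ⇝[5,3] lin_null hg ⇝[5,0,4] null_tens_left B B' ⇝[5] null_conull B')

theorem osum_tap {A B A' B' : Color} {f : A ⇒ B} {g : A' ⇒ B'} (hf : IsLin f) (hg : IsLin g) :
    𝓡 [(0, .plus A A')] [(2, .one), (1, .plus B B')]
    [hom (osumHom f g) 0 3, tapR (.plus B B') 3 1 2]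
    [tapR (.plus A A') 0 4 2, hom (osumHom f g) 4 1] :=
  derive (· ⇝[0,3,5,6,7,8] osumHom_def f g ⇝[7,8,1,2,3,9,10,11,12] plus_tap B B'
    ⇝[5,9,10,7,13] lin_tap hf ⇝[6,11,12,8,14] lin_tap hg
    ⇝[0,13,14,2,4,5,6,10,12] (coplus_tap A A').symm ⇝[4,1,13,14,9,11] (osumHom_def f g).symm)

theorem osum_contr {A B A' B' : Color} {f : A ⇒ B} {g : A' ⇒ B'} (hf : IsLin f) (hg : IsLin g) :
    𝓡 [(1, .plus A A'), (0, .plus A A')] [(2, .plus B B')]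
    [contr (.plus A A') 0 1 3, hom (osumHom f g) 3 2]
    [hom (osumHom f g) 0 4, hom (osumHom f g) 1 5, contr (.plus B B') 4 5 2] :=
  derive (· ⇝[3,2,6,7,8,9] osumHom_def f g ⇝[0,1,6,7,3,10,11,12,13,14,15] contr_coplus A A'
    ⇝[14,15,8,7,16,6] (lin_xplus_left A' hf).symm ⇝[16,15,8,9,17,7] (lin_xplus_right B hg).symm
    ⇝[10,12,16,14,18,19] lin_contr hf ⇝[11,13,17,15,20,21] lin_contr hg
    ⇝[2,16,17,8,9] (coplus_xplus_self B B').mirror ⇝[0,10,11,22,23] (coplus_xplus_self A A').symm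
    ⇝[22,23,18,11,24,10] (lin_xplus_left A' hf).symm
    ⇝[24,23,18,20,25,11] (lin_xplus_right B hg).symm ⇝[1,12,13,26,27] (coplus_xplus_self A A').symm
    ⇝[26,27,19,13,28,12] (lin_xplus_left A' hf).symm
    ⇝[28,27,19,21,29,13] (lin_xplus_right B hg).symm
    ⇝[24,25,28,29,2,4,5,18,20,19,21,16,17] (plus_plus_contr B B').symm
    ⇝[0,4,22,23,24,25] (osumHom_def f g).symm ⇝[1,5,26,27,28,29] (osumHom_def f g).symm)

theorem osum_null {A B A' B' : Color} {f : A ⇒ B} {g : A' ⇒ B'} (hf : IsLin f) (hg : IsLin g) :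
    𝓡 [] [(0, .plus B B')] [null (.plus A A') 1, hom (osumHom f g) 1 0]
    [null (.plus B B') 0] :=
  derive (· ⇝[1,0,2,3,4,5] osumHom_def f g ⇝[2,3,1] null_coplus A A' ⇝[4,2] lin_null hf
    ⇝[5,3] lin_null hg ⇝[4,5,6] (null_coplus B B').symm ⇝[6,0,4,5] coplus_plus B B' ⇤6 0)

theorem prl_def (A B : Color) :
    𝓡 [(0, .plus A B)] [(1, A)] [hom (prl A B) 0 1] [coplus A B 0 1 2, conull B 2] :=
  by_diag ▣(hom (prl A B) 0 1) (▣(coplus A B 0 1 2) ⨾ (▤[(1, A)] ⫼ ▣(conull B 2))) rfl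

theorem prr_def (A B : Color) :
    𝓡 [(0, .plus A B)] [(1, B)] [hom (prr A B) 0 1] [coplus A B 0 2 1, conull A 2] :=
  by_diag ▣(hom (prr A B) 0 1) (▣(coplus A B 0 2 1) ⨾ (▣(conull A 2) ⫼ ▤[(1, B)])) rfl

theorem inl_tap (A B : Color) : 𝓡 [(0, A)] [(2, .one), (1, .plus A B)]
    [hom (inl A B) 0 3, tapR (.plus A B) 3 1 2] [tapR A 0 4 2, hom (inl A B) 4 1] :=
  derive (· ⇝[0,3,5] inl_def A B ⇝[0,5,1,2,3,4,6,7,8] plus_tap A B ⇝[7,8,5] null_tap B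
    ⇝[6,2,8] contr_null .one ⇤6 2 ⇝[4,1,7] (inl_def A B).symm)

theorem inl_contr (A B : Color) : 𝓡 [(1, A), (0, A)] [(2, .plus A B)]
    [contr A 0 1 3, hom (inl A B) 3 2]
    [hom (inl A B) 0 4, hom (inl A B) 1 5, contr (.plus A B) 4 5 2] :=
  derive (· ⇝[3,2,6] inl_def A B ⇥6 7 ⇝[6,7,8] (null_contr B).symm ⇥0 9 ⇝[0,9,8,10] wire_null A B
    ⇥1 11 ⇝[1,11,6,12] wire_null A B ⇝[0,10,1,12,2,4,5,9,8,11,6,3,7] (plus_plus_contr A B).symm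
    ⇝[0,4,10] (inl_def A B).symm ⇝[1,5,12] (inl_def A B).symm)

theorem inl_null (A B : Color) : 𝓡 [] [(0, .plus A B)] [null A 1, hom (inl A B) 1 0]
    [null (.plus A B) 0] :=
  derive (· ⇝[1,0,2] inl_def A B ⇝[1,2,3] (null_coplus A B).symm ⇝[3,0,1,2] coplus_plus A B ⇤3 0)

theorem inr_tap (A B : Color) : 𝓡 [(0, B)] [(2, .one), (1, .plus A B)]
    [hom (inr A B) 0 3, tapR (.plus A B) 3 1 2] [tapR B 0 4 2, hom (inr A B) 4 1] :=
  derive (· ⇝[0,3,5] inr_def A B ⇝[5,0,1,2,3,6,7,4,8] plus_tap A B ⇝[6,7,5] null_tap A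
    ⇝[8,2,7] null_contr .one ⇤8 2 ⇝[4,1,6] (inr_def A B).symm)

theorem inr_contr (A B : Color) : 𝓡 [(1, B), (0, B)] [(2, .plus A B)]
    [contr B 0 1 3, hom (inr A B) 3 2]
    [hom (inr A B) 0 4, hom (inr A B) 1 5, contr (.plus A B) 4 5 2] :=
  derive (· ⇝[3,2,6] inr_def A B ⇥6 7 ⇝[6,7,8] (null_contr A).symm ⇥0 9 ⇝[0,8,9,10] null_wire A B
    ⇥1 11 ⇝[1,6,11,12] null_wire A B ⇝[10,0,12,1,2,4,5,8,9,6,11,7,3] (plus_plus_contr A B).symm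
    ⇝[0,4,10] (inr_def A B).symm ⇝[1,5,12] (inr_def A B).symm)

theorem inr_null (A B : Color) : 𝓡 [] [(0, .plus A B)] [null B 1, hom (inr A B) 1 0]
    [null (.plus A B) 0] :=
  derive (· ⇝[1,0,2] inr_def A B ⇝[2,1,3] (null_coplus A B).symm ⇝[3,0,2,1] coplus_plus A B ⇤3 0)

theorem prl_contr (A B : Color) : 𝓡 [(1, .plus A B), (0, .plus A B)] [(2, A)]
    [contr (.plus A B) 0 1 3, hom (prl A B) 3 2]
    [hom (prl A B) 0 4, hom (prl A B) 1 5, contr A 4 5 2] :=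
  derive (· ⇝[3,2,6] prl_def A B ⇝[0,1,2,6,3,4,7,5,8,9,10] contr_coplus A B
    ⇝[2,9,10,6] (wire_null A B).mirror.symm ⇤9 2 ⇝[7,8,10] (null_cocontr B).mirror
    ⇝[0,4,7] (prl_def A B).symm ⇝[1,5,8] (prl_def A B).symm)

theorem prl_null (A B : Color) : 𝓡 [] [(0, A)] [null (.plus A B) 1, hom (prl A B) 1 0]
    [null A 0] :=
  derive (· ⇝[1,0,2] prl_def A B ⇝[0,2,1] null_coplus A B ⇝[2] null_conull B)

theorem prr_contr (A B : Color) : 𝓡 [(1, .plus A B), (0, .plus A B)] [(2, B)]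
    [contr (.plus A B) 0 1 3, hom (prr A B) 3 2]
    [hom (prr A B) 0 4, hom (prr A B) 1 5, contr B 4 5 2] :=
  derive (· ⇝[3,2,6] prr_def A B ⇝[0,1,6,2,3,7,4,8,5,9,10] contr_coplus A B
    ⇝[2,9,10,6] (null_wire A B).mirror.symm ⇤10 2 ⇝[7,8,9] (null_cocontr A).mirror
    ⇝[0,4,7] (prr_def A B).symm ⇝[1,5,8] (prr_def A B).symm)

theorem prr_null (A B : Color) : 𝓡 [] [(0, B)] [null (.plus A B) 1, hom (prr A B) 1 0]
    [null B 0] :=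
  derive (· ⇝[1,0,2] prr_def A B ⇝[2,0,1] null_coplus A B ⇝[2] null_conull A)

end Rule

namespace IsLin

theorem of_mirror {A B : Color} {f : A ⇒ B} {g : B ⇒ A}
    (h : f.mirror = g)
    (tap : Rule [(0, A)] [(2, .one), (1, B)]
      [Step.hom f 0 3, Step.tapR B 3 1 2] [Step.tapR A 0 4 2, Step.hom f 4 1])
    (contr : Rule [(1, A), (0, A)] [(2, B)]
      [Step.contr A 0 1 3, Step.hom f 3 2] [Step.hom f 0 4, Step.hom f 1 5, Step.contr B 4 5 2])
    (null : Rule [] [(0, B)] [Step.null A 1, Step.hom f 1 0] [Step.null B 0])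
    (contr' : Rule [(1, B), (0, B)] [(2, A)]
      [Step.contr B 0 1 3, Step.hom g 3 2] [Step.hom g 0 4, Step.hom g 1 5, Step.contr A 4 5 2])
    (null' : Rule [] [(0, A)] [Step.null B 1, Step.hom g 1 0] [Step.null A 0]) : IsLin f := by
  subst h
  have e : f.mirror.mirror = f := Hom.mirror_mirror f
  have hc := contr'.mirror
  have hn := null'.mirror
  refine ⟨tap, contr, ?_, null, ?_⟩
  · have : 𝓡 [(2, A)] [(1, B), (0, B)]
      [Step.hom f.mirror.mirror 2 3, Step.cocontr B 3 0 1]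
      [Step.cocontr A 2 4 5, Step.hom f.mirror.mirror 5 1, Step.hom f.mirror.mirror 4 0] := hc
    rw [e] at this
    refine derive (· ⇝[1,2,0,3,4,5] this)
  · have : 𝓡 [(0, A)] [] [Step.hom f.mirror.mirror 0 1, Step.conull B 1]
      [Step.conull A 0] := hn
    rwa [e] at this

theorem mirror {A B : Color} {f : A ⇒ B} (hf : IsLin f) : IsLin f.mirror where
  tap :=
    have h : 𝓡 [(2, B)] [(1, .one), (0, A)] [Step.hom f.mirror 2 3, Step.tapR A 3 0 1]
      [Step.tapR B 2 4 1, Step.hom f.mirror 4 0] := (Rule.lin_untap hf).mirror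
    derive (· ⇝[1,2,0,3,4] h)
  contr :=
    have h : 𝓡 [(2, B), (1, B)] [(0, A)] [Step.contr B 1 2 3, Step.hom f.mirror 3 0]
      [Step.hom f.mirror 2 5, Step.hom f.mirror 1 4, Step.contr A 4 5 0] := hf.cocontr.mirror
    derive (· ⇝[2,0,1,3,4,5] h)
  cocontr :=
    have h : 𝓡 [(2, B)] [(1, A), (0, A)] [Step.hom f.mirror 2 3, Step.cocontr A 3 0 1]
      [Step.cocontr B 2 4 5, Step.hom f.mirror 5 1, Step.hom f.mirror 4 0] := hf.contr.mirror
    derive (· ⇝[1,2,0,3,4,5] h)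
  null := hf.conull.mirror
  conull := hf.null.mirror

theorem comp {A B C : Color} {f : A ⇒ B} {g : B ⇒ C}
    (hf : IsLin f) (hg : IsLin g) : IsLin (f ⬝ g) :=
  .of_mirror (Hom.mirror_comp f g) (.comp_tap hf hg) (.comp_contr hf hg) (.comp_null hf hg)
    (.comp_contr hg.mirror hf.mirror) (.comp_null hg.mirror hf.mirror)

protected theorem id (A : Color) : IsLin (Hom.id (R := R) (of A)) where
  tap := derive (· ⇤0 3 ⇥1 4)
  contr := derive (· ⇤3 2 ⇥0 4 ⇥1 5)
  cocontr :=
    derive (· ⇤0 3 ⇥1 4 ⇥2 5)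
  null := derive (· ⇤1 0)
  conull := derive (· ⇤0 1)

theorem zero (A B : Color) : IsLin (zeroHom (R := R) A B) :=
  .of_mirror (g := zeroHom B A) rfl (.zero_tap A B) (.zero_contr A B) (.zero_null A B)
    (.zero_contr B A) (.zero_null B A)

theorem add {A B : Color} {f g : A ⇒ B} (hf : IsLin f) (hg : IsLin g) :
    IsLin (addHom f g) :=
  .of_mirror (g := addHom f.mirror g.mirror) (by
      simp only [addHom, Hom.mirror_comp, Hom.mirror_par, Hom.assoc]; rfl)
    (.add_tap hf hg) (.add_contr hf hg) (.add_null hf hg)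
    (.add_contr hf.mirror hg.mirror) (.add_null hf.mirror hg.mirror)

theorem ten {A B A' B' : Color} {f : A ⇒ B} {g : A' ⇒ B'}
    (hf : IsLin f) (hg : IsLin g) : IsLin (tenHom f g) :=
  .of_mirror (g := tenHom f.mirror g.mirror) (by
      simp only [tenHom, Hom.mirror_comp, Hom.mirror_par, Hom.assoc]; rfl)
    (.ten_tap hf hg) (.ten_contr hf hg) (.ten_null hf hg)
    (.ten_contr hf.mirror hg.mirror) (.ten_null hf.mirror hg.mirror)

theorem osum {A B A' B' : Color} {f : A ⇒ B} {g : A' ⇒ B'}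
    (hf : IsLin f) (hg : IsLin g) : IsLin (osumHom f g) :=
  .of_mirror (g := osumHom f.mirror g.mirror) (by
      simp only [osumHom, Hom.mirror_comp, Hom.mirror_par, Hom.assoc]; rfl)
    (.osum_tap hf hg) (.osum_contr hf hg) (.osum_null hf hg)
    (.osum_contr hf.mirror hg.mirror) (.osum_null hf.mirror hg.mirror)

theorem inl (A B : Color) : IsLin (inl (R := R) A B) :=
  .of_mirror (g := TensorPlus.prl A B) rfl (.inl_tap A B) (.inl_contr A B) (.inl_null A B)
    (.prl_contr A B) (.prl_null A B)

theorem inr (A B : Color) : IsLin (inr (R := R) A B) :=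
  .of_mirror (g := TensorPlus.prr A B) rfl (.inr_tap A B) (.inr_contr A B) (.inr_null A B)
    (.prr_contr A B) (.prr_null A B)

theorem prl (A B : Color) : IsLin (prl (R := R) A B) := (IsLin.inl A B).mirror

theorem prr (A B : Color) : IsLin (prr (R := R) A B) := (IsLin.inr A B).mirror

theorem scal (s : R) (A : Color) : IsLin (Hom.mk (Diag.scal s A)) :=
  .of_mirror (g := Hom.mk (Diag.scal s A)) rfl
    (.scal_tap_left s A)
    (.contr_scal s A)
    (.null_scal s A)
    (.contr_scal s A)
    (.null_scal s A)

theorem adapt {A B : Color} (h : A.Approx B) : IsLin (R := R) (Hom.mk (Diag.adapt h)) :=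
  .of_mirror (g := Hom.mk (Diag.adapt h.symm)) rfl
    (.adapt_tap h)
    (.contr_adapt h)
    (.null_adapt h)
    (.contr_adapt h.symm)
    (.null_adapt h.symm)

end IsLin

/-- The tensor product of two states. -/
def tenState {A B : Color} (f : .one ⇒ A) (g : .one ⇒ B) :
    .one ⇒ (.tensor A B) :=
  Hom.mk (Diag.tapR .one) ⬝ (f ⊠ g) ⬝ Hom.mk (Diag.tens A B)

namespace Rule

open Step

/-- Two programs are interchangeable if they can be rewritten to the same program. -/
theorem join {l l' : List Wire} {P Q T U : List (Step R)} {F₁ F₂ : List Unit}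
    {F : List (Step R)} {E₁ E₂ E : List Wire}
    (e₁ : (Check.start l l' P).map Check.result = some ((), (F₁, F₁), (E₁, E₁)))
    (e₂ : (Check.start l l' Q).map Check.result = some ((), (F₂, F₂), (E₂, E₂)))
    (h₁ : Rule l l' P P → Rule l l' P T) (h₂ : Rule l l' Q Q → Rule l l' Q U)
    (e : (Check.finish l l' T U).map Check.result = some ((), (F, F), (E, E))) : Rule l l' P Q :=
  ((h₁ (.start e₁)).finish e).trans (h₂ (.start e₂)).symm

/-- A pair of derivations with the same end. -/
notation "meet " h:max k:max => Rule.join rfl rfl h k rfl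

theorem addHom_comm {A B : Color} (f g : A ⇒ B) :
    addHom f g = addHom g f :=
  hom_eq <| meet
    (· ⇝[0,1,2,3,4,5] addHom_def f g ⇝[5,4,1] contr_comm B ⇝[3,2,0] (contr_comm A).mirror)
    (· ⇝[0,1,3,2,5,4] addHom_def g f)

theorem addHom_assoc {A B : Color} (f g h : A ⇒ B) :
    addHom (addHom f g) h = addHom f (addHom g h) :=
  hom_eq <| meet
    (· ⇝[0,1,2,3,4,5] addHom_def (addHom f g) h ⇝[2,4,6,7,8,9] addHom_def f g
    ⇝[8,9,5,1,4,10] contr_assoc B ⇝[6,7,3,0,2,11] (contr_assoc A).mirror)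
    (· ⇝[0,1,6,11,8,10] addHom_def f (addHom g h) ⇝[11,10,7,3,9,5] addHom_def g h)

theorem addHom_zero {A B : Color} (f : A ⇒ B) :
    addHom f (zeroHom A B) = f :=
  hom_eq <| meet
    (· ⇝[0,1,2,3,4,5] addHom_def f (zeroHom A B) ⇝[3,5] zeroHom_def A B ⇝[4,1,5] contr_null B ⇤4 1
    ⇝[2,0,3] (contr_null A).mirror ⇤0 2)
    id

theorem addHom_comp {A B C : Color} (f g : A ⇒ B) {h : B ⇒ C} (hh : IsLin h) :
    addHom f g ⬝ h = addHom (f ⬝ h) (g ⬝ h) :=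
  hom_eq <| meet
    (· ⇝[0,1,2] hom_comp (addHom f g) h ⇝[0,2,3,4,5,6] addHom_def f g ⇝[5,6,1,2,7,8] lin_contr hh)
    (· ⇝[0,1,3,4,7,8] addHom_def (f ⬝ h) (g ⬝ h) ⇝[3,7,5] hom_comp f h ⇝[4,8,6] hom_comp g h)

theorem comp_addHom {A B C : Color} {h : A ⇒ B} (hh : IsLin h) (f g : B ⇒ C) :
    h ⬝ addHom f g = addHom (h ⬝ f) (h ⬝ g) :=
  hom_eq <| meet
    (· ⇝[0,1,2] hom_comp h (addHom f g) ⇝[2,1,3,4,5,6] addHom_def f g ⇝[0,3,4,2,7,8] lin_cocontr hh)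
    (· ⇝[0,1,7,8,5,6] addHom_def (h ⬝ f) (h ⬝ g) ⇝[7,5,3] hom_comp h f ⇝[8,6,4] hom_comp h g)

theorem zeroHom_comp (A : Color) {B C : Color} {h : B ⇒ C} (hh : IsLin h) :
    zeroHom A B ⬝ h = zeroHom A C :=
  hom_eq <| meet
    (· ⇝[0,1,2] hom_comp (zeroHom A B) h ⇝[0,2] zeroHom_def A B ⇝[1,2] lin_null hh)
    (· ⇝[0,1] zeroHom_def A C)

theorem comp_zeroHom {A B : Color} (C : Color) {h : A ⇒ B} (hh : IsLin h) :
    h ⬝ zeroHom B C = zeroHom A C :=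
  hom_eq <| meet
    (· ⇝[0,1,2] hom_comp h (zeroHom B C) ⇝[2,1] zeroHom_def B C ⇝[0,2] lin_conull hh)
    (· ⇝[0,1] zeroHom_def A C)

theorem inl_prl (A B : Color) :
    (inl A B ⬝ prl A B : A ⇒ A) = Hom.id (of A) :=
  hom_eq <| meet
    (· ⇝[0,1,2] hom_comp (inl A B) (prl A B) ⇝[0,2,3] inl_def A B ⇝[2,1,4] prl_def A B
    ⇝[0,3,1,4,2] (xplus_def A B).symm ⇝[0,1,4,3] (wire_null A B).symm ⇝[4] null_conull B)
    id

theorem inr_prr (A B : Color) :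
    (inr A B ⬝ prr A B : B ⇒ B) = Hom.id (of B) :=
  hom_eq <| meet
    (· ⇝[0,1,2] hom_comp (inr A B) (prr A B) ⇝[0,2,3] inr_def A B ⇝[2,1,4] prr_def A B
    ⇝[3,0,4,1,2] (xplus_def A B).symm ⇝[0,4,1,3] (null_wire A B).symm ⇝[4] null_conull A)
    id

theorem inl_prr (A B : Color) :
    (inl A B ⬝ prr A B : A ⇒ B) = zeroHom A B :=
  hom_eq <| meet
    (· ⇝[0,1,2] hom_comp (inl A B) (prr A B) ⇝[0,2,3] inl_def A B ⇝[2,1,4] prr_def A B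
    ⇝[0,3,4,1,2] (xplus_def A B).symm ⇝[0,4,1,3] (wire_null A B).symm ⇤0 4)
    (· ⇝[0,1] zeroHom_def A B)

theorem inr_prl (A B : Color) :
    (inr A B ⬝ prl A B : B ⇒ A) = zeroHom B A :=
  hom_eq <| meet
    (· ⇝[0,1,2] hom_comp (inr A B) (prl A B) ⇝[0,2,3] inr_def A B ⇝[2,1,4] prl_def A B
    ⇝[3,0,1,4,2] (xplus_def A B).symm ⇝[0,1,4,3] (null_wire A B).symm ⇤0 4)
    (· ⇝[0,1] zeroHom_def B A)

theorem prl_inl_add_prr_inr (A B : Color) :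
    (addHom (prl A B ⬝ inl A B) (prr A B ⬝ inr A B) : (.plus A B) ⇒ (.plus A B)) = Hom.id (of (.plus A B)) :=
  hom_eq <| meet
    (· ⇝[0,1,2,3,4,5] addHom_def ((prl A B) ⬝ (inl A B)) ((prr A B) ⬝ (inr A B))
    ⇝[2,4,6] hom_comp (prl A B) (inl A B) ⇝[2,6,7] prl_def A B ⇝[6,4,8] inl_def A B
    ⇝[3,5,9] hom_comp (prr A B) (inr A B) ⇝[3,9,10] prr_def A B ⇝[9,5,11] inr_def A B
    ⇝[6,8,11,9,1,4,5,12,13,14,15,16,17] plus_plus_contr A B ⇝[6,12,13,8] (wire_null A B).symm ⇤6 12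
    ⇝[9,14,15,11] (null_wire A B).symm ⇤9 15 ⇝[6,16,14] contr_null A ⇤6 16 ⇝[9,17,13] null_contr B
    ⇤9 17 ⇝[6,7,10,9,0,2,3,18,19,20,21,22,23] (plus_plus_contr A B).mirror
    ⇝[6,18,19,7] (wire_null A B).mirror.symm ⇤18 6 ⇝[9,20,21,10] (null_wire A B).mirror.symm ⇤21 9
    ⇝[18,22,20] (contr_null A).mirror ⇤22 18 ⇝[21,23,19] (null_contr B).mirror ⇤23 21
    ⇝[0,1,22,23] coplus_plus A B)
    id

theorem zero_eq :
    (Hom.id (of .zero) : .zero ⇒ .zero) = zeroHom .zero .zero :=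
  hom_eq <| meet
    (· ⇝[0,1] wire_zero)
    (· ⇝[0,1] zeroHom_def .zero .zero)

theorem zeroHom_ten (A B : Color) {A' B' : Color} {h : A' ⇒ B'} (hh : IsLin h) :
    tenHom (zeroHom A B) h = zeroHom (.tensor A A') (.tensor B B') :=
  hom_eq <| meet
    (· ⇝[0,1,2,3,4,5] tenHom_def (zeroHom A B) h ⇝[2,4] zeroHom_def A B ⇝[5,1,4] null_tens_left B B'
    ⇝[3,5] lin_conull hh ⇝[3,0,2] (null_tens_left A A').mirror ⇝[3] null_conull A')
    (· ⇝[0,1] zeroHom_def (.tensor A A') (.tensor B B'))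

theorem tenHom_zero (A B : Color) {A' B' : Color} {h : A' ⇒ B'} (hh : IsLin h) :
    tenHom h (zeroHom A B) = zeroHom (.tensor A' A) (.tensor B' B) :=
  hom_eq <| meet
    (· ⇝[0,1,2,3,4,5] tenHom_def h (zeroHom A B) ⇝[3,5] zeroHom_def A B
    ⇝[4,1,5] null_tens_right B' B ⇝[2,4] lin_conull hh ⇝[2,0,3] (null_tens_right A' A).mirror
    ⇝[2] null_conull A')
    (· ⇝[0,1] zeroHom_def (.tensor A' A) (.tensor B' B))

theorem scal_mul (s t : R) :
    (Hom.mk (Diag.scal s .one) ⬝ Hom.mk (Diag.scal t .one) : .one ⇒ .one) = Hom.mk (Diag.scal (s * t) .one) :=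
  hom_eq <| meet
    (· ⇝[0,1,2] hom_comp (Hom.mk (Diag.scal s .one)) (Hom.mk (Diag.scal t .one)) ⇥0 3
    ⇝[0,3,4,5] (tap_untap .one).symm ⇝[2,4,5,3,6] (scal_tap_left s .one).mirror
    ⇝[1,6,5,2,7] (scal_tap_right t .one).mirror ⇝[6,7,1,8] untapR_def .one
    ⇝[4,5,8,6,7,9] scal_tens s t .one .one
    ⇝[9,1,8,10] scal_adapt (s * t) (Color.Approx.tensor_one .one) ⇝[4,5,10,9] (untapR_def .one).symm
    ⇝[0,10,4,5] tap_untap .one ⇤0 10)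
    id

theorem addHom_ten {A B A' B' : Color} {f g : A ⇒ B} (hf : IsLin f) (hg : IsLin g) {h : A' ⇒ B'} (hh : IsLin h) :
    tenHom (addHom f g) h = addHom (tenHom f h) (tenHom g h) :=
  hom_eq <| meet
    (· ⇝[0,1,2,3,4,5] tenHom_def (addHom f g) h ⇝[2,4,6,7,8,9] addHom_def f g
    ⇝[8,9,5,1,4,10,11,12,13] contr_tens B B' ⇝[3,10,11,5,14,15] lin_cocontr hh)
    (· ⇝[0,1,16,17,12,13] addHom_def (tenHom f h) (tenHom g h) ⇝[16,12,18,19,20,21] tenHom_def f h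
    ⇝[17,13,22,23,24,25] tenHom_def g h
    ⇝[18,19,22,23,0,16,17,6,14,7,15,2,3] (tens_tens_contr A A').mirror
    ⇝[7,15,24,23,9,22] (lin_xtens_left A' hg).symm ⇝[9,15,24,25,11,23] (lin_xtens_right B hh).symm
    ⇝[6,14,20,19,8,18] (lin_xtens_left A' hf).symm ⇝[8,14,20,21,10,19] (lin_xtens_right B hh).symm
    ⇝[13,9,11,24,25] (cotens_xtens_self B B').mirror
    ⇝[12,8,10,20,21] (cotens_xtens_self B B').mirror)

theorem contr_tens_right (A B : Color) : 𝓡 [(2, B), (1, B), (0, A)] [(3, .tensor A B)]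
    [contr B 1 2 4, tens A B 0 4 3]
    [cocontr A 0 5 6, tens A B 5 1 7, tens A B 6 2 8, contr (.tensor A B) 7 8 3] :=
  derive (· ⇝[3,0,4,9,10] (cotens_xtens_self A B).mirror.symm ⇝[0,4,9,10] xtens_comm A B
    ⇝[4,0,10,9,11] xtens_def B A ⇝[1,2,0,11,4,5,6,12,13] contr_tens B A
    ⇝[12,13,10,9,11,14,15,16,17] contr_cotens B A ⇝[1,5,14,15,12] (xtens_def B A).symm
    ⇝[2,6,16,17,13] (xtens_def B A).symm ⇝[1,5,14,15] xtens_comm B A ⇝[2,6,16,17] xtens_comm B A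
    ⇝[5,1,6,2,3,7,8,15,14,17,16,9,10] (tens_tens_contr A B).symm)

theorem ten_addHom {A B A' B' : Color} {f g : A ⇒ B} (hf : IsLin f) (hg : IsLin g) {h : A' ⇒ B'} (hh : IsLin h) :
    tenHom h (addHom f g) = addHom (tenHom h f) (tenHom h g) :=
  hom_eq <| meet
    (· ⇝[0,1,2,3,4,5] tenHom_def h (addHom f g) ⇝[3,5,6,7,8,9] addHom_def f g
    ⇝[4,8,9,1,5,10,11,12,13] contr_tens_right B' B ⇝[2,10,11,4,14,15] lin_cocontr hh)
    (· ⇝[0,1,16,17,12,13] addHom_def (tenHom h f) (tenHom h g) ⇝[16,12,18,19,20,21] tenHom_def h f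
    ⇝[17,13,22,23,24,25] tenHom_def h g
    ⇝[18,19,22,23,0,16,17,14,6,15,7,2,3] (tens_tens_contr A' A).mirror
    ⇝[15,7,24,23,11,22] (lin_xtens_left A hh).symm ⇝[11,7,24,25,9,23] (lin_xtens_right B' hg).symm
    ⇝[14,6,18,21,8,19] (lin_xtens_right A' hf).symm ⇝[14,8,20,21,10,18] (lin_xtens_left B hh).symm
    ⇝[13,11,9,24,25] (cotens_xtens_self B' B).mirror
    ⇝[12,10,8,20,21] (cotens_xtens_self B' B).mirror)

theorem tenHom_comp {A B C A' B' C' : Color} {f : A ⇒ B} (hf : IsLin f) {g : A' ⇒ B'} (hg : IsLin g) (f' : B ⇒ C) (g' : B' ⇒ C') :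
    tenHom f g ⬝ tenHom f' g' = tenHom (f ⬝ f') (g ⬝ g') :=
  hom_eq <| meet
    (· ⇝[0,1,2] hom_comp (tenHom f g) (tenHom f' g') ⇝[0,2,3,4,5,6] tenHom_def f g
    ⇝[2,1,7,8,9,10] tenHom_def f' g' ⇝[5,6,7,8,2] (xtens_def B B').symm
    ⇝[3,6,7,8,5,11] lin_xtens_left B' hf ⇝[3,4,11,8,6,12] lin_xtens_right A hg
    ⇝[0,11,12,3,4] cotens_xtens_self A A')
    (· ⇝[0,1,11,12,9,10] tenHom_def (f ⬝ f') (g ⬝ g') ⇝[11,9,7] hom_comp f f'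
    ⇝[12,10,8] hom_comp g g')

theorem tenHom_id (A B : Color) :
    (tenHom (Hom.id (of A)) (Hom.id (of B)) : (.tensor A B) ⇒ (.tensor A B)) = Hom.id (of (.tensor A B)) :=
  hom_eq <| meet
    (· ⇝[0,1,2,3,4,5] tenHom_def (Hom.id (of A)) (Hom.id (of B)) ⇤2 4 ⇤3 5
    ⇝[0,1,2,3] cotens_tens A B)
    id

theorem inl_osumHom {A B A' B' : Color} (f : A ⇒ B) {g : A' ⇒ B'} (hg : IsLin g) :
    inl A A' ⬝ osumHom f g = f ⬝ inl B B' :=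
  hom_eq <| meet
    (· ⇝[0,1,2] hom_comp (inl A A') (osumHom f g) ⇝[0,2,3] inl_def A A'
    ⇝[2,1,4,5,6,7] osumHom_def f g ⇝[0,3,4,5,2] (xplus_def A A').symm
    ⇝[0,4,5,3] (wire_null A A').symm ⇤0 4 ⇝[7,5] lin_null hg)
    (· ⇝[0,1,6] hom_comp f (inl B B') ⇝[6,1,7] inl_def B B')

theorem inr_osumHom {A B A' B' : Color} {f : A ⇒ B} (hf : IsLin f) (g : A' ⇒ B') :
    inr A A' ⬝ osumHom f g = g ⬝ inr B B' :=
  hom_eq <| meet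
    (· ⇝[0,1,2] hom_comp (inr A A') (osumHom f g) ⇝[0,2,3] inr_def A A'
    ⇝[2,1,4,5,6,7] osumHom_def f g ⇝[3,0,4,5,2] (xplus_def A A').symm
    ⇝[0,4,5,3] (null_wire A A').symm ⇤0 5 ⇝[6,4] lin_null hf)
    (· ⇝[0,1,7] hom_comp g (inr B B') ⇝[7,1,6] inr_def B B')

theorem scal_add_eq (s t : R) :
    (Hom.mk (Diag.scal (s + t) .one) : .one ⇒ .one) = addHom (Hom.mk (Diag.scal s .one)) (Hom.mk (Diag.scal t .one)) :=
  hom_eq <| meet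
    (· ⇝[0,1,2,3,4,5] (scal_add s t .one).symm)
    (· ⇝[0,1,2,3,4,5] addHom_def (Hom.mk (Diag.scal s .one)) (Hom.mk (Diag.scal t .one)))

theorem scal_zero_eq :
    (Hom.mk (Diag.scal 0 .one) : .one ⇒ .one) = zeroHom .one .one :=
  hom_eq <| meet
    (· ⇝[0,1] scal_zero .one)
    (· ⇝[0,1] zeroHom_def .one .one)

theorem scal_one_eq :
    (Hom.mk (Diag.scal 1 .one) : .one ⇒ .one) = Hom.id (of .one) :=
  hom_eq <| meet
    (· ⇝[0,1] scal_one .one)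
    id

theorem scal_natural {A B : Color} {f : A ⇒ B} (hf : IsLin f) (s : R) :
    f ⬝ Hom.mk (Diag.scal s B) = Hom.mk (Diag.scal s A) ⬝ f :=
  hom_eq <| meet
    (· ⇝[0,1,2] hom_comp f (Hom.mk (Diag.scal s B)) ⇥0 3 ⇝[0,3,4,5] (tap_untap A).symm
    ⇝[4,5,2,3,6] lin_untap hf ⇝[1,6,5,2,7] (scal_tap_right s B).mirror)
    (· ⇝[0,1,8] hom_comp (Hom.mk (Diag.scal s A)) f ⇥0 9 ⇝[0,9,4,5] (tap_untap A).symm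
    ⇝[8,4,5,9,7] (scal_tap_right s A).mirror ⇝[4,7,1,8,6] lin_untap hf)

theorem adapt_comp {A B C : Color} (h : A.Approx B) (k : B.Approx C) (m : A.Approx C) :
    (Hom.mk (Diag.adapt h) ⬝ Hom.mk (Diag.adapt k) : A ⇒ C) = Hom.mk (Diag.adapt m) :=
  hom_eq <| meet
    (· ⇝[0,1,2] hom_comp (Hom.mk (Diag.adapt h)) (Hom.mk (Diag.adapt k)) ⇝[0,1,2] adapt_adapt h k m)
    id

theorem adapt_id {A : Color} (h : A.Approx A) :
    (Hom.mk (Diag.adapt h) : A ⇒ A) = Hom.id (of A) :=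
  hom_eq <| meet
    (· ⇝[0,1] adapt_self h)
    id

theorem tenHom_adapt {A A' B B' : Color} (h : A.Approx A') (k : B.Approx B') (m : (Color.tensor A B).Approx (.tensor A' B')) :
    (tenHom (Hom.mk (Diag.adapt h)) (Hom.mk (Diag.adapt k)) : (.tensor A B) ⇒ (.tensor A' B')) = Hom.mk (Diag.adapt m) :=
  hom_eq <| meet
    (· ⇝[0,1,2,3,4,5] tenHom_def (Hom.mk (Diag.adapt h)) (Hom.mk (Diag.adapt k))
    ⇝[2,3,1,4,5,6] adapt_tens h k m ⇝[0,6,2,3] cotens_tens A B ⇤0 6)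
    id

theorem osumHom_adapt {A A' B B' : Color} (h : A.Approx A') (k : B.Approx B') (m : (Color.plus A B).Approx (.plus A' B')) :
    (osumHom (Hom.mk (Diag.adapt h)) (Hom.mk (Diag.adapt k)) : (.plus A B) ⇒ (.plus A' B')) = Hom.mk (Diag.adapt m) :=
  hom_eq <| meet
    (· ⇝[0,1,2,3,4,5] osumHom_def (Hom.mk (Diag.adapt h)) (Hom.mk (Diag.adapt k))
    ⇝[2,3,1,4,5,6] adapt_plus h k m ⇝[0,6,2,3] coplus_plus A B ⇤0 6)
    id

theorem inl_plus_zero {A : Color} (h : (Color.plus A .zero).Approx A) :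
    (inl A .zero ⬝ Hom.mk (Diag.adapt h) : A ⇒ A) = Hom.id (of A) :=
  hom_eq <| meet
    (· ⇝[0,1,2] hom_comp (inl A .zero) (Hom.mk (Diag.adapt h)) ⇝[0,2,3] inl_def A .zero
    ⇝[0,3,1,2] plus_zero A h ⇝[3] null_conull .zero)
    id

theorem inr_zero_plus {A : Color} (h : (Color.plus .zero A).Approx A) :
    (inr .zero A ⬝ Hom.mk (Diag.adapt h) : A ⇒ A) = Hom.id (of A) :=
  hom_eq <| meet
    (· ⇝[0,1,2] hom_comp (inr .zero A) (Hom.mk (Diag.adapt h)) ⇝[0,2,3] inr_def .zero A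
    ⇝[3,0,1,2] zero_plus A h ⇝[3] null_conull .zero)
    id

theorem plus_plus (A B C : Color) :
    𝓡 [(2, C), (1, B), (0, A)] [(3, .plus A (.plus B C))]
    [plus A B 0 1 4, plus (.plus A B) C 4 2 5, adapt (Color.Approx.plus_assoc A B C) 5 3]
    [plus B C 1 2 6, plus A (.plus B C) 0 6 3] :=
  derive (· ⇝[3,0,1,2,6,5,4] (coplus_coplus A B C).mirror.symm)

theorem inl_inl_plus_assoc (A B C : Color) :
    (inl A B ⬝ inl (.plus A B) C ⬝ Hom.mk (Diag.adapt (Color.Approx.plus_assoc A B C)) : A ⇒ .plus A (.plus B C)) = inl A (.plus B C) :=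
  hom_eq <| meet
    (·
    ⇝[0,1,2] hom_comp ((inl A B) ⬝ (inl (.plus A B) C)) (Hom.mk (Diag.adapt (Color.Approx.plus_assoc A B C)))
    ⇝[0,2,3] hom_comp (inl A B) (inl (.plus A B) C) ⇝[0,3,4] inl_def A B
    ⇝[3,2,5] inl_def (.plus A B) C ⇝[0,4,5,1,3,2,6] plus_plus A B C ⇝[4,5,7] (null_coplus B C).symm
    ⇝[7,6,4,5] coplus_plus B C ⇤7 6)
    (· ⇝[0,1,7] inl_def A (.plus B C))

theorem inr_inl_plus_assoc (A B C : Color) :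
    (inr A B ⬝ inl (.plus A B) C ⬝ Hom.mk (Diag.adapt (Color.Approx.plus_assoc A B C)) : B ⇒ .plus A (.plus B C)) = inl B C ⬝ inr A (.plus B C) :=
  hom_eq <| meet
    (·
    ⇝[0,1,2] hom_comp ((inr A B) ⬝ (inl (.plus A B) C)) (Hom.mk (Diag.adapt (Color.Approx.plus_assoc A B C)))
    ⇝[0,2,3] hom_comp (inr A B) (inl (.plus A B) C) ⇝[0,3,4] inr_def A B
    ⇝[3,2,5] inl_def (.plus A B) C ⇝[4,0,5,1,3,2,6] plus_plus A B C)
    (· ⇝[0,1,6] hom_comp (inl B C) (inr A (.plus B C)) ⇝[0,6,5] inl_def B C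
    ⇝[6,1,4] inr_def A (.plus B C))

theorem inr_plus_assoc (A B C : Color) :
    (inr (.plus A B) C ⬝ Hom.mk (Diag.adapt (Color.Approx.plus_assoc A B C)) : C ⇒ .plus A (.plus B C)) = inr B C ⬝ inr A (.plus B C) :=
  hom_eq <| meet
    (· ⇝[0,1,2] hom_comp (inr (.plus A B) C) (Hom.mk (Diag.adapt (Color.Approx.plus_assoc A B C)))
    ⇝[0,2,3] inr_def (.plus A B) C ⇥3 4 ⇝[3,4,5,6] (coplus_plus A B).symm ⇝[5,6,3] null_coplus A B
    ⇝[5,6,0,1,4,2,7] plus_plus A B C)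
    (· ⇝[0,1,7] hom_comp (inr B C) (inr A (.plus B C)) ⇝[0,7,6] inr_def B C
    ⇝[7,1,5] inr_def A (.plus B C))

theorem tenState_def {A B : Color} (f : .one ⇒ A) (g : .one ⇒ B) :
    𝓡 [(0, .one)] [(1, .tensor A B)] [hom (tenState f g) 0 1]
    [tapR .one 0 2 3, hom f 2 4, hom g 3 5, tens A B 4 5 1] :=
  by_diag ▣(hom (tenState f g) 0 1) (▣(tapR .one 0 2 3) ⨾ (▣(hom f 2 4) ⫼ ▣(hom g 3 5)) ⨾ ▣(tens A B 4 5 1)) rfl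

theorem tenState_eq {A B : Color} (f : .one ⇒ A) (g : .one ⇒ B) :
    tenState f g = Hom.mk (Diag.adapt (Color.Approx.symm (Color.Approx.tensor_one .one))) ⬝ tenHom f g :=
  hom_eq <| meet
    (· ⇝[0,1,2,3,4,5] tenState_def f g ⇝[0,2,3,6] tapR_def .one)
    (·
    ⇝[0,1,6] hom_comp (Hom.mk (Diag.adapt (Color.Approx.symm (Color.Approx.tensor_one .one)))) (tenHom f g)
    ⇝[6,1,2,3,4,5] tenHom_def f g)

theorem _root_.TensorPlus.IsLin.tenState {A B : Color} {f : .one ⇒ A}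
    {g : .one ⇒ B} (hf : IsLin f) (hg : IsLin g) : IsLin (TensorPlus.tenState f g) :=
  tenState_eq f g ▸ (IsLin.adapt _).comp (hf.ten hg)

theorem tenState_tenHom {A B : Color} {f : .one ⇒ A} (hf : IsLin f) {g : .one ⇒ B} (hg : IsLin g) {A' B' : Color} (p : A ⇒ A') (q : B ⇒ B') :
    tenState f g ⬝ tenHom p q = tenState (f ⬝ p) (g ⬝ q) :=
  hom_eq <| meet
    (· ⇝[0,1,2] hom_comp (tenState f g) (tenHom p q) ⇝[0,2,3,4,5,6] tenState_def f g
    ⇝[2,1,7,8,9,10] tenHom_def p q ⇝[5,6,7,8,2] (xtens_def A B).symm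
    ⇝[3,6,7,8,5,11] lin_xtens_left B hf ⇝[3,4,11,8,6,12] lin_xtens_right .one hg
    ⇝[0,3,4,13] tapR_def .one ⇝[13,11,12,3,4] cotens_xtens_self .one .one
    ⇝[0,11,12,13] (tapR_def .one).symm)
    (· ⇝[0,1,11,12,9,10] tenState_def (f ⬝ p) (g ⬝ q) ⇝[11,9,7] hom_comp f p
    ⇝[12,10,8] hom_comp g q)

theorem tenState_tensor_one {A : Color} {f : .one ⇒ A} (hf : IsLin f) :
    tenState f (Hom.id (of .one)) ⬝ Hom.mk (Diag.adapt (Color.Approx.tensor_one A)) = f :=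
  hom_eq <| meet
    (·
    ⇝[0,1,2] hom_comp (tenState f (Hom.id (of .one))) (Hom.mk (Diag.adapt (Color.Approx.tensor_one A)))
    ⇝[0,2,3,4,5,6] tenState_def f (Hom.id (of .one)) ⇤4 6 ⇝[5,4,1,2] (untapR_def A).symm
    ⇝[3,4,1,7,5] (lin_untap hf).symm ⇝[0,7,3,4] tap_untap .one ⇤0 7)
    id

theorem tenState_one_tensor {A : Color} {f : .one ⇒ A} (hf : IsLin f) :
    tenState (Hom.id (of .one)) f ⬝ Hom.mk (Diag.adapt (Color.Approx.one_tensor A)) = f :=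
  hom_eq <| meet
    (·
    ⇝[0,1,2] hom_comp (tenState (Hom.id (of .one)) f) (Hom.mk (Diag.adapt (Color.Approx.one_tensor A)))
    ⇝[0,2,3,4,5,6] tenState_def (Hom.id (of .one)) f ⇤3 5 ⇝[3,6,1,2] (untapL_def A).symm
    ⇝[0,3,4] tap_one_comm ⇝[3,6,1] untapL_eq A ⇝[4,3,1,7,6] (lin_untap hf).symm
    ⇝[0,7,4,3] tap_untap .one ⇤0 7)
    id

theorem tenState_scal (s t : R) :
    (tenState (Hom.mk (Diag.scal s .one)) (Hom.mk (Diag.scal t .one)) ⬝ Hom.mk (Diag.adapt (Color.Approx.tensor_one .one)) : .one ⇒ .one) = Hom.mk (Diag.scal (s * t) .one) :=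
  hom_eq <| meet
    (·
    ⇝[0,1,2] hom_comp (tenState (Hom.mk (Diag.scal s .one)) (Hom.mk (Diag.scal t .one))) (Hom.mk (Diag.adapt (Color.Approx.tensor_one .one)))
    ⇝[0,2,3,4,5,6] tenState_def (Hom.mk (Diag.scal s .one)) (Hom.mk (Diag.scal t .one))
    ⇝[3,4,2,5,6,7] scal_tens s t .one .one
    ⇝[7,1,2,8] scal_adapt (s * t) (Color.Approx.tensor_one .one) ⇝[3,4,8,7] (untapR_def .one).symm
    ⇝[0,8,3,4] tap_untap .one ⇤0 8)
    id

theorem tenState_tensor_assoc {A B C : Color} (f : .one ⇒ A) (g : .one ⇒ B) (h : .one ⇒ C) :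
    tenState (tenState f g) h ⬝ Hom.mk (Diag.adapt (Color.Approx.tensor_assoc A B C)) = tenState f (tenState g h) :=
  hom_eq <| meet
    (·
    ⇝[0,1,2] hom_comp (tenState (tenState f g) h) (Hom.mk (Diag.adapt (Color.Approx.tensor_assoc A B C)))
    ⇝[0,2,3,4,5,6] tenState_def (tenState f g) h ⇝[3,5,7,8,9,10] tenState_def f g
    ⇝[0,7,8,4,3,11] tap_tap .one ⇝[1,9,10,6,12,2,5] (cotens_cotens A B C).mirror.symm)
    (· ⇝[0,1,7,11,9,12] tenState_def f (tenState g h) ⇝[11,12,8,4,10,6] tenState_def g h)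

end Rule

/-- The index set of the basis of a color. -/
def Ix : Color → Type
  | .zero => Empty
  | .one => Unit
  | .plus A B => Ix A ⊕ Ix B
  | .tensor A B => Ix A × Ix B

instance Ix.fintype : (A : Color) → Fintype (Ix A)
  | .zero => inferInstanceAs (Fintype Empty)
  | .one => inferInstanceAs (Fintype Unit)
  | .plus A B => @instFintypeSum _ _ (fintype A) (fintype B)
  | .tensor A B => @instFintypeProd _ _ (fintype A) (fintype B)

instance Ix.decEq : (A : Color) → DecidableEq (Ix A)
  | .zero => inferInstanceAs (DecidableEq Empty)
  | .one => inferInstanceAs (DecidableEq Unit)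
  | .plus A B => @instDecidableEqSum _ _ (decEq A) (decEq B)
  | .tensor A B => @instDecidableEqProd _ _ (decEq A) (decEq B)

/-- The position of a basis vector. -/
def Ix.pos : (A : Color) → Ix A ≃ Fin A.dim
  | .zero => Equiv.equivOfIsEmpty Empty (Fin 0)
  | .one => Equiv.ofUnique Unit (Fin 1)
  | .plus A B => (Equiv.sumCongr (pos A) (pos B)).trans finSumFinEquiv
  | .tensor A B => (Equiv.prodComm (Ix A) (Ix B)).trans <|
      (Equiv.prodCongr (pos B) (pos A)).trans <| finProdFinEquiv.trans <| finCongr <| mul_comm _ _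

theorem Color.Approx.dim_eq {A B : Color} (h : A.Approx B) : A.dim = B.dim := by
  induction h <;> simp_all [Color.dim, add_assoc, mul_assoc]

/-- The bijection of indices induced by a structural isomorphism. -/
def Ix.adapt {A B : Color} (h : A.Approx B) : Ix A ≃ Ix B :=
  (pos A).trans <| (finCongr h.dim_eq).trans (pos B).symm

theorem Ix.adapt_eq {A B : Color} (h : A.Approx B) (i : Ix A) (j : Ix B) :
    adapt h i = j ↔ (pos A i : ℕ) = pos B j := by
  rw [adapt, Equiv.trans_apply, Equiv.trans_apply, Equiv.symm_apply_eq, Fin.ext_iff]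
  rfl

/-- The scalars as diagrams. -/
abbrev sc (s : R) : .one ⇒ .one := Hom.mk (Diag.scal s .one)

theorem sc_zero : sc (0 : R) = zeroHom .one .one := Rule.scal_zero_eq
theorem sc_add (s t : R) : sc (s + t) = addHom (sc s) (sc t) := Rule.scal_add_eq s t
theorem sc_mul (s t : R) : sc s ⬝ sc t = sc (s * t) := Rule.scal_mul s t

/-- The basis vectors of a color. -/
def ket : (A : Color) → Ix A → .one ⇒ A
  | .zero, i => i.elim
  | .one, _ => .id _
  | .plus A B, .inl i => ket A i ⬝ inl A B
  | .plus A B, .inr i => ket B i ⬝ inr A B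
  | .tensor A B, (i, j) => tenState (ket A i) (ket B j)

theorem IsLin.ket : (A : Color) → (i : Ix A) → IsLin (ket (R := R) A i)
  | .zero, i => i.elim
  | .one, _ => .id _
  | .plus _ _, .inl i => (ket _ i).comp (.inl _ _)
  | .plus _ _, .inr i => (ket _ i).comp (.inr _ _)
  | .tensor _ _, (i, j) => (ket _ i).tenState (ket _ j)

/-- The dual basis vectors of a color. -/
def bra (A : Color) (i : Ix A) : A ⇒ .one := (ket A i).mirror

theorem IsLin.bra (A : Color) (i : Ix A) : IsLin (bra (R := R) A i) := (IsLin.ket A i).mirror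

theorem tenHom_mirror {A B A' B' : Color} (f : A ⇒ B) (g : A' ⇒ B') :
    (tenHom f g).mirror = tenHom f.mirror g.mirror := by
  simp only [tenHom, Hom.mirror_comp, Hom.mirror_par, Hom.assoc]
  rfl

theorem bra_inl {A B : Color} (i : Ix A) :
    bra (R := R) (.plus A B) (.inl i) = prl A B ⬝ bra A i := Hom.mirror_comp _ _

theorem bra_inr {A B : Color} (i : Ix B) :
    bra (R := R) (.plus A B) (.inr i) = prr A B ⬝ bra B i := Hom.mirror_comp _ _

theorem bra_pair {A B : Color} (i : Ix A) (j : Ix B) : bra (R := R) (.tensor A B) (i, j) =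
    tenHom (bra A i) (bra B j) ⬝ Hom.mk (Diag.adapt (.tensor_one .one)) := by
  change (tenState _ _).mirror = _
  rw [Rule.tenState_eq, Hom.mirror_comp, tenHom_mirror]
  rfl

/-- The linear diagrams between two wires. -/
def Lin (R : Type u) [CommSemiring R] (A B : Color) := {f : Hom R (of A) (of B) // IsLin f}

instance (A B : Color) : Zero (Lin R A B) := ⟨zeroHom A B, .zero A B⟩
instance (A B : Color) : Add (Lin R A B) := ⟨fun f g => ⟨addHom f.1 g.1, f.2.add g.2⟩⟩

instance (A B : Color) : AddCommMonoid (Lin R A B) where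
  add_assoc f g h := Subtype.ext (Rule.addHom_assoc f.1 g.1 h.1)
  add_comm f g := Subtype.ext (Rule.addHom_comm f.1 g.1)
  add_zero f := Subtype.ext (Rule.addHom_zero f.1)
  zero_add f := Subtype.ext ((Rule.addHom_comm _ f.1).trans (Rule.addHom_zero f.1))
  nsmul := nsmulRec

namespace Lin

/-- Composition with fixed linear diagrams on both sides. -/
def conj {A B C D : Color} (p : Lin R C A) (q : Lin R B D) : Lin R A B →+ Lin R C D where
  toFun f := ⟨p.1 ⬝ f.1 ⬝ q.1, (p.2.comp f.2).comp q.2⟩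
  map_zero' := Subtype.ext <| (congrArg (· ⬝ q.1) (Rule.comp_zeroHom B p.2)).trans
    (Rule.zeroHom_comp C q.2)
  map_add' f g := Subtype.ext <| (congrArg (· ⬝ q.1) (Rule.comp_addHom p.2 f.1 g.1)).trans
    (Rule.addHom_comp _ _ q.2)

/-- The tensor product of linear diagrams is bilinear. -/
def ten {A B A' B' : Color} :
    Lin R A B →+ Lin R A' B' →+ Lin R (.tensor A A') (.tensor B B') where
  toFun f :=
    { toFun g := ⟨tenHom f.1 g.1, f.2.ten g.2⟩
      map_zero' := Subtype.ext (Rule.tenHom_zero _ _ f.2)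
      map_add' g h := Subtype.ext (Rule.ten_addHom g.2 h.2 f.2) }
  map_zero' := AddMonoidHom.ext fun g => Subtype.ext (Rule.zeroHom_ten _ _ g.2)
  map_add' f g := AddMonoidHom.ext fun h => Subtype.ext (Rule.addHom_ten f.2 g.2 h.2)

/-- The scalars form an additive monoid. -/
def scalar : R →+ Lin R .one .one where
  toFun s := ⟨sc s, .scal s .one⟩
  map_zero' := Subtype.ext Rule.scal_zero_eq
  map_add' s t := Subtype.ext (Rule.scal_add_eq s t)

/-- The identity as a linear diagram. -/
protected def id (A : Color) : Lin R A A := ⟨.id _, .id A⟩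

/-- The projection to a basis vector. -/
def proj (A : Color) (i : Ix A) : Lin R A A := ⟨bra A i ⬝ ket A i, (IsLin.bra A i).comp (.ket A i)⟩

theorem id_eq_sum : (A : Color) → Lin.id (R := R) A = ∑ i, proj A i
  | .zero => Subtype.ext Rule.zero_eq
  | .one => (Subtype.ext (Hom.id_comp _).symm).trans (Fintype.sum_unique (ι := Unit) (proj (R := R) .one)).symm
  | .plus A B => by
    have hA := congrArg (conj ⟨prl A B, .prl A B⟩ ⟨inl A B, .inl A B⟩) (id_eq_sum A)
    have hB := congrArg (conj ⟨prr A B, .prr A B⟩ ⟨inr A B, .inr A B⟩) (id_eq_sum B)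
    rw [map_sum] at hA hB
    refine Eq.trans ?_ (Fintype.sum_sum_type (α₁ := Ix A) (α₂ := Ix B) _).symm
    refine Eq.trans ?_ (congrArg₂ (· + ·) (hA.trans ?_) (hB.trans ?_))
    · refine Subtype.ext ((Rule.prl_inl_add_prr_inr A B).symm.trans ?_)
      exact congrArg₂ addHom (congrArg (· ⬝ _) (Hom.comp_id _).symm)
        (congrArg (· ⬝ _) (Hom.comp_id _).symm)
    · refine Finset.sum_congr rfl fun i _ => Subtype.ext ?_
      change prl A B ⬝ (bra A i ⬝ ket A i) ⬝ inl A B = bra _ _ ⬝ (ket A i ⬝ inl A B)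
      simp only [bra_inl, Hom.assoc]
    · refine Finset.sum_congr rfl fun i _ => Subtype.ext ?_
      change prr A B ⬝ (bra B i ⬝ ket B i) ⬝ inr A B = bra _ _ ⬝ (ket B i ⬝ inr A B)
      simp only [bra_inr, Hom.assoc]
  | .tensor A B => by
    refine Eq.trans (Subtype.ext (Rule.tenHom_id A B).symm :
      _ = ten (Lin.id A) (Lin.id B)) ?_
    rw [id_eq_sum A, id_eq_sum B, map_sum ten, AddMonoidHom.finsetSum_apply]
    refine Eq.trans ?_ (Fintype.sum_prod_type (α₁ := Ix A) (α₂ := Ix B) _).symm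
    refine Finset.sum_congr rfl fun i _ => ?_
    rw [map_sum]
    refine Finset.sum_congr rfl fun j _ => Subtype.ext ?_
    change _ = bra (.tensor A B) (i, j) ⬝ tenState _ _
    rw [bra_pair, Rule.tenState_eq]
    change tenHom (bra A i ⬝ ket A i) (bra B j ⬝ ket B j) = _
    rw [← Rule.tenHom_comp (.bra A i) (.bra B j), Hom.assoc, ← Hom.assoc _ _ (tenHom _ _),
      Rule.adapt_comp _ _ (.refl _), Rule.adapt_id, Hom.id_comp]

theorem conj_id {A C D : Color} (p : Lin R C A) (q : Lin R A D) :
    conj p q (Lin.id A) = ∑ i, conj p q (proj A i) := by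
  rw [id_eq_sum, map_sum]

theorem sc_ite {p q : Prop} {_ : Decidable p} {_ : Decidable q} (h : p ↔ q) :
    sc (R := R) (if p then 1 else 0) = sc (if q then 1 else 0) :=
  congrArg sc (if_congr h rfl rfl)

theorem ket_bra : (A : Color) → (i j : Ix A) →
    ket (R := R) A i ⬝ bra A j = sc (if i = j then 1 else 0)
  | .zero, i, _ => i.elim
  | .one, _, _ => by
    refine (Hom.id_comp _).trans (Rule.scal_one_eq.symm.trans (congrArg sc ?_))
    exact (if_pos rfl).symm
  | .plus A B, .inl i, .inl j => by
    have := ket_bra A i j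
    rw [bra_inl, ket, Hom.assoc, ← Hom.assoc (inl A B), Rule.inl_prl, Hom.id_comp, this]
    exact sc_ite ⟨congrArg _, fun h => Sum.inl.inj h⟩
  | .plus A B, .inr i, .inr j => by
    have := ket_bra B i j
    rw [bra_inr, ket, Hom.assoc, ← Hom.assoc (inr A B), Rule.inr_prr, Hom.id_comp, this]
    exact sc_ite ⟨congrArg _, fun h => Sum.inr.inj h⟩
  | .plus A B, .inl i, .inr j => by
    rw [bra_inr, ket, Hom.assoc, ← Hom.assoc (inl A B), Rule.inl_prr,
      Rule.zeroHom_comp _ (.bra B j), Rule.comp_zeroHom _ (.ket A i), ← Rule.scal_zero_eq]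
    refine congrArg sc ?_
    exact (if_neg fun h => nomatch h).symm
  | .plus A B, .inr i, .inl j => by
    rw [bra_inl, ket, Hom.assoc, ← Hom.assoc (inr A B), Rule.inr_prl,
      Rule.zeroHom_comp _ (.bra A j), Rule.comp_zeroHom _ (.ket B i), ← Rule.scal_zero_eq]
    refine congrArg sc ?_
    exact (if_neg fun h => nomatch h).symm
  | .tensor A B, (i, j), (k, l) => by
    rw [bra_pair, ket, ← Hom.assoc, Rule.tenState_tenHom (.ket A i) (.ket B j), ket_bra A i k,
      ket_bra B j l, Rule.tenState_scal, ite_zero_mul_ite_zero, one_mul]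
    exact sc_ite ⟨fun h => Prod.ext h.1 h.2, fun h => Prod.mk.inj h⟩

end Lin

theorem ket_adapt_of_pos {A B : Color} {h : A.Approx B} {i : Ix A} (j : Ix B)
    (e : (Ix.pos A i : ℕ) = Ix.pos B j) (hk : ket (R := R) A i ⬝ Hom.mk (Diag.adapt h) = ket B j) :
    ket (R := R) A i ⬝ Hom.mk (Diag.adapt h) = ket B (Ix.adapt h i) :=
  hk.trans (congrArg _ ((Ix.adapt_eq h i j).2 e).symm)

theorem Ix.adapt_pos {A B : Color} (h : A.Approx B) (i : Ix A) :
    (pos A i : ℕ) = pos B (adapt h i) := (Ix.adapt_eq h i _).1 rfl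

theorem ket_adapt {A B : Color} (h : A.Approx B) : ∀ i : Ix A,
    ket (R := R) A i ⬝ Hom.mk (Diag.adapt h) = ket B (Ix.adapt h i) := by
  induction h with
  | refl A =>
    exact fun i => ket_adapt_of_pos i rfl ((congrArg _ (Rule.adapt_id _)).trans (Hom.comp_id _))
  | @symm A B h ih =>
    intro i
    obtain ⟨j, rfl⟩ := (Ix.adapt h).surjective i
    refine ket_adapt_of_pos j (Ix.adapt_pos h j).symm ?_
    rw [← ih j, Hom.assoc, Rule.adapt_comp _ _ (.refl _), Rule.adapt_id, Hom.comp_id]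
  | @trans A B C h k ih ih' =>
    refine fun i => ket_adapt_of_pos _ ((Ix.adapt_pos h i).trans (Ix.adapt_pos k _)) ?_
    rw [← Rule.adapt_comp h k, ← Hom.assoc, ih, ih']
  | plus_zero A =>
    rintro (i | i)
    · refine ket_adapt_of_pos i rfl ?_
      change ket A i ⬝ inl _ _ ⬝ _ = _
      rw [Hom.assoc, Rule.inl_plus_zero, Hom.comp_id]
    · exact i.elim
  | zero_plus A =>
    rintro (i | i)
    · exact i.elim
    · refine ket_adapt_of_pos i (Nat.zero_add _) ?_
      change ket A i ⬝ inr _ _ ⬝ _ = _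
      rw [Hom.assoc, Rule.inr_zero_plus, Hom.comp_id]
  | tensor_one A =>
    rintro ⟨i, ⟨⟩⟩
    exact ket_adapt_of_pos i rfl (Rule.tenState_tensor_one (.ket A i))
  | one_tensor A =>
    rintro ⟨⟨⟩, i⟩
    exact ket_adapt_of_pos i ((Nat.zero_add _).trans (Nat.one_mul _))
      (Rule.tenState_one_tensor (.ket A i))
  | plus_assoc A B C =>
    rintro ((i | i) | i)
    · refine ket_adapt_of_pos (.inl i) rfl ?_
      change ket A i ⬝ inl _ _ ⬝ inl _ _ ⬝ _ = ket A i ⬝ inl _ _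
      rw [Hom.assoc, Hom.assoc, ← Hom.assoc (inl A B), Rule.inl_inl_plus_assoc]
    · refine ket_adapt_of_pos (.inr (.inl i)) rfl ?_
      change ket B i ⬝ inr _ _ ⬝ inl _ _ ⬝ _ = ket B i ⬝ inl _ _ ⬝ inr _ _
      rw [Hom.assoc, Hom.assoc, ← Hom.assoc (inr A B), Rule.inr_inl_plus_assoc, Hom.assoc]
    · refine ket_adapt_of_pos (.inr (.inr i)) (Nat.add_assoc _ _ _) ?_
      change ket C i ⬝ inr _ _ ⬝ _ = ket C i ⬝ inr _ _ ⬝ inr _ _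
      rw [Hom.assoc, Rule.inr_plus_assoc, Hom.assoc]
  | tensor_assoc A B C =>
    rintro ⟨⟨i, j⟩, k⟩
    refine ket_adapt_of_pos (i, (j, k)) ?_ (Rule.tenState_tensor_assoc _ _ _)
    change (Ix.pos A i + A.dim * Ix.pos B j + A.dim * B.dim * Ix.pos C k : ℕ) =
      Ix.pos A i + A.dim * (Ix.pos B j + B.dim * Ix.pos C k)
    ring
  | @plus_right A B C h ih =>
    rintro (i | i)
    · refine ket_adapt_of_pos (.inl (Ix.adapt h i)) (Ix.adapt_pos h i) ?_
      change ket A i ⬝ inl _ _ ⬝ _ = ket B _ ⬝ inl _ _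
      rw [Hom.assoc, ← Rule.osumHom_adapt h (.refl C), Rule.inl_osumHom _ (.adapt _),
        ← Hom.assoc, ih]
    · refine ket_adapt_of_pos (.inr i) (congrArg (· + _) h.dim_eq) ?_
      change ket C i ⬝ inr _ _ ⬝ _ = ket C i ⬝ inr _ _
      rw [Hom.assoc, ← Rule.osumHom_adapt h (.refl C), Rule.inr_osumHom (.adapt _),
        Rule.adapt_id, Hom.id_comp]
  | @plus_left A B C h ih =>
    rintro (i | i)
    · refine ket_adapt_of_pos (.inl i) rfl ?_
      change ket C i ⬝ inl _ _ ⬝ _ = ket C i ⬝ inl _ _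
      rw [Hom.assoc, ← Rule.osumHom_adapt (.refl C) h, Rule.inl_osumHom _ (.adapt _),
        Rule.adapt_id, Hom.id_comp]
    · refine ket_adapt_of_pos (.inr (Ix.adapt h i)) (congrArg (_ + ·) (Ix.adapt_pos h i)) ?_
      change ket A i ⬝ inr _ _ ⬝ _ = ket B _ ⬝ inr _ _
      rw [Hom.assoc, ← Rule.osumHom_adapt (.refl C) h, Rule.inr_osumHom (.adapt _),
        ← Hom.assoc, ih]
  | @tensor_right A B C h ih =>
    rintro ⟨i, j⟩
    refine ket_adapt_of_pos (Ix.adapt h i, j)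
      (congrArg₂ (fun a b => a + b * _) (Ix.adapt_pos h i) h.dim_eq) ?_
    change tenState (ket A i) (ket C j) ⬝ _ = tenState (ket B _) (ket C j)
    rw [← Rule.tenHom_adapt h (.refl C), Rule.tenState_tenHom (.ket A i) (.ket C j), ih,
      Rule.adapt_id, Hom.comp_id]
  | @tensor_left A B C h ih =>
    rintro ⟨j, i⟩
    refine ket_adapt_of_pos (j, Ix.adapt h i)
      (congrArg (fun a => _ + _ * a) (Ix.adapt_pos h i)) ?_
    change tenState (ket C j) (ket A i) ⬝ _ = tenState (ket C j) (ket B _)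
    rw [← Rule.tenHom_adapt (.refl C) h, Rule.tenState_tenHom (.ket C j) (.ket A i), ih,
      Rule.adapt_id, Hom.comp_id]

/-- Linear diagrams that agree on the basis vectors are equal. -/
theorem Lin.ext_ket {A B : Color} (f g : Lin R A B) (h : ∀ i, ket A i ⬝ f.1 = ket A i ⬝ g.1) :
    f.1 = g.1 := by
  have e : conj (.id A) f (.id A) = conj (.id A) g (.id A) := by
    rw [conj_id, conj_id]
    refine Finset.sum_congr rfl fun i _ => Subtype.ext ?_
    change Hom.id _ ⬝ (bra A i ⬝ ket A i) ⬝ f.1 = Hom.id _ ⬝ (bra A i ⬝ ket A i) ⬝ g.1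
    simp only [Hom.assoc, h]
  have e' : Hom.id _ ⬝ Hom.id _ ⬝ f.1 = Hom.id _ ⬝ Hom.id _ ⬝ g.1 := congrArg Subtype.val e
  simpa only [Hom.id_comp] using e'

theorem ext_ket {A B : Color} {f g : A ⇒ B} (hf : IsLin f) (hg : IsLin g)
    (h : ∀ i, ket A i ⬝ f = ket A i ⬝ g) : f = g := Lin.ext_ket ⟨f, hf⟩ ⟨g, hg⟩ h

/-- Linear diagrams with the same entries are equal. -/
theorem ext_entry {A B : Color} {f g : A ⇒ B} (hf : IsLin f)
    (hg : IsLin g) (h : ∀ i j, ket A i ⬝ f ⬝ bra B j = ket A i ⬝ g ⬝ bra B j) : f = g := by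
  refine ext_ket hf hg fun i => Hom.mirror_injective ?_
  refine ext_ket ((IsLin.ket A i).comp hf).mirror ((IsLin.ket A i).comp hg).mirror fun j => ?_
  refine Hom.mirror_injective ?_
  rw [Hom.mirror_comp, Hom.mirror_mirror, Hom.mirror_comp, Hom.mirror_mirror]
  exact h i j

/-- A linear diagram is a matrix if its entries are scalars. -/
structure IsMat {A B : Color} (f : A ⇒ B) : Prop where
  lin : IsLin f
  entry : ∀ i j, ∃ s, ket A i ⬝ f ⬝ bra B j = sc s

namespace IsMat

theorem comp {A B C : Color} {f : A ⇒ B} {g : B ⇒ C} (hf : IsMat f)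
    (hg : IsMat g) : IsMat (f ⬝ g) where
  lin := hf.lin.comp hg.lin
  entry i j := by
    choose s hs using hf.entry i
    choose t ht using fun k => hg.entry k j
    have e := Lin.conj_id ⟨_, (IsLin.ket A i).comp hf.lin⟩ ⟨_, hg.lin.comp (.bra C j)⟩
    refine ⟨∑ k, s k * t k, ?_⟩
    have e' : _ = ∑ k, Lin.scalar (s k * t k) :=
      e.trans (Finset.sum_congr rfl fun k _ => Subtype.ext ?_)
    · rw [← map_sum] at e'
      refine Eq.trans ?_ (congrArg Subtype.val e')
      change _ = ket A i ⬝ f ⬝ Hom.id _ ⬝ (g ⬝ bra C j)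
      simp only [Hom.assoc, Hom.id_comp]
    · change ket A i ⬝ f ⬝ (bra B k ⬝ ket B k) ⬝ (g ⬝ bra C j) = sc (s k * t k)
      rw [← sc_mul, ← hs, ← ht]
      simp only [Hom.assoc]

theorem mirror {A B : Color} {f : A ⇒ B} (hf : IsMat f) : IsMat f.mirror where
  lin := hf.lin.mirror
  entry i j := by
    obtain ⟨s, hs⟩ := hf.entry j i
    refine ⟨s, (Hom.mirror_injective ?_)⟩
    rw [Hom.mirror_comp, Hom.mirror_comp, Hom.mirror_mirror, bra, Hom.mirror_mirror]
    exact (Hom.assoc _ _ _).symm.trans hs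

theorem of_ket {A B : Color} {f : A ⇒ B} (hf : IsLin f) (σ : Ix A → Ix B)
    (h : ∀ i, ket A i ⬝ f = ket B (σ i)) : IsMat f where
  lin := hf
  entry i j := ⟨_, (congrArg (· ⬝ _) (h i)).trans (Lin.ket_bra B (σ i) j)⟩

theorem zero (A B : Color) : IsMat (zeroHom (R := R) A B) where
  lin := .zero A B
  entry i j := ⟨0, by
    rw [Rule.comp_zeroHom _ (.ket A i), Rule.zeroHom_comp _ (.bra B j), sc_zero]⟩

theorem add {A B : Color} {f g : A ⇒ B} (hf : IsMat f) (hg : IsMat g) :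
    IsMat (addHom f g) where
  lin := hf.lin.add hg.lin
  entry i j := by
    obtain ⟨s, hs⟩ := hf.entry i j
    obtain ⟨t, ht⟩ := hg.entry i j
    exact ⟨s + t, by
      rw [Rule.comp_addHom (.ket A i), Rule.addHom_comp _ _ (.bra B j), hs, ht,
        sc_add]⟩

protected theorem id (A : Color) : IsMat (Hom.id (R := R) (of A)) :=
  .of_ket (.id A) id fun _ => Hom.comp_id _

theorem adapt {A B : Color} (h : A.Approx B) : IsMat (R := R) (Hom.mk (Diag.adapt h)) :=
  .of_ket (.adapt h) (Ix.adapt h) (ket_adapt h)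

theorem inl (A B : Color) : IsMat (inl (R := R) A B) := .of_ket (.inl A B) .inl fun _ => rfl
theorem inr (A B : Color) : IsMat (inr (R := R) A B) := .of_ket (.inr A B) .inr fun _ => rfl
theorem prl (A B : Color) : IsMat (prl (R := R) A B) := (IsMat.inl A B).mirror
theorem prr (A B : Color) : IsMat (prr (R := R) A B) := (IsMat.inr A B).mirror

theorem scal (s : R) (A : Color) : IsMat (Hom.mk (Diag.scal s A)) where
  lin := .scal s A
  entry i j := ⟨s * if i = j then 1 else 0, by
    rw [Rule.scal_natural (.ket A i), Hom.assoc, Lin.ket_bra, sc_mul]⟩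

theorem ten {A B A' B' : Color} {f : A ⇒ B} {g : A' ⇒ B'}
    (hf : IsMat f) (hg : IsMat g) : IsMat (tenHom f g) where
  lin := hf.lin.ten hg.lin
  entry := by
    rintro ⟨i, j⟩ ⟨k, l⟩
    obtain ⟨s, hs⟩ := hf.entry i k
    obtain ⟨t, ht⟩ := hg.entry j l
    refine ⟨s * t, ?_⟩
    change tenState _ _ ⬝ _ ⬝ _ = _
    rw [bra_pair, Rule.tenState_tenHom (.ket A i) (.ket A' j), ← Hom.assoc,
      Rule.tenState_tenHom ((IsLin.ket A i).comp hf.lin) ((IsLin.ket A' j).comp hg.lin), hs, ht,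
      Rule.tenState_scal]

theorem osum {A B A' B' : Color} {f : A ⇒ B} {g : A' ⇒ B'}
    (hf : IsMat f) (hg : IsMat g) : IsMat (osumHom f g) := by
  have e : osumHom f g =
      addHom (TensorPlus.prl A A' ⬝ f ⬝ TensorPlus.inl B B')
        (TensorPlus.prr A A' ⬝ g ⬝ TensorPlus.inr B B') := by
    rw [Hom.assoc, Hom.assoc, ← Rule.inl_osumHom f hg.lin, ← Rule.inr_osumHom hf.lin g,
      ← Hom.assoc, ← Hom.assoc, ← Rule.addHom_comp _ _ (hf.lin.osum hg.lin),
      Rule.prl_inl_add_prr_inr, Hom.id_comp]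
  exact e ▸ (((IsMat.prl _ _).comp hf).comp (.inl _ _)).add (((IsMat.prr _ _).comp hg).comp (.inr _ _))

end IsMat

/-- The color `(A ⊗ B) ⊕ (A ⊕ B)`. -/
abbrev pairC (A B : Color) : Color := .plus (.tensor A B) (.plus A B)

/-- The encoding of a pair of wires as a single wire. -/
def encHom (A B : Color) : Hom R (of A ++ of B) (of (pairC A B)) :=
  Hom.mk (Diag.cocontr₂ A B ⨟ (Diag.tens A B ∥ᵈ Diag.plus A B) ⨟
    Diag.plus (.tensor A B) (.plus A B))

/-- The decoding of a wire as a pair of wires. -/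
def decHom (A B : Color) : Hom R (of (pairC A B)) (of A ++ of B) := (encHom A B).mirror

/-- The encoding as a step. -/
def Step.enc (A B : Color) (a b c : ℕ) : Step R :=
  ⟨[(b, B), (a, A)], [(c, pairC A B)], encHom A B⟩

/-- The decoding as a step. -/
def Step.dec (A B : Color) (c a b : ℕ) : Step R :=
  ⟨[(c, pairC A B)], [(b, B), (a, A)], decHom A B⟩

/-- After `h`, decoding three wires and swapping the last two is the same as applying `γ`
before decoding. -/
abbrev DecSwap {C D A B : Color} (γ : pairC (pairC D A) B ⇒ pairC (pairC D B) A)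
    (h : C ⇒ pairC (pairC D A) B) : Prop :=
  Rule [(0, C)] [(3, A), (2, B), (1, D)]
    [Step.hom h 0 4, Step.dec (pairC D A) B 4 5 2, Step.dec D A 5 1 3]
    [Step.hom h 0 6, Step.hom γ 6 7, Step.dec (pairC D B) A 7 8 3, Step.dec D B 8 1 2]
set_option maxRecDepth 2000

namespace Rule

open Step

theorem enc_def (A B : Color) : 𝓡 [(1, B), (0, A)] [(2, pairC A B)] [enc A B 0 1 2]
    [cocontr A 0 3 4, cocontr B 1 5 6, tens A B 3 5 7, plus A B 4 6 8,
      plus (.tensor A B) (.plus A B) 7 8 2] :=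
  by_diag ▣(enc A B 0 1 2) ((▣(cocontr A 0 3 4) ⫼ ▣(cocontr B 1 5 6)) ⨾
      (▤[(3, A)] ⫼ ⤨ [(4, A)] [(5, B)] ⫼ ▤[(6, B)]) ⨾
      (▣(tens A B 3 5 7) ⫼ ▣(plus A B 4 6 8)) ⨾ ▣(plus (.tensor A B) (.plus A B) 7 8 2)) rfl

theorem enc_dec (A B : Color) : 𝓡 [(1, B), (0, A)] [(3, B), (2, A)]
    [enc A B 0 1 4, dec A B 4 2 3] [wire R A 0 2, wire R B 1 3] :=
  derive (· ⇝[0,1,4,5,6,7,8,9,10] enc_def A B ⇝[2,3,4,11,12,13,14,15,16] (enc_def A B).mirror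
    ⇝[9,10,15,16,4] (xplus_def (.tensor A B) (.plus A B)).symm
    ⇝[9,10,15,16] xplus_comm (.tensor A B) (.plus A B)
    ⇝[16,15,6,8,9,10,17,18,19] (coplus_xplus A B (.tensor A B)).mirror
    ⇝[8,9,18,19] xplus_comm B (.tensor A B) ⇝[5,7,8,19,18,9,20] tens_xplus_right A B B
    ⇝[20,18,1,7,8] (contr_xplus_self B).mirror.symm ⇝[6,19,17,15] xplus_comm A (.tensor A B)
    ⇝[5,20,6,15,17,19,21] tens_xplus_left A B A ⇝[21,17,0,5,6] (contr_xplus_self A).mirror.symm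
    ⇝[21,20,11,13,15] (xtens_def A B).symm ⇝[17,18,12,14,16] (xplus_def A B).symm
    ⇝[0,1,2,3,21,17,20,18,11,13,12,14] (wire_wire A B).symm)

theorem tap_tap_comm (A : Color) : 𝓡 [(0, A)] [(3, .one), (2, .one), (1, A)]
    [tapR A 0 4 2, tapR A 4 1 3] [tapR A 0 5 3, tapR A 5 1 2] :=
  derive (· ⇝[0,1,3,2,4,6] tap_tap A ⇝[6,3,2] tap_one_comm ⇝[0,1,2,3,5,6] (tap_tap A).symm)

theorem xplus_xplus_comm (A B C : Color) :
    𝓡 [(2, C), (1, B), (0, A)] [(5, C), (4, B), (3, A)]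
    [xplus A B 0 1 3 6, xplus B C 6 2 4 5] [xplus B C 1 2 7 5, xplus A B 0 7 3 4] :=
  derive (· ⇝[0,1,3,6,8,9,10] xplus_tap A B ⇝[6,2,4,5,11,12,13] xplus_tap B C
    ⇝[1,4,9,11,6,7] tap_tap_comm B ⇝[0,7,3,4,8,9,10] (xplus_tap A B).symm
    ⇝[1,2,7,5,11,12,13] (xplus_tap B C).symm)

theorem xplus_cocontr_tens (A B : Color) :
    𝓡 [(2, B), (1, B), (0, A)] [(4, B), (3, .tensor A B)]
    [xplus A B 0 1 5 6, cocontr B 6 7 4, cocontr A 5 8 9, tens A B 8 2 10, tens A B 9 7 11,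
      contr (.tensor A B) 10 11 3] [xplus A B 0 1 12 4, tens A B 12 2 3] :=
  derive (· ⇝[4,7,6] (contr_comm B).mirror ⇝[0,1,5,6] xplus_comm A B
    ⇝[4,7,5,1,0,6,13,12,14] (contr_xplus B A).mirror ⇝[13,12,7,5] xplus_comm B A
    ⇝[8,9,7,12,13,5,15,16,17] (contr_xplus A B).mirror ⇝[15,16,11,9,7] xplus_tens A B
    ⇝[10,3,11] contr_null (.tensor A B) ⇤10 3 ⇝[8,17,13,16] (wire_null A B).mirror.symm ⇤17 8
    ⇝[14,1,13] (contr_null B).mirror ⇤1 14 ⇝[17,12,15] (contr_null A).mirror ⇤12 17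
    ⇝[1,0,4,12] xplus_comm B A)

theorem contr_contr_tens (A B : Color) :
    𝓡 [(3, B), (2, A), (1, B), (0, A)] [(4, .tensor A B)]
    [xplus A B 0 3 5 6, xplus A B 2 1 7 8, contr A 5 7 9, contr B 8 6 10, tens A B 9 10 4]
    [xplus A B 0 3 11 12, xplus A B 2 1 13 14, tens A B 11 14 15, tens A B 13 12 16,
      contr (.tensor A B) 15 16 4] :=
  meet
    (· ⇝[5,7,10,4,9,17,18,19,20] contr_tens A B ⇝[8,6,17,18,10,21,22,23,24,25,26] contr_cocontr B
    ⇝[5,23,25,19,17,27,28,29,30] contr_tens_right A B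
    ⇝[7,24,26,20,18,31,32,33,34] contr_tens_right A B ⇝[2,1,6,7,21,22,8,35] xplus_xplus_comm A B B
    ⇝[1,6,35,22] xplus_comm B B ⇝[0,3,1,5,22,35,6,36] xplus_xplus_comm A B B
    ⇝[0,36,23,19,26,5,22,25,27,28,29,30,11] xplus_cocontr_tens A B ⇝[24,23,21] (contr_comm B).mirror
    ⇝[32,31,7] (contr_comm A).mirror ⇝[34,33,20] contr_comm (.tensor A B)
    ⇝[2,35,26,20,23,7,21,24,32,31,34,33,13] xplus_cocontr_tens A B)
    (· ⇝[15,16,4,19,20] contr_xplus_self (.tensor A B)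
    ⇝[11,14,16,19,20,15,23] tens_xplus_right A B (.tensor A B)
    ⇝[14,16,23,20] xplus_comm B (.tensor A B) ⇝[13,12,14,20,23,16,26] tens_xplus_right A B B
    ⇝[0,3,14,11,26,23,12,36] xplus_xplus_comm A B B ⇝[3,14,36,23] xplus_comm B B
    ⇝[2,1,3,13,23,36,14,35] xplus_xplus_comm A B B ⇝[1,3,35,36] xplus_comm B B)

theorem dec_tens (A B : Color) : 𝓡 [(0, pairC A B)] [(1, .tensor A B)]
    [dec A B 0 2 3, tens A B 2 3 1] [hom (prl (.tensor A B) (.plus A B)) 0 1] :=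
  meet
    (· ⇝[2,3,0,4,5,6,7,8,9] (enc_def A B).mirror
    ⇝[0,8,9,10,11] (coplus_xplus_self (.tensor A B) (.plus A B)).symm
    ⇝[10,11,8,9] xplus_comm (.tensor A B) (.plus A B)
    ⇝[11,10,5,7,8,9,12,13,14] coplus_xplus A B (.tensor A B) ⇝[13,14,7,8] xplus_comm B (.tensor A B)
    ⇝[4,6,7,14,13,8,15] (tens_xplus_left A B B).mirror ⇝[12,10,5,14] xplus_comm A (.tensor A B)
    ⇝[15,6,5,10,12,14,16] (tens_xplus_right A B A).mirror ⇝[16,12,6,5] xplus_comm B A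
    ⇝[15,16,12,13,1,4,7,5,6,2,3,17,18,19,20,21,22] contr_contr_tens A B
    ⇝[12,16,19,20] xplus_comm A B ⇝[15,20,19,10,12,23,16] (tens_xplus_right A B A).mirror.symm
    ⇝[17,20,18,23,13,24,15] (tens_xplus_left A B B).mirror.symm
    ⇝[23,13,24,18] xplus_comm (.tensor A B) B ⇝[10,12,23,19] xplus_comm (.tensor A B) A
    ⇝[11,10,19,18,24,25,12,13,23] (coplus_xplus A B (.tensor A B)).symm
    ⇝[11,10,25,24] xplus_comm (.plus A B) (.tensor A B)
    ⇝[0,24,25,10,11] coplus_xplus_self (.tensor A B) (.plus A B) ⇝[25,22,19,18] coplus_tens A B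
    ⇝[24,21,17,20] cotens_tens A B ⇤24 21 ⇝[24,1,22] contr_null (.tensor A B) ⇤24 1)
    (· ⇝[0,1,25] prl_def (.tensor A B) (.plus A B))

theorem cotens_dec (A B : Color) : 𝓡 [(0, .tensor A B)] [(2, B), (1, A)]
    [hom (inl (.tensor A B) (.plus A B)) 0 3, dec A B 3 1 2] [cotens A B 0 1 2] :=
  derive (· ⇝[0,3,4] inl_def (.tensor A B) (.plus A B) ⇝[1,2,3,5,6,7,8,9,10] (enc_def A B).mirror
    ⇝[0,4,9,10,3] (xplus_def (.tensor A B) (.plus A B)).symm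
    ⇝[0,9,10,4] (wire_null (.tensor A B) (.plus A B)).symm ⇤0 9 ⇝[6,8,10] null_coplus A B
    ⇝[5,1,6] contr_null A ⇤5 1 ⇝[7,2,8] contr_null B ⇤7 2)

theorem coplus_dec (A B : Color) : 𝓡 [(0, .plus A B)] [(2, B), (1, A)]
    [hom (inr (.tensor A B) (.plus A B)) 0 3, dec A B 3 1 2] [coplus A B 0 1 2] :=
  derive (· ⇝[0,3,4] inr_def (.tensor A B) (.plus A B) ⇝[1,2,3,5,6,7,8,9,10] (enc_def A B).mirror
    ⇝[4,0,9,10,3] (xplus_def (.tensor A B) (.plus A B)).symm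
    ⇝[0,9,10,4] (null_wire (.tensor A B) (.plus A B)).symm ⇤0 10 ⇝[5,7,9] null_cotens A B
    ⇝[6,1,5] null_contr A ⇤6 1 ⇝[8,2,7] null_contr B ⇤8 2)

theorem dec_plus (A B : Color) : 𝓡 [(0, pairC A B)] [(1, .plus A B)]
    [dec A B 0 2 3, plus A B 2 3 1] [hom (prr (.tensor A B) (.plus A B)) 0 1] :=
  meet
    (· ⇝[2,3,0,4,5,6,7,8,9] (enc_def A B).mirror ⇝[1,2,3,10,11] (coplus_xplus_self A B).mirror.symm
    ⇝[5,4,2] contr_comm A ⇝[7,6,3] contr_comm B ⇝[5,4,3,10,11,2,12,13,14] contr_xplus A B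
    ⇝[4,3,12,13] xplus_comm A B ⇝[7,6,4,13,12,3,15,16,17] contr_xplus B A
    ⇝[6,4,15,16] xplus_comm B A ⇝[16,15,8,4,6] (xplus_tens A B).mirror
    ⇝[7,17,12,16] (wire_null B A).symm ⇤7 17 ⇝[7,13,15] contr_null B ⇤7 13
    ⇝[9,14,11,5,7] coplus_xplus_self A B ⇝[14,10,12] contr_null A ⇤14 10
    ⇝[9,1,14,11] coplus_plus A B ⇤9 1)
    (· ⇝[0,1,8] prr_def (.tensor A B) (.plus A B))

theorem dec_contr (A : Color) : 𝓡 [(0, pairC A A)] [(1, A)]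
    [dec A A 0 2 3, contr A 2 3 1]
    [hom ((prr (.tensor A A) (.plus A A)) ⬝ (addHom (prl A A) (prr A A))) 0 1] :=
  meet
    (· ⇝[2,3,0,4,5,6,7,8,9] (enc_def A A).mirror ⇝[4,5,6,7,1,2,3,10,11] contr_interchange A
    ⇝[4,6,10,12,13] contr_xplus_self A ⇝[12,13,8,4,6] (xplus_tens A A).mirror
    ⇝[13,10,12] null_contr A ⇤13 10 ⇝[11,1,13] null_contr A ⇤11 1)
    (· ⇝[0,1,9] hom_comp (prr (.tensor A A) (.plus A A)) (addHom (prl A A) (prr A A))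
    ⇝[0,9,8] prr_def (.tensor A A) (.plus A A) ⇝[9,1,14,15,16,17] addHom_def (prl A A) (prr A A)
    ⇝[14,16,18] prl_def A A ⇝[15,17,19] prr_def A A
    ⇝[16,18,19,17,9,14,15,20,21,22,23,5,7] (plus_plus_contr A A).mirror
    ⇝[16,20,21,18] (wire_null A A).mirror.symm ⇤20 16 ⇝[17,22,23,19] (null_wire A A).mirror.symm
    ⇤23 17 ⇝[20,5,22] (contr_null A).mirror ⇤5 20 ⇝[23,7,21] (null_contr A).mirror ⇤7 23)

theorem dec_hom {A A' : Color} {f : A ⇒ A'} (hf : IsLin f) (B : Color) :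
    𝓡 [(0, pairC A B)] [(2, B), (1, A')] [dec A B 0 3 2, hom f 3 1]
    [hom (osumHom (tenHom f (Hom.id (of B))) (osumHom f (Hom.id (of B)))) 0 4, dec A' B 4 1 2] :=
  meet
    (· ⇝[3,2,0,5,6,7,8,9,10] (enc_def A B).mirror ⇝[5,6,1,3,11,12] lin_contr hf)
    (· ⇝[0,4,13,14,15,16] osumHom_def (tenHom f (Hom.id (of B))) (osumHom f (Hom.id (of B)))
    ⇝[1,2,4,11,12,7,8,17,18] (enc_def A' B).mirror
    ⇝[15,16,17,18,4] (xplus_def (.tensor A' B) (.plus A' B)).symm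
    ⇝[13,16,17,18,15,9] lin_xplus_left (.plus A' B) (hf.ten (IsLin.id B))
    ⇝[13,14,9,18,16,10] lin_xplus_right (.tensor A B) (hf.osum (IsLin.id B))
    ⇝[0,9,10,13,14] coplus_xplus_self (.tensor A B) (.plus A B)
    ⇝[10,18,19,20,21,22] osumHom_def f (Hom.id (of B)) ⇤20 22
    ⇝[9,17,23,24,25,26] tenHom_def f (Hom.id (of B)) ⇤24 26 ⇝[25,24,11,7,17] (xtens_def A' B).symm
    ⇝[21,20,12,8,18] (xplus_def A' B).symm ⇝[23,24,11,7,25,5] lin_xtens_left B hf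
    ⇝[9,5,7,23,24] cotens_xtens_self A B ⇝[19,20,12,8,21,6] lin_xplus_left B hf
    ⇝[10,6,8,19,20] coplus_xplus_self A B)

theorem contr_coplus_xplus (A B : Color) :
    𝓡 [(1, .plus A B), (0, .plus A B)] [(3, B), (2, A)]
    [contr (.plus A B) 0 1 4, coplus A B 4 2 3]
    [xplus (.plus A B) (.plus A B) 0 1 5 6, coplus A B 5 7 8, coplus A B 6 9 10, contr A 7 9 2,
      contr B 8 10 3] :=
  derive (· ⇝[0,1,2,3,4,11,12,13,14,15,16] contr_coplus A B ⇝[15,16,2,3,17,18,19] xplus_tap A B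
    ⇝[11,13,2,17,15,7,20,9,21] contr_tap A ⇝[12,14,3,18,16,8,22,10,23] contr_tap B
    ⇝[20,21,22,23,19,17,18,24,25] contr_interchange .one
    ⇝[0,7,8,24,5,11,12,20,22] (coplus_tap A B).symm ⇝[1,9,10,25,6,13,14,21,23] (coplus_tap A B).symm
    ⇝[0,1,5,6,24,25,19] (xplus_tap (.plus A B) (.plus A B)).symm)

theorem xplus_coplus_xplus (A B : Color) :
    𝓡 [(1, .plus A B), (0, .plus A B)] [(5, B), (4, A), (3, B), (2, A)]
    [xplus (.plus A B) (.plus A B) 0 1 6 7, coplus A B 6 2 3, coplus A B 7 4 5]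
    [xplus (.plus A B) (.plus A B) 0 1 8 9, coplus A B 8 2 10, coplus A B 9 4 11,
      xplus B B 10 11 3 5] :=
  meet
    (· ⇝[0,1,2,3,7,6,12,13,14] coplus_xplus A B (.plus A B) ⇝[13,14,3,7] xplus_comm B (.plus A B)
    ⇝[14,13,4,5,3,7,15,16,17] coplus_xplus A B B)
    (· ⇝[0,1,2,10,9,8,12,13,14] coplus_xplus A B (.plus A B) ⇝[13,14,10,9] xplus_comm B (.plus A B)
    ⇝[14,13,4,11,10,9,15,16,17] coplus_xplus A B B ⇝[10,11,3,5] xplus_comm B B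
    ⇝[16,17,5,3,11,10] xplus_idem B B)

theorem dec_contr_split (A B : Color) :
    𝓡 [(1, pairC A B), (0, pairC A B)] [(3, B), (2, A)]
    [contr (pairC A B) 0 1 4, dec A B 4 2 3]
    [xplus (pairC A B) (pairC A B) 0 1 5 6, dec A B 5 7 8, dec A B 6 9 10, contr A 7 9 2,
      contr B 8 10 3] :=
  meet
    (· ⇝[2,3,4,11,12,13,14,15,16] (enc_def A B).mirror
    ⇝[0,1,15,16,4,17,18,19,20,21,22] contr_coplus_xplus (.tensor A B) (.plus A B)
    ⇝[20,22,12,14,16,23,24,25,26,27,28] contr_coplus_xplus A B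
    ⇝[19,21,11,13,15,29,30,31,32] contr_cotens A B ⇝[29,31,25,27,2,11,12,7,9] contr_interchange A
    ⇝[30,32,26,28,3,13,14,8,10] contr_interchange B
    ⇝[0,1,19,23,21,24,5,6,17,18,20,22] (xplus_coplus_xplus (.tensor A B) (.plus A B)).symm)
    (· ⇝[7,8,5,29,25,30,26,19,23] (enc_def A B).mirror
    ⇝[9,10,6,31,27,32,28,21,24] (enc_def A B).mirror)

theorem dec_null (A B : Color) : 𝓡 [] [(1, B), (0, A)]
    [null (pairC A B) 2, dec A B 2 0 1] [null A 0, null B 1] :=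
  derive (· ⇝[0,1,2,3,4,5,6,7,8] (enc_def A B).mirror ⇝[7,8,2] null_coplus (.tensor A B) (.plus A B)
    ⇝[4,6,8] null_coplus A B ⇝[3,5,7] null_cotens A B ⇝[4,0,3] null_contr A ⇤4 0
    ⇝[6,1,5] null_contr B ⇤6 1)

theorem xplus_right_comm (A B C : Color) :
    𝓡 [(2, C), (1, B), (0, A)] [(5, C), (4, B), (3, A)]
    [xplus A C 0 2 3 6, xplus B C 1 6 4 5] [xplus B C 1 2 4 7, xplus A C 0 7 3 5] :=
  derive (· ⇝[1,6,4,5] xplus_comm B C ⇝[0,2,1,3,5,4,6,7] xplus_xplus_comm A C B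
    ⇝[2,1,7,4] xplus_comm C B)

theorem xplus_dec_xplus (A B C : Color) :
    𝓡 [(1, C), (0, pairC A B)] [(4, C), (3, B), (2, A)]
    [xplus (pairC A B) C 0 1 5 4, dec A B 5 2 3]
    [xplus (pairC A B) C 0 1 6 7, dec A B 6 8 3, xplus A C 8 7 2 4] :=
  meet
    (· ⇝[2,3,5,9,10,11,12,13,14] (enc_def A B).mirror
    ⇝[0,1,13,14,4,5,15,16,17] coplus_xplus (.tensor A B) (.plus A B) C
    ⇝[16,17,10,12,4,14,18,19,20] coplus_xplus A B C
    ⇝[9,11,17,15,1,13,21] (tens_xplus_left A B C).mirror)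
    (· ⇝[8,3,6,22,23,11,12,24,25] (enc_def A B).mirror
    ⇝[0,1,24,25,7,6,15,16,26] coplus_xplus (.tensor A B) (.plus A B) C
    ⇝[16,26,23,12,7,25,18,19,27] coplus_xplus A B C
    ⇝[22,11,26,15,1,24,21] (tens_xplus_left A B C).mirror ⇝[22,23,7,2,4,8,10,28,9] contr_xplus A C
    ⇝[19,23,27,12,10,28,7,29] xplus_right_comm B A C ⇝[18,26,10,29,23,27] xplus_idem A C
    ⇝[19,22,29,12,9,4,28,20] xplus_right_comm B A C ⇝[18,22,26,10,9,20,29,17] xplus_right_comm A A C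
    ⇝[21,1,9,17,22,26] xplus_idem A C)

theorem xplus_dec_dec (A B : Color) :
    𝓡 [(1, pairC A B), (0, pairC A B)] [(5, B), (4, A), (3, B), (2, A)]
    [xplus (pairC A B) (pairC A B) 0 1 6 7, dec A B 6 2 3, dec A B 7 4 5]
    [xplus (pairC A B) (pairC A B) 0 1 8 9, dec A B 8 10 3, dec A B 9 11 5, xplus A A 10 11 2 4] :=
  derive (· ⇝[0,1,2,3,7,6,12,13,14] xplus_dec_xplus A B (pairC A B)
    ⇝[14,13,2,7] xplus_comm A (pairC A B) ⇝[13,14,4,5,2,7,9,10,11] xplus_dec_xplus A B A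
    ⇝[13,14,9,10] xplus_comm (pairC A B) A
    ⇝[0,1,10,3,9,8,12,13,14] (xplus_dec_xplus A B (pairC A B)).symm ⇝[11,10,4,2] xplus_comm A A)

theorem dec_dec_contr (D A B : Color) :
    𝓡 [(1, pairC (pairC D A) B), (0, pairC (pairC D A) B)] [(4, B), (3, A), (2, D)]
    [contr (pairC (pairC D A) B) 0 1 5, dec (pairC D A) B 5 6 4, dec D A 6 2 3]
    [xplus (pairC (pairC D A) B) (pairC (pairC D A) B) 0 1 7 8, dec (pairC D A) B 7 9 10,
      dec D A 9 11 12, dec (pairC D A) B 8 13 14, dec D A 13 15 16, contr D 11 15 2,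
      contr A 12 16 3, contr B 10 14 4] :=
  derive (· ⇝[0,1,6,4,5,17,18,19,10,20,14] dec_contr_split (pairC D A) B
    ⇝[19,20,2,3,6,9,13,11,12,15,16] dec_contr_split D A
    ⇝[0,1,9,10,13,14,7,8,17,18,19,20] (xplus_dec_dec (pairC D A) B).symm)

theorem tenState_dec {A B : Color} {f : .one ⇒ A} (hf : IsLin f) {g : .one ⇒ B} (hg : IsLin g) :
    𝓡 [(0, .one)] [(2, B), (1, A)]
    [hom ((tenState f g) ⬝ (inl (.tensor A B) (.plus A B))) 0 3, dec A B 3 1 2]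
    [tapR .one 0 4 5, hom f 4 1, hom g 5 2] :=
  derive (· ⇝[0,3,6] hom_comp (tenState f g) (inl (.tensor A B) (.plus A B))
    ⇝[6,1,2,3] cotens_dec A B ⇝[0,6,7,8,9,10] tenState_def f g ⇝[9,10,1,2,6] (xtens_def A B).symm
    ⇝[7,10,1,2,9,4] lin_xtens_left B hf ⇝[7,8,4,2,10,5] lin_xtens_right .one hg
    ⇝[0,7,8,11] tapR_def .one ⇝[11,4,5,7,8] cotens_xtens_self .one .one
    ⇝[0,4,5,11] (tapR_def .one).symm)

theorem inl_inr_dec {C A : Color} (B : Color) (f : C ⇒ A) :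
    𝓡 [(0, C)] [(2, B), (1, A)]
    [hom ((f ⬝ (inl A B)) ⬝ (inr (.tensor A B) (.plus A B))) 0 3, dec A B 3 1 2]
    [hom f 0 1, null B 2] :=
  derive (· ⇝[0,3,4] hom_comp (f ⬝ (inl A B)) (inr (.tensor A B) (.plus A B))
    ⇝[4,1,2,3] coplus_dec A B ⇝[0,4,5] hom_comp f (inl A B) ⇝[5,4,6] inl_def A B
    ⇝[5,6,1,2,4] (xplus_def A B).symm ⇝[5,1,2,6] (wire_null A B).symm ⇤5 1)

theorem inr_inr_dec {C B : Color} (A : Color) (f : C ⇒ B) :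
    𝓡 [(0, C)] [(2, B), (1, A)]
    [hom ((f ⬝ (inr A B)) ⬝ (inr (.tensor A B) (.plus A B))) 0 3, dec A B 3 1 2]
    [null A 1, hom f 0 2] :=
  derive (· ⇝[0,3,4] hom_comp (f ⬝ (inr A B)) (inr (.tensor A B) (.plus A B))
    ⇝[4,1,2,3] coplus_dec A B ⇝[0,4,5] hom_comp f (inr A B) ⇝[5,4,6] inr_def A B
    ⇝[6,5,1,2,4] (xplus_def A B).symm ⇝[5,1,2,6] (null_wire A B).symm ⇤5 2)

theorem dec_swap_comp {E : Color} {C D A B : Color} {γ : pairC (pairC D A) B ⇒ pairC (pairC D B) A} {h : C ⇒ pairC (pairC D A) B} (p : E ⇒ C) (ih : DecSwap γ h) :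
    𝓡 [(0, E)] [(3, A), (2, B), (1, D)]
    [hom (p ⬝ h) 0 4, dec (pairC D A) B 4 5 2, dec D A 5 1 3]
    [hom (p ⬝ h) 0 6, hom γ 6 7, dec (pairC D B) A 7 8 3, dec D B 8 1 2] :=
  meet
    (· ⇝[0,4,9] hom_comp p h ⇝[9,1,2,3,4,5,6,7,8] ih)
    (· ⇝[0,6,9] hom_comp p h)

theorem dec_swap_zero (C : Color) {D A B : Color} {γ : pairC (pairC D A) B ⇒ pairC (pairC D B) A} (hγ : IsLin γ) :
    𝓡 [(0, C)] [(3, A), (2, B), (1, D)]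
    [hom (zeroHom C (pairC (pairC D A) B)) 0 4, dec (pairC D A) B 4 5 2, dec D A 5 1 3]
    [hom (zeroHom C (pairC (pairC D A) B)) 0 6, hom γ 6 7, dec (pairC D B) A 7 8 3,
      dec D B 8 1 2] :=
  meet
    (· ⇝[0,4] zeroHom_def C (pairC (pairC D A) B) ⇝[5,2,4] dec_null (pairC D A) B
    ⇝[1,3,5] dec_null D A)
    (· ⇝[0,6] zeroHom_def C (pairC (pairC D A) B) ⇝[7,6] lin_null hγ ⇝[8,3,7] dec_null (pairC D B) A
    ⇝[1,2,8] dec_null D B)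

theorem dec_swap_add {C D A B : Color} {γ : pairC (pairC D A) B ⇒ pairC (pairC D B) A} (hγ : IsLin γ) {h k : C ⇒ pairC (pairC D A) B} (hh : IsLin h) (hk : IsLin k) (ih : DecSwap γ h) (ih2 : DecSwap γ k) :
    𝓡 [(0, C)] [(3, A), (2, B), (1, D)]
    [hom (addHom h k) 0 4, dec (pairC D A) B 4 5 2, dec D A 5 1 3]
    [hom (addHom h k) 0 6, hom γ 6 7, dec (pairC D B) A 7 8 3, dec D B 8 1 2] :=
  meet
    (· ⇝[0,4,9,10,11,12] addHom_def h k
    ⇝[11,12,1,3,2,4,5,13,14,15,16,17,18,19,20,21,22] dec_dec_contr D A B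
    ⇝[9,12,13,14,11,23] lin_xplus_left (pairC (pairC D A) B) hh
    ⇝[9,10,23,14,12,24] lin_xplus_right C hk ⇝[23,17,16,18,13,15,25,26,27] ih
    ⇝[24,21,20,22,14,19,28,29,30] ih2)
    (· ⇝[0,6,9,10,31,32] addHom_def h k ⇝[31,32,7,6,33,34] lin_contr hγ
    ⇝[33,34,1,2,3,7,8,26,29,27,18,17,16,30,22,21,20] dec_dec_contr D B A
    ⇝[31,34,26,29,33,25] lin_xplus_left (pairC (pairC D B) A) hγ
    ⇝[31,32,25,29,34,28] lin_xplus_right (pairC (pairC D A) B) hγ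
    ⇝[9,32,25,28,31,23] lin_xplus_left (pairC (pairC D A) B) hh
    ⇝[9,10,23,28,32,24] lin_xplus_right C hk)

theorem dec_swap_dab {D A B : Color} {f : .one ⇒ D} (hf : IsLin f) {g : .one ⇒ A} (hg : IsLin g) {h : .one ⇒ B} (hh : IsLin h) :
    𝓡 [(0, .one)] [(3, A), (2, B), (1, D)]
    [hom ((tenState ((tenState f g) ⬝ (inl (.tensor D A) (.plus D A))) h) ⬝ (inl (.tensor (pairC D A) B) (.plus (pairC D A) B))) 0 4, dec (pairC D A) B 4 5 2, dec D A 5 1 3]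
    [hom ((tenState ((tenState f h) ⬝ (inl (.tensor D B) (.plus D B))) g) ⬝ (inl (.tensor (pairC D B) A) (.plus (pairC D B) A))) 0 6, dec (pairC D B) A 6 7 3, dec D B 7 1 2] :=
  meet
    (· ⇝[0,5,2,4,8,9] tenState_dec ((IsLin.tenState hf hg).comp (.inl (.tensor D A) (.plus D A))) hh
    ⇝[8,1,3,5,10,11] tenState_dec hf hg ⇝[0,10,9,11,8,12] tap_tap_comm .one)
    (·
    ⇝[0,7,3,6,12,11] tenState_dec ((IsLin.tenState hf hh).comp (.inl (.tensor D B) (.plus D B))) hg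
    ⇝[12,1,2,7,10,9] tenState_dec hf hh)

theorem dec_swap_db {D A B : Color} {f : .one ⇒ D} (hf : IsLin f) {h : .one ⇒ B} (hh : IsLin h) :
    𝓡 [(0, .one)] [(3, A), (2, B), (1, D)]
    [hom ((tenState ((f ⬝ (inl D A)) ⬝ (inr (.tensor D A) (.plus D A))) h) ⬝ (inl (.tensor (pairC D A) B) (.plus (pairC D A) B))) 0 4, dec (pairC D A) B 4 5 2, dec D A 5 1 3]
    [hom ((((tenState f h) ⬝ (inl (.tensor D B) (.plus D B))) ⬝ (inl (pairC D B) A)) ⬝ (inr (.tensor (pairC D B) A) (.plus (pairC D B) A))) 0 6, dec (pairC D B) A 6 7 3, dec D B 7 1 2] :=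
  meet
    (· ⇝[0,5,2,4,8,9] tenState_dec ((hf.comp (.inl D A)).comp (.inr (.tensor D A) (.plus D A))) hh
    ⇝[8,1,3,5] inl_inr_dec A f)
    (· ⇝[0,7,3,6] inl_inr_dec A ((tenState f h) ⬝ (inl (.tensor D B) (.plus D B)))
    ⇝[0,1,2,7,8,9] tenState_dec hf hh)

theorem dec_swap_da {D A B : Color} {f : .one ⇒ D} (hf : IsLin f) {g : .one ⇒ A} (hg : IsLin g) :
    𝓡 [(0, .one)] [(3, A), (2, B), (1, D)]
    [hom ((((tenState f g) ⬝ (inl (.tensor D A) (.plus D A))) ⬝ (inl (pairC D A) B)) ⬝ (inr (.tensor (pairC D A) B) (.plus (pairC D A) B))) 0 4, dec (pairC D A) B 4 5 2, dec D A 5 1 3]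
    [hom ((tenState ((f ⬝ (inl D B)) ⬝ (inr (.tensor D B) (.plus D B))) g) ⬝ (inl (.tensor (pairC D B) A) (.plus (pairC D B) A))) 0 6, dec (pairC D B) A 6 7 3, dec D B 7 1 2] :=
  meet
    (· ⇝[0,5,2,4] inl_inr_dec B ((tenState f g) ⬝ (inl (.tensor D A) (.plus D A)))
    ⇝[0,1,3,5,8,9] tenState_dec hf hg)
    (· ⇝[0,7,3,6,8,9] tenState_dec ((hf.comp (.inl D B)).comp (.inr (.tensor D B) (.plus D B))) hg
    ⇝[8,1,2,7] inl_inr_dec B f)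

theorem dec_swap_ab {D A B : Color} {g : .one ⇒ A} (hg : IsLin g) {h : .one ⇒ B} (hh : IsLin h) :
    𝓡 [(0, .one)] [(3, A), (2, B), (1, D)]
    [hom ((tenState ((g ⬝ (inr D A)) ⬝ (inr (.tensor D A) (.plus D A))) h) ⬝ (inl (.tensor (pairC D A) B) (.plus (pairC D A) B))) 0 4, dec (pairC D A) B 4 5 2, dec D A 5 1 3]
    [hom ((tenState ((h ⬝ (inr D B)) ⬝ (inr (.tensor D B) (.plus D B))) g) ⬝ (inl (.tensor (pairC D B) A) (.plus (pairC D B) A))) 0 6, dec (pairC D B) A 6 7 3, dec D B 7 1 2] :=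
  meet
    (· ⇝[0,5,2,4,8,9] tenState_dec ((hg.comp (.inr D A)).comp (.inr (.tensor D A) (.plus D A))) hh
    ⇝[8,1,3,5] inr_inr_dec D g ⇝[0,8,9] tap_one_comm)
    (· ⇝[0,7,3,6,9,8] tenState_dec ((hh.comp (.inr D B)).comp (.inr (.tensor D B) (.plus D B))) hg
    ⇝[9,1,2,7] inr_inr_dec D h)

theorem dec_swap_d {D A B : Color} (f : .one ⇒ D) :
    𝓡 [(0, .one)] [(3, A), (2, B), (1, D)]
    [hom ((((f ⬝ (inl D A)) ⬝ (inr (.tensor D A) (.plus D A))) ⬝ (inl (pairC D A) B)) ⬝ (inr (.tensor (pairC D A) B) (.plus (pairC D A) B))) 0 4, dec (pairC D A) B 4 5 2, dec D A 5 1 3]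
    [hom ((((f ⬝ (inl D B)) ⬝ (inr (.tensor D B) (.plus D B))) ⬝ (inl (pairC D B) A)) ⬝ (inr (.tensor (pairC D B) A) (.plus (pairC D B) A))) 0 6, dec (pairC D B) A 6 7 3, dec D B 7 1 2] :=
  meet
    (· ⇝[0,5,2,4] inl_inr_dec B ((f ⬝ (inl D A)) ⬝ (inr (.tensor D A) (.plus D A)))
    ⇝[0,1,3,5] inl_inr_dec A f)
    (· ⇝[0,7,3,6] inl_inr_dec A ((f ⬝ (inl D B)) ⬝ (inr (.tensor D B) (.plus D B)))
    ⇝[0,1,2,7] inl_inr_dec B f)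

theorem dec_swap_a {D A B : Color} (g : .one ⇒ A) :
    𝓡 [(0, .one)] [(3, A), (2, B), (1, D)]
    [hom ((((g ⬝ (inr D A)) ⬝ (inr (.tensor D A) (.plus D A))) ⬝ (inl (pairC D A) B)) ⬝ (inr (.tensor (pairC D A) B) (.plus (pairC D A) B))) 0 4, dec (pairC D A) B 4 5 2, dec D A 5 1 3]
    [hom ((g ⬝ (inr (pairC D B) A)) ⬝ (inr (.tensor (pairC D B) A) (.plus (pairC D B) A))) 0 6,
      dec (pairC D B) A 6 7 3, dec D B 7 1 2] :=
  meet
    (· ⇝[0,5,2,4] inl_inr_dec B ((g ⬝ (inr D A)) ⬝ (inr (.tensor D A) (.plus D A)))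
    ⇝[0,1,3,5] inr_inr_dec D g)
    (· ⇝[0,7,3,6] inr_inr_dec (pairC D B) g ⇝[1,2,7] dec_null D B)

theorem dec_swap_b {D A B : Color} (h : .one ⇒ B) :
    𝓡 [(0, .one)] [(3, A), (2, B), (1, D)]
    [hom ((h ⬝ (inr (pairC D A) B)) ⬝ (inr (.tensor (pairC D A) B) (.plus (pairC D A) B))) 0 4,
      dec (pairC D A) B 4 5 2, dec D A 5 1 3]
    [hom ((((h ⬝ (inr D B)) ⬝ (inr (.tensor D B) (.plus D B))) ⬝ (inl (pairC D B) A)) ⬝ (inr (.tensor (pairC D B) A) (.plus (pairC D B) A))) 0 6, dec (pairC D B) A 6 7 3, dec D B 7 1 2] :=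
  meet
    (· ⇝[0,5,2,4] inr_inr_dec (pairC D A) h ⇝[1,3,5] dec_null D A)
    (· ⇝[0,7,3,6] inl_inr_dec A ((h ⬝ (inr D B)) ⬝ (inr (.tensor D B) (.plus D B)))
    ⇝[0,1,2,7] inr_inr_dec D h)

end Rule

/-- The matrix with a single entry, as a linear diagram. -/
def Lin.single {A B : Color} (i : Ix A) (j : Ix B) (s : R) : Lin R A B :=
  ⟨bra A i ⬝ sc s ⬝ ket B j, ((IsLin.bra A i).comp (.scal _ _)).comp (.ket B j)⟩

/-- The matrix with given entries, as a linear diagram. -/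
def Lin.ofMatrix {A B : Color} (s : Ix A → Ix B → R) : Lin R A B := ∑ i, ∑ j, single i j (s i j)

theorem Lin.conj_ofMatrix {A B C D : Color} (p : Lin R C A) (q : Lin R B D)
    (s : Ix A → Ix B → R) :
    conj p q (ofMatrix s) = ∑ i, ∑ j, conj p q (single i j (s i j)) := by
  rw [ofMatrix, map_sum]
  exact Finset.sum_congr rfl fun i _ => map_sum _ _ _

theorem Lin.entry_ofMatrix {A B : Color} (s : Ix A → Ix B → R) (i : Ix A) (j : Ix B) :
    ket A i ⬝ (ofMatrix s).1 ⬝ bra B j = sc (s i j) := by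
  have e : conj ⟨ket A i, .ket A i⟩ ⟨bra B j, .bra B j⟩ (ofMatrix s) = scalar (s i j) := by
    have e' : s i j = ∑ i', ∑ j', (if i = i' then 1 else 0) * s i' j' *
        if j' = j then (1 : R) else 0 := by simp
    rw [e', map_sum]
    refine (conj_ofMatrix _ _ s).trans (Finset.sum_congr rfl fun i' _ => ?_)
    rw [map_sum]
    refine Finset.sum_congr rfl fun j' _ => Subtype.ext ?_
    change ket A i ⬝ (bra A i' ⬝ sc (s i' j') ⬝ ket B j') ⬝ bra B j = sc _
    rw [← sc_mul, ← sc_mul, ← ket_bra, ← ket_bra]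
    simp only [Hom.assoc]
  exact congrArg Subtype.val e

theorem IsMat.ofMatrix {A B : Color} (s : Ix A → Ix B → R) : IsMat (Lin.ofMatrix s).1 :=
  ⟨(Lin.ofMatrix s).2, fun i j => ⟨s i j, Lin.entry_ofMatrix s i j⟩⟩

theorem exists_isMat {A B : Color} (σ : Ix A → Ix B) :
    ∃ γ : A ⇒ B, IsMat γ ∧ ∀ i, ket A i ⬝ γ = ket B (σ i) := by
  refine ⟨_, .ofMatrix fun i j => if σ i = j then 1 else 0, fun i => ?_⟩
  refine ext_entry ((IsLin.ket A i).comp (Lin.ofMatrix _).2) (.ket B _) fun _ j => ?_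
  refine Eq.trans ?_ (Eq.trans (Lin.ket_bra B (σ i) j).symm ?_)
  · rw [← Lin.entry_ofMatrix (fun i j => if σ i = j then 1 else 0) i j]
    exact congrArg (· ⬝ _) (Hom.id_comp _)
  · exact congrArg (· ⬝ _) (Hom.id_comp _).symm

/-- The permutation of indices induced by the swap of two of three wires. -/
def Ix.swapPair {D A B : Color} :
    Ix (pairC (pairC D A) B) → Ix (pairC (pairC D B) A)
  | .inl (.inl (d, a), b) => .inl (.inl (d, b), a)
  | .inl (.inr (.inl d), b) => .inr (.inl (.inl (d, b)))
  | .inl (.inr (.inr a), b) => .inl (.inr (.inr b), a)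
  | .inr (.inl (.inl (d, a))) => .inl (.inr (.inl d), a)
  | .inr (.inl (.inr (.inl d))) => .inr (.inl (.inr (.inl d)))
  | .inr (.inl (.inr (.inr a))) => .inr (.inr a)
  | .inr (.inr b) => .inr (.inl (.inr (.inr b)))

theorem DecSwap.of_state {C D A B : Color} {γ : pairC (pairC D A) B ⇒ pairC (pairC D B) A}
    {h : C ⇒ pairC (pairC D A) B} {k : C ⇒ pairC (pairC D B) A}
    (e : h ⬝ γ = k) (r : Rule [(0, C)] [(3, A), (2, B), (1, D)]
      [Step.hom h 0 4, Step.dec (pairC D A) B 4 5 2, Step.dec D A 5 1 3]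
      [Step.hom k 0 6, Step.dec (pairC D B) A 6 7 3, Step.dec D B 7 1 2]) : DecSwap γ h :=
  meet (fun q => q ⇝[0,1,2,3,4,5,7,8] r)
    (fun q => q ⇝[0,7,6] (Rule.hom_comp h γ).symm ⇝[0,7] Rule.of_hom e)

theorem exists_decSwap (D A B : Color) :
    ∃ γ : pairC (pairC D A) B ⇒ pairC (pairC D B) A,
      IsMat γ ∧ DecSwap γ (.id _) := by
  obtain ⟨γ, hγ, e⟩ := exists_isMat (R := R) (Ix.swapPair (D := D) (A := A) (B := B))
  refine ⟨γ, hγ, ?_⟩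
  have h : ∀ s : Finset (Ix (pairC (pairC D A) B)),
      DecSwap γ (∑ i ∈ s, Lin.proj (R := R) _ i).1 := by
    intro s
    induction s using Finset.induction_on with
    | empty => exact Rule.dec_swap_zero _ hγ.lin
    | insert i s hi ih =>
      rw [Finset.sum_insert hi]
      refine Rule.dec_swap_add hγ.lin (Subtype.prop _) (Subtype.prop _)
        (Rule.dec_swap_comp (bra _ i) (.of_state (e i) ?_)) ih
      match i with
      | .inl (.inl (d, a), b) => exact Rule.dec_swap_dab (.ket D d) (.ket A a) (.ket B b)
      | .inl (.inr (.inl d), b) => exact Rule.dec_swap_db (.ket D d) (.ket B b)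
      | .inl (.inr (.inr a), b) => exact Rule.dec_swap_ab (.ket A a) (.ket B b)
      | .inr (.inl (.inl (d, a))) => exact Rule.dec_swap_da (.ket D d) (.ket A a)
      | .inr (.inl (.inr (.inl d))) => exact Rule.dec_swap_d (ket D d)
      | .inr (.inl (.inr (.inr a))) => exact Rule.dec_swap_a (ket A a)
      | .inr (.inr b) => exact Rule.dec_swap_b (ket B b)
  have h' := h Finset.univ
  rw [← Lin.id_eq_sum] at h'
  exact h'

/-- Decoding three wires and swapping the last two. -/
theorem exists_decHom_swap (D A B : Color) :
    ∃ γ : pairC (pairC D A) B ⇒ pairC (pairC D B) A, IsMat γ ∧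
      decHom (pairC D A) B ⬝ (decHom D A ◃ B) ⬝ Hom.tw (of D) A B =
        γ ⬝ (decHom (pairC D B) A ⬝ (decHom D B ◃ A)) := by
  obtain ⟨γ, hγ, h⟩ := exists_decSwap (R := R) D A B
  refine ⟨γ, hγ, ?_⟩
  have e := Rule.eval (▣(Step.hom (.id _) 0 4) ⨾ ▣(Step.dec (pairC D A) B 4 5 2) ⨾
    (▣(Step.dec D A 5 1 3) ⫼ ▤[(2, B)]) ⨾
      (▤[(1, D)] ⫼ ⤨ [(3, A)] [(2, B)]) ⨾
      ▤[(3, A), (2, B), (1, D)])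
    (▣(Step.hom (.id _) 0 6) ⨾ ▣(Step.hom γ 6 7) ⨾ ▣(Step.dec (pairC D B) A 7 8 3) ⨾
      (▣(Step.dec D B 8 1 2) ⫼ ▤[(3, A)]) ⨾ ▤[(3, A), (2, B), (1, D)]) h
  have e' : Hom.id _ ⬝ decHom (pairC D A) B ⬝ (decHom D A ◃ B) ⬝ Hom.tw (of D) A B ⬝ Hom.id _ =
      Hom.id _ ⬝ γ ⬝ decHom (pairC D B) A ⬝ (decHom D B ◃ A) ⬝ Hom.id _ := e
  simp only [Hom.id_comp, Hom.comp_id] at e'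
  exact e'.trans (Hom.assoc γ _ _)

/-- The passage from a Plus with a Unit to the encoding of a wire with a Unit. -/
def unitMap (D : Color) : (.plus D .one) ⇒ (pairC D .one) :=
  addHom (prl D .one ⬝ Hom.mk (Diag.adapt (Color.Approx.symm (.tensor_one D))) ⬝
    inl (.tensor D .one) (.plus D .one)) (inr (.tensor D .one) (.plus D .one))

namespace Rule

open Step

theorem dec_conull (D B : Color) : 𝓡 [(0, pairC D B)] [(1, B)]
    [dec D B 0 2 1, conull D 2] [hom ((prr (.tensor D B) (.plus D B)) ⬝ (prr D B)) 0 1] :=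
  meet
    (· ⇝[2,1,0,3,4,5,6,7,8] (enc_def D B).mirror ⇝[3,4,2] (null_cocontr D).mirror
    ⇝[5,7,3] (null_tens_left D B).mirror ⇝[6,1,5] null_contr B ⇤6 1)
    (· ⇝[0,1,8] hom_comp (prr (.tensor D B) (.plus D B)) (prr D B)
    ⇝[0,8,7] prr_def (.tensor D B) (.plus D B) ⇝[8,1,4] prr_def D B)

theorem unit_enc (D : Color) : 𝓡 [(0, D)] [(1, pairC D .one)] [unit 2, enc D .one 0 2 1]
    [unit 3, plus D .one 0 3 4,
      hom (addHom (((prl D .one) ⬝ (Hom.mk (Diag.adapt (Color.Approx.symm (.tensor_one D))))) ⬝ (inl (.tensor D .one) (.plus D .one))) (inr (.tensor D .one) (.plus D .one))) 4 1] :=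
  meet
    (· ⇝[0,2,1,5,6,7,8,9,10] enc_def D .one ⇝[7,8,11,3,2] counit_xplus.mirror.symm
    ⇝[5,11,3,9,8,12,7] (tens_xplus_right D .one .one).symm
    ⇝[5,11,3,9,8,12,13] tens_xplus_left D .one .one
    ⇝[10,6,8,14,15] (coplus_xplus_self D .one).mirror.symm
    ⇝[13,14,15,0,3,16,6,8,5] (contr_xplus D .one).mirror.symm ⇥9 17
    ⇝[9,17] (adapt_self (Color.Approx.trans (.tensor_one D) (Color.Approx.symm (.tensor_one D)))).symm
    ⇝[9,17,18] (adapt_adapt (.tensor_one D) (Color.Approx.symm (.tensor_one D)) (Color.Approx.trans (.tensor_one D) (Color.Approx.symm (.tensor_one D)))).symm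
    ⇝[13,11,18,9] (untapR_def D).symm ⇝[18,13,11] (tapR_counit D).mirror ⇤13 18)
    (·
    ⇝[4,1,19,10,20,21] addHom_def (((prl D .one) ⬝ (Hom.mk (Diag.adapt (Color.Approx.symm (.tensor_one D))))) ⬝ (inl (.tensor D .one) (.plus D .one))) (inr (.tensor D .one) (.plus D .one))
    ⇝[19,20,17] hom_comp ((prl D .one) ⬝ (Hom.mk (Diag.adapt (Color.Approx.symm (.tensor_one D))))) (inl (.tensor D .one) (.plus D .one))
    ⇝[19,17,22] hom_comp (prl D .one) (Hom.mk (Diag.adapt (Color.Approx.symm (.tensor_one D))))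
    ⇝[19,22,23] prl_def D .one ⇝[17,20,24] inl_def (.tensor D .one) (.plus D .one)
    ⇝[10,21,25] inr_def (.tensor D .one) (.plus D .one)
    ⇝[17,24,25,10,1,20,21,26,27,28,29,30,31] plus_plus_contr (.tensor D .one) (.plus D .one)
    ⇝[17,26,27,24] (wire_null (.tensor D .one) (.plus D .one)).symm ⇤17 26
    ⇝[10,28,29,25] (null_wire (.tensor D .one) (.plus D .one)).symm ⇤10 29
    ⇝[17,30,28] contr_null (.tensor D .one) ⇤17 30 ⇝[10,31,27] null_contr (.plus D .one) ⇤10 31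
    ⇝[19,10,0,3,4,13,32,14,33,16,15] (contr_coplus D .one).mirror
    ⇝[13,32,22,23,19] (xplus_def D .one).symm ⇝[22,13,32,23] (wire_null D .one).mirror.symm ⇤13 22
    ⇝[33,15,32] (null_contr .one).mirror ⇤15 33)

theorem unit_unit : 𝓡 [] [(1, .one), (0, .one)]
    [unit 2, cocontr .one 2 3 4, plus .one .one 3 4 5,
      hom (addHom (((prl .one .one) ⬝ (Hom.mk (Diag.adapt (Color.Approx.symm (.tensor_one .one))))) ⬝ (inl (.tensor .one .one) (.plus .one .one))) (inr (.tensor .one .one) (.plus .one .one))) 5 6, dec .one .one 6 0 1]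
    [unit 0, unit 1] :=
  derive (· ⇝[3,4,7,8,2] counit_xplus.mirror.symm ⇝[5,7,8,3,4] (coplus_xplus_self .one .one).mirror
    ⇝[7,6,9,8,5] (unit_enc .one).symm ⇝[7,9,0,1,6] enc_dec .one .one ⇤7 0 ⇤9 1)

end Rule

theorem IsMat.unitMap (D : Color) : IsMat (unitMap (R := R) D) :=
  (((IsMat.prl _ _).comp (.adapt _)).comp (.inl _ _)).add (.inr _ _)

section Hom

open Step

theorem encHom_decHom (A B : Color) : encHom (R := R) A B ⬝ decHom A B = .id _ :=
  Rule.eval (▣(enc A B 0 1 4) ⨾ ▣(dec A B 4 2 3)) (▣(wire R A 0 2) ⫼ ▣(wire R B 1 3))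
    (Rule.enc_dec A B) |>.trans (Hom.par_id _ _)

theorem decHom_tens (A B : Color) :
    decHom A B ⬝ Hom.mk (Diag.tens A B) = prl (R := R) (.tensor A B) (.plus A B) :=
  Rule.eval (▣(dec A B 0 2 3) ⨾ ▣(tens A B 2 3 1)) ▣(hom (prl (.tensor A B) (.plus A B)) 0 1) (Rule.dec_tens (R := R) A B)

theorem decHom_plus (A B : Color) :
    decHom A B ⬝ Hom.mk (Diag.plus A B) = prr (R := R) (.tensor A B) (.plus A B) :=
  Rule.eval (▣(dec A B 0 2 3) ⨾ ▣(plus A B 2 3 1)) ▣(hom (prr (.tensor A B) (.plus A B)) 0 1) (Rule.dec_plus (R := R) A B)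

theorem decHom_contr (A : Color) : decHom A A ⬝ Hom.mk (Diag.contr A) =
    prr (R := R) (.tensor A A) (.plus A A) ⬝ addHom (prl A A) (prr A A) :=
  Rule.eval (▣(dec A A 0 2 3) ⨾ ▣(contr A 2 3 1)) ▣(hom (prr (.tensor A A) (.plus A A) ⬝ addHom (prl A A) (prr A A)) 0 1) (Rule.dec_contr (R := R) A)

theorem inl_decHom (A B : Color) :
    inl (R := R) (.tensor A B) (.plus A B) ⬝ decHom A B = Hom.mk (Diag.cotens A B) :=
  Rule.eval (▣(hom (inl (.tensor A B) (.plus A B)) 0 3) ⨾ ▣(dec A B 3 1 2)) ▣(cotens A B 0 1 2) (Rule.cotens_dec (R := R) A B)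

theorem inr_decHom (A B : Color) :
    inr (R := R) (.tensor A B) (.plus A B) ⬝ decHom A B = Hom.mk (Diag.coplus A B) :=
  Rule.eval (▣(hom (inr (.tensor A B) (.plus A B)) 0 3) ⨾ ▣(dec A B 3 1 2)) ▣(coplus A B 0 1 2) (Rule.coplus_dec (R := R) A B)

theorem decHom_whisk {A A' : Color} {f : A ⇒ A'} (hf : IsLin f) (B : Color) :
    decHom A B ⬝ (f ◃ B) =
      osumHom (tenHom f (.id (of B))) (osumHom f (.id (of B))) ⬝ decHom A' B :=
  Rule.eval (▣(dec A B 0 3 2) ⨾ (▣(hom f 3 1) ⫼ ▤[(2, B)]))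
    (▣(hom (osumHom (tenHom f (.id (of B))) (osumHom f (.id (of B)))) 0 4) ⨾ ▣(dec A' B 4 1 2)) (Rule.dec_hom hf B)

theorem decHom_conull (D B : Color) :
    decHom D B ⬝ (Hom.mk (Diag.conull D) ◃ B) =
      prr (R := R) (.tensor D B) (.plus D B) ⬝ prr D B :=
  Rule.eval (▣(dec D B 0 2 1) ⨾ (▣(conull D 2) ⫼ ▤[(1, B)])) ▣(hom (prr (.tensor D B) (.plus D B) ⬝ prr D B) 0 1)
    (Rule.dec_conull (R := R) D B)

/-- A wire with a Unit. -/
def addUnit (X : Obj) : Hom R X (snoc X .one) := Hom.id X ⊠ Hom.mk Diag.unit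

theorem addUnit_encHom (D : Color) : addUnit (of D) ⬝ encHom D .one =
    addUnit (of D) ⬝ Hom.mk (Diag.plus D .one) ⬝ unitMap (R := R) D :=
  Rule.eval ((▤[(0, D)] ⫼ ▣(unit 2)) ⨾ ▣(enc D .one 0 2 1))
    ((▤[(0, D)] ⫼ ▣(unit 3)) ⨾ ▣(plus D .one 0 3 4) ⨾ ▣(hom (unitMap D) 4 1))
    (Rule.unit_enc (R := R) D)

/-- The duplication of a Unit. -/
def unitDup : Hom R (of .one) (of .one ++ of .one) :=
  Hom.mk (Diag.cocontr .one) ⬝ Hom.mk (Diag.plus .one .one) ⬝ unitMap .one ⬝ decHom .one .one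

theorem unit_addUnit : Hom.mk Diag.unit ⬝ addUnit (of .one) = Hom.mk Diag.unit ⬝ unitDup (R := R) := by
  have e := Rule.eval (▣(unit 2) ⨾ ▣(cocontr .one 2 3 4) ⨾ ▣(plus .one .one 3 4 5) ⨾ ▣(hom (unitMap .one) 5 6) ⨾
      ▣(dec .one .one 6 0 1)) (▣(unit 0) ⨾ (▤[(0, .one)] ⫼ ▣(unit 1)))
    (Rule.unit_unit (R := R))
  refine e.symm.trans ?_
  change Hom.mk Diag.unit ⬝ Hom.mk (Diag.cocontr .one) ⬝ Hom.mk (Diag.plus .one .one) ⬝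
    unitMap .one ⬝ decHom .one .one = _
  rw [unitDup, Hom.assoc, Hom.assoc, Hom.assoc, Hom.assoc, Hom.assoc]

end Hom

/-! ### The single wire encoding of an object -/

/-- The color of the encoding of an object on a single wire. -/
def Obj.color : Obj → Color
  | .nil => .zero
  | .snoc X B => pairC X.color B

/-- The encoding of an object on a single wire. -/
def encObj : (X : Obj) → Hom R X (of X.color)
  | .nil => Hom.mk (Diag.null .zero)
  | .snoc X B => (encObj X ◃ B) ⬝ encHom X.color B

/-- The decoding of an object from a single wire. -/
def decObj : (X : Obj) → Hom R (of X.color) X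
  | .nil => Hom.mk (Diag.conull .zero)
  | .snoc X B => decHom X.color B ⬝ (decObj X ◃ B)

theorem mirror_encObj : (X : Obj) → (encObj (R := R) X).mirror = decObj X
  | .nil => rfl
  | .snoc X B => (Hom.mirror_comp (encObj X ◃ B) (encHom X.color B)).trans
      (congrArg (decHom X.color B ⬝ ·)
        ((Hom.mirror_whisk (encObj X) B).trans (congrArg (· ◃ B) (mirror_encObj X))))

section Square

variable {X Y C D D' E P P' Q T : Obj} {A B : Color}

theorem whisk_comp_cancel {x : Hom R X D} {y : Hom R D X} (e : x ⬝ y = .id X)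
    {p : Hom R (snoc D B) P} {q : Hom R P (snoc D B)} (e' : p ⬝ q = .id _) :
    (x ◃ B) ⬝ p ⬝ (q ⬝ (y ◃ B)) = .id _ := by
  rw [Hom.assoc, ← Hom.assoc p, e', Hom.id_comp, ← Hom.whisk_comp, e, Hom.id_whisk]

theorem square_whisk {p : Hom R P (snoc D B)} {q : Hom R P' (snoc D' B)} {x : Hom R D X}
    {y : Hom R D' Y} {g : Hom R X Y} {f : Hom R D D'} {F : Hom R P P'} (e : x ⬝ g = f ⬝ y)
    (e' : p ⬝ (f ◃ B) = F ⬝ q) : p ⬝ (x ◃ B) ⬝ (g ◃ B) = F ⬝ (q ⬝ (y ◃ B)) := by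
  rw [Hom.assoc, ← Hom.whisk_comp, e, Hom.whisk_comp, ← Hom.assoc, e', Hom.assoc]

theorem square_tw {p : Hom R P (snoc D' B)} {q : Hom R D' (snoc D A)} {x : Hom R D X}
    {p' : Hom R Q (snoc E A)} {q' : Hom R E (snoc D B)} {γ : Hom R P Q}
    (e : p ⬝ (q ◃ B) ⬝ Hom.tw D A B = γ ⬝ (p' ⬝ (q' ◃ A))) :
    p ⬝ ((q ⬝ (x ◃ A)) ◃ B) ⬝ Hom.tw X A B = γ ⬝ (p' ⬝ ((q' ⬝ (x ◃ B)) ◃ A)) := by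
  rw [Hom.whisk_comp, Hom.whisk_comp, Hom.assoc, Hom.assoc, Hom.tw_naturality, ← Hom.assoc p',
    ← Hom.assoc γ, ← e]
  simp only [Hom.assoc]

theorem square_pair {t : Hom R T C} {f : Hom R C P} {d : Hom R P (snoc D B)} {i : Hom R D E}
    {x : Hom R E D} (h : i ⬝ x = .id D) {G : Hom R P Q} {d' : Hom R Q (snoc E B)}
    (e : d ⬝ (i ◃ B) = G ⬝ d') : t ⬝ (f ⬝ d) = t ⬝ f ⬝ G ⬝ (d' ⬝ (x ◃ B)) := by
  rw [Hom.assoc, ← Hom.assoc G, ← e, Hom.assoc d, ← Hom.whisk_comp, h, Hom.id_whisk,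
    Hom.comp_id, Hom.assoc]

theorem square_conj {u : Hom R X P} {x : Hom R P D} {x' : Hom R D P} (hx : x ⬝ x' = .id P)
    {g : Hom R P Q} {f : Hom R D E} {y' : Hom R E Q} (e : x' ⬝ g = f ⬝ y') {v : Hom R Q Y}
    {b : Hom R X C} {k : Hom R C D} (h : u ⬝ x = b ⬝ k) {k' : Hom R E T} {b' : Hom R T Y}
    (h' : y' ⬝ v = k' ⬝ b') : u ⬝ g ⬝ v = b ⬝ (k ⬝ f ⬝ k') ⬝ b' := by
  calc u ⬝ g ⬝ v = u ⬝ (x ⬝ x') ⬝ g ⬝ v := by rw [hx, Hom.comp_id]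
    _ = u ⬝ x ⬝ (x' ⬝ g) ⬝ v := by simp only [Hom.assoc]
    _ = b ⬝ k ⬝ f ⬝ (y' ⬝ v) := by rw [h, e]; simp only [Hom.assoc]
    _ = _ := by rw [h']; simp only [Hom.assoc]

end Square

theorem encObj_decObj : (X : Obj) → encObj (R := R) X ⬝ decObj X = .id X
  | .nil => Hom.sound (.ax (.null_null .zero))
  | .snoc X B => whisk_comp_cancel (encObj_decObj X) (encHom_decHom X.color B)

/-- The inclusion of a color into its encoding as an object. -/
def ofIncl (A : Color) : A ⇒ (pairC .zero A) :=
  inr .zero A ⬝ inr (.tensor .zero A) (.plus .zero A)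

theorem IsMat.ofIncl (A : Color) : IsMat (ofIncl (R := R) A) := (IsMat.inr _ _).comp (.inr _ _)

theorem decObj_of (A : Color) : decObj (R := R) (of A) = (ofIncl A).mirror :=
  (decHom_conull .zero A).trans
    (Hom.mirror_comp (inr .zero A) (inr (.tensor .zero A) (.plus .zero A))).symm

theorem ofIncl_decObj (A : Color) : ofIncl (R := R) A ⬝ decObj (of A) = .id _ := by
  refine (congrArg (ofIncl A ⬝ ·) ((decObj_of A).trans (Hom.mirror_comp _ _))).trans ?_
  change inr .zero A ⬝ inr _ _ ⬝ (prr (.tensor .zero A) (.plus .zero A) ⬝ prr .zero A) = _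
  rw [Hom.assoc, ← Hom.assoc (inr (.tensor .zero A) _), Rule.inr_prr, Hom.id_comp, Rule.inr_prr]

theorem Hom.par_mem (P : ∀ {X Y : Obj}, Hom R X Y → Prop)
    (comp : ∀ {X Y Z : Obj} {g : Hom R X Y} {h : Hom R Y Z}, P g → P h → P (g ⬝ h))
    (whisk : ∀ {X Y : Obj} {g : Hom R X Y}, P g → ∀ B, P (g ◃ B))
    (swap : ∀ X Y : Obj, P (Hom.swap X Y)) {X Y X' Y' : Obj} {g : Hom R X Y} {h : Hom R X' Y'}
    (hg : P g) (hh : P h) : P (g ⊠ h) := by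
  have par_id : ∀ {X Y : Obj} {g : Hom R X Y}, P g → ∀ Z : Obj, P (g ⊠ Hom.id Z) := by
    intro X Y g hg Z
    induction Z with
    | nil => exact (congrArg P (Hom.par_nil g)).mpr hg
    | snoc Z B ih =>
      have e : g ⊠ Hom.id (snoc Z B) = (g ⊠ Hom.id Z) ◃ B := by
        rw [Hom.par_whisk, Hom.id_whisk]
      exact e ▸ whisk ih B
  have e : Hom.id Y ⊠ h = Hom.swap Y X' ⬝ (h ⊠ Hom.id Y) ⬝ Hom.swap Y' Y := by
    rw [← Hom.swap_naturality, Hom.assoc, Hom.swap_swap, Hom.comp_id]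
  have e' : g ⊠ h = (g ⊠ Hom.id X') ⬝ (Hom.id Y ⊠ h) := by
    rw [Hom.interchange, Hom.comp_id, Hom.id_comp]
  rw [e', e]
  exact comp (par_id hg X') (comp (comp (swap _ _) (par_id hh Y)) (swap _ _))

/-- A diagram that is a matrix on the single wire encodings. -/
def HasMat {X Y : Obj} (g : Hom R X Y) : Prop := ∃ f, IsMat f ∧ decObj X ⬝ g = f ⬝ decObj Y

theorem IsMat.whisk {A B : Color} {f : A ⇒ B} (hf : IsMat f) (C : Color) :
    IsMat (osumHom (tenHom f (.id (of C))) (osumHom f (.id (of C)))) :=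
  (hf.ten (.id C)).osum (hf.osum (.id C))

namespace HasMat

variable {X Y Z : Obj} {A B C : Color}

protected theorem id (X : Obj) : HasMat (Hom.id (R := R) X) :=
  ⟨_, .id _, (Hom.comp_id _).trans (Hom.id_comp _).symm⟩

theorem comp {g : Hom R X Y} {h : Hom R Y Z} : HasMat g → HasMat h → HasMat (g ⬝ h) := by
  rintro ⟨f, hf, e⟩ ⟨f', hf', e'⟩
  exact ⟨_, hf.comp hf', by rw [← Hom.assoc, e, Hom.assoc, e', Hom.assoc]⟩

theorem whisk {g : Hom R X Y} : HasMat g → (B : Color) → HasMat (g ◃ B) := fun ⟨_, hf, e⟩ B =>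
  ⟨_, hf.whisk B, square_whisk e (decHom_whisk hf.lin B)⟩

theorem tw (X : Obj) (A B : Color) : HasMat (Hom.tw (R := R) X A B) :=
  have ⟨γ, hγ, e⟩ := exists_decHom_swap (R := R) X.color A B
  ⟨γ, hγ, square_tw e⟩

theorem out {g : Hom R X (of C)} {f : X.color ⇒ C} (hf : IsMat f)
    (e : decObj X ⬝ g = f) : HasMat g :=
  ⟨_, hf.comp (.ofIncl C), e.trans ((Hom.comp_id f).symm.trans
    ((congrArg (f ⬝ ·) (ofIncl_decObj C).symm).trans (Hom.assoc _ _ _).symm))⟩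

theorem of_isMat {f : A ⇒ B} (hf : IsMat f) : HasMat f :=
  out (X := of A) ((IsMat.ofIncl A).mirror.comp hf) (congrArg (· ⬝ f) (decObj_of A))

theorem of_pair {g : Hom R (of A ++ of B) (of C)} {f : (pairC A B) ⇒ C}
    (hf : IsMat f) (e : decHom A B ⬝ g = f) : HasMat g := by
  refine out (X := of A ++ of B) (((IsMat.ofIncl A).mirror.whisk B).comp hf) ?_
  refine (congrArg (fun x => decHom _ B ⬝ (x ◃ B) ⬝ g) (decObj_of A)).trans ?_
  refine (congrArg (· ⬝ g) (decHom_whisk (IsMat.ofIncl A).mirror.lin B)).trans ?_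
  exact (Hom.assoc _ _ _).trans (congrArg (_ ⬝ ·) e)

theorem to_pair {f : C ⇒ (pairC A B)} (hf : IsMat f) :
    HasMat (f ⬝ decHom A B) :=
  ⟨_, ((IsMat.ofIncl C).mirror.comp hf).comp ((IsMat.ofIncl A).whisk B),
    (congrArg (· ⬝ (f ⬝ decHom A B)) (decObj_of C)).trans
      (square_pair (ofIncl_decObj A) (decHom_whisk (IsMat.ofIncl A).lin B))⟩

theorem fgen : {X Y : Obj} → (g : FGen R X Y) → HasMat (Hom.mk (Diag.fgen g))
  | _, _, .tens A B => of_pair (.prl _ _) (decHom_tens A B)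
  | _, _, .plus A B => of_pair (.prr _ _) (decHom_plus A B)
  | _, _, .contr A => of_pair ((IsMat.prr _ _).comp ((IsMat.prl _ _).add (.prr _ _))) (decHom_contr A)
  | _, _, .cotens A B => inl_decHom (R := R) A B ▸ to_pair (.inl _ _)
  | _, _, .coplus A B => inr_decHom (R := R) A B ▸ to_pair (.inr _ _)
  | _, _, .cocontr A => by
    have e : Hom.mk (Diag.cocontr A) ⬝ encHom A A = _ :=
      (Hom.mirror_comp (decHom A A) (Hom.mk (Diag.contr (R := R) A))).symm.trans
        (congrArg Hom.mirror (decHom_contr A))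
    have e' := congrArg (· ⬝ decHom A A) e
    rw [Hom.assoc, encHom_decHom] at e'
    have h := to_pair ((IsMat.prr (R := R) _ _).comp ((IsMat.prl A A).add (.prr _ _))).mirror
    rw [← e'] at h
    exact (Hom.comp_id (Hom.mk (Diag.cocontr (R := R) A))) ▸ h
  | _, _, .null A => out (.zero _ _) rfl
  | _, _, .conull A => by
    have e : (ofIncl (R := R) A).mirror ⬝ Hom.mk (Diag.conull A) = Hom.mk (Diag.conull _) :=
      Rule.eval (▣(Step.hom (ofIncl (R := R) A).mirror 0 1) ⨾ ▣(Step.conull (R := R) A 1))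
        ▣(Step.conull (R := R) (pairC .zero A) 0) (Rule.lin_conull (R := R) (IsMat.ofIncl A).mirror.lin)
    have e' : zeroHom (R := R) (pairC .zero A) .zero ⬝ Hom.mk (Diag.conull .zero) =
        Hom.mk (Diag.conull _) :=
      (Hom.assoc _ _ _).trans ((congrArg (Hom.mk (Diag.conull _) ⬝ ·)
        (Hom.sound (.ax (.null_null .zero)))).trans (Hom.comp_id _))
    exact ⟨_, .zero (pairC .zero A) .zero, (congrArg (· ⬝ Hom.mk (Diag.conull A)) (decObj_of A)).trans (e.trans e'.symm)⟩
  | _, _, .adapt h => of_isMat (.adapt h)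
  | _, _, .scal s A => of_isMat (.scal s A)

theorem cast {X' Y' : Obj} (h : X = X') (k : Y = Y') {g : Hom R X Y} (hg : HasMat g) :
    HasMat (Hom.cast h k g) := by subst h k; exact hg

theorem of_cast {X' Y' : Obj} (h : X = X') (k : Y = Y') {g : Hom R X Y}
    (hg : HasMat (Hom.cast h k g)) : HasMat g := by subst h k; exact hg

theorem id_par_swap (Z : Obj) (B : Color) :
    (X : Obj) → HasMat (Hom.id (R := R) Z ⊠ Hom.swap X (of B))
  | .nil => by
    refine (congrArg (HasMat (R := R)) ?_).mpr (HasMat.id (Z ++ of B))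
    exact (congrArg (_ ⊠ ·) (Hom.nil_swap B)).trans (Hom.par_id _ _)
  | .snoc X A => by
    have e : (Hom.id Z ⊠ Hom.swap (snoc X A) (of B) : Hom R _ _) =
        Hom.tw (Z ++ X) A B ⬝ ((Hom.id Z ⊠ Hom.swap X (of B)) ◃ A) := by
      rw [Hom.swap_snoc]
      refine Eq.trans (congrArg (· ⊠ _) (Hom.id_comp (Hom.id Z)).symm) ?_
      refine (Hom.interchange _ _ _ _).symm.trans (congrArg₂ Hom.comp ?_ (Hom.par_whisk _ _ _).symm)
      refine (Hom.par_assoc _ _ _).symm.trans ?_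
      rw [Hom.par_id]; rfl
    rw [e]
    exact comp (.tw _ _ _) ((id_par_swap Z B X).whisk A)

theorem swap (X : Obj) : (Y : Obj) → HasMat (Hom.swap (R := R) X Y)
  | .nil => by
    exact of_cast rfl (nil_append X) ((congrArg (HasMat (R := R)) (Hom.swap_nil X)).mpr (.id X))
  | .snoc Y B => by
    have h := comp ((swap X Y).whisk B)
      ((id_par_swap (R := R) Y B X).cast rfl (append_assoc Y (of B) X).symm)
    exact (congrArg (HasMat (R := R)) (Hom.hexagon X Y (of B))).mpr h

theorem par {X' Y' : Obj} {g : Hom R X Y} {h : Hom R X' Y'} (hg : HasMat g) (hh : HasMat h) :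
    HasMat (g ⊠ h) := Hom.par_mem HasMat comp whisk swap hg hh

end HasMat

/-! ### Diagrams with Units -/

theorem HasMat.encHom (A B : Color) : HasMat (encHom (R := R) A B) :=
  ((((fgen (.cocontr A)).par (fgen (.cocontr B))).comp
    (((HasMat.id (of A)).par (swap (of A) (of B))).par (.id (of B)))).comp
      ((fgen (.tens A B)).par (fgen (.plus A B)))).comp (fgen (.plus (.tensor A B) (.plus A B)))

theorem HasMat.unitDup : HasMat (unitDup (R := R)) :=
  (((fgen (.cocontr .one)).comp (fgen (.plus .one .one))).comp (of_isMat (.unitMap .one))).comp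
    (Hom.id_comp (decHom (R := R) .one .one) ▸ to_pair (.id _))

theorem HasMat.unitDup_mirror : HasMat (TensorPlus.unitDup (R := R)).mirror := by
  have e : (TensorPlus.unitDup (R := R)).mirror = TensorPlus.encHom .one .one ⬝
      ((unitMap .one).mirror ⬝ (Hom.mk (Diag.coplus .one .one) ⬝ Hom.mk (Diag.contr .one))) := by
    rw [TensorPlus.unitDup, Hom.mirror_comp, Hom.mirror_comp, Hom.mirror_comp, decHom,
      Hom.mirror_mirror]
    rfl
  exact e ▸ (HasMat.encHom .one .one).comp ((of_isMat (IsMat.unitMap .one).mirror).comp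
    ((fgen (.coplus .one .one)).comp (fgen (.contr .one))))

section Unit

variable {X Y Z : Obj}

theorem Hom.mirror_tw (X : Obj) (A B : Color) : (Hom.tw (R := R) X A B).mirror = Hom.tw X B A :=
  Hom.mirror_par _ _

theorem addUnit_naturality (h : Hom R X Y) : h ⬝ addUnit Y = addUnit X ⬝ (h ◃ .one) := by
  refine Eq.trans (congrArg (· ⬝ addUnit Y) (Hom.par_nil h).symm)
    ((Hom.interchange h (.id Y) (.id nil) (Hom.mk Diag.unit)).trans ?_)
  refine Eq.trans ?_ (Hom.interchange (.id X) h (Hom.mk Diag.unit) (.id (of .one))).symm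
  rw [Hom.comp_id, Hom.id_comp, Hom.id_comp, Hom.comp_id]

theorem addUnit_snoc (X : Obj) (B : Color) :
    addUnit (R := R) (snoc X B) = Hom.id X ⊠ addUnit (of B) :=
  (congrArg (· ⊠ Hom.mk Diag.unit) (Hom.par_id X (of B)).symm).trans
    (Hom.par_assoc (.id X) (.id (of B)) (Hom.mk Diag.unit))

theorem addUnit_whisk (X : Obj) (B : Color) :
    addUnit (R := R) X ◃ B = addUnit (snoc X B) ⬝ Hom.tw X B .one := by
  have h : (Hom.swap (of B) nil : B ⇒ B) = Hom.id (of B) := Hom.swap_nil (of B)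
  refine Eq.trans ?_ (congrArg (· ⬝ Hom.tw X B .one) (addUnit_snoc X B)).symm
  refine Eq.trans ?_ (Hom.interchange (.id X) (.id X) (addUnit (of B))
    (Hom.swap (of B) (of .one))).symm
  refine (Hom.par_whisk (.id X) (Hom.mk Diag.unit) B).trans
    (congrArg₂ Hom.par (Hom.id_comp _).symm (Eq.trans ?_
      (Hom.swap_naturality (.id (of B)) (Hom.mk Diag.unit)).symm))
  exact (Hom.id_comp _).symm.trans
    (congrArg (· ⬝ (Hom.mk Diag.unit ⊠ Hom.id (R := R) (of B))) h.symm)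

/-- The duplication of the last wire if it is a Unit. -/
def dupUnit (X : Obj) : Hom R (snoc X .one) (snoc (snoc X .one) .one) := Hom.id X ⊠ unitDup

theorem HasMat.dupUnit (X : Obj) : HasMat (dupUnit (R := R) X) := (HasMat.id X).par .unitDup

theorem HasMat.dupUnit_mirror (X : Obj) : HasMat (TensorPlus.dupUnit (R := R) X).mirror :=
  (congrArg (HasMat (R := R)) (Hom.mirror_par (.id X) TensorPlus.unitDup)).mpr
    ((HasMat.id X).par .unitDup_mirror)

theorem addUnit_addUnit (X : Obj) :
    addUnit (R := R) X ⬝ addUnit (snoc X .one) = addUnit X ⬝ dupUnit X := by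
  refine (congrArg (addUnit X ⬝ ·) (addUnit_snoc X .one)).trans ?_
  refine (Hom.interchange (.id X) (.id X) (Hom.mk Diag.unit) (addUnit (of .one))).trans ?_
  refine Eq.trans ?_ (Hom.interchange (.id X) (.id X) (Hom.mk Diag.unit) unitDup).symm
  exact congrArg (_ ⊠ ·) unit_addUnit

/-- A diagram that is a matrix up to an additional Unit. -/
def HasMatUnit (d : Hom R X Y) : Prop :=
  ∃ g, HasMat g ∧ d = addUnit X ⬝ g ⬝ (addUnit Y).mirror

namespace HasMatUnit

theorem of_hasMat {d : Hom R X Y} (hd : HasMat d) : HasMatUnit d := by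
  refine ⟨d ⊠ (Hom.mk (Diag.conull .one) ⬝ Hom.mk (Diag.null .one)),
    hd.par ((HasMat.fgen (.conull .one)).comp (.fgen (.null .one))), ?_⟩
  have e : Hom.mk Diag.unit ⬝ (Hom.mk (Diag.conull .one) ⬝ Hom.mk (Diag.null .one)) ⬝
      Hom.mk Diag.counit = Hom.id (R := R) nil := by
    have e₁ : Hom.mk Diag.unit ⬝ Hom.mk (Diag.conull .one) = Hom.id (R := R) nil :=
      Hom.sound (.ax .unit_null)
    have e₂ : Hom.mk (Diag.null .one) ⬝ Hom.mk Diag.counit = Hom.id (R := R) nil :=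
      Hom.sound (.ax_mirror .unit_null)
    rw [← Hom.assoc, e₁, Hom.id_comp, e₂]
  have e₃ : addUnit X ⬝ (d ⊠ (Hom.mk (Diag.conull .one) ⬝ Hom.mk (Diag.null .one))) =
      (Hom.id X ⬝ d) ⊠ (Hom.mk Diag.unit ⬝ (Hom.mk (Diag.conull .one) ⬝ Hom.mk (Diag.null .one))) :=
    Hom.interchange (.id X) d _ _
  have e₄ : (addUnit (R := R) Y).mirror = Hom.id Y ⊠ Hom.mk Diag.counit := Hom.mirror_par _ _
  refine ((congrArg₂ Hom.comp e₃ e₄).trans ((Hom.interchange _ _ _ _).trans ?_)).symm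
  refine (congrArg₂ Hom.par ?_ e).trans (Hom.par_nil d)
  rw [Hom.id_comp, Hom.comp_id]

theorem comp {d : Hom R X Y} {e : Hom R Y Z} : HasMatUnit d → HasMatUnit e → HasMatUnit (d ⬝ e) := by
  rintro ⟨g, hg, rfl⟩ ⟨h, hh, rfl⟩
  have e₁ : (addUnit Y).mirror ⬝ addUnit Y =
      addUnit (snoc Y .one) ⬝ ((addUnit (R := R) Y).mirror ◃ .one) := addUnit_naturality _
  have e₂ : (addUnit (R := R) Y).mirror ◃ .one =
      Hom.tw Y .one .one ⬝ (addUnit (snoc Y .one)).mirror := by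
    rw [← Hom.mirror_whisk, addUnit_whisk, Hom.mirror_comp, Hom.mirror_tw]
  have e₃ : (addUnit (snoc Y .one)).mirror ⬝ h = (h ◃ .one) ⬝ (addUnit (snoc Z .one)).mirror := by
    have e := congrArg Hom.mirror (addUnit_naturality h.mirror)
    rw [Hom.mirror_comp, Hom.mirror_comp, Hom.mirror_whisk, Hom.mirror_mirror] at e
    exact e
  have e₄ : (addUnit (snoc Z .one)).mirror ⬝ (addUnit (R := R) Z).mirror =
      (dupUnit Z).mirror ⬝ (addUnit Z).mirror := by
    rw [← Hom.mirror_comp, addUnit_addUnit, Hom.mirror_comp]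
  refine ⟨dupUnit X ⬝ ((g ◃ .one) ⬝ (Hom.tw Y .one .one ⬝ ((h ◃ .one) ⬝
    (dupUnit Z).mirror))), ?_, ?_⟩
  · exact (HasMat.dupUnit X).comp ((hg.whisk _).comp ((HasMat.tw _ _ _).comp
      ((hh.whisk _).comp (HasMat.dupUnit_mirror Z))))
  · calc addUnit X ⬝ g ⬝ (addUnit Y).mirror ⬝ (addUnit Y ⬝ h ⬝ (addUnit Z).mirror)
        = addUnit X ⬝ (g ⬝ ((addUnit Y).mirror ⬝ addUnit Y) ⬝ h ⬝ (addUnit Z).mirror) := by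
          simp only [Hom.assoc]
      _ = addUnit X ⬝ (g ⬝ addUnit (snoc Y .one) ⬝ Hom.tw Y .one .one ⬝
            ((addUnit (snoc Y .one)).mirror ⬝ h) ⬝ (addUnit Z).mirror) := by
          rw [e₁, e₂]; simp only [Hom.assoc]
      _ = addUnit X ⬝ addUnit (snoc X .one) ⬝ (g ◃ .one) ⬝ Hom.tw Y .one .one ⬝ (h ◃ .one) ⬝
            ((addUnit (snoc Z .one)).mirror ⬝ (addUnit Z).mirror) := by
          rw [e₃, addUnit_naturality g]; simp only [Hom.assoc]
      _ = _ := by rw [addUnit_addUnit, e₄]; simp only [Hom.assoc]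

theorem whisk {d : Hom R X Y} : HasMatUnit d → (B : Color) → HasMatUnit (d ◃ B) := by
  rintro ⟨g, hg, rfl⟩ B
  refine ⟨Hom.tw X B .one ⬝ ((g ◃ B) ⬝ Hom.tw Y .one B),
    (HasMat.tw _ _ _).comp ((hg.whisk B).comp (.tw _ _ _)), ?_⟩
  rw [Hom.whisk_comp, Hom.whisk_comp, addUnit_whisk, ← Hom.mirror_whisk, addUnit_whisk,
    Hom.mirror_comp, Hom.mirror_tw]
  simp only [Hom.assoc]

theorem par {X' Y' : Obj} {d : Hom R X Y} {e : Hom R X' Y'} (hd : HasMatUnit d)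
    (he : HasMatUnit e) : HasMatUnit (d ⊠ e) :=
  Hom.par_mem HasMatUnit comp whisk (fun X Y => of_hasMat (.swap X Y)) hd he

theorem unit : HasMatUnit (Hom.mk (Diag.unit (R := R))) := by
  refine ⟨(Hom.id (of .one) ⊠ Hom.mk (Diag.null .one) : Hom R (of .one) (of .one ++ of .one)),
    (HasMat.id (of .one)).par (.fgen (.null .one)), ?_⟩
  have e₁ : (Hom.mk (Diag.null .one) ⬝ Hom.mk Diag.counit : Hom R nil nil) = Hom.id nil :=
    Hom.sound (.ax_mirror .unit_null)
  have e₂ : (Hom.id (of .one) ⊠ Hom.mk (Diag.null .one)) ⬝ (addUnit (of .one)).mirror =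
      Hom.id (R := R) (of .one) := by
    refine (congrArg (_ ⬝ ·) (Hom.mirror_par (.id (of .one)) (Hom.mk Diag.unit))).trans
      ((Hom.interchange _ _ _ _).trans ?_)
    refine (congrArg₂ Hom.par (Hom.comp_id _) e₁).trans (Hom.par_nil _)
  have e₃ : addUnit nil = Hom.mk (Diag.unit (R := R)) :=
    Hom.nil_par (Hom.mk (Diag.unit (R := R)))
  refine Eq.trans ?_ (Hom.assoc _ _ _).symm
  refine Eq.trans ?_ (congrArg₂ Hom.comp e₃ e₂).symm
  exact (Hom.comp_id _).symm

theorem counit : HasMatUnit (Hom.mk (Diag.counit (R := R))) := by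
  refine ⟨(Hom.id (of .one) ⊠ Hom.mk (Diag.conull .one) : Hom R (of .one ++ of .one) (of .one)),
    (HasMat.id (of .one)).par (.fgen (.conull .one)), ?_⟩
  have e₁ : (Hom.mk Diag.unit ⬝ Hom.mk (Diag.conull .one) : Hom R nil nil) = Hom.id nil :=
    Hom.sound (.ax .unit_null)
  have e₂ : addUnit (of .one) ⬝ (Hom.id (of .one) ⊠ Hom.mk (Diag.conull .one)) =
      Hom.id (R := R) (of .one) :=
    (Hom.interchange _ _ _ _).trans
      ((congrArg₂ Hom.par (Hom.comp_id _) e₁).trans (Hom.par_nil _))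
  have e₃ : (addUnit nil).mirror = Hom.mk (Diag.counit (R := R)) :=
    congrArg Hom.mirror (Hom.nil_par (Hom.mk (Diag.unit (R := R))))
  refine Eq.trans ?_ (congrArg₂ Hom.comp e₂ e₃).symm
  exact (Hom.id_comp _).symm

end HasMatUnit

theorem hasMatUnit_mk (d : Diag R X Y) : HasMatUnit (Hom.mk d) := by
  induction d with
  | id X => exact .of_hasMat (.id X)
  | swap X Y => exact .of_hasMat (.swap X Y)
  | comp d e ih ih' => exact ih.comp ih'
  | par d e ih ih' => exact ih.par ih'
  | fgen g => exact .of_hasMat (.fgen g)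
  | unit => exact .unit
  | counit => exact .counit

/-- The passage from an object to a single wire whose last basis vector is the vacuum. -/
def base (X : Obj) : Hom R X (of (.plus X.color .one)) :=
  encObj X ⬝ (addUnit (of X.color) ⬝ Hom.mk (Diag.plus X.color .one))

theorem addUnit_encObj (X : Obj) :
    addUnit (R := R) X ⬝ encObj (snoc X .one) = base X ⬝ unitMap X.color := by
  refine (Hom.assoc _ _ _).symm.trans ((congrArg (· ⬝ encHom X.color .one)
    (addUnit_naturality (encObj X)).symm).trans ((Hom.assoc _ _ _).trans ?_))
  refine (congrArg (encObj X ⬝ ·) (addUnit_encHom X.color)).trans (Hom.assoc _ _ _).symm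

theorem exists_eq_base (d : Hom R X Y) :
    ∃ f, IsMat f ∧ d = base X ⬝ f ⬝ (base Y).mirror := by
  induction d using Quotient.ind with | _ d
  obtain ⟨g, ⟨f, hf, e⟩, h⟩ := hasMatUnit_mk d
  refine ⟨_, ((IsMat.unitMap X.color).comp hf).comp (IsMat.unitMap Y.color).mirror, h.trans ?_⟩
  refine square_conj (encObj_decObj (snoc X .one)) e (addUnit_encObj X) ?_
  refine (congrArg (· ⬝ _) (mirror_encObj (snoc Y .one)).symm).trans ((Hom.mirror_comp _ _).symm.trans ?_)
  exact (congrArg Hom.mirror (addUnit_encObj Y)).trans (Hom.mirror_comp (base Y) (unitMap Y.color))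

end Unit

/-! ### Points and the action of diagrams on functions -/

/-- The points of an object: every wire is empty or carries a basis vector. -/
def Pt : Obj → Type
  | .nil => Unit
  | .snoc X B => Pt X × Option (Ix B)

namespace Pt

variable {X Y Z : Obj} {B : Color}

/-- The parallel composition of points. -/
def app : {X Y : Obj} → Pt X → Pt Y → Pt (X ++ Y)
  | _, .nil, x, _ => x
  | _, .snoc _ _, x, y => (app x y.1, y.2)

/-- The first part of a point. -/
def fst : {X Y : Obj} → Pt (X ++ Y) → Pt X
  | _, .nil, p => p
  | X, .snoc Y _, p => fst (X := X) (Y := Y) p.1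

/-- The second part of a point. -/
def snd : {X Y : Obj} → Pt (X ++ Y) → Pt Y
  | _, .nil, _ => ()
  | X, .snoc Y _, p => (snd (X := X) (Y := Y) p.1, p.2)

@[simp] theorem fst_app : {Y : Obj} → (x : Pt X) → (y : Pt Y) → fst (app x y) = x
  | .nil, _, _ => rfl
  | .snoc _ _, x, y => fst_app x y.1

@[simp] theorem snd_app : {Y : Obj} → (x : Pt X) → (y : Pt Y) → snd (app x y) = y
  | .nil, _, _ => rfl
  | .snoc _ _, x, y => congrArg (·, y.2) (snd_app x y.1)

@[simp] theorem app_fst_snd : {Y : Obj} → (p : Pt (X ++ Y)) → app (fst p) (snd p) = p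
  | .nil, _ => rfl
  | .snoc Y _, p => congrArg (·, p.2) (app_fst_snd (Y := Y) p.1)

theorem exists_app (p : Pt (X ++ Y)) : ∃ x y, p = app x y := ⟨_, _, (app_fst_snd p).symm⟩

/-- Transport of points. -/
def cast (h : X = Y) (p : Pt X) : Pt Y := h ▸ p

theorem cast_snoc (h : X = Y) (p : Pt X) (b : Option (Ix B)) :
    cast (congrArg (snoc · B) h) ((p, b) : Pt (snoc X B)) = ((cast h p, b) : Pt (snoc Y B)) := by
  subst h; rfl

theorem cast_app_assoc (x : Pt X) (y : Pt Y) : {Z : Obj} → (z : Pt Z) →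
    cast (append_assoc X Y Z) (app (app x y) z) = app x (app y z)
  | .nil, _ => rfl
  | .snoc Z _, z => (cast_snoc (append_assoc X Y Z) _ _).trans
      (congrArg (·, z.2) (cast_app_assoc x y z.1))

theorem cast_nil_app : {X : Obj} → (x : Pt X) →
    cast (nil_append X) (app (X := nil) () x) = x
  | .nil, _ => rfl
  | .snoc X _, x => (cast_snoc (nil_append X) _ _).trans (congrArg (·, x.2) (cast_nil_app x.1))

end Pt

namespace Ix

variable {A B : Color}

/-- The index of a vector in the first summand. -/
def inl (i : Ix A) : Ix (.plus A B) := Sum.inl i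
/-- The index of a vector in the second summand. -/
def inr (i : Ix B) : Ix (.plus A B) := Sum.inr i
/-- The unique index of `𝟙`. -/
def star : Ix .one := ()
/-- The index of a pair. -/
def pair (i : Ix A) (j : Ix B) : Ix (.tensor A B) := (i, j)

theorem forall_plus {P : Ix (.plus A B) → Prop} :
    (∀ i, P i) ↔ (∀ i, P (inl i)) ∧ ∀ i, P (inr i) := Sum.forall
theorem forall_tensor {P : Ix (.tensor A B) → Prop} : (∀ i, P i) ↔ ∀ i j, P (pair i j) :=
  Prod.forall
theorem forall_zero {P : Ix .zero → Prop} : (∀ i, P i) ↔ True := ⟨fun _ => trivial, fun _ i => i.elim⟩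
theorem forall_one {P : Ix .one → Prop} : (∀ i, P i) ↔ P star := ⟨fun h => h star, fun h _ => h⟩

end Ix

namespace Act

variable {A B : Color}

/-- The action of the Tensor. -/
def tens (f : Option (Ix A) → Option (Ix B) → R) : Option (Ix (.tensor A B)) → R
  | none => f none none
  | some i => f (some (Prod.fst i)) (some (Prod.snd i))
/-- The action of the mirrored Tensor. -/
def cotens (f : Option (Ix (.tensor A B)) → R) : Option (Ix A) → Option (Ix B) → R
  | none, none => f none
  | some i, some j => f (some (Ix.pair i j))
  | _, _ => 0
/-- The action of the Plus. -/
def plus (f : Option (Ix A) → Option (Ix B) → R) : Option (Ix (.plus A B)) → R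
  | none => f none none
  | some i => Sum.elim (fun i => f (some i) none) (fun i => f none (some i)) i
/-- The action of the mirrored Plus. -/
def coplus (f : Option (Ix (.plus A B)) → R) : Option (Ix A) → Option (Ix B) → R
  | none, none => f none
  | some i, none => f (some (Ix.inl i))
  | none, some i => f (some (Ix.inr i))
  | _, _ => 0
/-- The action of the Contraction. -/
def contr (f : Option (Ix A) → Option (Ix A) → R) : Option (Ix A) → R
  | none => f none none
  | some i => f (some i) none + f none (some i)
/-- The action of the mirrored Contraction. -/
def cocontr (f : Option (Ix A) → R) : Option (Ix A) → Option (Ix A) → R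
  | none, none => f none
  | some i, none => f (some i)
  | none, some i => f (some i)
  | _, _ => 0
/-- The action of the Null. -/
def null (s : R) : Option (Ix A) → R
  | none => s
  | some _ => 0
/-- The action of the Scalar. -/
def scal (s : R) (f : Option (Ix A) → R) : Option (Ix A) → R
  | none => f none
  | some i => s * f (some i)

variable (f : Option (Ix A) → Option (Ix B) → R) (g : Option (Ix A) → R)
  (h : Option (Ix A) → Option (Ix A) → R) (k : Option (Ix (.plus A B)) → R)
  (t : Option (Ix (.tensor A B)) → R) (i i' : Ix A) (j : Ix B) (s : R)

theorem tens_none : tens f none = f none none := rfl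
theorem tens_some : tens f (some (Ix.pair i j)) = f (some i) (some j) := rfl
theorem cotens_none_none : cotens t none none = t none := rfl
theorem cotens_some_some : cotens t (some i) (some j) = t (some (Ix.pair i j)) := rfl
theorem cotens_some_none : cotens t (some i) none = 0 := rfl
theorem cotens_none_some : cotens t none (some j) = 0 := rfl
theorem plus_none : plus f none = f none none := rfl
theorem plus_inl : plus f (some (Ix.inl i)) = f (some i) none := rfl
theorem plus_inr : plus f (some (Ix.inr j)) = f none (some j) := rfl
theorem coplus_none_none : coplus k none none = k none := rfl
theorem coplus_some_none : coplus k (some i) none = k (some (Ix.inl i)) := rfl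
theorem coplus_none_some : coplus k none (some j) = k (some (Ix.inr j)) := rfl
theorem coplus_some_some : coplus k (some i) (some j) = 0 := rfl
theorem contr_none : contr h none = h none none := rfl
theorem contr_some : contr h (some i) = h (some i) none + h none (some i) := rfl
theorem cocontr_none_none : cocontr g none none = g none := rfl
theorem cocontr_some_none : cocontr g (some i) none = g (some i) := rfl
theorem cocontr_none_some : cocontr g none (some i) = g (some i) := rfl
theorem cocontr_some_some : cocontr g (some i) (some i') = 0 := rfl
theorem null_none : null (A := A) s none = s := rfl
theorem null_some : null s (some i) = 0 := rfl
theorem scal_none : scal s g none = g none := rfl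
theorem scal_some : scal s g (some i) = s * g (some i) := rfl

end Act

/-- The action of a generator on functions on points. -/
def FGen.act : {X Y : Obj} → FGen R X Y → (Pt X → R) → Pt Y → R
  | _, _, .tens _ _ => fun v p => Act.tens (fun a b => v (((), a), b)) p.2
  | _, _, .cotens _ _ => fun v p => Act.cotens (fun a => v ((), a)) (Prod.snd p.1) p.2
  | _, _, .plus _ _ => fun v p => Act.plus (fun a b => v (((), a), b)) p.2
  | _, _, .coplus _ _ => fun v p => Act.coplus (fun a => v ((), a)) (Prod.snd p.1) p.2
  | _, _, .contr _ => fun v p => Act.contr (fun a b => v (((), a), b)) p.2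
  | _, _, .cocontr _ => fun v p => Act.cocontr (fun a => v ((), a)) (Prod.snd p.1) p.2
  | _, _, .null _ => fun v p => Act.null (v ()) p.2
  | _, _, .conull _ => fun v _ => v ((), none)
  | _, _, .adapt h => fun v p => v ((), p.2.map (Ix.adapt h.symm))
  | _, _, .scal s _ => fun v p => Act.scal s (fun a => v ((), a)) p.2

/-- The action of a diagram on functions on points. -/
def Diag.act : {X Y : Obj} → Diag R X Y → (Pt X → R) → Pt Y → R
  | _, _, .id _ => fun v p => v p
  | _, _, .swap _ _ => fun v p => v (Pt.app (Pt.snd p) (Pt.fst p))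
  | _, _, .comp d e => fun v p => e.act (d.act v) p
  | _, _, .par d e => fun v p =>
      d.act (fun x => e.act (fun x' => v (Pt.app x x')) (Pt.snd p)) (Pt.fst p)
  | _, _, .fgen g => g.act
  | _, _, .unit => fun v _ => v ()
  | _, _, .counit => fun v _ => v ((), some Ix.star) + v ((), none)

namespace Ix

variable {A B C A' B' : Color}

theorem adapt_of_pos {h : A.Approx B} {i : Ix A} {j : Ix B} (e : (pos A i : ℕ) = pos B j) :
    adapt h i = j := (adapt_eq h i j).2 e

theorem adapt_self (h : A.Approx A) (i : Ix A) : adapt h i = i := adapt_of_pos rfl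
theorem adapt_adapt (h : A.Approx B) (k : B.Approx C) (i : Ix A) :
    adapt k (adapt h i) = adapt (h.trans k) i :=
  (adapt_of_pos ((adapt_pos h i).trans (adapt_pos k _))).symm
theorem adapt_tensor_one (h : (Color.tensor A .one).Approx A) (i : Ix A) :
    adapt h (pair i star) = i := adapt_of_pos rfl
theorem adapt_tensor_one_symm (h : A.Approx (.tensor A .one)) (i : Ix A) :
    adapt h i = pair i star := adapt_of_pos rfl
theorem adapt_one_tensor (h : (Color.tensor .one A).Approx A) (i : Ix A) :
    adapt h (pair star i) = i := adapt_of_pos ((Nat.zero_add _).trans (Nat.one_mul _))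
theorem adapt_one_tensor_symm (h : A.Approx (.tensor .one A)) (i : Ix A) :
    adapt h i = pair star i := adapt_of_pos ((Nat.zero_add _).trans (Nat.one_mul _)).symm
theorem adapt_plus_zero (h : (Color.plus A .zero).Approx A) (i : Ix A) :
    adapt h (inl i) = i := adapt_of_pos rfl
theorem adapt_plus_zero_symm (h : A.Approx (.plus A .zero)) (i : Ix A) :
    adapt h i = inl i := adapt_of_pos rfl
theorem adapt_zero_plus (h : (Color.plus .zero A).Approx A) (i : Ix A) :
    adapt h (inr i) = i := adapt_of_pos (Nat.zero_add _)
theorem adapt_zero_plus_symm (h : A.Approx (.plus .zero A)) (i : Ix A) :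
    adapt h i = inr i := adapt_of_pos (Nat.zero_add _).symm

theorem pos_tensor_assoc (i : Ix A) (j : Ix B) (k : Ix C) :
    (pos _ (pair (pair i j) k) : ℕ) = pos _ (pair i (pair j k)) := by
  change (pos A i + A.dim * pos B j + A.dim * B.dim * pos C k : ℕ) =
    pos A i + A.dim * (pos B j + B.dim * pos C k)
  ring
theorem adapt_tensor_assoc (h : (Color.tensor (.tensor A B) C).Approx (.tensor A (.tensor B C)))
    (i : Ix A) (j : Ix B) (k : Ix C) : adapt h (pair (pair i j) k) = pair i (pair j k) :=
  adapt_of_pos (pos_tensor_assoc i j k)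
theorem adapt_tensor_assoc_symm
    (h : (Color.tensor A (.tensor B C)).Approx (.tensor (.tensor A B) C))
    (i : Ix A) (j : Ix B) (k : Ix C) : adapt h (pair i (pair j k)) = pair (pair i j) k :=
  adapt_of_pos (pos_tensor_assoc i j k).symm

section Plus

variable (h : (Color.plus (.plus A B) C).Approx (.plus A (.plus B C)))
  (h' : (Color.plus A (.plus B C)).Approx (.plus (.plus A B) C)) (i : Ix A) (j : Ix B) (k : Ix C)

theorem adapt_plus_assoc_inl_inl : adapt h (inl (inl i)) = inl i := adapt_of_pos rfl
theorem adapt_plus_assoc_inl_inr : adapt h (inl (inr j)) = inr (inl j) := adapt_of_pos rfl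
theorem adapt_plus_assoc_inr : adapt h (inr k) = inr (inr k) := adapt_of_pos (Nat.add_assoc _ _ _)
theorem adapt_plus_assoc_symm_inl : adapt h' (inl i) = inl (inl i) := adapt_of_pos rfl
theorem adapt_plus_assoc_symm_inr_inl : adapt h' (inr (inl j)) = inl (inr j) := adapt_of_pos rfl
theorem adapt_plus_assoc_symm_inr_inr : adapt h' (inr (inr k)) = inr k :=
  adapt_of_pos (Nat.add_assoc _ _ _).symm

end Plus

section Congr

variable (h : A.Approx A') (k : B.Approx B') (m : (Color.tensor A B).Approx (.tensor A' B'))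
  (n : (Color.plus A B).Approx (.plus A' B')) (i : Ix A) (j : Ix B)

theorem adapt_pair : adapt m (pair i j) = pair (adapt h i) (adapt k j) :=
  adapt_of_pos (congrArg₂ (· + ·) (adapt_pos h i) (congrArg₂ (· * ·) h.dim_eq (adapt_pos k j)))
theorem adapt_inl : adapt n (inl i) = inl (adapt h i) := adapt_of_pos (adapt_pos h i)
theorem adapt_inr (h : A.Approx A') (k : B.Approx B') (n : (Color.plus A B).Approx (.plus A' B'))
    (j : Ix B) : adapt n (inr j) = inr (adapt k j) :=
  adapt_of_pos (congrArg₂ (· + ·) h.dim_eq (adapt_pos k j))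

end Congr

end Ix

theorem Pt.ext_nil {f g : Pt nil → R} (h : f () = g ()) : f = g := funext fun _ => h
theorem Pt.ext_snoc {X : Obj} {B : Color} {f g : Pt (snoc X B) → R}
    (h : ∀ b, (fun x : Pt X => f (x, b)) = fun x => g (x, b)) : f = g :=
  funext fun p => congrFun (h p.2) p.1

set_option maxHeartbeats 2000000 in
theorem Diag.Axiom.act_eq {X Y : Obj} {d e : Diag R X Y} (h : Axiom d e) :
    d.act = e.act ∧ d.mirror.act = e.mirror.act := by
  cases h
  all_goals refine ⟨funext fun v => ?_, funext fun v => ?_⟩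
  all_goals
    repeat' first
      | refine Pt.ext_nil ?_
      | refine Pt.ext_snoc ?_
      | refine Option.forall.2 ⟨?_, ?_⟩
      | refine Ix.forall_plus.2 ⟨?_, ?_⟩
      | refine Ix.forall_tensor.2 ?_
      | refine Ix.forall_zero.2 trivial
      | refine Ix.forall_one.2 ?_
      | intro _
  all_goals try rfl
  all_goals try exact add_comm _ _
  all_goals try
    dsimp only [Diag.act, FGen.act, Diag.mirror, FGen.mirror, Diag.xplus, Diag.xtens, Diag.tapL,
      Diag.tapR, Diag.untapL, Diag.untapR, Diag.contr₂, Diag.cocontr₂, Diag.canLoop,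
      HAppend.hAppend, Append.append, Obj.append, Pt.app, Pt.fst, Pt.snd, Option.map,
      Act.tens_none, Act.tens_some, Act.cotens_none_none, Act.cotens_some_some,
      Act.cotens_some_none, Act.cotens_none_some, Act.plus_none, Act.plus_inl, Act.plus_inr,
      Act.coplus_none_none, Act.coplus_none_some, Act.coplus_some_none, Act.coplus_some_some,
      Act.contr_none, Act.contr_some, Act.cocontr_none_none, Act.cocontr_some_none,
      Act.cocontr_none_some, Act.cocontr_some_some, Act.null_none, Act.null_some, Act.scal_none,
      Act.scal_some]
  all_goals try
    simp only [zero_add, add_zero, mul_zero, one_mul, zero_mul, Ix.adapt_self, Ix.adapt_adapt,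
      Ix.adapt_tensor_one, Ix.adapt_one_tensor, Ix.adapt_tensor_one_symm,
      Ix.adapt_one_tensor_symm, Ix.adapt_tensor_assoc, Ix.adapt_tensor_assoc_symm,
      Ix.adapt_plus_assoc_inl_inl, Ix.adapt_plus_assoc_inl_inr, Ix.adapt_plus_assoc_inr,
      Ix.adapt_plus_assoc_symm_inl, Ix.adapt_plus_assoc_symm_inr_inl,
      Ix.adapt_plus_assoc_symm_inr_inr, Ix.adapt_plus_zero, Ix.adapt_zero_plus,
      Ix.adapt_plus_zero_symm, Ix.adapt_zero_plus_symm, Act.tens_none, Act.tens_some,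
      Act.cotens_none_none, Act.cotens_some_some, Act.cotens_some_none, Act.cotens_none_some,
      Act.plus_none, Act.plus_inl, Act.plus_inr, Act.coplus_none_none, Act.coplus_none_some,
      Act.coplus_some_none, Act.coplus_some_some, Act.contr_none, Act.contr_some,
      Act.cocontr_none_none, Act.cocontr_some_none, Act.cocontr_none_some, Act.cocontr_some_some,
      Act.null_none, Act.null_some, Act.scal_none, Act.scal_some]
  all_goals try ring1
  case tensor_adapt.refine_1.refine_2 h k _ _ =>
    exact congrArg (fun o => Act.tens (fun a b => v (((), a), b)) (some o))
      (Ix.adapt_pair h.symm k.symm _ _ _).symm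
  case plus_adapt.refine_1.refine_2.refine_1 h k _ =>
    exact congrArg (fun o => Act.plus (fun a b => v (((), a), b)) (some o))
      (Ix.adapt_inl h.symm _ _).symm
  case plus_adapt.refine_1.refine_2.refine_2 h k _ =>
    exact congrArg (fun o => Act.plus (fun a b => v (((), a), b)) (some o))
      (Ix.adapt_inr h.symm k.symm _ _).symm
  case tensor_adapt.refine_2.refine_2.refine_2 h k _ _ =>
    exact congrArg (fun o => v ((), some o)) (Ix.adapt_pair h k _ _ _).symm
  case plus_adapt.refine_2.refine_2.refine_1 h k _ =>
    exact congrArg (fun o => v ((), some o)) (Ix.adapt_inr h k _ _).symm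
  case plus_adapt.refine_2.refine_1.refine_2 h k _ =>
    exact congrArg (fun o => v ((), some o)) (Ix.adapt_inl h _ _).symm
  all_goals
    rename_i h
    have e := congrArg (· * v ((), none)) h
    simp only [add_one_mul] at e
    rw [add_assoc, add_assoc, e]

/-- The linear functionals with finite support. -/
inductive IsFunctional {P : Type} : ((P → R) → R) → Prop
  | zero : IsFunctional fun _ => 0
  | eval (p : P) : IsFunctional fun v => v p
  | add {f g : (P → R) → R} : IsFunctional f → IsFunctional g → IsFunctional fun v => f v + g v
  | smul (s : R) {f : (P → R) → R} : IsFunctional f → IsFunctional fun v => s * f v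

namespace IsFunctional

variable {P Q : Type} {f : (P → R) → R} {g : (Q → R) → R}

theorem map_zero (hf : IsFunctional f) : f (fun _ => 0) = 0 := by
  induction hf with
  | zero => rfl
  | eval p => rfl
  | add _ _ ih ih' => beta_reduce; rw [ih, ih', add_zero]
  | smul s _ ih => beta_reduce; rw [ih, mul_zero]

theorem map_add (hf : IsFunctional f) (v w : P → R) : f (fun p => v p + w p) = f v + f w := by
  induction hf with
  | zero => exact (add_zero _).symm
  | eval p => rfl
  | add _ _ ih ih' => beta_reduce; rw [ih, ih', add_add_add_comm]
  | smul s _ ih => beta_reduce; rw [ih, mul_add]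

theorem map_smul (hf : IsFunctional f) (s : R) (v : P → R) : f (fun p => s * v p) = s * f v := by
  induction hf with
  | zero => exact (mul_zero _).symm
  | eval p => rfl
  | add _ _ ih ih' => beta_reduce; rw [ih, ih', mul_add]
  | smul t _ ih => beta_reduce; rw [ih, mul_left_comm]

theorem comm (hf : IsFunctional f) (hg : IsFunctional g) (w : P → Q → R) :
    f (fun p => g (w p)) = g fun q => f fun p => w p q := by
  induction hf with
  | zero => exact hg.map_zero.symm
  | eval p => rfl
  | add _ _ ih ih' => beta_reduce; rw [ih, ih', hg.map_add]
  | smul t _ ih => beta_reduce; rw [ih, hg.map_smul]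

theorem bind (hg : IsFunctional g) {F : Q → (P → R) → R} (hF : ∀ q, IsFunctional (F q)) :
    IsFunctional fun v => g fun q => F q v := by
  induction hg with
  | zero => exact .zero
  | eval p => exact hF p
  | add _ _ ih ih' => exact ih.add ih'
  | smul t _ ih => exact ih.smul t

end IsFunctional

theorem FGen.isFunctional {X Y : Obj} (g : FGen R X Y) (y : Pt Y) :
    IsFunctional fun v => g.act v y := by
  cases g with
  | tens A B => obtain ⟨_, _ | _⟩ := y <;> exact .eval _
  | cotens A B => obtain ⟨⟨_, _ | _⟩, _ | _⟩ := y <;> first | exact .zero | exact .eval _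
  | plus A B => obtain ⟨_, _ | _ | _⟩ := y <;> exact .eval _
  | coplus A B => obtain ⟨⟨_, _ | _⟩, _ | _⟩ := y <;> first | exact .zero | exact .eval _
  | contr A => obtain ⟨_, _ | _⟩ := y; exacts [.eval _, .add (.eval _) (.eval _)]
  | cocontr A => obtain ⟨⟨_, _ | _⟩, _ | _⟩ := y <;> first | exact .zero | exact .eval _
  | null A => obtain ⟨_, _ | _⟩ := y; exacts [.eval _, .zero]
  | conull A => exact .eval _
  | adapt h => exact .eval _
  | scal s A => obtain ⟨_, _ | _⟩ := y; exacts [.eval _, .smul s (.eval _)]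

namespace Diag

variable {X Y X' Y' : Obj}

theorem isFunctional {X Y : Obj} (d : Diag R X Y) : (y : Pt Y) → IsFunctional fun v => d.act v y := by
  induction d with
  | id X => exact fun y => .eval y
  | swap X Y => exact fun y => .eval _
  | comp d e ih ih' => exact fun y => (ih' y).bind ih
  | par d e ih ih' =>
    exact fun y => (ih _).bind fun x => (ih' (Pt.snd y)).bind fun x' => .eval (Pt.app x x')
  | fgen g => exact g.isFunctional
  | unit => exact fun y => .eval ()
  | counit => exact fun y => .add (.eval _) (.eval _)

theorem act_par (d : Diag R X Y) (e : Diag R X' Y') (v : Pt (X ++ X') → R) (y : Pt Y) (y' : Pt Y') :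
    (d ∥ᵈ e).act v (Pt.app y y') = d.act (fun x => e.act (fun x' => v (Pt.app x x')) y') y := by
  change d.act (fun x => e.act (fun x' => v (Pt.app x x')) (Pt.snd (Pt.app y y')))
    (Pt.fst (Pt.app y y')) = _
  rw [Pt.fst_app, Pt.snd_app]

theorem act_cast {X₁ Y₁ : Obj} (h : X = X₁) (k : Y = Y₁) (d : Diag R X Y) (v : Pt X₁ → R)
    (p : Pt Y) : (cast h k d).act v (Pt.cast k p) = d.act (fun x => v (Pt.cast h x)) p := by
  subst h k; rfl

theorem act_swap (v : Pt (X ++ Y) → R) (x : Pt X) (y : Pt Y) :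
    (swap X Y).act v (Pt.app y x) = v (Pt.app x y) :=
  congrArg v (congrArg₂ Pt.app (Pt.snd_app _ _) (Pt.fst_app _ _))

theorem Equiv.act_eq {d e : Diag R X Y} (h : d ≣ e) : d.act = e.act := by
  induction h with
  | refl => rfl
  | symm _ ih => exact ih.symm
  | trans _ _ ih ih' => exact ih.trans ih'
  | comp_congr _ _ ih ih' => funext v p; change act _ (act _ v) p = act _ (act _ v) p; rw [ih, ih']
  | par_congr _ _ ih ih' =>
    funext v p; obtain ⟨y, y', rfl⟩ := Pt.exists_app p
    rw [act_par, act_par, ih, ih']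
  | id_comp d => rfl
  | comp_id d => rfl
  | assoc d e f => rfl
  | par_id X Y => funext v p; exact congrArg v (Pt.app_fst_snd p)
  | interchange d e d' e' =>
    funext v p; obtain ⟨y, y', rfl⟩ := Pt.exists_app p
    refine (act_par _ _ _ _ _).trans (Eq.trans ?_ (act_par _ _ _ _ _).symm)
    refine congrArg (e.act · y) (funext fun z => ?_)
    refine Eq.trans ?_ ((d.isFunctional z).comm (e'.isFunctional y') _).symm
    exact congrArg (e'.act · y') (funext fun z' => (act_par _ _ _ _ _).trans rfl)
  | par_assoc d e f =>
    funext v p; obtain ⟨y, q, rfl⟩ := Pt.exists_app p; obtain ⟨y', y'', rfl⟩ := Pt.exists_app q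
    rw [← Pt.cast_app_assoc, act_cast, act_par, act_par, Pt.cast_app_assoc, act_par]
    refine congrArg (d.act · y) (funext fun x => ?_)
    rw [act_par]
    simp only [Pt.cast_app_assoc]
  | nil_par d =>
    funext v p
    refine (congrArg _ (Pt.cast_nil_app p).symm).trans ((act_cast _ _ _ _ _).trans
      ((act_par (id nil) d _ () p).trans ?_))
    exact congrArg (d.act · p) (funext fun x => congrArg v (Pt.cast_nil_app x))
  | par_nil d => rfl
  | swap_naturality d e =>
    funext v p; obtain ⟨y, y', rfl⟩ := Pt.exists_app p
    refine (act_swap _ _ _).trans ((act_par _ _ _ _ _).trans (Eq.trans ?_ (act_par _ _ _ _ _).symm))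
    refine ((d.isFunctional _).comm (e.isFunctional _) _).trans ?_
    exact congrArg (e.act · _) (funext fun x => congrArg (d.act · _) (funext fun x' =>
      (act_swap _ _ _).symm))
  | swap_swap X Y =>
    funext v p; obtain ⟨y, y', rfl⟩ := Pt.exists_app p
    exact (act_swap _ _ _).trans (act_swap _ _ _)
  | swap_nil X =>
    funext v p
    refine (congrArg _ (Pt.cast_nil_app p).symm).trans ((act_cast rfl _ _ _ _).trans ?_)
    exact act_swap (X := X) (Y := nil) v p ()
  | hexagon X Y Z =>
    funext v p; obtain ⟨q, x, rfl⟩ := Pt.exists_app p; obtain ⟨y, z, rfl⟩ := Pt.exists_app q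
    refine (act_swap v x (Pt.app y z)).trans ?_
    have e : Pt.app (Pt.app y z) x = Pt.cast (append_assoc Y Z X).symm (Pt.app y (Pt.app z x)) := by
      rw [← Pt.cast_app_assoc]; simp only [Pt.cast, eqRec_eq_cast, cast_cast, cast_eq]
    change _ = act (cast _ _ _) (act _ v) _
    rw [e, act_cast, act_par]
    change _ = act _ _ _
    change _ = act (swap X Z) _ _
    rw [act_swap]
    change _ = (cast _ _ _).act v (Pt.app y (Pt.app x z))
    rw [← Pt.cast_app_assoc y x z, act_cast, act_par, act_swap]
    exact congrArg v (Pt.cast_app_assoc x y z).symm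
  | ax h => exact h.act_eq.1
  | ax_mirror h => exact h.act_eq.2

end Diag

/-! ### The action of classes of diagrams -/

section Act

variable {X Y Z X' Y' : Obj}

/-- The action of a class of diagrams. -/
def Hom.act (d : Hom R X Y) : (Pt X → R) → Pt Y → R :=
  Quotient.lift Diag.act (fun _ _ h => Diag.Equiv.act_eq h) d

theorem Hom.act_comp (d : Hom R X Y) (e : Hom R Y Z) (v : Pt X → R) :
    (d ⬝ e).act v = e.act (d.act v) := by
  induction d using Quotient.ind; induction e using Quotient.ind; rfl

theorem Hom.act_par (d : Hom R X Y) (e : Hom R X' Y') (v : Pt (X ++ X') → R) (y : Pt Y)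
    (y' : Pt Y') :
    (d ⊠ e).act v (Pt.app y y') = d.act (fun x => e.act (fun x' => v (Pt.app x x')) y') y := by
  induction d using Quotient.ind; induction e using Quotient.ind; exact Diag.act_par _ _ _ _ _

theorem Hom.act_whisk (d : Hom R X Y) (B : Color) (v : Pt (snoc X B) → R) (y : Pt Y)
    (b : Option (Ix B)) :
    (d ◃ B).act v (y, b) = d.act (fun x => v (x, b)) y :=
  Hom.act_par d (.id (of B)) v y ((), b)

theorem Hom.isFunctional (d : Hom R X Y) (y : Pt Y) : IsFunctional fun v => d.act v y := by
  induction d using Quotient.ind; exact Diag.isFunctional _ y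

theorem act_tapR_some (v : Pt (of .one) → R) :
    (Diag.tapR .one).act v (((), some Ix.star), some Ix.star) = v ((), some Ix.star) :=
  congrArg (fun o => v ((), some o)) (Ix.adapt_tensor_one _ _)

theorem act_untapR_some (v : Pt (of .one ++ of .one) → R) :
    (Diag.untapR .one).act v ((), some Ix.star) = v (((), some Ix.star), some Ix.star) :=
  congrArg (fun o => Act.tens (fun a b => v (((), a), b)) (some o)) (Ix.adapt_tensor_one_symm _ _)

theorem IsLin.act_none {A B : Color} {f : A ⇒ B} (hf : IsLin f)
    (v : Pt (of A) → R) : f.act v ((), none) = v ((), none) :=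
  (congrFun (Hom.act_comp f (Hom.mk (Diag.conull B)) v) ()).symm.trans <|
    congrArg (fun d : Hom R (of A) nil => d.act v ()) <|
      Rule.eval (▣(Step.hom f 0 1) ⨾ ▣(Step.conull B 1)) ▣(Step.conull A 0) hf.conull

/-- The function on the points of a wire that is one at a given point. -/
def dirac {A : Color} (o : Option (Ix A)) : Pt (of A) → R := fun p => if p.2 = o then 1 else 0

theorem IsLin.act_dirac_none {A B : Color} {f : A ⇒ B} (hf : IsLin f) :
    f.act (dirac none) = dirac none := by
  have e (A : Color) : (Hom.mk (Diag.null A)).act (fun _ => (1 : R)) = dirac none :=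
    Pt.ext_snoc (Option.forall.2 ⟨rfl, fun _ => rfl⟩)
  rw [← e, ← e, ← Hom.act_comp]
  exact congrArg (fun d : Hom R nil (of B) => d.act fun _ => (1 : R)) <|
    Rule.eval (▣(Step.null A 1) ⨾ ▣(Step.hom f 1 0)) ▣(Step.null B 0) hf.null

theorem act_ket_some : (A : Color) → (i k : Ix A) → (v : Pt (of .one) → R) →
    (ket A i).act v ((), some k) = if i = k then v ((), some Ix.star) else 0
  | .zero, i, _, _ => i.elim
  | .one, _, _, _ => rfl
  | .plus A B, .inl i, .inl k, v => by
    refine (congrFun (Hom.act_comp (ket A i) (inl A B) v) _).trans ?_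
    exact (act_ket_some A i k v).trans (if_congr Sum.inl_injective.eq_iff.symm rfl rfl)
  | .plus A B, .inr i, .inr k, v => by
    refine (congrFun (Hom.act_comp (ket B i) (inr A B) v) _).trans ?_
    exact (act_ket_some B i k v).trans (if_congr Sum.inr_injective.eq_iff.symm rfl rfl)
  | .plus A B, .inl i, .inr k, v =>
    (congrFun (Hom.act_comp (ket A i) (inl A B) v) _).trans rfl
  | .plus A B, .inr i, .inl k, v =>
    (congrFun (Hom.act_comp (ket B i) (inr A B) v) _).trans rfl
  | .tensor A B, (i, j), (k, l), v => by
    refine (congrFun (Hom.act_comp (_ ⬝ (ket A i ⊠ ket B j)) (Hom.mk (Diag.tens A B)) v) _).trans ?_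
    change ((_ ⬝ (ket A i ⊠ ket B j)).act v) (((), some k), some l) = _
    rw [Hom.act_comp]
    refine (Hom.act_par (ket A i) (ket B j) _ ((), some k) ((), some l)).trans ?_
    rw [act_ket_some A i k, act_ket_some B j l]
    refine (if_congr Iff.rfl (if_congr Iff.rfl (act_tapR_some v) rfl) rfl).trans ?_
    exact ((if_congr Prod.mk_inj rfl rfl).trans (ite_and ..)).symm

theorem act_bra_some : (A : Color) → (i : Ix A) → (v : Pt (of A) → R) →
    (bra A i).act v ((), some Ix.star) = v ((), some i)
  | .zero, i, _ => i.elim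
  | .one, _, _ => rfl
  | .plus A B, .inl i, v => by
    refine (congrArg (fun d : (.plus A B) ⇒ .one => d.act v ((), some Ix.star))
      (bra_inl i)).trans ?_
    exact (congrFun (Hom.act_comp (prl A B) (bra A i) v) _).trans (act_bra_some A i _)
  | .plus A B, .inr i, v => by
    refine (congrArg (fun d : (.plus A B) ⇒ .one => d.act v ((), some Ix.star))
      (bra_inr i)).trans ?_
    exact (congrFun (Hom.act_comp (prr A B) (bra B i) v) _).trans (act_bra_some B i _)
  | .tensor A B, (i, j), v => by
    have e : bra (R := R) (.tensor A B) (i, j) = Hom.mk (Diag.cotens A B) ⬝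
        ((bra A i ⊠ bra B j) ⬝ Hom.mk (Diag.untapR .one)) := by
      change (tenState (ket A i) (ket B j)).mirror = _
      rw [tenState, Hom.mirror_comp, Hom.mirror_comp, Hom.mirror_par]; rfl
    rw [e, Hom.act_comp, Hom.act_comp]
    refine (act_untapR_some _).trans ?_
    refine (Hom.act_par (bra A i) (bra B j) _ ((), some Ix.star) ((), some Ix.star)).trans ?_
    rw [act_bra_some A i, act_bra_some B j]
    rfl

theorem act_dirac_of_entry {A B : Color} {f : A ⇒ B} {i : Ix A} {j : Ix B} {s : R}
    (h : ket A i ⬝ f ⬝ bra B j = sc s) : f.act (dirac (some i)) ((), some j) = s := by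
  have e : (ket A i).act (dirac (some Ix.star) : _ → R) = dirac (some i) := by
    refine Pt.ext_snoc (Option.forall.2 ⟨Pt.ext_nil ((IsLin.ket A i).act_none _), fun k => Pt.ext_nil ?_⟩)
    refine (act_ket_some A i k _).trans ?_
    refine if_congr ?_ rfl rfl
    exact eq_comm.trans (Option.some_inj).symm
  have h' := congrArg (fun d : .one ⇒ .one => d.act (dirac (some Ix.star)) ((), some Ix.star)) h
  simp only [Hom.act_comp, e, act_bra_some] at h'
  exact h'.trans (mul_one s)

/-- The index of a point of a pair of wires. -/
def Pt.comb {A B : Type} : Option A × Option B ≃ Option ((A × B) ⊕ (A ⊕ B)) where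
  toFun
    | (none, none) => none
    | (some a, some b) => some (.inl (a, b))
    | (some a, none) => some (.inr (.inl a))
    | (none, some b) => some (.inr (.inr b))
  invFun
    | none => (none, none)
    | some (.inl (a, b)) => (some a, some b)
    | some (.inr (.inl a)) => (some a, none)
    | some (.inr (.inr b)) => (none, some b)
  left_inv := by rintro ⟨_ | a, _ | b⟩ <;> rfl
  right_inv := by rintro (_ | ⟨⟨a, b⟩⟩ | a | b) <;> rfl

/-- The index of a point of an object. -/
def Pt.code : (X : Obj) → Pt X ≃ Option (Ix X.color)
  | .nil => ⟨fun _ => none, fun _ => (), fun _ => rfl, Option.forall.2 ⟨rfl, fun i => i.elim⟩⟩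
  | .snoc X _ => ((code X).prodCongr (Equiv.refl _)).trans Pt.comb

theorem act_encHom (A B : Color) (v : Pt (of A ++ of B) → R) (a : Option (Ix A))
    (b : Option (Ix B)) :
    (encHom A B).act v ((), Pt.comb (a, b)) = v (((), a), b) := by
  rcases a with _ | a <;> rcases b with _ | b <;> rfl

theorem act_encObj : (X : Obj) → (v : Pt X → R) → (p : Pt X) →
    (encObj X).act v ((), Pt.code X p) = v p
  | .nil, _, _ => rfl
  | .snoc X B, v, p => by
    refine (congrFun (Hom.act_comp (encObj X ◃ B) (encHom X.color B) v) _).trans ?_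
    refine (act_encHom X.color B _ (Pt.code X p.1) p.2).trans ?_
    exact (Hom.act_whisk (encObj X) B v _ _).trans (act_encObj X _ p.1)

theorem act_decObj (X : Obj) (v : Pt (of X.color) → R) (p : Pt X) :
    (decObj X).act v p = v ((), Pt.code X p) := by
  have e : (encObj X).act (fun p => v ((), Pt.code X p)) = v := by
    refine Pt.ext_snoc fun b => Pt.ext_nil ?_
    obtain ⟨p, rfl⟩ := (Pt.code X).surjective b
    exact act_encObj X _ p
  conv_lhs => rw [← e, ← Hom.act_comp, encObj_decObj]
  rfl

/-- The basis vector that represents a point in the last wire of `base`. -/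
def Ix.ofOption {A : Color} : Option (Ix A) → Ix (.plus A .one)
  | none => .inr star
  | some i => .inl i

theorem Ix.ofOption_surjective {A : Color} : Function.Surjective (ofOption (A := A))
  | .inl i => ⟨some i, rfl⟩
  | .inr _ => ⟨none, rfl⟩

theorem Ix.ofOption_injective {A : Color} : Function.Injective (ofOption (A := A))
  | none, none, _ => rfl
  | some _, some _, h => congrArg some (Sum.inl_injective h)

theorem act_base (X : Obj) (v : Pt X → R) (p : Pt X) :
    (base X).act v ((), some (Ix.ofOption (Pt.code X p))) = v p := by
  refine Eq.trans ?_ (act_encObj X v p)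
  rw [base, Hom.act_comp, Hom.act_comp]
  rcases Pt.code X p with _ | i <;> rfl

theorem act_base_none (X : Obj) (v : Pt X → R) :
    (base X).act v ((), none) = v ((Pt.code X).symm none) := by
  obtain ⟨p, hp⟩ := (Pt.code X).surjective none
  rw [← hp, Equiv.symm_apply_apply]
  refine Eq.trans ?_ (act_encObj X v p)
  rw [base, Hom.act_comp, Hom.act_comp, hp]
  rfl

theorem act_mirror_base (X : Obj) (v : Pt (of (.plus X.color .one)) → R) (p : Pt X) :
    (base X).mirror.act v p = v ((), some (Ix.ofOption (Pt.code X p))) +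
      if Pt.code X p = none then v ((), none) else 0 := by
  have e : (base (R := R) X).mirror = Hom.mk (Diag.coplus X.color .one) ⬝
      ((addUnit (of X.color)).mirror ⬝ decObj X) := by
    rw [base, Hom.mirror_comp, Hom.mirror_comp, Hom.assoc, mirror_encObj]; rfl
  rw [e]
  refine (congrFun (Hom.act_comp _ ((addUnit (of X.color)).mirror ⬝ decObj X) v) p).trans ?_
  refine (congrFun (Hom.act_comp (addUnit (of X.color)).mirror (decObj X) _) p).trans ?_
  refine (act_decObj X _ p).trans ?_
  rcases Pt.code X p with _ | i
  · rfl
  · exact (zero_add _).trans (add_zero _).symm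

open Classical in
/-- The entries of the matrix of a diagram. -/
noncomputable def Hom.coef (d : Hom R X Y) (x : Pt X) (y : Pt Y) : R := d.act (fun p => if p = x then 1 else 0) y

theorem coef_base {f : (.plus X.color .one) ⇒ (.plus Y.color .one)} (hf : IsLin f)
    {x : Pt X} {y : Pt Y} {s : R}
    (h : ket _ (Ix.ofOption (Pt.code X x)) ⬝ f ⬝ bra _ (Ix.ofOption (Pt.code Y y)) = sc s) :
    (base X ⬝ f ⬝ (base Y).mirror).coef x y =
      s + if Pt.code X x = none ∧ Pt.code Y y = none then 1 else 0 := by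
  classical
  have e : (base X).act (fun p => if p = x then (1 : R) else 0) = fun p =>
      dirac (some (Ix.ofOption (Pt.code X x))) p +
        (if Pt.code X x = none then 1 else 0) * dirac none p := by
    refine Pt.ext_snoc (Option.forall.2 ⟨Pt.ext_nil ?_, fun k => Pt.ext_nil ?_⟩)
    · refine (act_base_none X _).trans ?_
      simp [dirac, Equiv.symm_apply_eq, @eq_comm _ none]
    · obtain ⟨o, rfl⟩ := Ix.ofOption_surjective k
      obtain ⟨p, rfl⟩ := (Pt.code X).surjective o
      refine (act_base X _ p).trans ?_
      simp [dirac, Ix.ofOption_injective.eq_iff]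
  have e₁ : ∀ o, f.act (fun p => dirac (some (Ix.ofOption (Pt.code X x))) p +
        (if Pt.code X x = none then 1 else 0) * dirac none p) ((), o) =
      f.act (dirac (some (Ix.ofOption (Pt.code X x)))) ((), o) +
        (if Pt.code X x = none then 1 else 0) * dirac none ((), o) := by
    intro o
    refine ((Hom.isFunctional f ((), o)).map_add _ _).trans (congrArg (_ + ·) ?_)
    refine ((Hom.isFunctional f ((), o)).map_smul _ _).trans ?_
    rw [hf.act_dirac_none]
  rw [Hom.coef, Hom.act_comp, Hom.act_comp, e, act_mirror_base, e₁, e₁, act_dirac_of_entry h,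
    hf.act_none]
  by_cases h₁ : Pt.code X x = none <;> by_cases h₂ : Pt.code Y y = none <;> simp [h₁, h₂, dirac]

theorem Hom.eq_of_coef_of_isCancelAdd [IsCancelAdd R] {d e : Hom R X Y}
    (h : ∀ x y, d.coef x y = e.coef x y) : d = e := by
  obtain ⟨f, hf, rfl⟩ := exists_eq_base d
  obtain ⟨g, hg, rfl⟩ := exists_eq_base e
  rw [ext_entry hf.lin hg.lin fun i j => ?_]
  obtain ⟨o, rfl⟩ := Ix.ofOption_surjective i
  obtain ⟨o', rfl⟩ := Ix.ofOption_surjective j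
  obtain ⟨x, rfl⟩ := (Pt.code X).surjective o
  obtain ⟨y, rfl⟩ := (Pt.code Y).surjective o'
  obtain ⟨s, hs⟩ := hf.entry (Ix.ofOption (Pt.code X x)) (Ix.ofOption (Pt.code Y y))
  obtain ⟨t, ht⟩ := hg.entry (Ix.ofOption (Pt.code X x)) (Ix.ofOption (Pt.code Y y))
  have := h x y
  rw [coef_base hf.lin hs, coef_base hg.lin ht] at this
  rw [hs, ht, add_right_cancel this]

end Act

/-! ### Change of scalars -/

section Map

variable {K : Type u} [CommSemiring K] (φ : K →+* R) {X Y Z X' Y' : Obj}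

/-- Change of scalars in a generator. -/
def FGen.map : {X Y : Obj} → FGen K X Y → FGen R X Y
  | _, _, .tens A B => .tens A B
  | _, _, .cotens A B => .cotens A B
  | _, _, .plus A B => .plus A B
  | _, _, .coplus A B => .coplus A B
  | _, _, .contr A => .contr A
  | _, _, .cocontr A => .cocontr A
  | _, _, .null A => .null A
  | _, _, .conull A => .conull A
  | _, _, .adapt h => .adapt h
  | _, _, .scal s A => .scal (φ s) A

namespace Diag

/-- Change of scalars in a diagram. -/
def map : {X Y : Obj} → Diag K X Y → Diag R X Y
  | _, _, .id X => .id X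
  | _, _, .swap X Y => .swap X Y
  | _, _, .comp d e => .comp d.map e.map
  | _, _, .par d e => .par d.map e.map
  | _, _, .fgen g => .fgen (g.map φ)
  | _, _, .unit => .unit
  | _, _, .counit => .counit

theorem map_mirror {X Y : Obj} (d : Diag K X Y) : d.mirror.map φ = (d.map φ).mirror := by
  induction d with
  | id X => rfl
  | swap X Y => rfl
  | comp d e ih ih' => exact congrArg₂ comp ih' ih
  | par d e ih ih' => exact congrArg₂ par ih ih'
  | fgen g => cases g <;> rfl
  | unit => rfl
  | counit => rfl

theorem map_cast {X₁ Y₁ : Obj} (h : X = X₁) (k : Y = Y₁) (d : Diag K X Y) :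
    (cast h k d).map φ = cast h k (d.map φ) := by
  subst h k; rfl

theorem Axiom.map {d e : Diag K X Y} (h : Axiom d e) : Axiom (d.map φ) (e.map φ) := by
  cases h
  case scal_one A => exact (congrArg (fun s => Axiom (scal s A) (wire A)) (map_one φ)).mpr (.scal_one A)
  case scal_zero A =>
    exact (congrArg (fun s => Axiom (scal s A) (conull A ⨟ null A)) (map_zero φ)).mpr (.scal_zero A)
  case scal_add s t A =>
    exact (congrArg (fun r => Axiom (cocontr A ⨟ (scal (φ s) A ∥ᵈ scal (φ t) A) ⨟ contr A)
      (scal r A)) (map_add φ s t)).mpr (.scal_add _ _ A)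
  case tensor_scal s t A B =>
    exact (congrArg (fun r => Axiom ((scal (φ s) A ∥ᵈ scal (φ t) B) ⨟ tens A B)
      (tens A B ⨟ scal r (.tensor A B))) (map_mul φ s t)).mpr (.tensor_scal _ _ A B)
  case can s t h =>
    exact Axiom.can (φ s) (φ t) (by rw [← map_one φ, ← map_add, h, map_add])
  all_goals constructor

theorem Equiv.map {d e : Diag K X Y} (h : d ≣ e) : d.map φ ≣ e.map φ := by
  induction h with
  | refl => exact .refl _
  | symm _ ih => exact ih.symm
  | trans _ _ ih ih' => exact ih.trans ih'
  | comp_congr _ _ ih ih' => exact ih.comp_congr ih'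
  | par_congr _ _ ih ih' => exact ih.par_congr ih'
  | id_comp d => exact .id_comp _
  | comp_id d => exact .comp_id _
  | assoc d e f => exact .assoc _ _ _
  | par_id X Y => exact .par_id X Y
  | interchange d e d' e' => exact .interchange _ _ _ _
  | par_assoc d e f => rw [map_cast]; exact .par_assoc _ _ _
  | nil_par d => rw [map_cast]; exact .nil_par _
  | par_nil d => exact .par_nil _
  | swap_naturality d e => exact .swap_naturality _ _
  | swap_swap X Y => exact .swap_swap X Y
  | swap_nil X => rw [map_cast]; exact .swap_nil X
  | hexagon X Y Z =>
    change swap X (Y ++ Z) ≣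
      (Diag.map φ (cast (append_assoc X Y Z) (append_assoc Y X Z) (swap X Y ∥ᵈ id Z)) ⨟
        Diag.map φ (cast rfl (append_assoc Y Z X).symm (id Y ∥ᵈ swap X Z)))
    rw [map_cast, map_cast]; exact .hexagon X Y Z
  | ax h => exact .ax (h.map φ)
  | ax_mirror h => rw [map_mirror, map_mirror]; exact .ax_mirror (h.map φ)

end Diag

namespace Hom

/-- Change of scalars in a class of diagrams. -/
def map : Hom K X Y → Hom R X Y :=
  Quotient.map (Diag.map φ) fun _ _ h => Diag.Equiv.map φ h

theorem map_comp (d : Hom K X Y) (e : Hom K Y Z) : (d ⬝ e).map φ = d.map φ ⬝ e.map φ := by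
  induction d using Quotient.ind; induction e using Quotient.ind; rfl

theorem map_par (d : Hom K X Y) (e : Hom K X' Y') : (d ⊠ e).map φ = d.map φ ⊠ e.map φ := by
  induction d using Quotient.ind; induction e using Quotient.ind; rfl

theorem map_whisk (d : Hom K X Y) (B : Color) : (d ◃ B).map φ = d.map φ ◃ B :=
  map_par φ d (.id (of B))

theorem map_mirror (d : Hom K X Y) : d.mirror.map φ = (d.map φ).mirror := by
  induction d using Quotient.ind; exact congrArg mk (Diag.map_mirror φ _)

end Hom

theorem map_addHom {A B : Color} (f g : Hom K (of A) (of B)) :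
    (addHom f g).map φ = addHom (f.map φ) (g.map φ) := by
  rw [addHom, Hom.map_comp, Hom.map_comp, Hom.map_par]; rfl

theorem map_inl (A B : Color) : (inl A B).map φ = inl A B := rfl

theorem map_inr (A B : Color) : (inr A B).map φ = inr A B := rfl

theorem map_ket : (A : Color) → (i : Ix A) → (ket A i).map φ = ket A i
  | .zero, i => i.elim
  | .one, _ => rfl
  | .plus A B, .inl i => (Hom.map_comp φ (ket A i) (inl A B)).trans
      (congrArg₂ Hom.comp (map_ket A i) (map_inl φ A B))
  | .plus A B, .inr i => (Hom.map_comp φ (ket B i) (inr A B)).trans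
      (congrArg₂ Hom.comp (map_ket B i) (map_inr φ A B))
  | .tensor A B, (i, j) => by
    change (_ ⬝ (ket A i ⊠ ket B j) ⬝ _).map φ = _ ⬝ (ket A i ⊠ ket B j) ⬝ _
    rw [Hom.map_comp, Hom.map_comp, Hom.map_par, map_ket A i, map_ket B j]
    rfl

theorem map_bra (A : Color) (i : Ix A) : (bra A i).map φ = bra A i :=
  (Hom.map_mirror φ _).trans (congrArg Hom.mirror (map_ket φ A i))

theorem Lin.map_sum {A B : Color} {ι : Type} (t : Finset ι) {f : ι → Lin K A B}
    {g : ι → Lin R A B} (h : ∀ i, (f i).1.map φ = (g i).1) :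
    (∑ i ∈ t, f i).1.map φ = (∑ i ∈ t, g i).1 := by
  classical
  induction t using Finset.induction_on with
  | empty => rfl
  | insert i t hi ih =>
    rw [Finset.sum_insert hi, Finset.sum_insert hi]
    exact (map_addHom φ _ _).trans (congrArg₂ addHom (h i) ih)

theorem Lin.map_ofMatrix {A B : Color} (s : Ix A → Ix B → K) :
    (ofMatrix s).1.map φ = (ofMatrix fun i j => φ (s i j)).1 :=
  Lin.map_sum φ _ fun i => Lin.map_sum φ _ fun j => by
    change (bra A i ⬝ sc (s i j) ⬝ ket B j).map φ = bra A i ⬝ sc (φ (s i j)) ⬝ ket B j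
    rw [Hom.map_comp, Hom.map_comp, map_bra, map_ket]; rfl

theorem map_encObj : (X : Obj) → (encObj X).map φ = encObj X
  | .nil => rfl
  | .snoc X B => (Hom.map_comp φ (encObj X ◃ B) (encHom X.color B)).trans
      (congrArg (· ⬝ encHom X.color B) ((Hom.map_whisk φ (encObj X) B).trans
        (congrArg (· ◃ B) (map_encObj X))))

theorem map_decObj (X : Obj) : (decObj X).map φ = decObj X := by
  rw [← mirror_encObj, Hom.map_mirror, map_encObj, mirror_encObj]

theorem map_base (X : Obj) : (base X).map φ = base X := by
  rw [base, Hom.map_comp, map_encObj]; rfl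

end Map

/-! ### Completeness for the action -/

section Complete

variable {X Y : Obj}

/-- A diagram given by a matrix whose last entry is isolated in a loop. -/
def looped (s : Ix (.plus X.color .one) → Ix (.plus Y.color .one) → R) (c : R) : Hom R X Y :=
  encObj X ⬝ Hom.mk (Diag.tapR X.color) ⬝
    ((decObj X ⬝ (base X ⬝ (Lin.ofMatrix s).1 ⬝ (base Y).mirror) ⬝ encObj Y) ⊠
      Hom.mk (Diag.canLoop c)) ⬝ Hom.mk (Diag.untapR Y.color) ⬝ decObj Y

theorem map_looped {K : Type u} [CommSemiring K] (φ : K →+* R)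
    (s : Ix (.plus X.color .one) → Ix (.plus Y.color .one) → K) (c : K) :
    (looped s c).map φ = looped (X := X) (Y := Y) (fun i j => φ (s i j)) (φ c) := by
  simp only [looped, Hom.map_comp, Hom.map_par, Hom.map_mirror, map_encObj, map_decObj, map_base,
    Lin.map_ofMatrix]
  rfl

theorem act_tapR_dirac {A : Color} (o : Option (Ix A)) :
    (Hom.mk (Diag.tapR A)).act (dirac o) = fun p : Pt (of A ++ of .one) =>
      (dirac o p.1 * dirac (o.map fun _ => Ix.star) ((), p.2) : R) := by
  refine Pt.ext_snoc (Option.forall.2 ⟨Pt.ext_snoc (Option.forall.2 ⟨Pt.ext_nil ?_, fun a =>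
    Pt.ext_nil ?_⟩), Ix.forall_one.2 (Pt.ext_snoc (Option.forall.2 ⟨Pt.ext_nil ?_, fun a =>
    Pt.ext_nil ?_⟩))⟩)
  · change (dirac o ((), none) : R) = _
    cases o <;> simp [dirac]
  · change (0 : R) = _
    cases o <;> simp [dirac]
  · change (0 : R) = _
    cases o <;> simp [dirac]
  · refine (congrArg (fun k => (dirac o ((), some k) : R)) (Ix.adapt_tensor_one _ _)).trans ?_
    cases o <;> simp [dirac]

theorem act_untapR {A : Color} (v : Pt (of A ++ of .one) → R) (o : Option (Ix A)) :
    (Hom.mk (Diag.untapR A)).act v ((), o) = v (((), o), o.map fun _ => Ix.star) := by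
  cases o with
  | none => rfl
  | some a =>
    exact congrArg (fun k => Act.tens (fun a b => v (((), a), b)) (some k))
      (Ix.adapt_tensor_one_symm _ _)

theorem act_canLoop (c : R) (o o' : Option (Ix .one)) :
    (Hom.mk (Diag.canLoop c)).act (dirac o) ((), o') =
      if o = none ∧ o' = none then c + 1 else 1 := by
  have e (v : Pt (of .one) → R) : (Hom.mk (Diag.canLoop c)).act v ((), none) =
    v ((), some Ix.star) + c * v ((), none) + v ((), none) := rfl
  have e' (v : Pt (of .one) → R) : (Hom.mk (Diag.canLoop c)).act v ((), some Ix.star) =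
    v ((), some Ix.star) + c * 0 + v ((), none) := rfl
  rcases o with _ | ⟨⟨⟩⟩ <;> rcases o' with _ | ⟨⟨⟩⟩
  · rw [e]; simp [dirac]
  · refine (e' _).trans ?_; simp [dirac]
  · rw [e]; simp [dirac]; exact fun h => absurd rfl h
  · refine (e' _).trans ?_; simp [dirac]; exact fun h => absurd rfl h

theorem act_encObj_dirac (x : Pt X) [DecidableEq (Pt X)] :
    (encObj X).act (fun p => if p = x then (1 : R) else 0) = dirac (Pt.code X x) := by
  refine Pt.ext_snoc fun o => Pt.ext_nil ?_
  obtain ⟨p, rfl⟩ := (Pt.code X).surjective o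
  refine (act_encObj X _ p).trans ?_
  simp [dirac]

theorem act_decObj_dirac (x : Pt X) [DecidableEq (Pt X)] :
    (decObj X).act (dirac (Pt.code X x)) = fun p => if p = x then (1 : R) else 0 := by
  funext p
  rw [act_decObj]
  simp [dirac]

theorem coef_looped (s : Ix (.plus X.color .one) → Ix (.plus Y.color .one) → R) (c : R)
    (x : Pt X) (y : Pt Y) : (looped s c).coef x y =
      (if Pt.code X x = none ∧ Pt.code Y y = none then c + 1 else 1) *
        (s (Ix.ofOption (Pt.code X x)) (Ix.ofOption (Pt.code Y y)) +
          if Pt.code X x = none ∧ Pt.code Y y = none then 1 else 0) := by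
  classical
  have hd := coef_base (Lin.ofMatrix s).2
    (Lin.entry_ofMatrix s (Ix.ofOption (Pt.code X x)) (Ix.ofOption (Pt.code Y y)))
  rw [Hom.coef] at hd ⊢
  set d := base X ⬝ (Lin.ofMatrix s).1 ⬝ (base Y).mirror
  have e : (decObj X ⬝ d ⬝ encObj Y).act (dirac (Pt.code X x)) ((), Pt.code Y y) =
      d.act (fun p => if p = x then (1 : R) else 0) y := by
    rw [Hom.act_comp, Hom.act_comp, act_decObj_dirac]
    exact act_encObj Y _ y
  rw [looped, Hom.act_comp, Hom.act_comp, Hom.act_comp, Hom.act_comp, act_decObj, act_untapR,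
    act_encObj_dirac, act_tapR_dirac]
  refine (Hom.act_par (decObj X ⬝ d ⬝ encObj Y) (Hom.mk (Diag.canLoop c)) _ ((), Pt.code Y y)
    ((), (Pt.code Y y).map fun _ => Ix.star)).trans ?_
  refine (congrArg (fun v => (decObj X ⬝ d ⬝ encObj Y).act v ((), Pt.code Y y)) (funext fun z =>
    ((Hom.isFunctional (Hom.mk (Diag.canLoop c)) _).map_smul (dirac (Pt.code X x) z) _).trans
      ((mul_comm _ _).trans (congrArg (· * _) (act_canLoop c _ _))))).trans ?_
  refine ((Hom.isFunctional (decObj X ⬝ d ⬝ encObj Y) _).map_smul _ _).trans ?_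
  rw [e, ← hd]
  simp

theorem Ix.ofOption_none {A : Color} : ofOption (A := A) none = inr star := rfl

theorem Ix.ofOption_eq_inr {A : Color} {o : Option (Ix A)} : ofOption o = inr star ↔ o = none := by
  cases o
  · exact iff_of_true rfl rfl
  · exact iff_of_false Sum.inl_ne_inr (Option.some_ne_none _)

theorem base_eq_looped (s : Ix (.plus X.color .one) → Ix (.plus Y.color .one) → R) :
    base X ⬝ (Lin.ofMatrix s).1 ⬝ (base Y).mirror =
      looped (fun i j => if i = .inr Ix.star ∧ j = .inr Ix.star then 0 else s i j)
        (s (.inr Ix.star) (.inr Ix.star)) := by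
  let φ : MvPolynomial R ℕ →+* R := MvPolynomial.eval₂Hom (Nat.castRingHom R) id
  have e : base X ⬝ (Lin.ofMatrix fun i j => MvPolynomial.X (s i j)).1 ⬝ (base Y).mirror =
      looped (R := MvPolynomial R ℕ)
        (fun i j => if i = .inr Ix.star ∧ j = .inr Ix.star then 0 else .X (s i j))
        (.X (s (.inr Ix.star) (.inr Ix.star))) := by
    refine Hom.eq_of_coef_of_isCancelAdd fun x y => ?_
    rw [coef_looped, coef_base (Lin.ofMatrix _).2 (Lin.entry_ofMatrix _ _ _)]
    rcases Pt.code X x with _ | i <;> rcases Pt.code Y y with _ | j <;>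
      simp [Ix.ofOption_eq_inr, Ix.ofOption_none]
  have h := congrArg (Hom.map φ) e
  rw [map_looped] at h
  simpa [Hom.map_comp, Hom.map_mirror, map_base, Lin.map_ofMatrix, φ, apply_ite] using h

theorem Hom.eq_of_coef {d e : Hom R X Y} (h : ∀ x y, d.coef x y = e.coef x y) : d = e := by
  obtain ⟨f, hf, rfl⟩ := exists_eq_base d
  obtain ⟨g, hg, rfl⟩ := exists_eq_base e
  choose s hs using hf.entry
  choose t ht using hg.entry
  obtain rfl : f = (Lin.ofMatrix s).1 :=
    ext_entry hf.lin (Lin.ofMatrix s).2 fun i j => (hs i j).trans (Lin.entry_ofMatrix s i j).symm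
  obtain rfl : g = (Lin.ofMatrix t).1 :=
    ext_entry hg.lin (Lin.ofMatrix t).2 fun i j => (ht i j).trans (Lin.entry_ofMatrix t i j).symm
  have h' : ∀ o o', s (Ix.ofOption o) (Ix.ofOption o') + (if o = none ∧ o' = none then 1 else 0) =
      t (Ix.ofOption o) (Ix.ofOption o') + if o = none ∧ o' = none then 1 else 0 := fun o o' => by
    obtain ⟨x, rfl⟩ := (Pt.code X).surjective o
    obtain ⟨y, rfl⟩ := (Pt.code Y).surjective o'
    have := h x y
    rwa [coef_base hf.lin (hs _ _), coef_base hg.lin (ht _ _)] at this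
  rw [base_eq_looped, base_eq_looped, looped, looped]
  have e₁ : Hom.mk (Diag.canLoop (s (.inr Ix.star) (.inr Ix.star))) =
      Hom.mk (Diag.canLoop (t (.inr Ix.star) (.inr Ix.star))) :=
    Hom.sound (.ax (.can _ _ (by simpa [Ix.ofOption] using h' none none)))
  have e₂ : (fun i j => if i = .inr Ix.star ∧ j = .inr Ix.star then 0 else s i j) =
      fun i j => if i = .inr Ix.star ∧ j = .inr Ix.star then 0 else t i j := by
    funext i j
    obtain ⟨o, rfl⟩ := Ix.ofOption_surjective i
    obtain ⟨o', rfl⟩ := Ix.ofOption_surjective j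
    have := h' o o'
    rcases o with _ | i <;> rcases o' with _ | j <;> simp_all [Ix.ofOption_eq_inr]
  rw [e₁, e₂]

end Complete

/-! ### The semantics and the action -/

section Sem

variable {H : Type v} [Category.{w} H] [HasZeroMorphisms H] [HasZeroObject H]
  [HasBinaryBiproducts H] [MonoidalCategory H]

/-- The form on `K ⊗ L` given by forms on `K` and on `L`. -/
def formTen {K L : H} (f : K ⟶ 𝟙_ H) (g : L ⟶ 𝟙_ H) : K ⊗ L ⟶ 𝟙_ H := (f ⊗ₘ g) ≫ (λ_ (𝟙_ H)).hom

/-- The dual basis of the semantics of a color. -/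
noncomputable def Color.form (H : Type v) [Category.{w} H] [HasZeroMorphisms H] [HasZeroObject H]
    [HasBinaryBiproducts H] [MonoidalCategory H] : (A : Color) → Ix A → (A.sem H ⟶ 𝟙_ H)
  | .zero, _ => 0
  | .one, _ => 𝟙 (𝟙_ H)
  | .plus A _, .inl i => biprod.fst ≫ A.form H i
  | .plus _ B, .inr i => biprod.snd ≫ B.form H i
  | .tensor A B, (i, j) => formTen (A.form H i) (B.form H j)

/-- A form on `K`, or the projection to the vacuum, as a form on `K ⊕ 𝟙`. -/
noncomputable def formEv {K : H} : Option (K ⟶ 𝟙_ H) → (K ⊞ 𝟙_ H ⟶ 𝟙_ H)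
  | none => biprod.snd
  | some f => biprod.fst ≫ f

/-- The form on `K | L` given by forms on `K` and on `L`. -/
noncomputable def formComb {K L : H} :
    Option (K ⟶ 𝟙_ H) → Option (L ⟶ 𝟙_ H) → Option (bar K L ⟶ 𝟙_ H)
  | none, none => none
  | some f, none => some (biprod.snd ≫ biprod.fst ≫ f)
  | none, some g => some (biprod.snd ≫ biprod.snd ≫ g)
  | some f, some g => some (biprod.fst ≫ formTen f g)

/-- The form of a point. -/
noncomputable def Pt.form : {X : Obj} → Pt X → Option (X.sem H ⟶ 𝟙_ H)
  | .nil, _ => none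
  | .snoc _ B, p => formComb (Pt.form p.1) (p.2.map (B.form H))

section FormTen

variable {K K' L L' M : H} (f : K ⟶ 𝟙_ H) (g : L ⟶ 𝟙_ H) (h : M ⟶ 𝟙_ H)

theorem tensor_formTen (a : K' ⟶ K) (b : L' ⟶ L) :
    (a ⊗ₘ b) ≫ formTen f g = formTen (a ≫ f) (b ≫ g) := by
  rw [formTen, formTen, MonoidalCategory.tensorHom_comp_tensorHom_assoc]

theorem whiskerRight_formTen (a : K' ⟶ K) : a ▷ L ≫ formTen f g = formTen (a ≫ f) g := by
  rw [← tensorHom_id, tensor_formTen, Category.id_comp]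

theorem whiskerLeft_formTen (b : L' ⟶ L) : K ◁ b ≫ formTen f g = formTen f (b ≫ g) := by
  rw [← id_tensorHom, tensor_formTen, Category.id_comp]

theorem rightUnitor_form : (ρ_ K).hom ≫ f = formTen f (𝟙 (𝟙_ H)) := by
  rw [formTen, MonoidalCategory.unitors_equal, tensorHom_id, rightUnitor_naturality]

theorem leftUnitor_form : (λ_ K).hom ≫ f = formTen (𝟙 (𝟙_ H)) f := by
  rw [formTen, id_tensorHom, leftUnitor_naturality]

theorem rightUnitor_inv_formTen : (ρ_ K).inv ≫ formTen f (𝟙 (𝟙_ H)) = f := by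
  rw [← rightUnitor_form, Iso.inv_hom_id_assoc]

theorem leftUnitor_inv_formTen : (λ_ K).inv ≫ formTen (𝟙 (𝟙_ H)) f = f := by
  rw [← leftUnitor_form, Iso.inv_hom_id_assoc]

theorem associator_formTen :
    (α_ K L M).hom ≫ formTen f (formTen g h) = formTen (formTen f g) h := by
  have e : formTen (formTen f g) h = ((f ⊗ₘ g) ⊗ₘ h) ≫ formTen (λ_ (𝟙_ H)).hom (𝟙 (𝟙_ H)) := by
    rw [tensor_formTen, Category.comp_id]; rfl
  have e' : formTen f (formTen g h) = (f ⊗ₘ (g ⊗ₘ h)) ≫ formTen (𝟙 (𝟙_ H)) (λ_ (𝟙_ H)).hom := by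
    rw [tensor_formTen, Category.comp_id]; rfl
  rw [e, e', ← MonoidalCategory.associator_naturality_assoc, formTen, formTen, tensorHom_id,
    id_tensorHom, MonoidalCategory.triangle_assoc, ← MonoidalCategory.unitors_equal]

theorem associator_inv_formTen :
    (α_ K L M).inv ≫ formTen (formTen f g) h = formTen f (formTen g h) := by
  rw [← associator_formTen, Iso.inv_hom_id_assoc]

theorem unit_formTen (f g : 𝟙_ H ⟶ 𝟙_ H) : (λ_ (𝟙_ H)).inv ≫ formTen f g = f ≫ g := by
  rw [formTen, MonoidalCategory.tensorHom_def, Category.assoc, leftUnitor_naturality,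
    MonoidalCategory.unitors_equal, rightUnitor_naturality_assoc,
    ← MonoidalCategory.unitors_equal, Iso.inv_hom_id_assoc]

theorem smulId_comp (s : 𝟙_ H ⟶ 𝟙_ H) : smulId s K ≫ f = f ≫ s := by
  rw [smulId, Category.assoc, Category.assoc, ← leftUnitor_naturality,
    ← whisker_exchange_assoc, ← leftUnitor_inv_naturality_assoc, MonoidalCategory.unitors_equal,
    rightUnitor_naturality, ← MonoidalCategory.unitors_equal, Iso.inv_hom_id_assoc]

theorem braiding_formTen [BraidedCategory H] : (β_ K L).hom ≫ formTen g f = formTen f g := by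
  rw [formTen, formTen, ← BraidedCategory.braiding_naturality_assoc, braiding_leftUnitor,
    ← MonoidalCategory.unitors_equal]

end FormTen

section Biprod

variable {K K' L L' M P : H}

theorem map_formEv (f : K ⟶ L) (o : Option (L ⟶ 𝟙_ H)) :
    biprod.map f (𝟙 (𝟙_ H)) ≫ formEv o = formEv (o.map (f ≫ ·)) := by
  cases o <;> simp [formEv]

theorem formComb_map (f : K ≅ K') (g : L ≅ L') (o : Option (K' ⟶ 𝟙_ H))
    (o' : Option (L' ⟶ 𝟙_ H)) :
    formComb (o.map (f.hom ≫ ·)) (o'.map (g.hom ≫ ·)) =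
      (formComb o o').map ((barIso f g).hom ≫ ·) := by
  cases o <;> cases o' <;> simp [formComb, tensor_formTen]

theorem formComb_map_left (f : K ≅ K') (o : Option (K' ⟶ 𝟙_ H)) (o' : Option (L ⟶ 𝟙_ H)) :
    formComb (o.map (f.hom ≫ ·)) o' = (formComb o o').map ((barIso f (Iso.refl L)).hom ≫ ·) := by
  rw [← formComb_map]
  simp

variable [Distributive H]

theorem distL_inv_formTen_fst (f : K ⟶ 𝟙_ H) (g : L ⟶ 𝟙_ H) :
    (distL K L M).inv ≫ formTen f (biprod.fst ≫ g) = biprod.fst ≫ formTen f g := by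
  rw [← whiskerLeft_formTen, ← Category.assoc, distL_inv_fst]

theorem distL_inv_formTen_snd (f : K ⟶ 𝟙_ H) (g : M ⟶ 𝟙_ H) :
    (distL K L M).inv ≫ formTen f (biprod.snd ≫ g) = biprod.snd ≫ formTen f g := by
  rw [← whiskerLeft_formTen, ← Category.assoc, distL_inv_snd]

variable [SymmetricCategory H]

theorem expand_formEv (o : Option (K ⟶ 𝟙_ H)) (o' : Option (L ⟶ 𝟙_ H)) :
    (expand K L).hom ≫ formEv (formComb o o') = formTen (formEv o) (formEv o') := by
  cases o <;> cases o' <;>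
    simp [formComb, formEv, expand, reassoc_of% (distR_hom_fst (H := H)),
      reassoc_of% (distR_hom_snd (H := H)), reassoc_of% (distL_hom_fst (H := H)),
      reassoc_of% (distL_hom_snd (H := H)), rightUnitor_form, leftUnitor_form,
      whiskerRight_formTen, whiskerLeft_formTen]

theorem formComb_barSwap (o : Option (K ⟶ 𝟙_ H)) (o' : Option (L ⟶ 𝟙_ H)) :
    (formComb o' o).map (barSwap K L ≫ ·) = formComb o o' := by
  cases o <;> cases o' <;> simp [formComb, barSwap, braiding_formTen]

theorem formComb_barAssoc (o : Option (K ⟶ 𝟙_ H)) (o' : Option (L ⟶ 𝟙_ H))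
    (o'' : Option (M ⟶ 𝟙_ H)) :
    (formComb o (formComb o' o'')).map ((barAssoc K L M).hom ≫ ·) =
      formComb (formComb o o') o'' := by
  cases o <;> cases o' <;> cases o'' <;>
    simp [formComb, barAssoc, distL_inv_formTen_fst, distL_inv_formTen_snd,
      whiskerRight_formTen, associator_formTen]

theorem formComb_none_right (o : Option (K ⟶ 𝟙_ H)) :
    (formComb o (none : Option ((0 : H) ⟶ 𝟙_ H))).map ((barRight K).inv ≫ ·) = o := by
  cases o <;> simp [formComb, barRight]

theorem formComb_append (a : bar K L ≅ P) (o : Option (K ⟶ 𝟙_ H)) (o' : Option (L ⟶ 𝟙_ H))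
    (o'' : Option (M ⟶ 𝟙_ H)) :
    (formComb o (formComb o' o'')).map
        (((barAssoc K L M).symm ≪≫ barIso a (Iso.refl M)).inv ≫ ·) =
      formComb ((formComb o o').map (a.inv ≫ ·)) o'' := by
  rw [← Iso.symm_hom a, formComb_map_left, ← formComb_barAssoc, Option.map_map]
  congr 1
  funext x
  simp

end Biprod

variable [Distributive H] [SymmetricCategory H]

theorem Pt.form_app {X : Obj} (x : Pt X) : {Y : Obj} → (y : Pt Y) →
    form (H := H) (app x y) = (formComb (form x) (form y)).map ((appendIso X Y).inv ≫ ·)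
  | .nil, _ => (formComb_none_right _).symm
  | .snoc Y B, y => (congrArg (formComb · _) (form_app x y.1)).trans
      (formComb_append (appendIso X Y) (form x) (form y.1) (y.2.map (B.form H))).symm

theorem Pt.form_of (A : Color) (a : Option (Ix A)) :
    Pt.form (H := H) (X := of A) ((), a) =
      (a.map (A.form H)).map ((oneIso A).hom ≫ ·) := by
  cases a
  · rfl
  · exact congrArg some (Category.assoc _ _ _).symm

theorem Pt.form_two (A B : Color) (a : Option (Ix A)) (b : Option (Ix B)) :
    Pt.form (H := H) (X := of A ++ of B) (((), a), b) =
      (formComb (a.map (A.form H)) (b.map (B.form H))).map ((twoIso A B).hom ≫ ·) :=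
  (congrArg (formComb · _) (Pt.form_of A a)).trans (formComb_map_left (oneIso A) _ _)

theorem plus_assoc_form (K L M : H) :
    (∀ f : K ⟶ 𝟙_ H, (biprod.associator K L M).hom ≫ biprod.fst ≫ f =
      biprod.fst ≫ biprod.fst ≫ f) ∧
    (∀ f : L ⟶ 𝟙_ H, (biprod.associator K L M).hom ≫ biprod.snd ≫ biprod.fst ≫ f =
      biprod.fst ≫ biprod.snd ≫ f) ∧
    ∀ f : M ⟶ 𝟙_ H, (biprod.associator K L M).hom ≫ biprod.snd ≫ biprod.snd ≫ f =
      biprod.snd ≫ f := by simp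

theorem plus_assoc_inv_form (K L M : H) :
    (∀ f : K ⟶ 𝟙_ H, (biprod.associator K L M).inv ≫ biprod.fst ≫ biprod.fst ≫ f =
      biprod.fst ≫ f) ∧
    (∀ f : L ⟶ 𝟙_ H, (biprod.associator K L M).inv ≫ biprod.fst ≫ biprod.snd ≫ f =
      biprod.snd ≫ biprod.fst ≫ f) ∧
    ∀ f : M ⟶ 𝟙_ H, (biprod.associator K L M).inv ≫ biprod.snd ≫ f =
      biprod.snd ≫ biprod.snd ≫ f := by simp

theorem IsCoherence.approx {A B : Color} {f : A.sem H ⟶ B.sem H} (h : IsCoherence A B f) :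
    A.Approx B := by
  induction h with
  | id A => exact .refl A
  | comp _ _ ih ih' => exact ih.trans ih'
  | tensor _ _ ih ih' => exact (Color.Approx.tensor_right _ ih).trans (.tensor_left _ ih')
  | plus _ _ ih ih' => exact (Color.Approx.plus_right _ ih).trans (.plus_left _ ih')
  | tensor_one A => exact .tensor_one A
  | tensor_one_inv A => exact (Color.Approx.tensor_one A).symm
  | one_tensor A => exact .one_tensor A
  | one_tensor_inv A => exact (Color.Approx.one_tensor A).symm
  | tensor_assoc A B C => exact .tensor_assoc A B C
  | tensor_assoc_inv A B C => exact (Color.Approx.tensor_assoc A B C).symm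
  | plus_zero A => exact .plus_zero A
  | plus_zero_inv A => exact (Color.Approx.plus_zero A).symm
  | zero_plus A => exact .zero_plus A
  | zero_plus_inv A => exact (Color.Approx.zero_plus A).symm
  | plus_assoc A B C => exact .plus_assoc A B C
  | plus_assoc_inv A B C => exact (Color.Approx.plus_assoc A B C).symm

theorem IsCoherence.comp_form {A B : Color} {f : A.sem H ⟶ B.sem H} (hf : IsCoherence A B f) :
    ∀ (h : B.Approx A) (j : Ix B), f ≫ B.form H j = A.form H (Ix.adapt h j) := by
  induction hf with
  | id A => intro h j; rw [Ix.adapt_self, Category.id_comp]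
  | comp hf hg ih ih' =>
    intro h j
    rw [Category.assoc, ih' hg.approx.symm, ih hf.approx.symm, Ix.adapt_adapt]
  | tensor hf hg ih ih' =>
    refine fun h => Ix.forall_tensor.2 fun i j => ?_
    rw [Ix.adapt_pair hf.approx.symm hg.approx.symm]
    exact (tensor_formTen _ _ _ _).trans (congrArg₂ formTen (ih _ i) (ih' _ j))
  | plus hf hg ih ih' =>
    refine fun h => Ix.forall_plus.2 ⟨fun i => ?_, fun i => ?_⟩
    · rw [Ix.adapt_inl hf.approx.symm]
      exact (biprod.map_fst_assoc _ _ _).trans (congrArg (_ ≫ ·) (ih _ i))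
    · rw [Ix.adapt_inr hf.approx.symm hg.approx.symm]
      exact (biprod.map_snd_assoc _ _ _).trans (congrArg (_ ≫ ·) (ih' _ i))
  | tensor_one A =>
    intro h j; rw [Ix.adapt_tensor_one_symm]; exact rightUnitor_form _
  | tensor_one_inv A =>
    refine fun h => Ix.forall_tensor.2 fun i => Ix.forall_one.2 ?_
    rw [Ix.adapt_tensor_one]; exact rightUnitor_inv_formTen _
  | one_tensor A =>
    intro h j; rw [Ix.adapt_one_tensor_symm]; exact leftUnitor_form _
  | one_tensor_inv A =>
    refine fun h => Ix.forall_tensor.2 (Ix.forall_one.2 fun i => ?_)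
    rw [Ix.adapt_one_tensor]; exact leftUnitor_inv_formTen _
  | tensor_assoc A B C =>
    refine fun h => Ix.forall_tensor.2 fun i => Ix.forall_tensor.2 fun j k => ?_
    rw [Ix.adapt_tensor_assoc_symm]; exact associator_formTen _ _ _
  | tensor_assoc_inv A B C =>
    refine fun h => Ix.forall_tensor.2 (Ix.forall_tensor.2 fun i j k => ?_)
    rw [Ix.adapt_tensor_assoc]; exact associator_inv_formTen _ _ _
  | plus_zero A => intro h j; rw [Ix.adapt_plus_zero_symm]; rfl
  | plus_zero_inv A =>
    refine fun h => Ix.forall_plus.2 ⟨fun i => ?_, fun i => i.elim⟩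
    rw [Ix.adapt_plus_zero]; exact biprod.inl_fst_assoc _
  | zero_plus A => intro h j; rw [Ix.adapt_zero_plus_symm]; rfl
  | zero_plus_inv A =>
    refine fun h => Ix.forall_plus.2 ⟨fun i => i.elim, fun i => ?_⟩
    rw [Ix.adapt_zero_plus]; exact biprod.inr_snd_assoc _
  | plus_assoc A B C =>
    have e := plus_assoc_form (A.sem H) (B.sem H) (C.sem H)
    refine fun h => Ix.forall_plus.2 ⟨fun i => ?_, Ix.forall_plus.2 ⟨fun i => ?_, fun i => ?_⟩⟩
    · rw [Ix.adapt_plus_assoc_symm_inl]; exact e.1 _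
    · rw [Ix.adapt_plus_assoc_symm_inr_inl]; exact e.2.1 _
    · rw [Ix.adapt_plus_assoc_symm_inr_inr]; exact e.2.2 _
  | plus_assoc_inv A B C =>
    have e := plus_assoc_inv_form (A.sem H) (B.sem H) (C.sem H)
    refine fun h => Ix.forall_plus.2 ⟨Ix.forall_plus.2 ⟨fun i => ?_, fun i => ?_⟩, fun i => ?_⟩
    · rw [Ix.adapt_plus_assoc_inl_inl]; exact e.1 _
    · rw [Ix.adapt_plus_assoc_inl_inr]; exact e.2.1 _
    · rw [Ix.adapt_plus_assoc_inr]; exact e.2.2 _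

theorem coherence_comp_form {A B : Color} (h : A.Approx B) (j : Ix B) :
    coherence H h ≫ B.form H j = A.form H (Ix.adapt h.symm j) :=
  (exists_isCoherence H h).1.choose_spec.comp_form h.symm j

end Sem

section Represents

variable {H : Type v} [Category.{w} H] [HasZeroMorphisms H] [HasZeroObject H]
  [HasBinaryBiproducts H] [MonoidalCategory H] [Distributive H] [SymmetricCategory H]
  (S : ScalarIso R H)

/-- A morphism `m` has the components `v`. -/
def Represents {X : Obj} (v : Pt X → R) (m : 𝟙_ H ⟶ X.sem H ⊞ 𝟙_ H) : Prop :=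
  ∀ p, m ≫ formEv p.form = S.scal (v p)

theorem scal_desc (s t : R) {m : 𝟙_ H ⟶ 𝟙_ H ⊞ 𝟙_ H} (h : m ≫ biprod.fst = S.scal s)
    (h' : m ≫ biprod.snd = S.scal t) :
    m ≫ biprod.desc (𝟙 (𝟙_ H)) (𝟙 (𝟙_ H)) = S.scal (s + t) := by
  rw [S.map_add, ← Category.assoc]
  congr 1
  apply biprod.hom_ext <;> simp [h, h']

variable {S}

namespace FormGen

variable {K L P Q : H} (f : K ⟶ 𝟙_ H) (g : L ⟶ 𝟙_ H)

section Two

variable (a : P ≅ bar K L) (b : Q ≅ K ⊗ L) (c : Q ≅ K ⊞ L)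

theorem tens : ((some (formTen f g)).map (b.hom ≫ ·)).map ((a.hom ≫ biprod.fst ≫ b.inv) ≫ ·) =
    (formComb (some f) (some g)).map (a.hom ≫ ·) := by simp [formComb]

theorem cotens : ((formComb (some f) (some g)).map (a.hom ≫ ·)).map
    ((b.hom ≫ biprod.inl ≫ a.inv) ≫ ·) = (some (formTen f g)).map (b.hom ≫ ·) := by
  simp [formComb]

theorem cotens_none_some : ((formComb (none : Option (K ⟶ 𝟙_ H)) (some g)).map (a.hom ≫ ·)).map
    ((b.hom ≫ biprod.inl ≫ a.inv) ≫ ·) = some 0 := by simp [formComb]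

theorem cotens_some_none : ((formComb (some f) (none : Option (L ⟶ 𝟙_ H))).map (a.hom ≫ ·)).map
    ((b.hom ≫ biprod.inl ≫ a.inv) ≫ ·) = some 0 := by simp [formComb]

theorem plus_inl :
    ((some (biprod.fst ≫ f)).map (c.hom ≫ ·)).map ((a.hom ≫ biprod.snd ≫ c.inv) ≫ ·) =
      (formComb (some f) (none : Option (L ⟶ 𝟙_ H))).map (a.hom ≫ ·) := by simp [formComb]

theorem plus_inr :
    ((some (biprod.snd ≫ g)).map (c.hom ≫ ·)).map ((a.hom ≫ biprod.snd ≫ c.inv) ≫ ·) =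
      (formComb (none : Option (K ⟶ 𝟙_ H)) (some g)).map (a.hom ≫ ·) := by simp [formComb]

theorem coplus_inr : ((formComb (none : Option (K ⟶ 𝟙_ H)) (some g)).map (a.hom ≫ ·)).map
    ((c.hom ≫ biprod.inr ≫ a.inv) ≫ ·) = (some (biprod.snd ≫ g)).map (c.hom ≫ ·) := by
  simp [formComb]

theorem coplus_inl : ((formComb (some f) (none : Option (L ⟶ 𝟙_ H))).map (a.hom ≫ ·)).map
    ((c.hom ≫ biprod.inr ≫ a.inv) ≫ ·) = (some (biprod.fst ≫ f)).map (c.hom ≫ ·) := by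
  simp [formComb]

theorem coplus_zero : ((formComb (some f) (some g)).map (a.hom ≫ ·)).map
    ((c.hom ≫ biprod.inr ≫ a.inv) ≫ ·) = some 0 := by simp [formComb]

end Two

section One

variable (a : P ≅ bar K K) (b : Q ≅ K) (f' : K ⟶ 𝟙_ H)

theorem contr : ((some f).map (b.hom ≫ ·)).map
    ((a.hom ≫ biprod.snd ≫ biprod.desc (𝟙 K) (𝟙 K) ≫ b.inv) ≫ ·) =
      some (a.hom ≫ biprod.snd ≫ biprod.desc f f) := by
  have e : biprod.desc (𝟙 K) (𝟙 K) ≫ f = biprod.desc f f := by ext <;> simp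
  simp [← e]

theorem ev_desc (m : 𝟙_ H ⟶ P ⊞ 𝟙_ H) : m ≫ formEv (some (a.hom ≫ biprod.snd ≫ biprod.desc f f)) =
    (m ≫ biprod.fst ≫ a.hom ≫ biprod.snd ≫ biprod.map f f) ≫
      biprod.desc (𝟙 (𝟙_ H)) (𝟙 (𝟙_ H)) := by
  have e : biprod.map f f ≫ biprod.desc (𝟙 (𝟙_ H)) (𝟙 (𝟙_ H)) = biprod.desc f f := by
    ext <;> simp
  simp [formEv, e]

theorem ev_fst (m : 𝟙_ H ⟶ P ⊞ 𝟙_ H) :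
    (m ≫ biprod.fst ≫ a.hom ≫ biprod.snd ≫ biprod.map f f) ≫ biprod.fst =
      m ≫ formEv ((formComb (some f) none).map (a.hom ≫ ·)) := by simp [formEv, formComb]

theorem ev_snd (m : 𝟙_ H ⟶ P ⊞ 𝟙_ H) :
    (m ≫ biprod.fst ≫ a.hom ≫ biprod.snd ≫ biprod.map f f) ≫ biprod.snd =
      m ≫ formEv ((formComb none (some f)).map (a.hom ≫ ·)) := by simp [formEv, formComb]

theorem cocontr_right : ((formComb none (some f)).map (a.hom ≫ ·)).map
    ((b.hom ≫ biprod.lift (𝟙 K) (𝟙 K) ≫ biprod.inr ≫ a.inv) ≫ ·) =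
      (some f).map (b.hom ≫ ·) := by simp [formComb]

theorem cocontr_left : ((formComb (some f) none).map (a.hom ≫ ·)).map
    ((b.hom ≫ biprod.lift (𝟙 K) (𝟙 K) ≫ biprod.inr ≫ a.inv) ≫ ·) =
      (some f).map (b.hom ≫ ·) := by simp [formComb]

theorem cocontr_zero : ((formComb (some f) (some f')).map (a.hom ≫ ·)).map
    ((b.hom ≫ biprod.lift (𝟙 K) (𝟙 K) ≫ biprod.inr ≫ a.inv) ≫ ·) = some 0 := by simp [formComb]

theorem conj (i : P ≅ L) (φ : L ⟶ K) : ((some f).map (b.hom ≫ ·)).map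
    ((i.hom ≫ φ ≫ b.inv) ≫ ·) = some (i.hom ≫ φ ≫ f) := by simp

theorem ev_smul (m : 𝟙_ H ⟶ P ⊞ 𝟙_ H) (i : P ≅ K) (s : 𝟙_ H ⟶ 𝟙_ H) :
    m ≫ formEv (some (i.hom ≫ smulId s K ≫ f)) =
      (m ≫ formEv (((some f)).map (i.hom ≫ ·))) ≫ s := by simp [formEv, smulId_comp]

end One

section Unit

variable (i : Q ≅ 𝟙_ H)

theorem unit_none : (biprod.snd ≫ biprod.lift (𝟙 (𝟙_ H)) (𝟙 (𝟙_ H)) ≫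
    biprod.map i.inv (𝟙 (𝟙_ H))) ≫ biprod.snd = (biprod.snd : (0 : H) ⊞ 𝟙_ H ⟶ 𝟙_ H) := by simp

theorem unit_some : (biprod.snd ≫ biprod.lift (𝟙 (𝟙_ H)) (𝟙 (𝟙_ H)) ≫
    biprod.map i.inv (𝟙 (𝟙_ H))) ≫ biprod.fst ≫ i.hom ≫ 𝟙 (𝟙_ H) =
      (biprod.snd : (0 : H) ⊞ 𝟙_ H ⟶ 𝟙_ H) := by simp

theorem counit (m : 𝟙_ H ⟶ Q ⊞ 𝟙_ H) : (m ≫ biprod.map i.hom (𝟙 (𝟙_ H)) ≫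
    biprod.desc (𝟙 (𝟙_ H)) (𝟙 (𝟙_ H)) ≫ (biprod.inr : 𝟙_ H ⟶ (0 : H) ⊞ 𝟙_ H)) ≫ biprod.snd =
      (m ≫ biprod.map i.hom (𝟙 (𝟙_ H))) ≫ biprod.desc (𝟙 (𝟙_ H)) (𝟙 (𝟙_ H)) := by simp

theorem counit_fst (m : 𝟙_ H ⟶ Q ⊞ 𝟙_ H) : (m ≫ biprod.map i.hom (𝟙 (𝟙_ H))) ≫ biprod.fst =
    m ≫ formEv ((some (𝟙 (𝟙_ H))).map (i.hom ≫ ·)) := by simp [formEv]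

theorem counit_snd (m : 𝟙_ H ⟶ Q ⊞ 𝟙_ H) : (m ≫ biprod.map i.hom (𝟙 (𝟙_ H))) ≫ biprod.snd =
    m ≫ formEv none := by simp [formEv]

end Unit

theorem inl_fst (k : 𝟙_ H ⟶ K) : (k ≫ (biprod.inl : K ⟶ K ⊞ L)) ≫ biprod.fst ≫ f = k ≫ f := by
  simp

theorem inl_snd (k : 𝟙_ H ⟶ K) : (k ≫ (biprod.inl : K ⟶ K ⊞ L)) ≫ biprod.snd ≫ g = 0 := by simp

theorem inr_fst (k : 𝟙_ H ⟶ L) : (k ≫ (biprod.inr : L ⟶ K ⊞ L)) ≫ biprod.fst ≫ f = 0 := by simp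

theorem inr_snd (k : 𝟙_ H ⟶ L) : (k ≫ (biprod.inr : L ⟶ K ⊞ L)) ≫ biprod.snd ≫ g = k ≫ g := by
  simp

theorem inr_ev : (biprod.inr : 𝟙_ H ⟶ K ⊞ 𝟙_ H) ≫ formEv none = 𝟙 (𝟙_ H) := by simp [formEv]

theorem expand_ev (m : 𝟙_ H ⟶ K ⊞ 𝟙_ H) (l : 𝟙_ H ⟶ L ⊞ 𝟙_ H) (o : Option (K ⟶ 𝟙_ H))
    (o' : Option (L ⟶ 𝟙_ H)) :
    ((λ_ (𝟙_ H)).inv ≫ (m ⊗ₘ l) ≫ (expand K L).hom) ≫ formEv (formComb o o') =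
      (λ_ (𝟙_ H)).inv ≫ formTen (m ≫ formEv o) (l ≫ formEv o') := by
  rw [Category.assoc, Category.assoc, expand_formEv, tensor_formTen]

end FormGen

theorem Represents.fgen {X Y : Obj} (g : FGen R X Y) {v : Pt X → R}
    {m : 𝟙_ H ⟶ X.sem H ⊞ 𝟙_ H} (h : Represents S v m) :
    Represents S (g.act v) (m ≫ biprod.map (g.sem S) (𝟙 (𝟙_ H))) := by
  intro p
  rw [Category.assoc, map_formEv]
  have zero {o : Option (X.sem H ⟶ 𝟙_ H)} (e : o = some 0) : m ≫ formEv o = S.scal 0 := by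
    rw [e, formEv, comp_zero, comp_zero, S.map_zero]
  have point (x : Pt X) {o} (e : o = x.form) : m ≫ formEv o = S.scal (v x) := e ▸ h x
  have two {A B : Color} {Q : H} (a : Option (Ix A)) (b : Option (Ix B))
      {φ : Q ⟶ (of A ++ of B).sem H} {o} (e : ((formComb (a.map (A.form H)) (b.map (B.form H))).map
        ((twoIso A B).hom ≫ ·)).map (φ ≫ ·) = o) :
      (Pt.form (X := of A ++ of B) (((), a), b)).map (φ ≫ ·) = o :=
    (congrArg (Option.map _) (Pt.form_two A B a b)).trans e
  have one {A : Color} {Q : H} (a : Option (Ix A)) {φ : Q ⟶ (of A).sem H} {o}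
      (e : ((a.map (A.form H)).map ((oneIso A).hom ≫ ·)).map (φ ≫ ·) = o) :
      (Pt.form (X := of A) ((), a)).map (φ ≫ ·) = o :=
    (congrArg (Option.map _) (Pt.form_of A a)).trans e
  cases g with
  | tens A B =>
    obtain ⟨⟨⟩, _ | ⟨i, j⟩⟩ := p
    · exact h (((), none), none)
    · exact point (((), some i), some j) ((one (some (Ix.pair i j)) (FormGen.tens _ _ _ _)).trans
        (Pt.form_two A B (some i) (some j)).symm)
  | cotens A B =>
    obtain ⟨⟨⟨⟩, _ | i⟩, _ | j⟩ := p
    · exact h ((), none)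
    · exact zero (two none (some j) (FormGen.cotens_none_some _ _ _))
    · exact zero (two (some i) none (FormGen.cotens_some_none _ _ _))
    · exact point ((), some (Ix.pair i j)) ((two (some i) (some j) (FormGen.cotens _ _ _ _)).trans
        (Pt.form_of _ (some (Ix.pair i j))).symm)
  | plus A B =>
    obtain ⟨⟨⟩, _ | i | j⟩ := p
    · exact h (((), none), none)
    · exact point (((), some i), none) ((one (some (Ix.inl i)) (FormGen.plus_inl _ _ _)).trans
        (Pt.form_two A B (some i) none).symm)
    · exact point (((), none), some j) ((one (some (Ix.inr j)) (FormGen.plus_inr _ _ _)).trans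
        (Pt.form_two A B none (some j)).symm)
  | coplus A B =>
    obtain ⟨⟨⟨⟩, _ | i⟩, _ | j⟩ := p
    · exact h ((), none)
    · exact point ((), some (Ix.inr j)) ((two none (some j) (FormGen.coplus_inr _ _ _)).trans
        (Pt.form_of _ (some (Ix.inr j))).symm)
    · exact point ((), some (Ix.inl i)) ((two (some i) none (FormGen.coplus_inl _ _ _)).trans
        (Pt.form_of _ (some (Ix.inl i))).symm)
    · exact zero (two (some i) (some j) (FormGen.coplus_zero _ _ _ _))
  | contr A =>
    obtain ⟨⟨⟩, _ | i⟩ := p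
    · exact h (((), none), none)
    · have h₁ := h (((), some i), none)
      have h₂ := h (((), none), some i)
      rw [show Pt.form (H := H) (X := of A ++ of A) _ = _ from Pt.form_two A A (some i) none] at h₁
      rw [show Pt.form (H := H) (X := of A ++ of A) _ = _ from Pt.form_two A A none (some i)] at h₂
      refine (congrArg (m ≫ formEv ·) (one (some i) (FormGen.contr (A.form H i) (twoIso A A) (oneIso A)))).trans ?_
      refine (FormGen.ev_desc (A.form H i) (twoIso A A) m).trans (scal_desc S _ _ ?_ ?_)
      · exact (FormGen.ev_fst (A.form H i) (twoIso A A) m).trans h₁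
      · exact (FormGen.ev_snd (A.form H i) (twoIso A A) m).trans h₂
  | cocontr A =>
    obtain ⟨⟨⟨⟩, _ | i⟩, _ | j⟩ := p
    · exact h ((), none)
    · exact point ((), some j) ((two none (some j) (FormGen.cocontr_right _ _ _)).trans
        (Pt.form_of _ (some j)).symm)
    · exact point ((), some i) ((two (some i) none (FormGen.cocontr_left _ _ _)).trans
        (Pt.form_of _ (some i)).symm)
    · exact zero (two (some i) (some j) (FormGen.cocontr_zero _ _ _ _))
  | null A =>
    obtain ⟨⟨⟩, _ | i⟩ := p
    · exact h ()
    · exact zero (one (some i) (congrArg some zero_comp))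
  | conull A => exact h ((), none)
  | @adapt A B k =>
    obtain ⟨⟨⟩, _ | i⟩ := p
    · exact h ((), none)
    · refine point ((), some (Ix.adapt k.symm i)) ((one (some i) (FormGen.conj _ _ _ _)).trans
        (Eq.trans ?_ (Pt.form_of _ (some _)).symm))
      exact congrArg (fun f => some ((oneIso A).hom ≫ f)) (coherence_comp_form k i)
  | scal s A =>
    obtain ⟨⟨⟩, _ | i⟩ := p
    · exact h ((), none)
    · have h₁ := h ((), some i)
      rw [show Pt.form (H := H) (X := of A) _ = _ from Pt.form_of A (some i)] at h₁
      refine (congrArg (m ≫ formEv ·) (one (some i) (FormGen.conj _ _ _ _))).trans ?_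
      refine (FormGen.ev_smul (A.form H i) m (oneIso A) (S.scal s)).trans ((congrArg (· ≫ S.scal s) h₁).trans ?_)
      exact (S.map_mul s _).symm

theorem Represents.diag {X Y : Obj} (d : Diag R X Y) : {v : Pt X → R} →
    {m : 𝟙_ H ⟶ X.sem H ⊞ 𝟙_ H} → Represents S v m → Represents S (d.act v) (m ≫ d.sem S) := by
  induction d with
  | id X => intro v m h; rw [Diag.sem, Category.comp_id]; exact h
  | swap X Y =>
    intro v m h p
    obtain ⟨y, x, rfl⟩ := Pt.exists_app p
    rw [Diag.act_swap, ← h, Diag.sem, Category.assoc, map_formEv, Pt.form_app, Pt.form_app,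
      Option.map_map,
      ← formComb_barSwap (Pt.form x) (Pt.form y), Option.map_map]
    congr 3
    funext f
    simp
  | comp d e ih ih' =>
    intro v m h
    rw [Diag.sem, ← Category.assoc]
    exact ih' (ih h)
  | @par X Y X' Y' d e ih ih' =>
    intro v m h p
    obtain ⟨y, y', rfl⟩ := Pt.exists_app p
    have hm : ∀ x x', (m ≫ biprod.map (appendIso X X').inv (𝟙 (𝟙_ H)) ≫
        (expand (X.sem H) (X'.sem H)).inv) ≫ formTen (formEv (Pt.form x)) (formEv (Pt.form x')) =
          S.scal (v (Pt.app x x')) := by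
      intro x x'
      rw [← h, Pt.form_app, ← map_formEv, ← expand_formEv]
      simp
    have e₁ : (m ≫ (Diag.par d e).sem S) ≫ formEv (Pt.form (Pt.app y y')) =
        (m ≫ biprod.map (appendIso X X').inv (𝟙 (𝟙_ H)) ≫
          (expand (X.sem H) (X'.sem H)).inv) ≫
          formTen (d.sem S ≫ formEv y.form) (e.sem S ≫ formEv y'.form) := by
      rw [Pt.form_app, ← map_formEv, Diag.sem, ← tensor_formTen, ← expand_formEv]
      simp only [Category.assoc]
      congr 5
      have e : biprod.map (appendIso Y Y').hom (𝟙 (𝟙_ H)) ≫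
          biprod.map (appendIso Y Y').inv (𝟙 (𝟙_ H)) = 𝟙 _ := by ext <;> simp
      rw [reassoc_of% e]
    rw [e₁, Diag.act_par]
    generalize m ≫ biprod.map (appendIso X X').inv (𝟙 (𝟙_ H)) ≫
          (expand (X.sem H) (X'.sem H)).inv = n at hm
    have e₂ {K L : H} (n : 𝟙_ H ⟶ K ⊗ L) (a : K ⟶ 𝟙_ H) (b : L ⟶ 𝟙_ H) :
        n ≫ formTen a b = (n ≫ K ◁ b ≫ (ρ_ K).hom) ≫ a := by
      rw [Category.assoc, Category.assoc, rightUnitor_form, whiskerLeft_formTen, Category.comp_id]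
    have e₃ {K L : H} (n : 𝟙_ H ⟶ K ⊗ L) (a : K ⟶ 𝟙_ H) (b : L ⟶ 𝟙_ H) :
        n ≫ formTen a b = (n ≫ a ▷ L ≫ (λ_ L).hom) ≫ b := by
      rw [Category.assoc, Category.assoc, leftUnitor_form, whiskerRight_formTen, Category.comp_id]
    rw [e₂, ← Category.assoc]
    refine ih (fun x => ?_) y
    rw [← e₂, e₃, ← Category.assoc]
    refine ih' (fun x' => ?_) y'
    rw [← e₃]
    exact hm x x'
  | fgen g => exact Represents.fgen g
  | unit =>
    intro v m h p
    refine Eq.trans ?_ (h ())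
    obtain ⟨⟨⟩, _ | ⟨⟨⟩⟩⟩ := p
    · exact (Category.assoc _ _ _).trans (congrArg (m ≫ ·) (FormGen.unit_none (oneIso .one)))
    · refine (congrArg (_ ≫ formEv ·) (Pt.form_of .one (some Ix.star))).trans ?_
      exact (Category.assoc _ _ _).trans (congrArg (m ≫ ·) (FormGen.unit_some (oneIso .one)))
  | counit =>
    intro v m h p
    have h₁ := h ((), some Ix.star)
    rw [show Pt.form (H := H) (X := of .one) _ = _ from Pt.form_of .one (some Ix.star)] at h₁
    refine (FormGen.counit (oneIso .one) m).trans (scal_desc S _ _ ?_ ?_)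
    · exact (FormGen.counit_fst (oneIso .one) m).trans h₁
    · exact (FormGen.counit_snd (oneIso .one) m).trans (h ((), none))

theorem unit_formTen_scal (s t : R) :
    (λ_ (𝟙_ H)).inv ≫ formTen (S.scal s) (S.scal t) = S.scal (s * t) := by
  rw [unit_formTen, mul_comm, S.map_mul]

variable (S)

theorem exists_vector : (A : Color) → (i : Ix A) →
    ∃ k : 𝟙_ H ⟶ A.sem H, ∀ j, k ≫ A.form H j = S.scal (if j = i then 1 else 0)
  | .zero, i => i.elim
  | .one, i => ⟨𝟙 (𝟙_ H), fun _ => (Category.id_comp _).trans S.map_one.symm⟩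
  | .plus A B, .inl i => by
    obtain ⟨k, hk⟩ := exists_vector A i
    refine ⟨k ≫ biprod.inl, Ix.forall_plus.2 ⟨fun j => ?_, fun j => ?_⟩⟩
    · refine (FormGen.inl_fst _ k).trans ((hk j).trans (congrArg S.scal ?_))
      exact if_congr Sum.inl_injective.eq_iff.symm rfl rfl
    · exact (FormGen.inl_snd _ k).trans S.map_zero.symm
  | .plus A B, .inr i => by
    obtain ⟨k, hk⟩ := exists_vector B i
    refine ⟨k ≫ biprod.inr, Ix.forall_plus.2 ⟨fun j => ?_, fun j => ?_⟩⟩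
    · exact (FormGen.inr_fst _ k).trans S.map_zero.symm
    · refine (FormGen.inr_snd _ k).trans ((hk j).trans (congrArg S.scal ?_))
      exact if_congr Sum.inr_injective.eq_iff.symm rfl rfl
  | .tensor A B, (i, j) => by
    obtain ⟨k, hk⟩ := exists_vector A i
    obtain ⟨l, hl⟩ := exists_vector B j
    refine ⟨(λ_ (𝟙_ H)).inv ≫ (k ⊗ₘ l), Ix.forall_tensor.2 fun i' j' => ?_⟩
    refine (Category.assoc _ _ _).trans ((congrArg (_ ≫ ·) (tensor_formTen _ _ k l)).trans ?_)
    rw [hk i', hl j', unit_formTen_scal, ite_zero_mul_ite_zero, one_mul]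
    refine congrArg S.scal ?_
    by_cases h : i' = i ∧ j' = j
    · exact (if_pos h).trans (if_pos (Prod.mk_inj.2 h)).symm
    · exact (if_neg h).trans (if_neg (mt Prod.mk_inj.1 h)).symm

theorem exists_represents : {X : Obj} → (x : Pt X) →
    ∃ m, Represents S (X := X) (fun p => open Classical in if p = x then 1 else 0) m
  | .nil, _ => ⟨biprod.inr, fun _ => (FormGen.inr_ev).trans
      (S.map_one.symm.trans (congrArg S.scal (if_pos rfl).symm))⟩
  | .snoc X B, x => by
    classical
    obtain ⟨m, hm⟩ := exists_represents x.1
    obtain ⟨l, hl⟩ : ∃ l : 𝟙_ H ⟶ B.sem H ⊞ 𝟙_ H, ∀ b : Option (Ix B),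
        l ≫ formEv (b.map (B.form H)) = S.scal (if b = x.2 then 1 else 0) := by
      rcases x.2 with _ | i
      · refine ⟨biprod.inr, Option.forall.2 ⟨?_, fun j => ?_⟩⟩
        · simp [formEv, S.map_one]
        · simp [formEv, S.map_zero]
      · obtain ⟨k, hk⟩ := exists_vector S B i
        refine ⟨k ≫ biprod.inl, Option.forall.2 ⟨?_, fun j => ?_⟩⟩
        · simp [formEv, S.map_zero]
        · simpa [formEv] using hk j
    refine ⟨(λ_ (𝟙_ H)).inv ≫ (m ⊗ₘ l) ≫ (expand (X.sem H) (B.sem H)).hom, fun p => ?_⟩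
    refine (FormGen.expand_ev m l (Pt.form p.1) (p.2.map (B.form H))).trans ?_
    rw [hm, hl, unit_formTen_scal, ite_zero_mul_ite_zero, one_mul]
    exact congrArg S.scal (if_congr Prod.ext_iff.symm rfl rfl)

theorem Diag.coef_eq_of_sem_eq {X Y : Obj} {d e : Diag R X Y} (h : d.sem S = e.sem S) (x : Pt X)
    (y : Pt Y) : (Hom.mk d).coef x y = (Hom.mk e).coef x y := by
  obtain ⟨m, hm⟩ := exists_represents S x
  refine S.bijective.1 ((hm.diag d y).symm.trans (Eq.trans ?_ (hm.diag e y)))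
  rw [h]

end Represents

/-! ### The coefficients of a normal form -/

namespace Pt

variable {X Y Z : Obj}

/-- The point without basis vectors. -/
def vac : (X : Obj) → Pt X
  | .nil => ()
  | .snoc X _ => (vac X, none)

/-- The point with a basis vector on the `k`-th of `n` wires, if `k < n`. -/
def wire : (n : ℕ) → ℕ → Pt (ones n)
  | 0, _ => ()
  | n + 1, k => (wire n k, if k = n then some Ix.star else none)

theorem wire_of_le : {n k : ℕ} → n ≤ k → wire n k = vac (ones n)
  | 0, _, _ => rfl
  | _ + 1, _, h => Prod.ext (wire_of_le (by omega)) (if_neg (by omega))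

theorem wire_injective : {n k l : ℕ} → k < n → wire n k = wire n l → k = l
  | n + 1, k, l, hk, h => by
    have h₂ := congrArg Prod.snd h
    change (if k = n then some Ix.star else none) = (if l = n then some Ix.star else none) at h₂
    rcases eq_or_ne k n with rfl | hk'
    · by_contra hl
      rw [if_pos rfl, if_neg (Ne.symm hl)] at h₂
      exact Option.some_ne_none _ h₂
    · exact wire_injective (by omega) (congrArg Prod.fst h)

theorem code_vac : (X : Obj) → code X (vac X) = none
  | .nil => rfl
  | .snoc X _ => congrArg (fun o => comb (o, none)) (code_vac X)

theorem cast_app_wire_left {a k : ℕ} (h : k < a) : (b : ℕ) →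
    cast (ones_add a b) (app (wire a k) (vac (ones b))) = wire (a + b) k
  | 0 => rfl
  | b + 1 => (cast_snoc (ones_add a b) _ _).trans
      (Prod.ext (cast_app_wire_left h b) (if_neg (show k ≠ a + b by omega)).symm)

theorem cast_app_wire_right (a k : ℕ) : (b : ℕ) →
    cast (ones_add a b) (app (vac (ones a)) (wire b k)) = wire (a + b) (a + k)
  | 0 => (wire_of_le (Nat.le_add_right a k)).symm
  | b + 1 => (cast_snoc (ones_add a b) _ _).trans
      (Prod.ext (cast_app_wire_right a k b) (if_congr (Nat.add_left_cancel_iff).symm rfl rfl))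

theorem cast_app_vac (a b : ℕ) :
    cast (ones_add a b) (app (vac (ones a)) (vac (ones b))) = vac (ones (a + b)) := by
  rw [← wire_of_le le_rfl, ← wire_of_le le_rfl, ← wire_of_le (Nat.le_refl (a + b)),
    ← cast_app_wire_right, wire_of_le le_rfl]

theorem app_assoc (x : Pt X) (y : Pt Y) (z : Pt Z) :
    app (app x y) z = cast (append_assoc X Y Z).symm (app x (app y z)) := by
  rw [← cast_app_assoc, cast, cast, eqRec_eq_cast, eqRec_eq_cast, cast_cast]; rfl

theorem cast_ones_dim {x b : ℕ} (p : Pt (ones (x * b))) (q : Pt (ones x)) (r : Pt (ones b)) :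
    cast (Diag.ones_dim x b) (app p (app q r)) =
      cast (ones_add _ _) (app (cast (ones_add _ _) (app p q)) r) := by
  have e₁ {X Y Z : Obj} (h : X = Y) (p : Pt X) (z : Pt Z) :
      cast (congrArg (· ++ Z) h) (app p z) = app (cast h p) z := by subst h; rfl
  have e₂ {X Y Z : Obj} (h : X = Y) (k : Y = Z) (p : Pt X) :
      cast k (cast h p) = cast (h.trans k) p := by subst h k; rfl
  rw [← cast_app_assoc, e₂, ← e₁, e₂]

end Pt

namespace Diag

open Pt

variable {X Y : Obj}

theorem act_dup_snoc (X : Obj) (B : Color) (v : Pt (snoc X B) → R) (p p' : Pt X)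
    (b b' : Option (Ix B)) :
    (dup (snoc X B)).act v (app (X := snoc X B) (Y := snoc X B) (p, b) (p', b')) =
      (dup X).act (fun x => Act.cocontr (fun o => v (x, o)) b b') (app p p') := by
  have e : app (X := snoc X B) (p, b) p' =
      Pt.cast (append_assoc X (of B) X).symm (app p (app (X := of B) ((), b) p')) :=
    app_assoc p (Y := of B) ((), b) p'
  refine (congrArg (fun q => (dup (snoc X B)).act v (q, b')) e).trans ?_
  refine (act_cast rfl _ (id X ∥ᵈ swap X (of B)) _ _).trans ?_
  refine (act_par _ _ _ _ _).trans ?_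
  refine (act_swap (X := X) (Y := of B) _ p' ((), b)).trans ?_
  exact act_par (dup X) (cocontr B) v (app p p') (((), b), b')

theorem act_dup_left : {X : Obj} → (v : Pt X → R) → (p : Pt X) →
    (dup X).act v (app p (vac X)) = v p
  | .nil, _, _ => rfl
  | .snoc X B, v, p => by
    refine (act_dup_snoc X B v p.1 (vac X) p.2 none).trans ((act_dup_left _ p.1).trans ?_)
    obtain ⟨p, _ | b⟩ := p <;> rfl

theorem act_dup_right : {X : Obj} → (v : Pt X → R) → (p : Pt X) →
    (dup X).act v (app (vac X) p) = v p
  | .nil, _, _ => rfl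
  | .snoc X B, v, p => by
    refine (act_dup_snoc X B v (vac X) p.1 none p.2).trans ((act_dup_right _ p.1).trans ?_)
    obtain ⟨p, _ | b⟩ := p <;> rfl

theorem act_nPlus : (n k : ℕ) → ∃ o, (∀ w : Pt (of (nPlusColor n)) → R,
    (nPlus n).mirror.act w (Pt.wire n k) = w ((), o)) ∧
    (∀ v : Pt (ones n) → R, (nPlus n).act v ((), o) = v (Pt.wire n k)) ∧ (o = none ↔ n ≤ k)
  | 0, k => ⟨none, fun _ => rfl, fun _ => rfl, by simp⟩
  | 1, k => ⟨if k = 0 then some Ix.star else none, fun _ => rfl, fun _ => rfl, by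
      rcases k with _ | k <;> simp⟩
  | n + 2, k => by
    obtain ⟨o, h₁, h₂, h₃⟩ := act_nPlus (n + 1) k
    by_cases hk : k = n + 1
    · have ho : o = none := h₃.2 (by omega)
      subst ho
      have e : Pt.wire (n + 2) k = (Pt.wire (n + 1) k, some Ix.star) := Prod.ext rfl (if_pos hk)
      rw [e]
      exact ⟨some (Ix.inr Ix.star), fun w => h₁ _, fun v => h₂ _, by simp; omega⟩
    · have e : Pt.wire (n + 2) k = (Pt.wire (n + 1) k, none) := Prod.ext rfl (if_neg hk)
      rw [e]
      rcases o with _ | i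
      · exact ⟨none, fun w => h₁ _, fun v => h₂ _, by simp at h₃ ⊢; omega⟩
      · exact ⟨some (Ix.inl i), fun w => h₁ _, fun v => h₂ _, by simp at h₃ ⊢; omega⟩

theorem act_disj_wire {n : ℕ} (v : Pt (ones n) → R) (k : ℕ) :
    (disj n).act v (Pt.wire n k) = v (Pt.wire n k) := by
  obtain ⟨o, h₁, h₂, -⟩ := act_nPlus (R := R) n k
  exact (h₁ _).trans (h₂ v)

theorem act_disj_vac {n : ℕ} (v : Pt (ones n) → R) :
    (disj n).act v (vac (ones n)) = v (vac (ones n)) := by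
  rw [← wire_of_le le_rfl, act_disj_wire]

theorem act_mirror_nPlus_of_ne : (n : ℕ) → {p : Pt (ones n)} → (∀ k, p ≠ Pt.wire n k) →
    (w : Pt (of (nPlusColor n)) → R) → (nPlus n).mirror.act w p = 0
  | 0, _, h, _ => (h 0 rfl).elim
  | 1, ((), some i), h, _ => (h 0 rfl).elim
  | 1, ((), none), h, _ => (h 1 rfl).elim
  | n + 2, (p, c), h, w => by
    by_cases hp : ∀ k, p ≠ Pt.wire (n + 1) k
    · exact act_mirror_nPlus_of_ne (n + 1) hp _
    push Not at hp
    obtain ⟨k, rfl⟩ := hp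
    obtain ⟨o, h₁, -, h₃⟩ := act_nPlus (R := R) (n + 1) k
    refine (h₁ fun x => Act.coplus (fun a => w ((), a)) x.2 c).trans ?_
    rcases c with _ | c
    · rcases eq_or_ne k (n + 1) with rfl | hk
      · refine (h (n + 2) (Prod.ext ?_ (if_neg (by omega)).symm)).elim
        exact (wire_of_le le_rfl).trans (wire_of_le (Nat.le_succ _)).symm
      · exact (h k (Prod.ext rfl (if_neg hk).symm)).elim
    · rcases o with _ | o
      · refine (h (n + 1) (Prod.ext ?_ (if_pos rfl).symm)).elim
        exact (wire_of_le (h₃.1 rfl)).trans (wire_of_le le_rfl).symm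
      · rfl

theorem act_disj_of_ne {n : ℕ} {p : Pt (ones n)} (h : ∀ k, p ≠ Pt.wire n k) (v : Pt (ones n) → R) :
    (disj n).act v p = 0 :=
  act_mirror_nPlus_of_ne n h _

theorem act_discard : (n : ℕ) → (v : Pt (ones n) → R) → (discard n).act v () = v (vac (ones n))
  | 0, _ => rfl
  | n + 1, v => act_discard n fun x => v (x, none)

theorem act_pairOne : (a i : ℕ) → (v : Pt (ones a ++ of .one) → R) →
    (pairOne a).act v (Pt.wire a i) = v (Pt.wire a i, if i < a then some Ix.star else none)
  | 0, _, _ => rfl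
  | a + 1, i, v => by
    have e (c) : (pairOne (a + 1)).act v (Pt.wire a i, c) = (pairOne a).act (fun x =>
        (untapR .one).act (fun y => Act.cocontr (fun o => v ((x.1, Prod.snd y.1), o)) x.2 y.2)
          ((), c)) (Pt.wire a i) := rfl
    refine (e _).trans ((act_pairOne a i _).trans ?_)
    rcases lt_trichotomy i a with h | rfl | h
    · have h₁ : Pt.wire (a + 1) i = (Pt.wire a i, none) := Prod.ext rfl (if_neg h.ne)
      rw [h₁, if_pos h, if_neg h.ne, if_pos (by omega)]; rfl
    · have h₁ : Pt.wire (i + 1) i = (Pt.wire i i, some Ix.star) := Prod.ext rfl (if_pos rfl)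
      rw [h₁, if_neg (lt_irrefl _), if_pos rfl, if_pos (by omega)]
      exact (act_untapR_some _).trans rfl
    · have h₁ : Pt.wire (a + 1) i = (Pt.wire a i, none) := Prod.ext rfl (if_neg h.ne')
      rw [h₁, if_neg h.not_gt, if_neg h.ne', if_neg (by omega)]; rfl

theorem act_shuffle (X Y : Obj) (B : Color) (v : Pt (X ++ snoc Y B) → R) (p p' : Pt X) (q : Pt Y)
    (b : Option (Ix B)) :
    ((dup X ∥ᵈ id (snoc Y B)) ⨟ (cast (append_assoc X X Y).symm (append_assoc X Y X).symm
      (id X ∥ᵈ swap X Y) ∥ᵈ wire B)).act v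
        (app (X := X ++ Y) (app p q) p', b) =
      (dup X).act (fun x => v (app (Y := snoc Y B) x (q, b))) (app p p') := by
  refine (congrArg (fun z => ((dup X ∥ᵈ id (snoc Y B)) ⨟ (cast (append_assoc X X Y).symm
    (append_assoc X Y X).symm (id X ∥ᵈ swap X Y) ∥ᵈ wire B)).act v (z, b)) (app_assoc p q p')).trans ?_
  refine (act_cast (append_assoc X X Y).symm (append_assoc X Y X).symm (id X ∥ᵈ swap X Y)
    (fun z => (dup X ∥ᵈ id (snoc Y B)).act v (z, b)) _).trans ?_
  refine (act_par _ _ _ _ _).trans ?_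
  refine (act_swap (X := X) (Y := Y) _ p' q).trans ?_
  refine Eq.trans (congrArg (fun z => (dup X ∥ᵈ id (snoc Y B)).act v (z, b))
    (app_assoc p p' q).symm) ?_
  exact act_par (dup X) (id (snoc Y B)) v (app p p') (q, b)

theorem act_pairing (a : ℕ) : (b : ℕ) → (v : Pt (ones a ++ ones b) → R) →
    (pairing a b).act v (vac _) = v (app (vac _) (vac _)) ∧
    ∀ i < a, ∀ j < b, (pairing a b).act v (Pt.wire (a * b) (i + a * j)) =
      v (app (Pt.wire a i) (Pt.wire b j))
  | 0, v => ⟨act_discard a v, by omega⟩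
  | b + 1, v => by
    have key (p : Pt (ones (a * b))) (k : ℕ) : (pairing a (b + 1)).act v
        (Pt.cast (ones_add (a * b) a) (app p (Pt.wire a k))) =
        (pairing a b).act (fun x => (dup (ones a)).act (fun y => v (app y (snd x,
          if k < a then some Ix.star else none))) (app (fst x) (Pt.wire a k))) p := by
      refine (act_cast rfl _ _ v _).trans ((act_par (pairing a b) (pairOne a) _ _ _).trans ?_)
      refine congrArg (fun f => (pairing a b).act f p) (funext fun x => ?_)
      refine (act_pairOne a k _).trans ?_
      obtain ⟨y, z, rfl⟩ := exists_app x
      rw [fst_app, snd_app]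
      exact act_shuffle (ones a) (ones b) .one v y (Pt.wire a k) z _
    have key' (p : Pt (ones (a * b))) : (pairing a (b + 1)).act v
        (Pt.cast (ones_add (a * b) a) (app p (vac _))) =
        (pairing a b).act (fun x => v (app (fst x) (snd x, none))) p := by
      rw [← wire_of_le le_rfl]
      refine (key p a).trans ?_
      rw [wire_of_le le_rfl, if_neg (lt_irrefl a)]
      exact congrArg (fun f => (pairing a b).act f p) (funext fun x => act_dup_left _ _)
    constructor
    · refine (congrArg _ (cast_app_vac (a * b) a).symm).trans ((key' _).trans ?_)
      refine (act_pairing a b _).1.trans ?_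
      rw [fst_app, snd_app]; rfl
    · intro i hi j hj
      rcases Nat.lt_succ_iff_lt_or_eq.1 hj with hj' | rfl
      · have e : i + a * j < a * b := by nlinarith [Nat.mul_le_mul_left a (Nat.succ_le_of_lt hj')]
        refine (congrArg _ (cast_app_wire_left e a).symm).trans ((key' _).trans ?_)
        refine ((act_pairing a b _).2 i hi j hj').trans ?_
        rw [fst_app, snd_app]
        exact congrArg (fun o => v (app (Pt.wire a i) (Y := ones (b + 1)) (Pt.wire b j, o)))
          (if_neg hj'.ne).symm
      · rw [Nat.add_comm i]
        refine (congrArg _ (cast_app_wire_right (a * j) i a).symm).trans ((key _ _).trans ?_)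
        refine (act_pairing a j _).1.trans ?_
        rw [fst_app, snd_app, if_pos hi]
        refine (act_dup_right _ _).trans ?_
        exact congrArg (fun q : Pt (ones (j + 1)) => v (app (Pt.wire a i) q))
          (Prod.ext (wire_of_le le_rfl).symm (if_pos rfl).symm)

theorem act_isoColor : (A : Color) → (v : Pt (of A) → R) →
    (isoColor A).act v (vac _) = v ((), none) ∧
    ∀ i, (isoColor A).act v (Pt.wire A.dim (Ix.pos A i)) = v ((), some i)
  | .zero, _ => ⟨rfl, fun i => i.elim⟩
  | .one, _ => ⟨rfl, fun _ => rfl⟩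
  | .plus A B, v => by
    have key (p : Pt (ones A.dim)) (q : Pt (ones B.dim)) :
        (coplus A B ⨟ cast rfl (ones_add A.dim B.dim) (isoColor A ∥ᵈ isoColor B)).act v
          (Pt.cast (ones_add A.dim B.dim) (app p q)) = (isoColor A).act (fun x =>
            (isoColor B).act (fun y => Act.coplus (fun a => v ((), a)) x.2 y.2) q) p :=
      (act_cast rfl _ _ _ _).trans (act_par _ _ _ _ _)
    refine ⟨(act_disj_vac _).trans ?_, Sum.rec (fun i => ?_) fun i => ?_⟩
    · refine (congrArg _ (cast_app_vac _ _).symm).trans ((key _ _).trans ?_)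
      exact (act_isoColor A _).1.trans (act_isoColor B _).1
    · refine (act_disj_wire _ _).trans ?_
      refine (congrArg _ (cast_app_wire_left (Ix.pos A i).2 _).symm).trans ((key _ _).trans ?_)
      exact ((act_isoColor A _).2 i).trans (act_isoColor B _).1
    · refine (act_disj_wire _ _).trans ?_
      refine (congrArg _ (cast_app_wire_right A.dim _ _).symm).trans ((key _ _).trans ?_)
      exact (act_isoColor A _).1.trans ((act_isoColor B _).2 i)
  | .tensor A B, v => by
    have key (p : Pt (ones A.dim)) (q : Pt (ones B.dim)) :
        (cotens A B ⨟ (isoColor A ∥ᵈ isoColor B)).act v (app p q) = (isoColor A).act (fun x =>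
            (isoColor B).act (fun y => Act.cotens (fun a => v ((), a)) x.2 y.2) q) p :=
      act_par _ _ _ _ _
    refine ⟨(act_disj_vac _).trans ?_, Prod.rec fun i j => (act_disj_wire _ _).trans ?_⟩
    · refine (act_pairing _ _ _).1.trans ((key _ _).trans ?_)
      exact (act_isoColor A _).1.trans (act_isoColor B _).1
    · refine ((act_pairing _ _ _).2 _ (Ix.pos A i).2 _ (Ix.pos B j).2).trans ((key _ _).trans ?_)
      exact ((act_isoColor A _).2 i).trans ((act_isoColor B _).2 j)

end Diag

theorem Obj.color_dim : (X : Obj) → X.color.dim = X.dim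
  | .nil => rfl
  | .snoc X B => by
    change X.color.dim * B.dim + (X.color.dim + B.dim) = X.dim * B.dim + X.dim + B.dim
    rw [color_dim X, add_assoc]

/-- The position of a point in a normal form; the last one is that of the vacuum. -/
def Pt.idx (X : Obj) : Pt X ≃ Fin (X.dim + 1) :=
  (code X).trans <| (Equiv.optionCongr ((Ix.pos X.color).trans (finCongr X.color_dim))).trans
    finSuccEquivLast.symm

theorem Pt.idx_of_none {X : Obj} {p : Pt X} (h : code X p = none) : idx X p = Fin.last _ := by
  rw [idx, Equiv.trans_apply, h]; simp

theorem Pt.idx_eq_last {X : Obj} {p : Pt X} : idx X p = Fin.last _ ↔ p = vac X := by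
  rw [← idx_of_none (code_vac X), EmbeddingLike.apply_eq_iff_eq]

theorem Pt.idx_eq_last_iff_code {X : Obj} {p : Pt X} :
    idx X p = Fin.last _ ↔ code X p = none := by
  rw [idx_eq_last, ← (code X).apply_eq_iff_eq, code_vac]

theorem Pt.idx_of_some {X : Obj} {p : Pt X} {i : Ix X.color} (h : code X p = some i) :
    (idx X p : ℕ) = Ix.pos X.color i := by
  rw [idx, Equiv.trans_apply, h]; simp

namespace Diag

open Pt

theorem act_iso : (X : Obj) → (v : Pt X → R) → (p : Pt X) →
    (iso X).act v (Pt.wire X.dim (idx X p)) = v p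
  | .nil, _, _ => rfl
  | .snoc X B, v, (p, b) => by
    let x := X.dim
    have key (q : Pt (ones (x * B.dim))) (r : Pt (ones x)) (s : Pt (ones B.dim)) :
        ((iso X ∥ᵈ isoColor B) ⨟ dup (ones x ++ ones B.dim) ⨟ cast rfl (ones_dim x B.dim)
          (pairing x B.dim ∥ᵈ id (ones x ++ ones B.dim))).act v
          (Pt.cast (ones_dim x B.dim) (app q (app r s))) =
        (pairing x B.dim).act (fun z => (dup (ones x ++ ones B.dim)).act
          ((iso X ∥ᵈ isoColor B).act v) (app z (app r s))) q :=
      (act_cast rfl _ _ _ _).trans (act_par _ _ _ _ _)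
    have vac_vac : app (vac (ones x)) (vac (ones B.dim)) = vac (ones x ++ ones B.dim) := by
      generalize ones x = Y; generalize ones B.dim = Z
      induction Z with
      | nil => rfl
      | snoc Z C ih => exact Prod.ext ih rfl
    have hp (q : Pt (ones B.dim)) {k : ℕ} (h : (idx X p : ℕ) = k) :
        (iso X ∥ᵈ isoColor B).act v (app (Pt.wire x k) q) =
          (isoColor B).act (fun z => v (p, z.2)) q := by
      subst h
      exact (act_par _ _ _ _ _).trans (act_iso X _ p)
    refine (act_disj_wire _ _).trans ?_
    rcases hx : code X p with _ | i <;> rcases b with _ | j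
    · have h : code (snoc X B) (p, none) = none := congrArg (fun o => comb (o, none)) hx
      have e : Pt.wire (x * B.dim + x + B.dim) (idx (snoc X B) (p, none)) = Pt.cast (ones_dim x B.dim)
          (app (vac _) (app (vac _) (vac _))) := by
        rw [cast_ones_dim, cast_app_vac, cast_app_vac, idx_of_none h]
        exact wire_of_le le_rfl
      refine (congrArg _ e).trans ((key _ _ _).trans ((act_pairing _ _ _).1.trans ?_))
      rw [vac_vac, act_dup_left, ← vac_vac, ← wire_of_le le_rfl,
        hp _ (k := x) (congrArg Fin.val (idx_of_none hx))]
      exact (act_isoColor B _).1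
    · have h : code (snoc X B) (p, some j) = some (.inr (.inr j)) :=
        congrArg (fun o => comb (o, some j)) hx
      have e : Pt.wire (x * B.dim + x + B.dim) (idx (snoc X B) (p, some j)) =
          Pt.cast (ones_dim x B.dim) (app (vac _) (app (vac _) (Pt.wire _ (Ix.pos B j)))) := by
        rw [cast_ones_dim, cast_app_vac, cast_app_wire_right, idx_of_some h]
        refine congrArg _ ?_
        change X.color.dim * B.dim + (X.color.dim + Ix.pos B j) = _
        rw [color_dim, add_assoc]
      refine (congrArg _ e).trans ((key _ _ _).trans ((act_pairing _ _ _).1.trans ?_))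
      rw [vac_vac, act_dup_right, ← wire_of_le le_rfl, hp _ (k := x) (congrArg Fin.val (idx_of_none hx))]
      exact (act_isoColor B _).2 j
    · have h : code (snoc X B) (p, none) = some (.inr (.inl i)) :=
        congrArg (fun o => comb (o, none)) hx
      have hi : (Ix.pos X.color i : ℕ) < x := (Ix.pos X.color i).2.trans_eq X.color_dim
      have e : Pt.wire (x * B.dim + x + B.dim) (idx (snoc X B) (p, none)) =
          Pt.cast (ones_dim x B.dim)
            (app (vac _) (app (Pt.wire _ (Ix.pos X.color i)) (vac _))) := by
        rw [cast_ones_dim, cast_app_wire_right, cast_app_wire_left (by omega), idx_of_some h]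
        exact congrArg (fun d => Pt.wire _ (d * B.dim + Ix.pos X.color i)) X.color_dim
      refine (congrArg _ e).trans ((key _ _ _).trans ((act_pairing _ _ _).1.trans ?_))
      rw [vac_vac, act_dup_right, hp _ (idx_of_some hx)]
      exact (act_isoColor B _).1
    · have h : code (snoc X B) (p, some j) = some (.inl (i, j)) :=
        congrArg (fun o => comb (o, some j)) hx
      have hi : (Ix.pos X.color i : ℕ) < x := (Ix.pos X.color i).2.trans_eq X.color_dim
      have hij : (Ix.pos X.color i + x * Ix.pos B j : ℕ) < x * B.dim := by
        nlinarith [Nat.mul_le_mul_left x (Nat.succ_le_of_lt (Ix.pos B j).2)]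
      have e : Pt.wire (x * B.dim + x + B.dim) (idx (snoc X B) (p, some j)) =
          Pt.cast (ones_dim x B.dim)
            (app (Pt.wire _ (Ix.pos X.color i + x * Ix.pos B j)) (app (vac _) (vac _))) := by
        rw [cast_ones_dim, cast_app_wire_left hij, cast_app_wire_left (by omega), idx_of_some h]
        exact congrArg (fun d => Pt.wire _ (Ix.pos X.color i + d * Ix.pos B j)) X.color_dim
      refine (congrArg _ e).trans ((key _ _ _).trans
        (((act_pairing _ _ _).2 _ hi _ (Ix.pos B j).2).trans ?_))
      rw [vac_vac, act_dup_left, hp _ (idx_of_some hx)]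
      exact (act_isoColor B _).2 j

theorem act_row : {n : ℕ} → (s : Fin n → R) → (v : Pt (ones n) → R) →
    (row s).act v ((), none) = v (vac _) ∧
    (row s).act v ((), some Ix.star) = ∑ j, s j * v (Pt.wire n j)
  | 0, _, _ => ⟨rfl, rfl⟩
  | 1, s, v => ⟨rfl, (Fin.sum_univ_one fun j => s j * v (Pt.wire 1 j)).symm⟩
  | n + 2, s, v => by
    have h (w : Pt (ones (n + 1)) → R) := act_row (fun i : Fin (n + 1) => s i.castSucc) w
    refine ⟨(h _).1, Eq.trans (congrArg₂ (fun a b : R => a + b) (h fun x => v (x, none)).2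
      (h fun x => s (Fin.last (n + 1)) * v (x, some Ix.star)).1) ?_⟩
    refine Eq.trans ?_ (Fin.sum_univ_castSucc fun j => s j * v (Pt.wire (n + 2) j)).symm
    refine congrArg₂ (fun a b : R => a + b) (Finset.sum_congr rfl fun j _ => ?_) ?_
    · exact congrArg (fun o => s j.castSucc * v (Pt.wire (n + 1) j, o)) (if_neg j.2.ne).symm
    · exact congrArg (fun q : Pt (ones (n + 2)) => s (Fin.last (n + 1)) * v q)
        (Prod.ext (wire_of_le le_rfl).symm (if_pos rfl).symm)

theorem act_rows {n : ℕ} : {m : ℕ} → (M : Matrix (Fin m) (Fin n) R) → (v : Pt (ones n) → R) →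
    (rows M).act v (vac _) = v (vac _) ∧
    ∀ i : Fin m, (rows M).act v (Pt.wire m i) = ∑ j, M i j * v (Pt.wire n j)
  | 0, _, v => ⟨act_discard n v, fun i => i.elim0⟩
  | 1, M, v => ⟨(act_row _ v).1, fun i => by
      rw [Subsingleton.elim i 0]; exact (act_row (M 0) v).2⟩
  | m + 2, M, v => by
    have h (w : Pt (ones n) → R) := act_rows (fun i : Fin (m + 1) => M i.castSucc) w
    have key (p : Pt (ones (m + 1))) (o) : (rows M).act v (p, o) =
        (rows fun i : Fin (m + 1) => M i.castSucc).act (fun x =>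
          (row (M (Fin.last (m + 1)))).act (fun y => (dup (ones n)).act v (app x y)) ((), o)) p :=
      rfl
    have key' (p : Pt (ones (m + 1))) : (rows M).act v (p, none) =
        (rows fun i : Fin (m + 1) => M i.castSucc).act v p :=
      (key _ _).trans <| congrArg (fun f => act _ f p) <| funext fun x =>
        ((act_row _ _).1.trans (act_dup_left v x))
    refine ⟨(key' _).trans (h v).1, Fin.lastCases ?_ fun i => ?_⟩
    · have e : Pt.wire (m + 2) (Fin.last (m + 1) : ℕ) = (vac (ones (m + 1)), some Ix.star) :=
        Prod.ext (wire_of_le le_rfl) (if_pos rfl)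
      rw [e]
      refine (key _ _).trans ((h _).1.trans ((act_row _ _).2.trans ?_))
      exact Finset.sum_congr rfl fun j _ => congrArg _ (act_dup_right v _)
    · have e : Pt.wire (m + 2) (i.castSucc : ℕ) = (Pt.wire (m + 1) i, none) :=
        Prod.ext rfl (if_neg i.2.ne)
      rw [e]
      exact (key' _).trans ((h v).2 i)

end Diag

theorem IsFunctional.map_sum {P ι : Type} {f : (P → R) → R} (hf : IsFunctional f) (s : Finset ι)
    (v : ι → P → R) : f (fun p => ∑ i ∈ s, v i p) = ∑ i ∈ s, f (v i) := by
  classical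
  induction s using Finset.induction_on with
  | empty => exact hf.map_zero
  | insert i s h ih =>
    simp only [Finset.sum_insert h]
    rw [hf.map_add, ih]

theorem Hom.coef_mirror {X Y : Obj} (d : Hom R X Y) (x : Pt X) (y : Pt Y) :
    d.mirror.coef y x = d.coef x y := by
  obtain ⟨f, hf, rfl⟩ := exists_eq_base d
  obtain ⟨s, hs⟩ := hf.entry (Ix.ofOption (Pt.code X x)) (Ix.ofOption (Pt.code Y y))
  have e : ket _ (Ix.ofOption (Pt.code Y y)) ⬝ f.mirror ⬝
      bra _ (Ix.ofOption (Pt.code X x)) = sc s := by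
    refine Hom.mirror_injective ?_
    rw [mirror_comp, mirror_comp, mirror_mirror, bra, mirror_mirror]
    exact (assoc _ _ _).symm.trans hs
  rw [mirror_comp, mirror_comp, mirror_mirror, ← assoc, coef_base hf.lin hs,
    coef_base hf.lin.mirror e]
  simp only [and_comm]

namespace Diag

open Pt

variable {X Y : Obj}

theorem act_iso_par_unit_vac (v : Pt X → R) :
    (iso X ∥ᵈ unit).act v (vac (ones (X.dim + 1))) = v (vac X) := by
  have e : Pt.wire X.dim (idx X (vac X)) = vac (ones X.dim) := by
    rw [idx_of_none (code_vac X)]; exact wire_of_le le_rfl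
  exact (congrArg (fun p => (iso X).act v p) e.symm).trans (act_iso X v (vac X))

theorem act_iso_par_unit (v : Pt X → R) (p : Pt X) :
    (iso X ∥ᵈ unit).act v (Pt.wire (X.dim + 1) (idx X p)) = v p :=
  act_iso X v p

open Classical in
theorem coef_iso_par_unit (x : Pt X) (i : Fin (X.dim + 1)) :
    (Hom.mk (iso X ∥ᵈ (unit : Diag R _ _))).coef x (Pt.wire (X.dim + 1) i) =
      if i = idx X x then 1 else 0 := by
  obtain ⟨p, rfl⟩ := (idx X).surjective i
  refine (act_iso_par_unit (R := R) (fun p => if p = x then 1 else 0) p).trans ?_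
  exact if_congr (idx X).apply_eq_iff_eq.symm rfl rfl

open Classical in
theorem coef_iso_par_unit_vac (x : Pt X) :
    (Hom.mk (iso X ∥ᵈ (unit : Diag R _ _))).coef x (vac (ones (X.dim + 1))) =
      if x = vac X then 1 else 0 := by
  exact (act_iso_par_unit_vac _).trans (if_congr eq_comm rfl rfl)

theorem act_ofMatrix {m n : ℕ} (M : Matrix (Fin m) (Fin n) R) (v : Pt (ones n) → R) :
    (ofMatrix M).act v (vac _) = v (vac _) ∧
    (∀ i : Fin m, (ofMatrix M).act v (Pt.wire m i) = ∑ j, M i j * v (Pt.wire n j)) ∧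
    ∀ p, (∀ k, p ≠ Pt.wire m k) → (ofMatrix M).act v p = 0 := by
  refine ⟨?_, fun i => ?_, fun p hp => act_disj_of_ne hp _⟩
  · exact (act_disj_vac _).trans ((act_rows M _).1.trans (act_disj_vac v))
  · refine (act_disj_wire _ _).trans (((act_rows M _).2 i).trans ?_)
    exact Finset.sum_congr rfl fun j _ => congrArg _ (act_disj_wire v _)

open Classical in
theorem coef_nf (M : Matrix (Fin (Y.dim + 1)) (Fin (X.dim + 1)) R) (x : Pt X) (y : Pt Y) :
    (Hom.mk (nf M)).coef x y =
      M (idx Y y) (idx X x) + if idx X x = Fin.last _ ∧ idx Y y = Fin.last _ then 1 else 0 := by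
  let P : Hom R Y (ones (Y.dim + 1)) := Hom.mk (iso Y ∥ᵈ unit)
  let u : Pt (ones (Y.dim + 1)) → R :=
    ((iso X ∥ᵈ unit) ⨟ ofMatrix M).act fun p => if p = x then 1 else 0
  have hM := act_ofMatrix M ((iso X ∥ᵈ unit).act fun p => if p = x then 1 else 0)
  have h₀ : u (vac _) = if x = vac X then 1 else 0 := by
    exact hM.1.trans ((act_iso_par_unit_vac _).trans (if_congr eq_comm rfl rfl))
  have h₁ (i : Fin (Y.dim + 1)) : u (Pt.wire _ i) = M i (idx X x) := by
    refine (hM.2.1 i).trans ?_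
    refine (Finset.sum_congr rfl fun j _ => congrArg (M i j * ·) (coef_iso_par_unit x j)).trans ?_
    simp
  have hu : u = fun p => (∑ i : Fin (Y.dim + 1), u (Pt.wire _ i) *
      if p = Pt.wire (Y.dim + 1) i then 1 else 0) + u (vac _) * if p = vac _ then 1 else 0 := by
    funext p
    have hne (i : Fin (Y.dim + 1)) : Pt.wire (Y.dim + 1) i ≠ vac (ones (Y.dim + 1)) := fun h =>
      i.2.ne (wire_injective i.2 (h.trans (wire_of_le le_rfl).symm))
    by_cases hp : ∀ k, p ≠ Pt.wire (Y.dim + 1) k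
    · refine (hM.2.2 p hp).trans ?_
      have : p ≠ vac _ := fun h => hp _ (h.trans (wire_of_le le_rfl).symm)
      simp [hp, this]
    push Not at hp
    obtain ⟨k, rfl⟩ := hp
    by_cases hk : k < Y.dim + 1
    · have h (i : Fin (Y.dim + 1)) : Pt.wire (Y.dim + 1) k = Pt.wire (Y.dim + 1) i ↔ i = ⟨k, hk⟩ :=
        ⟨fun h => Fin.ext (wire_injective hk h).symm, fun h => by rw [h]⟩
      simp [h, hne ⟨k, hk⟩]
    · rw [wire_of_le (not_lt.1 hk)]
      simp [fun i => (hne i).symm]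
  have hP : IsFunctional fun w => P.mirror.act w y := P.mirror.isFunctional y
  change P.mirror.act u y = _
  rw [hu, hP.map_add, hP.map_sum, hP.map_smul]
  refine (congrArg₂ (· + ·) (Finset.sum_congr rfl fun i _ => (hP.map_smul _ _).trans
    (congrArg _ ((P.coef_mirror y _).trans (coef_iso_par_unit y i))))
    (congrArg _ ((P.coef_mirror y _).trans (coef_iso_par_unit_vac y)))).trans ?_
  simp only [h₀, h₁, mul_ite, mul_one, mul_zero, Finset.sum_ite_eq', Finset.mem_univ, if_true,
    idx_eq_last]
  by_cases hx : x = vac X <;> by_cases hy : y = vac Y <;> simp [hx, hy]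

end Diag

end TensorPlus

theorem mainTheorem4 {R : Type u} [CommSemiring R] (canon : R → R)
    (canon_add_one : ∀ s : R, canon s + 1 = s + 1)
    (canon_eq : ∀ s t : R, s + 1 = t + 1 → canon s = canon t)
    {H : Type v} [Category.{w} H] [HasZeroMorphisms H] [HasZeroObject H] [HasBinaryBiproducts H]
    [MonoidalCategory H] [SymmetricCategory H] [Distributive H] (S : ScalarIso R H) :
    -- every diagram has a normal form
    (∀ {X Y : Obj} (d : Diag R X Y),
      ∃ M : Matrix (Fin (Y.dim + 1)) (Fin (X.dim + 1)) R,
        canon (M (Fin.last _) (Fin.last _)) = M (Fin.last _) (Fin.last _) ∧ d ≣ Diag.nf M) ∧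
    -- two diagrams with the same semantics have the same normal form
    (∀ {X Y : Obj} (d e : Diag R X Y), d.sem S = e.sem S →
      ∀ N M : Matrix (Fin (Y.dim + 1)) (Fin (X.dim + 1)) R,
        canon (N (Fin.last _) (Fin.last _)) = N (Fin.last _) (Fin.last _) →
        canon (M (Fin.last _) (Fin.last _)) = M (Fin.last _) (Fin.last _) →
        d ≣ Diag.nf N → e ≣ Diag.nf M → N = M ∧ d ≣ e) ∧
    -- completeness
    (∀ {X Y : Obj} (d e : Diag R X Y), d.sem S = e.sem S → d ≣ e) := by
  have complete {X Y : Obj} (d e : Diag R X Y) (h : d.sem S = e.sem S) : d ≣ e :=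
    Hom.mk_eq_iff.1 (Hom.eq_of_coef (Diag.coef_eq_of_sem_eq S h))
  refine ⟨fun {X Y} d => ?_, fun {X Y} d e h N M hN hM dN eM => ⟨?_, complete d e h⟩, complete⟩
  · obtain ⟨f, hf, hd⟩ := exists_eq_base (Hom.mk d)
    choose s hs using fun (x : Pt X) (y : Pt Y) =>
      hf.entry (Ix.ofOption (Pt.code X x)) (Ix.ofOption (Pt.code Y y))
    have hs' (x : Pt X) (y : Pt Y) : (Hom.mk d).coef x y = s x y +
        if Pt.idx X x = Fin.last _ ∧ Pt.idx Y y = Fin.last _ then 1 else 0 := by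
      rw [hd, coef_base hf.lin (hs x y)]
      simp only [Pt.idx_eq_last_iff_code]
    let M : Matrix (Fin (Y.dim + 1)) (Fin (X.dim + 1)) R := fun j i =>
      if i = Fin.last _ ∧ j = Fin.last _ then canon (s ((Pt.idx X).symm i) ((Pt.idx Y).symm j))
      else s ((Pt.idx X).symm i) ((Pt.idx Y).symm j)
    refine ⟨M, ?_, Hom.mk_eq_iff.1 (Hom.eq_of_coef fun x y => ?_)⟩
    · simp only [M, and_self, if_true]
      exact canon_eq _ _ (canon_add_one _)
    · rw [hs', Diag.coef_nf]
      simp only [M, Equiv.symm_apply_apply]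
      split_ifs
      · exact (canon_add_one _).symm
      · rfl
  · have key (i : Fin (X.dim + 1)) (j : Fin (Y.dim + 1)) : N j i +
        (if i = Fin.last _ ∧ j = Fin.last _ then 1 else 0) = M j i +
        (if i = Fin.last _ ∧ j = Fin.last _ then 1 else 0) := by
      have := Diag.coef_eq_of_sem_eq S h ((Pt.idx X).symm i) ((Pt.idx Y).symm j)
      rw [Hom.sound dN, Hom.sound eM, Diag.coef_nf, Diag.coef_nf] at this
      simpa only [Equiv.apply_symm_apply] using this
    ext j i
    have hk := key i j
    by_cases h : i = Fin.last _ ∧ j = Fin.last _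
    · obtain ⟨rfl, rfl⟩ := h
      rw [if_pos ⟨rfl, rfl⟩] at hk
      rw [← hN, ← hM, canon_eq _ _ hk]
    · rwa [if_neg h, add_zero, add_zero] at hk
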